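/- **Setting.** For $\zeta=(\beta,\gamma,\lambda)\in\mathbb{C}^3$ and a finite simple graph $G=(V,E)$, a configuration $\sigma:V\to\{+,-\}$ has weight $w(\sigma)=\beta^{m_+(\sigma)}\gamma^{m_-(\sigma)}\lambda^{n_+(\sigma)}$, where $m_\pm(\sigma)$ is the number of edges with both ends assigned $\pm$ and $n_+(\sigma)$ is the number of vertices assigned $+$ (with $0^0=1$). For a pinning $\sigma_\Lambda:\Lambda\to\{+,-\}$, $\Lambda\subseteq V$, let $Z_G^{\sigma_\Lambda}(\zeta)$ be the sum of $w(\sigma)$ over all $\sigma$ extending $\sigma_\Lambda$, let $Z_G=Z_G^{\emptyset}$, and for $v\notin\Lambda$ let $p_v^{\sigma_\Lambda}$ be the part of $Z_G^{\sigma_\Lambda}(\zeta)$ coming from configurations with $\sigma(v)=+$, divided by $Z_G^{\sigma_\Lambda}(\zeta)$. The pinning is *feasible* if it assigns $+$ to no vertex in case $\lambda=0$, and does not assign $+$ to two adjacent vertices in case $\beta=0$. The $\Delta$-bounded 2-spin system specified by $\zeta$ exhibits *strong spatial mixing* (correlation decay) if there are $C,\alpha>0$ such that for every finite graph $G$ of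 maximum degree at most $\Delta$, every vertex $v$, and all feasible pinnings $\sigma_{\Lambda_1},\tau_{\Lambda_2}$ with $v\notin\Lambda_1\cup\Lambda_2$, we have $Z_G^{\sigma_{\Lambda_1}}(\zeta)\ne0$, $Z_G^{\tau_{\Lambda_2}}(\zeta)\neq 0$ and $|p_v^{\sigma_{\Lambda_1}}-p_v^{\tau_{\Lambda_2}}|\le C e^{-\alpha\,\mathrm{dist}_G(v,S)}$, where $S$ is the set of vertices on which the two pinnings differ (including vertices pinned by exactly one of them); if no vertex of $S$ can be reached from $v$, the bound is read as $p_v^{\sigma_{\Lambda_1}}=p_v^{\tau_{\Lambda_2}}$. For an integer $\Delta\ge3$ define the following sets of $(\beta,\gamma,\lambda)\in\mathbb{R}^3$: - $S_1$: $\frac{\Delta-2}{\Delta}<\sqrt{\beta\gamma}<\frac{\Delta}{\Delta-2}$, $\beta,\gamma>0$, $\lambda\ge0$; - $S_2$: $\beta\gamma<1$, $\beta\ge0$, $\gamma>0$, $\lambda\ge0$, and either $\lambda=0$, or $\lambda>0$ and there is a constant $0<c<1$ such that $|f_d'(\hat x_d)|\le c$ for every integer $1\le d\le\Delta-1$, where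 $f_d(x)=\lambda\bigl(\frac{\beta x+1}{x+\gamma}\bigr)^d$ and $\hat x_d$ is the unique positive fixed point of $f_d$; - $S_3$: $\beta\gamma>\frac{\Delta}{\Delta-2}$, $\beta,\gamma>0$, $0\le\lambda<\frac{\gamma}{t^{\Delta-1}[(\Delta-2)\beta\gamma-\Delta]}$ with $t=\max\{1,\beta\}$; - $S_4$: $\beta\gamma>\frac{\Delta}{\Delta-2}$, $\beta,\gamma>0$, $\lambda>\frac{(\Delta-2)\beta\gamma-\Delta}{\beta r^{\Delta-1}}$ with $r=\min\{1,1/\gamma\}$. An *FPTAS for $Z_G(\zeta)$ on graphs of maximum degree at most $\Delta$* is a deterministic algorithm that, given such a graph $G$ on $n$ vertices and an accuracy $\varepsilon=1/N$ ($N\ge1$ an integer), outputs a Gaussian rational $\hat Z$ with $|\hat Z-Z_G(\zeta)|\le\varepsilon|Z_G(\zeta)|$ in time polynomial in $n$ and $1/\varepsilon$. Here an algorithm is a random access machine over the integers with the logarithmic cost criterion, and the fixed complex numbers $\beta,\gamma,\lambda$ are available to it through an oracle for binary approximations, a request for $k$ binary digits costing at least $k$. **Theorem.** Fix an integer $\Delta\ge3$.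 For every $\zeta_0\in S_1\cup S_2\cup S_3\cup S_4$ there is a $\delta>0$, depending only on $\Delta$ and $\zeta_0$, such that for every $\zeta\in\mathbb{C}^3$ with $\|\zeta-\zeta_0\|_\infty<\delta$: 1. $Z_G^{\sigma_\Lambda}(\zeta)\ne0$ for every finite graph $G$ of maximum degree at most $\Delta$ and every feasible pinning $\sigma_\Lambda$; 2. the $\Delta$-bounded 2-spin system specified by $\zeta$ exhibits strong spatial mixing; 3. there is an FPTAS for $Z_G(\zeta)$ on graphs of maximum degree at most $\Delta$. -/

import Mathlib

universe u

namespace TwoSpin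

/-! ### Two-spin systems

Parameters are `ζ : Fin 3 → ℂ` with `ζ 0 = β`, `ζ 1 = γ`, `ζ 2 = λ`; the norm on `Fin 3 → ℂ` is the
sup norm. The spin `+` is `true` and the spin `-` is `false`. -/

section Spin

variable {V : Type u} [Fintype V] [DecidableEq V]

/-- The weight `β ^ m₊(σ) * γ ^ m₋(σ) * λ ^ n₊(σ)` of a configuration `σ`. -/
def weight (G : SimpleGraph V) [DecidableRel G.Adj] (ζ : Fin 3 → ℂ) (σ : V → Bool) : ℂ :=
  ζ 0 ^ (G.edgeFinset.filter fun e => e.map σ = s(true, true)).card *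
  ζ 1 ^ (G.edgeFinset.filter fun e => e.map σ = s(false, false)).card *
  ζ 2 ^ (Finset.univ.filter fun v => σ v = true).card

/-- A pinning of some of the vertices: `p v = some s` if `v` is pinned to the spin `s`, and
`p v = none` if `v` is free. The configuration `σ` extends the pinning `p`. -/
def Extends (p : V → Option Bool) (σ : V → Bool) : Prop :=
  ∀ v s, p v = some s → σ v = s

instance (p : V → Option Bool) (σ : V → Bool) : Decidable (Extends p σ) := by
  unfold Extends; infer_instance

/-- The partition function with pinned vertices: total weight of the configurations extending `p`. -/
def Z (G : SimpleGraph V) [DecidableRel G.Adj] (ζ : Fin 3 → ℂ) (p : V → Option Bool) : ℂ :=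
  ∑ σ : V → Bool with Extends p σ, weight G ζ σ

/-- The contribution to `Z G ζ p` of the configurations with `v` assigned to `+`. -/
def ZPlus (G : SimpleGraph V) [DecidableRel G.Adj] (ζ : Fin 3 → ℂ) (p : V → Option Bool)
    (v : V) : ℂ :=
  ∑ σ : V → Bool with Extends p σ ∧ σ v = true, weight G ζ σ

/-- The (complex) marginal of `v` being assigned to `+`, given the pinning `p`. -/
noncomputable def marginal (G : SimpleGraph V) [DecidableRel G.Adj] (ζ : Fin 3 → ℂ)
    (p : V → Option Bool) (v : V) : ℂ :=
  ZPlus G ζ p v / Z G ζ p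

end Spin

/-- Feasible pinnings: no vertex pinned to `+` if `λ = 0`, and no two adjacent vertices both pinned
to `+` if `β = 0`. -/
def Feasible {V : Type u} (G : SimpleGraph V) (ζ : Fin 3 → ℂ) (p : V → Option Bool) : Prop :=
  (ζ 2 = 0 → ∀ v, p v ≠ some true) ∧
  (ζ 0 = 0 → ∀ v w, G.Adj v w → ¬ (p v = some true ∧ p w = some true))

/-- The distance from `v` to the set `S`, which is `⊤` if no vertex of `S` can be reached. -/
noncomputable def distToSet {V : Type u} (G : SimpleGraph V) (v : V) (S : Set V) : ℕ∞ :=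
  ⨅ w ∈ S, G.edist v w

/-- Strong spatial mixing (correlation decay) of the `Δ`-bounded 2-spin system specified by `ζ`.
The decay `exp (-Ω(dist))` is `C * exp (-α * dist)` with `C, α > 0` uniform over all graphs, vertices
and pinnings; bounding by `k ≤ dist` also covers infinite distance, where the marginals agree. -/
def StrongSpatialMixing (Δ : ℕ) (ζ : Fin 3 → ℂ) : Prop :=
  ∃ C α : ℝ, 0 < C ∧ 0 < α ∧
    ∀ (V : Type u) [Fintype V] [DecidableEq V] (G : SimpleGraph V) [DecidableRel G.Adj],
      (∀ v, G.degree v ≤ Δ) →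
      ∀ (v : V) (p q : V → Option Bool), Feasible G ζ p → Feasible G ζ q →
        p v = none → q v = none →
        Z G ζ p ≠ 0 ∧ Z G ζ q ≠ 0 ∧
        ∀ k : ℕ, (k : ℕ∞) ≤ distToSet G v {w | p w ≠ q w} →
          ‖marginal G ζ p v - marginal G ζ q v‖ ≤ C * Real.exp (-α * k)

/-! ### The sets of real parameters -/

/-- `S₁`. -/
def S1 (Δ : ℕ) : Set (Fin 3 → ℝ) :=
  {ζ | ((Δ : ℝ) - 2) / Δ < √(ζ 0 * ζ 1) ∧ √(ζ 0 * ζ 1) < (Δ : ℝ) / (Δ - 2) ∧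
    0 < ζ 0 ∧ 0 < ζ 1 ∧ 0 ≤ ζ 2}

/-- The symmetric tree recursion `f_d(x) = λ ((β x + 1) / (x + γ)) ^ d`. -/
noncomputable def treeRec (ζ : Fin 3 → ℝ) (d : ℕ) (x : ℝ) : ℝ :=
  ζ 2 * ((ζ 0 * x + 1) / (x + ζ 1)) ^ d

/-- `ζ` is up-to-`Δ` unique. For `β γ < 1`, `β ≥ 0` and `γ, λ > 0`, the function `f_d` has exactly
one positive fixed point if `d ≥ 1`. -/
def UpToUnique (Δ : ℕ) (ζ : Fin 3 → ℝ) : Prop :=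
  ζ 2 = 0 ∨ (0 < ζ 2 ∧ ∃ c : ℝ, 0 < c ∧ c < 1 ∧ ∀ d : ℕ, 1 ≤ d → d ≤ Δ - 1 →
    ∀ x : ℝ, 0 < x → treeRec ζ d x = x → |deriv (treeRec ζ d) x| ≤ c)

/-- `S₂`. -/
def S2 (Δ : ℕ) : Set (Fin 3 → ℝ) :=
  {ζ | ζ 0 * ζ 1 < 1 ∧ 0 ≤ ζ 0 ∧ 0 < ζ 1 ∧ 0 ≤ ζ 2 ∧ UpToUnique Δ ζ}

/-- `S₃`. -/
def S3 (Δ : ℕ) : Set (Fin 3 → ℝ) :=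
  {ζ | (Δ : ℝ) / (Δ - 2) < ζ 0 * ζ 1 ∧ 0 < ζ 0 ∧ 0 < ζ 1 ∧ 0 ≤ ζ 2 ∧
    ζ 2 < ζ 1 / (max 1 (ζ 0) ^ (Δ - 1) * (((Δ : ℝ) - 2) * (ζ 0 * ζ 1) - Δ))}

/-- `S₄`. -/
def S4 (Δ : ℕ) : Set (Fin 3 → ℝ) :=
  {ζ | (Δ : ℝ) / (Δ - 2) < ζ 0 * ζ 1 ∧ 0 < ζ 0 ∧ 0 < ζ 1 ∧
    (((Δ : ℝ) - 2) * (ζ 0 * ζ 1) - Δ) / (ζ 0 * min 1 (1 / ζ 1) ^ (Δ - 1)) < ζ 2}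

/-! ### Algorithms

Deterministic random access machines with integer cells and the logarithmic cost criterion, given as
structured programs. The (arbitrary) complex parameters are available through an oracle that returns
dyadic approximations, at a cost linear in the number of requested binary digits. -/

/-- The memory: cells indexed by integers, holding integers. -/
abbrev Memory := ℤ → ℤ

/-- A parameter oracle: real and imaginary part of an approximation to `2 ^ k * ζ i`. -/
abbrev ParamOracle := Fin 3 → ℕ → ℤ × ℤ

/-- The oracle answers represent `ζ` : the answer at precision `k` is within `1` of `2 ^ k * ζ i`, in
the real and in the imaginary part. -/
def ParamOracle.Represents (ω : ParamOracle) (ζ : Fin 3 → ℂ) : Prop :=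
  ∀ i k, |2 ^ k * (ζ i).re - ((ω i k).1 : ℝ)| ≤ 1 ∧ |2 ^ k * (ζ i).im - ((ω i k).2 : ℝ)| ≤ 1

/-- The binary length of an integer. -/
def bitLen (z : ℤ) : ℕ := z.natAbs.size

/-- Integer expressions: constants, contents of a (computed) cell, ring operations, and oracle
queries at a computed precision (a negative precision is read as `0`). -/
inductive Expr where
  | const (c : ℤ)
  | load (a : Expr)
  | add (a b : Expr)
  | sub (a b : Expr)
  | mul (a b : Expr)
  | queryRe (i : Fin 3) (a : Expr)
  | queryIm (i : Fin 3) (a : Expr)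

/-- The value of an expression. -/
def Expr.eval (ω : ParamOracle) (m : Memory) : Expr → ℤ
  | .const c => c
  | .load a => m (a.eval ω m)
  | .add a b => a.eval ω m + b.eval ω m
  | .sub a b => a.eval ω m - b.eval ω m
  | .mul a b => a.eval ω m * b.eval ω m
  | .queryRe i a => (ω i (a.eval ω m).toNat).1
  | .queryIm i a => (ω i (a.eval ω m).toNat).2

/-- The cost of evaluating an expression: every operation costs one plus the binary lengths of the
numbers involved, and a query additionally costs the requested precision. -/
def Expr.cost (ω : ParamOracle) (m : Memory) : Expr → ℕ
  | .const c => 1 + bitLen c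
  | .load a => a.cost ω m + 1 + bitLen (a.eval ω m) + bitLen (m (a.eval ω m))
  | .add a b => a.cost ω m + b.cost ω m + 1 + bitLen (a.eval ω m) + bitLen (b.eval ω m)
  | .sub a b => a.cost ω m + b.cost ω m + 1 + bitLen (a.eval ω m) + bitLen (b.eval ω m)
  | .mul a b => a.cost ω m + b.cost ω m + 1 + bitLen (a.eval ω m) + bitLen (b.eval ω m)
  | .queryRe i a => a.cost ω m + 1 + (a.eval ω m).toNat + bitLen (ω i (a.eval ω m).toNat).1
  | .queryIm i a => a.cost ω m + 1 + (a.eval ω m).toNat + bitLen (ω i (a.eval ω m).toNat).2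

/-- Programs. `store a e` writes the value of `e` to the cell with address `a`; `branch e c₁ c₂` runs
`c₁` if `e` is positive and `c₂` otherwise; `loop e c` repeats `c` as long as `e` is positive. -/
inductive Prog where
  | skip
  | store (a e : Expr)
  | seq (c₁ c₂ : Prog)
  | branch (e : Expr) (c₁ c₂ : Prog)
  | loop (e : Expr) (c : Prog)

/-- `Exec ω c m t m'` : started in memory `m`, the program `c` halts after cost exactly `t` in
memory `m'`. -/
inductive Exec (ω : ParamOracle) : Prog → Memory → ℕ → Memory → Prop where
  | skip (m : Memory) : Exec ω .skip m 1 m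
  | store (a e : Expr) (m : Memory) :
      Exec ω (.store a e) m
        (a.cost ω m + e.cost ω m + 1 + bitLen (a.eval ω m) + bitLen (e.eval ω m))
        (Function.update m (a.eval ω m) (e.eval ω m))
  | seq {c₁ c₂ : Prog} {m₁ m₂ m₃ : Memory} {t₁ t₂ : ℕ} :
      Exec ω c₁ m₁ t₁ m₂ → Exec ω c₂ m₂ t₂ m₃ → Exec ω (.seq c₁ c₂) m₁ (t₁ + t₂) m₃
  | branchPos {e : Expr} {c₁ c₂ : Prog} {m m' : Memory} {t : ℕ} :
      0 < e.eval ω m → Exec ω c₁ m t m' → Exec ω (.branch e c₁ c₂) m (e.cost ω m + 1 + t) m'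
  | branchNonpos {e : Expr} {c₁ c₂ : Prog} {m m' : Memory} {t : ℕ} :
      e.eval ω m ≤ 0 → Exec ω c₂ m t m' → Exec ω (.branch e c₁ c₂) m (e.cost ω m + 1 + t) m'
  | loopPos {e : Expr} {c : Prog} {m₁ m₂ m₃ : Memory} {t₁ t₂ : ℕ} :
      0 < e.eval ω m₁ → Exec ω c m₁ t₁ m₂ → Exec ω (.loop e c) m₂ t₂ m₃ →
      Exec ω (.loop e c) m₁ (e.cost ω m₁ + 1 + t₁ + t₂) m₃
  | loopNonpos {e : Expr} {c : Prog} {m : Memory} :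
      e.eval ω m ≤ 0 → Exec ω (.loop e c) m (e.cost ω m + 1) m

open Classical in
/-- The input: the number `n` of vertices in cell `0`, the accuracy `N` in cell `1`, the adjacency
matrix of the graph row by row in the cells from `2` on, and `0` elsewhere. -/
noncomputable def inputMemory {n : ℕ} (G : SimpleGraph (Fin n)) (N : ℕ) : Memory := fun a =>
  if a = 0 then n else if a = 1 then N else
    if ∃ i j : Fin n, a = 2 + (i : ℤ) * n + j ∧ G.Adj i j then 1 else 0

/-- There is an FPTAS for `Z_G(ζ)` on graphs of maximum degree at most `Δ`: a deterministic program
that, given `G` on `n` vertices and accuracy `ε = 1 / N`, halts within cost polynomial in `n` and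
`1 / ε` and outputs a Gaussian rational `(a + b i) / c` (in cells `0`, `1`, `2`) that approximates
`Z_G(ζ)` with relative error at most `ε`. -/
def HasFPTAS (Δ : ℕ) (ζ : Fin 3 → ℂ) : Prop :=
  ∃ (P : Prog) (K d : ℕ), ∀ ω : ParamOracle, ω.Represents ζ →
    ∀ (n : ℕ) (G : SimpleGraph (Fin n)) [DecidableRel G.Adj], (∀ v, G.degree v ≤ Δ) →
    ∀ N : ℕ, 1 ≤ N →
    ∃ (t : ℕ) (m : Memory), Exec ω P (inputMemory G N) t m ∧ t ≤ K * (n + N) ^ d ∧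
      m 2 ≠ 0 ∧
      ‖((m 0 : ℂ) + (m 1 : ℂ) * Complex.I) / (m 2 : ℂ) - Z G ζ (fun _ => none)‖ ≤
        1 / (N : ℝ) * ‖Z G ζ (fun _ => none)‖

end TwoSpin

set_option linter.unusedSectionVars false

namespace TwoSpin

/-! ### Partition functions of partially removed graphs -/

section StateSum

variable {V : Type u} [Fintype V] [DecidableEq V]

/-! The engine is Weitz's self-avoiding walk recursion, run with complex messages. Let x be the
ratio of the weights of + and - at a vertex. Changing the spin of u from + to - as seen by one alive
neighbour after another factorises the ratio at u as λ ∏ y_w. For an alive neighbour w, the message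
y_w = (βx + 1)/(x + γ) is computed from the ratio x at w in a smaller graph: u is removed, the
neighbours before w see + at u, those after w see -, and w sees nothing. Removed neighbours that are
seen send β or 1/γ. A vertex entered from a parent therefore has at most Δ - 1 messages to multiply.

Suppose that a complex region U contains β and 1/γ, is preserved by the recursion with at most Δ - 1
children, and forces x + γ ≠ 0 there and |1 + x| ≥ 1/2 for up to Δ messages. Induction on the number
of alive vertices then shows that no partition function vanishes, because summing over the spin of u
gives (1 + x) times a nonzero number. If the recursion also contracts on U, ratios depend
exponentially little on what lies far away. This is strong spatial mixing, and it also bounds the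
error of truncating the recursion. `Contraction` packages the hypotheses,
`stateSum_ne_zero_and_ratio` is the induction and `norm_ratio_sub_ratio_le` is the decay.

The region comes from a real statement, `RealContraction`. For ζ₀ the messages fill the interval
between β and 1/γ, and it suffices to have a positive weight w with Σ |∂_i F(k)| w(k_i) < w(F(k)),
that is, strict contraction in the metric |dy|/w(y). By compactness this survives, with a uniform
rate, for nearby complex parameters and messages. Then U is a union of discs of radius ε w(k) about
real messages k, and closeness in U is measured by chains of short links
(`RealContraction.exists_contraction`).

On S₁, S₃ and S₄ the logarithmic metric w(y) = y works, and the condition becomes (Δ-1)|βγ-1| x <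
(βx+1)(x+γ). On S₂ with λ > 0 the weight is essentially y √s(y), where s is the absolute logarithmic
derivative of the message function (`slope`). Cauchy-Schwarz and the AM-GM inequality reduce to
equal children, leaving the two-step rate d² s(y) s(Y) < 1 with Y the image of y. At an interior
maximum the critical equation and the log-concavity of s allow a comparison with the fixed point z
between y and Y, where d s(z) = |f_d'| < 1 by uniqueness (`two_step_lt_one`).

For the algorithm, Z is a product over the vertices v of powers of γ times 1 + (ratio at v), the
vertices before v being pinned to -. The ratios are truncated at depth O(log(n + N)) and evaluated
by a depth-first search with an explicit stack, with numerators and denominators kept as Gaussian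
integers built from 2^K-fold approximations of the parameters. The rounded parameters lie in the
same ball around ζ₀, so the certificate applies to them, and a lower bound 2^(-O(n²)) for |Z| turns
the rounding error into a relative error. Trees of logarithmic depth and bounded degree have
polynomially many nodes and involve numbers of polynomial length. The cost is certified by the
program logic `Runs`, and everything is put together in `hasFPTAS_of_contraction`. -/

/-- A state of a graph: `st v = none` if `v` is alive; otherwise `v` has been removed and
`st v = some f`, where `f u` is the spin that the neighbour `u` of `v` sees at `v` (if any). -/
abbrev State (V : Type u) := V → Option (V → Option Bool)

/-- The spin seen by `u` at the vertex `w`. -/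
def seen (st : State V) (u w : V) : Option Bool := (st w).bind fun f => f u

/-- The alive vertices. -/
def alive (st : State V) : Finset V := Finset.univ.filter fun v => st v = none

@[simp] lemma mem_alive {st : State V} {v : V} : v ∈ alive st ↔ st v = none := by simp [alive]

variable (G : SimpleGraph V) [DecidableRel G.Adj] (ζ : Fin 3 → ℂ)

/-- The number of edges inside a set of vertices. -/
def innerEdges (T : Finset V) : ℕ := (G.edgeFinset.filter fun e => e ∈ T.sym2).card

/-- The weight of the spin `+` at an alive vertex. -/
def plusW (st : State V) (u : V) : ℂ :=
  ζ 2 * ∏ w with G.Adj u w, if seen st u w = some true then ζ 0 else 1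

/-- The weight of the spin `-` at an alive vertex. -/
def minusW (st : State V) (u : V) : ℂ :=
  ∏ w with G.Adj u w, if seen st u w = some false then ζ 1 else 1

/-- The summand of `stateSum`. -/
def stateTerm (st : State V) (S T : Finset V) : ℂ :=
  (∏ u ∈ T, plusW G ζ st u) * (∏ u ∈ S \ T, minusW G ζ st u) *
    (ζ 0 ^ innerEdges G T * ζ 1 ^ innerEdges G (S \ T))

/-- The partition function of the subgraph of the alive vertices, where the removed vertices act as
external fields. -/
def stateSum (st : State V) : ℂ := ∑ T ∈ (alive st).powerset, stateTerm G ζ st (alive st) T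

/-- Remove the vertex `u`; the vertex `x` sees the spin `f x` at `u`. -/
def remove (st : State V) (u : V) (f : V → Option Bool) : State V := Function.update st u (some f)

/-- Remove the vertex `u`, pinning it to a spin. -/
def pin (st : State V) (u : V) (s : Bool) : State V := remove st u fun _ => some s

lemma innerEdges_insert {v : V} {T : Finset V} (hv : v ∉ T) :
    innerEdges G (insert v T) = innerEdges G T + (T.filter fun w => G.Adj w v).card := by
  have h : (G.edgeFinset.filter fun e => e ∈ (insert v T).sym2) =
      (G.edgeFinset.filter fun e => e ∈ T.sym2) ∪
        (T.filter fun w => G.Adj w v).image fun w => s(w, v) := by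
    ext e
    induction e using Sym2.ind with
    | _ x y =>
      simp only [Finset.mem_filter, SimpleGraph.mem_edgeFinset, SimpleGraph.mem_edgeSet,
        Finset.mk_mem_sym2_iff, Finset.mem_insert, Finset.mem_union, Finset.mem_image,
        Sym2.eq_iff]
      constructor
      · rintro ⟨h, rfl | hx, rfl | hy⟩
        · exact absurd h G.irrefl
        · exact Or.inr ⟨y, ⟨hy, h.symm⟩, Or.inr ⟨rfl, rfl⟩⟩
        · exact Or.inr ⟨x, ⟨hx, h⟩, Or.inl ⟨rfl, rfl⟩⟩
        · exact Or.inl ⟨h, hx, hy⟩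
      · rintro (⟨h, hx, hy⟩ | ⟨w, ⟨hw, h⟩, ⟨rfl, rfl⟩ | ⟨rfl, rfl⟩⟩)
        · exact ⟨h, Or.inr hx, Or.inr hy⟩
        · exact ⟨h, Or.inr hw, Or.inl rfl⟩
        · exact ⟨h.symm, Or.inl rfl, Or.inr hw⟩
  rw [innerEdges, h, Finset.card_union_of_disjoint, Finset.card_image_of_injective]
  · rfl
  · intro a b hab
    simp only [Sym2.eq_iff] at hab
    grind
  · rw [Finset.disjoint_left]
    intro e he he'
    obtain ⟨w, hw, rfl⟩ := Finset.mem_image.1 he'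
    simp only [Finset.mem_filter, Finset.mk_mem_sym2_iff] at he
    exact hv he.2.2

lemma seen_remove_of_ne {st : State V} {u w : V} (f : V → Option Bool) (x : V) (h : w ≠ u) :
    seen (remove st u f) x w = seen st x w := by simp [seen, remove, h]

lemma seen_remove_self (st : State V) (u : V) (f : V → Option Bool) (x : V) :
    seen (remove st u f) x u = f x := by simp [seen, remove]

lemma seen_of_alive {st : State V} {u : V} (h : st u = none) (x : V) : seen st x u = none := by
  simp [seen, h]

lemma alive_remove {st : State V} {u : V} (f : V → Option Bool) :
    alive (remove st u f) = (alive st).erase u := by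
  ext x
  by_cases hx : x = u <;> simp [remove, hx]

lemma prod_seen_remove {st : State V} {u : V} (hu : st u = none) (f : V → Option Bool) (x : V)
    (s : Bool) (a : ℂ) :
    (∏ w with G.Adj x w, if seen (remove st u f) x w = some s then a else 1) =
      (∏ w with G.Adj x w, if seen st x w = some s then a else 1) *
        if G.Adj x u ∧ f x = some s then a else 1 := by
  by_cases hxu : G.Adj x u
  · have hm : u ∈ Finset.univ.filter fun w => G.Adj x w := by simpa using hxu
    rw [← Finset.mul_prod_erase _ _ hm, ← Finset.mul_prod_erase _ _ hm, seen_remove_self,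
      seen_of_alive hu]
    simp only [hxu, true_and, reduceCtorEq, if_false, one_mul]
    rw [mul_comm]
    congr 1
    refine Finset.prod_congr rfl fun w hw => ?_
    rw [seen_remove_of_ne _ _ (Finset.ne_of_mem_erase hw)]
  · simp only [hxu, false_and, if_false, mul_one]
    refine Finset.prod_congr rfl fun w hw => ?_
    rw [seen_remove_of_ne]
    rintro rfl
    exact hxu (Finset.mem_filter.1 hw).2

lemma plusW_remove {st : State V} {u : V} (hu : st u = none) (f : V → Option Bool) (x : V) :
    plusW G ζ (remove st u f) x =
      plusW G ζ st x * if G.Adj x u ∧ f x = some true then ζ 0 else 1 := by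
  rw [plusW, plusW, prod_seen_remove G hu, mul_assoc]

lemma minusW_remove {st : State V} {u : V} (hu : st u = none) (f : V → Option Bool) (x : V) :
    minusW G ζ (remove st u f) x =
      minusW G ζ st x * if G.Adj x u ∧ f x = some false then ζ 1 else 1 := by
  rw [minusW, minusW, prod_seen_remove G hu]

lemma prod_ite_adj (T : Finset V) (u : V) (a : ℂ) :
    ∏ x ∈ T, (if G.Adj x u then a else 1) = a ^ (T.filter fun w => G.Adj w u).card := by
  rw [Finset.prod_ite]; simp

lemma stateSum_congr {st st' : State V} (h : alive st = alive st')
    (h1 : ∀ x ∈ alive st, plusW G ζ st x = plusW G ζ st' x)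
    (h2 : ∀ x ∈ alive st, minusW G ζ st x = minusW G ζ st' x) :
    stateSum G ζ st = stateSum G ζ st' := by
  rw [stateSum, stateSum, ← h]
  refine Finset.sum_congr rfl fun T hT => ?_
  rw [Finset.mem_powerset] at hT
  rw [stateTerm, stateTerm, Finset.prod_congr rfl fun x hx => h1 x (hT hx),
    Finset.prod_congr rfl fun x hx => h2 x (Finset.sdiff_subset hx)]

lemma stateSum_of_alive_eq_empty {st : State V} (h : alive st = ∅) : stateSum G ζ st = 1 := by
  have h0 : innerEdges G ∅ = 0 := by
    rw [innerEdges, Finset.card_eq_zero, Finset.filter_eq_empty_iff]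
    intro e _
    simp
  simp [stateSum, h, stateTerm, h0]

/-- Summing over the spin of an alive vertex. -/
lemma stateSum_eq {st : State V} {u : V} (hu : st u = none) :
    stateSum G ζ st = plusW G ζ st u * stateSum G ζ (pin st u true) +
      minusW G ζ st u * stateSum G ζ (pin st u false) := by
  have hal : alive st = insert u ((alive st).erase u) := by
    rw [Finset.insert_erase]; simpa using hu
  have hn : u ∉ (alive st).erase u := Finset.notMem_erase _ _
  rw [stateSum, hal, Finset.sum_powerset_insert hn, add_comm]
  set S := (alive st).erase u with hS
  have halive : ∀ s, alive (pin st u s) = S := fun s => by rw [pin, alive_remove]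
  congr 1
  · rw [stateSum, halive, Finset.mul_sum]
    refine Finset.sum_congr rfl fun T hT => ?_
    rw [Finset.mem_powerset] at hT
    have huT : u ∉ T := fun h => hn (hT h)
    have hd : insert u S \ insert u T = S \ T := by
      ext x; simp only [Finset.mem_sdiff, Finset.mem_insert]; grind
    -- The edges from `u` into `T` leave the inner edge count and reappear as factors β in `plusW`
    -- of the remaining vertices.
    rw [stateTerm, stateTerm, hd, Finset.prod_insert huT, innerEdges_insert G huT, pow_add,
      ← prod_ite_adj]
    simp only [pin, plusW_remove G ζ hu, minusW_remove G ζ hu, Finset.prod_mul_distrib]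
    simp
    ring
  · rw [stateSum, halive, Finset.mul_sum]
    refine Finset.sum_congr rfl fun T hT => ?_
    rw [Finset.mem_powerset] at hT
    have huT : u ∉ T := fun h => hn (hT h)
    have hd : insert u S \ T = insert u (S \ T) := by
      ext x; simp only [Finset.mem_sdiff, Finset.mem_insert]; grind
    have huT' : u ∉ S \ T := fun h => hn (Finset.sdiff_subset h)
    rw [stateTerm, stateTerm, hd, Finset.prod_insert huT', innerEdges_insert G huT', pow_add,
      ← prod_ite_adj]
    simp only [pin, plusW_remove G ζ hu, minusW_remove G ζ hu, Finset.prod_mul_distrib]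
    simp
    ring

/-! ### Pinned partition functions -/

/-- The state in which the pinned vertices are removed. -/
def ofPinning (p : V → Option Bool) : State V := fun v => (p v).map fun s _ => some s

/-- The vertices pinned to the spin `s`. -/
def pinnedSet (p : V → Option Bool) (s : Bool) : Finset V := Finset.univ.filter fun v => p v = some s

/-- The weight of the pinned vertices. -/
def pinnedWeight (p : V → Option Bool) : ℂ :=
  ζ 0 ^ innerEdges G (pinnedSet p true) * ζ 1 ^ innerEdges G (pinnedSet p false) *
    ζ 2 ^ (pinnedSet p true).card

lemma ofPinning_update (p : V → Option Bool) (v : V) (s : Bool) :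
    ofPinning (Function.update p v (some s)) = pin (ofPinning p) v s := by
  funext x
  by_cases h : x = v
  · subst h; simp [ofPinning, pin, remove]
  · simp [ofPinning, pin, remove, h]

lemma ofPinning_eq_none {p : V → Option Bool} {v : V} : ofPinning p v = none ↔ p v = none := by
  simp [ofPinning]

lemma seen_ofPinning (p : V → Option Bool) (u w : V) : seen (ofPinning p) u w = p w := by
  cases h : p w <;> simp [seen, ofPinning, h]

lemma pinnedSet_update_self (p : V → Option Bool) {v : V} (s : Bool) :
    pinnedSet (Function.update p v (some s)) s = insert v (pinnedSet p s) := by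
  ext x
  by_cases h : x = v <;> simp [pinnedSet, h]

lemma pinnedSet_update_ne (p : V → Option Bool) {v : V} (hv : p v = none) {s s' : Bool}
    (hs : s ≠ s') : pinnedSet (Function.update p v (some s)) s' = pinnedSet p s' := by
  ext x
  by_cases h : x = v <;> simp [pinnedSet, h, hs, hv]

lemma prod_seen_ofPinning (p : V → Option Bool) (v : V) (s : Bool) (a : ℂ) :
    (∏ w with G.Adj v w, if seen (ofPinning p) v w = some s then a else 1) =
      a ^ ((pinnedSet p s).filter fun w => G.Adj w v).card := by
  rw [Finset.prod_ite]
  simp only [Finset.prod_const, one_pow, mul_one]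
  congr 2
  ext x
  simp [seen_ofPinning, pinnedSet, and_comm, G.adj_comm]

lemma pinnedWeight_update_true {p : V → Option Bool} {v : V} (hv : p v = none) :
    pinnedWeight G ζ (Function.update p v (some true)) =
      pinnedWeight G ζ p * plusW G ζ (ofPinning p) v := by
  have hn : v ∉ pinnedSet p true := by simp [pinnedSet, hv]
  rw [pinnedWeight, pinnedSet_update_self, pinnedSet_update_ne p hv (by simp),
    innerEdges_insert G hn, Finset.card_insert_of_notMem hn, plusW, prod_seen_ofPinning,
    pinnedWeight]
  ring

lemma pinnedWeight_update_false {p : V → Option Bool} {v : V} (hv : p v = none) :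
    pinnedWeight G ζ (Function.update p v (some false)) =
      pinnedWeight G ζ p * minusW G ζ (ofPinning p) v := by
  have hn : v ∉ pinnedSet p false := by simp [pinnedSet, hv]
  rw [pinnedWeight, pinnedSet_update_self, pinnedSet_update_ne p hv (by simp),
    innerEdges_insert G hn, minusW, prod_seen_ofPinning, pinnedWeight]
  ring

lemma extends_update {p : V → Option Bool} {v : V} (hv : p v = none) (s : Bool) (σ : V → Bool) :
    Extends (Function.update p v (some s)) σ ↔ Extends p σ ∧ σ v = s := by
  constructor
  · intro h
    refine ⟨fun x t hx => h x t ?_, h v s (by simp)⟩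
    rw [Function.update_of_ne, hx]
    rintro rfl
    simp [hv] at hx
  · rintro ⟨h, h'⟩ x t hx
    by_cases hxv : x = v
    · subst hxv
      simp only [Function.update_self, Option.some.injEq] at hx
      rw [h', hx]
    · rw [Function.update_of_ne hxv] at hx
      exact h x t hx

lemma ZPlus_eq {p : V → Option Bool} {v : V} (hv : p v = none) :
    ZPlus G ζ p v = Z G ζ (Function.update p v (some true)) := by
  simp only [ZPlus, Z, extends_update hv]

lemma Z_eq_add {p : V → Option Bool} {v : V} (hv : p v = none) :
    Z G ζ p = Z G ζ (Function.update p v (some true)) +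
      Z G ζ (Function.update p v (some false)) := by
  simp only [Z, extends_update hv]
  rw [← Finset.sum_filter_add_sum_filter_not (Finset.univ.filter (Extends p)) (fun σ => σ v = true)]
  simp [Finset.filter_filter]

lemma weight_eq_pinnedWeight (σ : V → Bool) : weight G ζ σ = pinnedWeight G ζ fun v => some (σ v) := by
  have h : ∀ s : Bool, (G.edgeFinset.filter fun e => e.map σ = s(s, s)).card =
      innerEdges G (pinnedSet (fun v => some (σ v)) s) := by
    intro s
    rw [innerEdges]
    congr 1
    ext e
    induction e using Sym2.ind with
    | _ x y => simp [pinnedSet]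
  rw [weight, pinnedWeight, h, h]
  simp [pinnedSet]

/-- `pinnedWeight` collects what involves pinned vertices only; an edge between a pinned and a free
vertex is already a factor in `plusW` or `minusW` of the free one. Splitting by the spin of one free
vertex gives the same recursion on both sides. -/
theorem Z_eq_pinnedWeight_mul (p : V → Option Bool) :
    Z G ζ p = pinnedWeight G ζ p * stateSum G ζ (ofPinning p) := by
  induction hn : (alive (ofPinning p)).card generalizing p with
  | zero =>
    rw [Finset.card_eq_zero] at hn
    have hp : ∀ v, ∃ s, p v = some s := by
      intro v
      rw [← Option.ne_none_iff_exists']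
      intro h
      have : v ∈ alive (ofPinning p) := by simpa [ofPinning_eq_none] using h
      simp [hn] at this
    choose σ hσ using hp
    obtain rfl : p = fun v => some (σ v) := funext hσ
    have : (Finset.univ.filter fun τ : V → Bool => Extends (fun v => some (σ v)) τ) = {σ} := by
      ext τ
      simp only [Finset.mem_filter, Finset.mem_univ, true_and, Finset.mem_singleton]
      constructor
      · intro h; funext v; exact h v _ rfl
      · rintro rfl v s h; simpa using h
    rw [stateSum_of_alive_eq_empty G ζ hn, mul_one, Z, this, Finset.sum_singleton,
      weight_eq_pinnedWeight]
  | succ n ih =>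
    obtain ⟨v, hv⟩ : (alive (ofPinning p)).Nonempty := by
      rw [← Finset.card_pos]; omega
    have hv' : p v = none := by simpa [ofPinning_eq_none] using hv
    have hc : ∀ s, (alive (ofPinning (Function.update p v (some s)))).card = n := by
      intro s
      rw [ofPinning_update, pin, alive_remove, Finset.card_erase_of_mem hv, hn]; rfl
    rw [Z_eq_add G ζ hv', ih _ (hc true), ih _ (hc false), pinnedWeight_update_true G ζ hv',
      pinnedWeight_update_false G ζ hv', stateSum_eq G ζ (mem_alive.1 hv), ofPinning_update,
      ofPinning_update]
    ring

/-- Feasibility removes the possible zeros: if β = 0 its exponent is 0, if λ = 0 its exponent is 0,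
and `0 ^ 0 = 1`. -/
lemma pinnedWeight_ne_zero {p : V → Option Bool} (hp : Feasible G ζ p) (h1 : ζ 1 ≠ 0) :
    pinnedWeight G ζ p ≠ 0 := by
  have hb : ζ 0 ^ innerEdges G (pinnedSet p true) ≠ 0 := by
    by_cases h0 : ζ 0 = 0
    · have : innerEdges G (pinnedSet p true) = 0 := by
        rw [innerEdges, Finset.card_eq_zero, Finset.filter_eq_empty_iff]
        intro e he hT
        induction e using Sym2.ind with
        | _ x y =>
          rw [SimpleGraph.mem_edgeFinset, SimpleGraph.mem_edgeSet] at he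
          simp only [Finset.mk_mem_sym2_iff, pinnedSet, Finset.mem_filter, Finset.mem_univ,
            true_and] at hT
          exact hp.2 h0 x y he hT
      rw [this, pow_zero]
      exact one_ne_zero
    · exact pow_ne_zero _ h0
  have hl : ζ 2 ^ (pinnedSet p true).card ≠ 0 := by
    by_cases h0 : ζ 2 = 0
    · have : pinnedSet p true = ∅ := by
        rw [pinnedSet, Finset.filter_eq_empty_iff]
        exact fun v _ => hp.1 h0 v
      rw [this, Finset.card_empty, pow_zero]
      exact one_ne_zero
    · exact pow_ne_zero _ h0
  exact mul_ne_zero (mul_ne_zero hb (pow_ne_zero _ h1)) hl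

end StateSum

/-! ### Messages along self-avoiding walks -/

/-- The message that a vertex with ratio `x` sends along an edge. -/
noncomputable def edgeFun (ζ : Fin 3 → ℂ) (x : ℂ) : ℂ := (ζ 0 * x + 1) / (x + ζ 1)

/-- The message of a vertex that is seen to have a given spin. -/
noncomputable def viewMsg (ζ : Fin 3 → ℂ) : Option Bool → ℂ
  | none => 1
  | some true => ζ 0
  | some false => (ζ 1)⁻¹

/-- A certificate that the tree recursion with at most `Δ - 1` children preserves a complex region
`U` and contracts: two vectors of messages that are `L`-related have related images one level up, and
`L`-related messages are exponentially close in `L`. -/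
structure Contraction (Δ : ℕ) (ζ : Fin 3 → ℂ) (C η : ℝ) where
  /-- The region of the messages. -/
  U : Set ℂ
  /-- The closeness relation after a given number of levels. -/
  rel : ℕ → ℂ → ℂ → Prop
  gamma_ne_zero : ζ 1 ≠ 0
  beta_mem : ζ 0 ∈ U
  gammaInv_mem : (ζ 1)⁻¹ ∈ U
  add_ne_zero : ∀ d < Δ, ∀ y : Fin d → ℂ, (∀ i, y i ∈ U) → ζ 2 * ∏ i, y i + ζ 1 ≠ 0
  edgeFun_mem : ∀ d < Δ, ∀ y : Fin d → ℂ, (∀ i, y i ∈ U) → edgeFun ζ (ζ 2 * ∏ i, y i) ∈ U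
  rel_zero : ∀ y ∈ U, ∀ y' ∈ U, rel 0 y y'
  rel_refl : ∀ L, ∀ y ∈ U, rel L y y
  rel_succ : ∀ L, ∀ d < Δ, ∀ y y' : Fin d → ℂ, (∀ i, y i ∈ U) → (∀ i, y' i ∈ U) →
    (∀ i, rel L (y i) (y' i)) →
    rel (L + 1) (edgeFun ζ (ζ 2 * ∏ i, y i)) (edgeFun ζ (ζ 2 * ∏ i, y' i))
  half_le : ∀ d ≤ Δ, ∀ y : Fin d → ℂ, (∀ i, y i ∈ U) → 1 / 2 ≤ ‖1 + ζ 2 * ∏ i, y i‖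
  dist_le : ∀ L, ∀ d ≤ Δ, ∀ y y' : Fin d → ℂ, (∀ i, y i ∈ U) → (∀ i, y' i ∈ U) →
    (∀ i, rel L (y i) (y' i)) → ‖ζ 2 * ∏ i, y i - ζ 2 * ∏ i, y' i‖ ≤ C * η ^ L

/-- The certificate speaks of vectors indexed by `Fin d`; this re-indexes products over sets of
neighbours to match. -/
lemma prod_eq_prod_fin {ι : Type*} (s : Finset ι) (y : ι → ℂ) :
    ∏ i ∈ s, y i = ∏ j : Fin s.card, y (s.equivFin.symm j) := by
  rw [← Finset.prod_coe_sort, ← Equiv.prod_comp s.equivFin.symm]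

lemma Contraction.rel_succ_finset {Δ : ℕ} {ζ : Fin 3 → ℂ} {C η : ℝ} (K : Contraction Δ ζ C η)
    {ι : Type*} (L : ℕ) (s : Finset ι) (hs : s.card < Δ) (y y' : ι → ℂ) (hy : ∀ i ∈ s, y i ∈ K.U)
    (hy' : ∀ i ∈ s, y' i ∈ K.U) (h : ∀ i ∈ s, K.rel L (y i) (y' i)) :
    K.rel (L + 1) (edgeFun ζ (ζ 2 * ∏ i ∈ s, y i)) (edgeFun ζ (ζ 2 * ∏ i ∈ s, y' i)) := by
  rw [prod_eq_prod_fin, prod_eq_prod_fin s y']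
  exact K.rel_succ L s.card hs (fun j => y (s.equivFin.symm j)) (fun j => y' (s.equivFin.symm j))
    (fun i => hy _ (s.equivFin.symm i).2) (fun i => hy' _ (s.equivFin.symm i).2)
    fun i => h _ (s.equivFin.symm i).2

lemma Contraction.dist_le_finset {Δ : ℕ} {ζ : Fin 3 → ℂ} {C η : ℝ} (K : Contraction Δ ζ C η)
    {ι : Type*} (L : ℕ) (s : Finset ι) (hs : s.card ≤ Δ) (y y' : ι → ℂ) (hy : ∀ i ∈ s, y i ∈ K.U)
    (hy' : ∀ i ∈ s, y' i ∈ K.U) (h : ∀ i ∈ s, K.rel L (y i) (y' i)) :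
    ‖ζ 2 * ∏ i ∈ s, y i - ζ 2 * ∏ i ∈ s, y' i‖ ≤ C * η ^ L := by
  rw [prod_eq_prod_fin, prod_eq_prod_fin s y']
  exact K.dist_le L s.card hs (fun j => y (s.equivFin.symm j)) (fun j => y' (s.equivFin.symm j))
    (fun i => hy _ (s.equivFin.symm i).2) (fun i => hy' _ (s.equivFin.symm i).2)
    fun i => h _ (s.equivFin.symm i).2

/-! ### Truncated messages, Weitz's recursion and its dependence on distant vertices. -/

section Messages

variable {V : Type u} [Fintype V] [DecidableEq V] (G : SimpleGraph V) [DecidableRel G.Adj]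
  (ζ : Fin 3 → ℂ) (ord : V → ℕ)

/-- The view at a vertex that has been removed when the walk went on to its neighbour `w`: the
neighbours before `w` see `+`, the neighbours after `w` see `-`. -/
def towards (w : V) : V → Option Bool := fun x => if x = w then none else some (decide (ord x < ord w))

/-- The message sent by `u` in the state `st`, with the recursion truncated at a given depth. -/
noncomputable def msg : ℕ → State V → V → ℂ
  | 0, _, _ => (ζ 1)⁻¹
  | f + 1, st, u => edgeFun ζ (ζ 2 * ∏ w with G.Adj u w,
      match st w with
      | some g => viewMsg ζ (g u)
      | none => msg f (remove st u (towards ord w)) w)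

/-- The message received by `u` from its neighbour `w`. -/
noncomputable def edgeMsg (f : ℕ) (st : State V) (u w : V) : ℂ :=
  match st w with
  | some g => viewMsg ζ (g u)
  | none => msg G ζ ord f (remove st u (towards ord w)) w

/-- The ratio of the weights of `+` and `-` at `u`, with the recursion truncated. -/
noncomputable def ratio (f : ℕ) (st : State V) (u : V) : ℂ :=
  ζ 2 * ∏ w with G.Adj u w, edgeMsg G ζ ord f st u w

lemma msg_succ (f : ℕ) (st : State V) (u : V) :
    msg G ζ ord (f + 1) st u = edgeFun ζ (ratio G ζ ord f st u) := rfl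

lemma edgeMsg_of_alive (f : ℕ) {st : State V} (u : V) {w : V} (hw : st w = none) :
    edgeMsg G ζ ord f st u w = msg G ζ ord f (remove st u (towards ord w)) w := by
  simp [edgeMsg, hw]

lemma edgeMsg_of_some (f : ℕ) {st : State V} (u : V) {w : V} {g : V → Option Bool}
    (hw : st w = some g) : edgeMsg G ζ ord f st u w = viewMsg ζ (g u) := by
  simp [edgeMsg, hw]

/-- The neighbours of `u` that are alive or whose spin is seen by `u`. -/
def active (st : State V) (u : V) : Finset V :=
  Finset.univ.filter fun w => G.Adj u w ∧ (st w = none ∨ seen st u w ≠ none)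

/-- The vertex `u` has a removed neighbour at which it sees nothing. -/
def Entered (st : State V) (u : V) : Prop := ∃ x, G.Adj u x ∧ st x ≠ none ∧ seen st u x = none

lemma edgeMsg_eq_one (f : ℕ) {st : State V} {u w : V} (h : st w ≠ none) (h' : seen st u w = none) :
    edgeMsg G ζ ord f st u w = 1 := by
  obtain ⟨g, hg⟩ := Option.ne_none_iff_exists'.1 h
  have : g u = none := by simpa [seen, hg] using h'
  simp [edgeMsg, hg, this, viewMsg]

/-- A removed neighbour at which nothing is seen contributes the factor 1, and 1 need not belong to
the region `U`. Discarding these factors leaves only messages in `U`. -/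
lemma ratio_eq_prod_active (f : ℕ) (st : State V) (u : V) :
    ratio G ζ ord f st u = ζ 2 * ∏ w ∈ active G st u, edgeMsg G ζ ord f st u w := by
  rw [ratio]
  congr 1
  symm
  refine Finset.prod_subset (fun w hw => ?_) fun w hw hw' => ?_
  · simp only [active, Finset.mem_filter] at hw ⊢
    exact ⟨hw.1, hw.2.1⟩
  · simp only [active, Finset.mem_filter, Finset.mem_univ, true_and, not_and, not_or,
      not_not] at hw hw'
    exact edgeMsg_eq_one G ζ ord f (hw' hw).1 (hw' hw).2

lemma card_active_le {Δ : ℕ} (hΔ : ∀ v, G.degree v ≤ Δ) (st : State V) (u : V) :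
    (active G st u).card ≤ Δ := by
  refine le_trans (Finset.card_le_card fun w hw => ?_) (hΔ u)
  simp only [active, Finset.mem_filter] at hw
  simpa using hw.2.1

/-- The vertex from which the walk came is a neighbour but not active; this is where the arity `Δ -
1` comes from. -/
lemma card_active_lt {Δ : ℕ} (hΔ : ∀ v, G.degree v ≤ Δ) {st : State V} {u : V}
    (h : Entered G st u) : (active G st u).card < Δ := by
  refine lt_of_lt_of_le (Finset.card_lt_card ?_) (hΔ u)
  rw [Finset.ssubset_iff_of_subset]
  · obtain ⟨x, hx, hx', hx''⟩ := h
    exact ⟨x, by simpa using hx, by simp [active, hx', hx'']⟩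
  · intro w hw
    simp only [active, Finset.mem_filter] at hw
    simpa using hw.2.1

lemma entered_remove_towards (st : State V) {u w : V} (h : G.Adj u w) :
    Entered G (remove st u (towards ord w)) w :=
  ⟨u, h.symm, by simp [remove], by rw [seen_remove_self]; simp [towards]⟩

variable {G ζ} {Δ : ℕ} {C η : ℝ} (K : Contraction Δ ζ C η) (hΔ : ∀ v, G.degree v ≤ Δ)

include hΔ in
lemma msg_mem (f : ℕ) (st : State V) (u : V) (h : Entered G st u) : msg G ζ ord f st u ∈ K.U := by
  induction f generalizing st u with
  -- The value at the truncation depth is the message of a vertex pinned to `-`, so truncation does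
  -- not leave the region.
  | zero => exact K.gammaInv_mem
  | succ f ih =>
    rw [msg_succ, ratio_eq_prod_active, prod_eq_prod_fin]
    refine K.edgeFun_mem _ (card_active_lt G hΔ h) _ fun i => ?_
    obtain ⟨w, hw⟩ := (active G st u).equivFin.symm i
    simp only [active, Finset.mem_filter, Finset.mem_univ, true_and] at hw
    cases hst : st w with
    | none =>
      rw [edgeMsg_of_alive _ _ _ _ _ hst]
      exact ih _ _ (entered_remove_towards G ord st hw.1)
    | some g =>
      rw [edgeMsg_of_some _ _ _ _ _ hst]
      have : g u ≠ none := by simpa [hst, seen] using hw.2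
      rcases hgu : g u with _ | _ | _
      · exact absurd hgu this
      · exact K.gammaInv_mem
      · exact K.beta_mem

include hΔ in
lemma edgeMsg_mem (f : ℕ) (st : State V) (u : V) {w : V} (hw : w ∈ active G st u) :
    edgeMsg G ζ ord f st u w ∈ K.U := by
  simp only [active, Finset.mem_filter, Finset.mem_univ, true_and] at hw
  cases hst : st w with
  | none =>
    rw [edgeMsg_of_alive _ _ _ _ _ hst]
    exact msg_mem ord K hΔ _ _ _ (entered_remove_towards G ord st hw.1)
  | some g =>
    rw [edgeMsg_of_some _ _ _ _ _ hst]
    have : g u ≠ none := by simpa [hst, seen] using hw.2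
    rcases hgu : g u with _ | _ | _
    · exact absurd hgu this
    · exact K.gammaInv_mem
    · exact K.beta_mem

include K hΔ in
lemma half_le_norm_one_add_ratio (f : ℕ) (st : State V) (u : V) :
    1 / 2 ≤ ‖1 + ratio G ζ ord f st u‖ := by
  rw [ratio_eq_prod_active, prod_eq_prod_fin]
  exact K.half_le _ (card_active_le G hΔ st u) _ fun i =>
    edgeMsg_mem ord K hΔ f st u ((active G st u).equivFin.symm i).2

include K hΔ in
lemma ratio_add_ne_zero (f : ℕ) (st : State V) (u : V) (h : Entered G st u) :
    ratio G ζ ord f st u + ζ 1 ≠ 0 := by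
  rw [ratio_eq_prod_active, prod_eq_prod_fin]
  exact K.add_ne_zero _ (card_active_lt G hΔ h) _ fun i =>
    edgeMsg_mem ord K hΔ f st u ((active G st u).equivFin.symm i).2

lemma stateSum_congr_seen {st st' : State V} (h : alive st = alive st')
    (h1 : ∀ x ∈ alive st, ∀ w, G.Adj x w → seen st x w = seen st' x w) :
    stateSum G ζ st = stateSum G ζ st' := by
  refine stateSum_congr G ζ h (fun x hx => ?_) fun x hx => ?_
  · rw [plusW, plusW]
    congr 1
    refine Finset.prod_congr rfl fun w hw => ?_
    rw [h1 x hx w (Finset.mem_filter.1 hw).2]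
  · rw [minusW, minusW]
    refine Finset.prod_congr rfl fun w hw => ?_
    rw [h1 x hx w (Finset.mem_filter.1 hw).2]

lemma stateSum_remove_congr (st : State V) (u : V) {f g : V → Option Bool}
    (h : ∀ x, st x = none → G.Adj u x → f x = g x) :
    stateSum G ζ (remove st u f) = stateSum G ζ (remove st u g) := by
  refine stateSum_congr_seen (by simp [alive_remove]) fun x hx w hw => ?_
  by_cases hwu : w = u
  · subst hwu
    rw [seen_remove_self, seen_remove_self]
    rw [alive_remove] at hx
    exact h x (mem_alive.1 (Finset.mem_of_mem_erase hx)) hw.symm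
  · rw [seen_remove_of_ne _ _ hwu, seen_remove_of_ne _ _ hwu]

/-- Once `w` is pinned, what `w` itself sees at `u` enters no weight any more. -/
lemma stateSum_pin_remove_congr (st : State V) {u w : V} (huw : u ≠ w) (s : Bool)
    {f g : V → Option Bool} (h : ∀ x, x ≠ w → f x = g x) :
    stateSum G ζ (pin (remove st u f) w s) = stateSum G ζ (pin (remove st u g) w s) := by
  have hc : ∀ f', pin (remove st u f') w s = remove (pin st w s) u f' := fun f' =>
    Function.update_comm huw _ _ _
  rw [hc, hc]
  refine stateSum_remove_congr _ _ fun x hx _ => h x ?_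
  rintro rfl
  simp [pin, remove] at hx

/-- A product that telescopes along an ordered finite set. -/
lemma telescope_filter (hord : Function.Injective ord) (F : Finset V → ℂ) (c : V → ℂ) (s : Finset V)
    (h : ∀ w ∈ s, F (s.filter fun x => ord x ≤ ord w) = c w * F (s.filter fun x => ord x < ord w)) :
    F s = (∏ w ∈ s, c w) * F ∅ := by
  induction s using Finset.induction_on_max_value ord with
  | empty => simp
  | insert a s has hmax ih =>
    have hlt : ∀ x ∈ s, ord x < ord a := fun x hx =>
      lt_of_le_of_ne (hmax x hx) fun he => has (hord he ▸ hx)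
    have h1 : (insert a s).filter (fun x => ord x ≤ ord a) = insert a s := by
      rw [Finset.filter_eq_self]
      intro x hx
      rcases Finset.mem_insert.1 hx with rfl | hx
      exacts [le_rfl, hmax x hx]
    have h2 : (insert a s).filter (fun x => ord x < ord a) = s := by
      ext x
      simp only [Finset.mem_filter, Finset.mem_insert]
      constructor
      · rintro ⟨rfl | hx, h⟩
        exacts [absurd h (lt_irrefl _), hx]
      · exact fun hx => ⟨Or.inr hx, hlt x hx⟩
    have h3 := h a (Finset.mem_insert_self _ _)
    rw [h1, h2] at h3
    rw [h3, ih, Finset.prod_insert has, mul_assoc]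
    intro w hw
    have h4 := h w (Finset.mem_insert_of_mem hw)
    rwa [Finset.filter_insert, Finset.filter_insert, if_neg (not_le.2 (hlt w hw)),
      if_neg (not_lt.2 (hlt w hw).le)] at h4

/-- Explains the values of `viewMsg`: relative to the weight of `-`, a seen `+` contributes β and a
seen `-` contributes 1/γ. -/
lemma plusW_eq (h1 : ζ 1 ≠ 0) (st : State V) (u : V) :
    plusW G ζ st u = ζ 2 * (∏ w with G.Adj u w, viewMsg ζ (seen st u w)) * minusW G ζ st u := by
  rw [plusW, minusW, mul_assoc, ← Finset.prod_mul_distrib]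
  congr 1
  refine Finset.prod_congr rfl fun w _ => ?_
  rcases seen st u w with _ | _ | _ <;> simp [viewMsg, h1]

lemma minusW_ne_zero (h1 : ζ 1 ≠ 0) (st : State V) (u : V) : minusW G ζ st u ≠ 0 := by
  rw [minusW, Finset.prod_ne_zero_iff]
  intro w _
  split_ifs
  exacts [h1, one_ne_zero]

/-- The views account for the quotient of `plusW` and `minusW`. What remains of the ratio is the
product over the alive neighbours, which is the part that telescoping has to explain. -/
lemma ratio_mul_minusW (h1 : ζ 1 ≠ 0) (f : ℕ) (st : State V) (u : V) :
    ratio G ζ ord f st u * minusW G ζ st u =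
      plusW G ζ st u * ∏ w ∈ (Finset.univ.filter fun w => G.Adj u w).filter (fun w => st w = none),
        edgeMsg G ζ ord f st u w := by
  rw [plusW_eq h1, ratio, Finset.prod_filter (fun w => st w = none)]
  have : ∏ w with G.Adj u w, edgeMsg G ζ ord f st u w =
      (∏ w with G.Adj u w, viewMsg ζ (seen st u w)) * ∏ w with G.Adj u w,
        if st w = none then edgeMsg G ζ ord f st u w else 1 := by
    rw [← Finset.prod_mul_distrib]
    refine Finset.prod_congr rfl fun w _ => ?_
    cases hw : st w with
    | none => simp [viewMsg, seen, hw]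
    | some g => simp [edgeMsg_of_some _ _ _ _ _ hw, seen, hw]
  rw [this]
  ring

include K hΔ in
-- Weitz's recursion and zero-freeness in one induction. The ratio identity is kept in multiplied
-- form, so it only needs the denominators `ratio + γ` to be nonzero, which the certificate
-- supplies; the sum over the spin of an alive vertex is then `1 + ratio` times a smaller nonzero
-- sum. Each step of the walk removes an alive vertex, so with `m ≤ f + 1` the truncation depth is
-- never reached.
theorem stateSum_ne_zero_and_ratio (hord : Function.Injective ord) (m : ℕ) (st : State V)
    (hm : (alive st).card ≤ m) : stateSum G ζ st ≠ 0 ∧ ∀ u, st u = none → ∀ f, m ≤ f + 1 →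
      plusW G ζ st u * stateSum G ζ (pin st u true) =
        ratio G ζ ord f st u * (minusW G ζ st u * stateSum G ζ (pin st u false)) := by
  have hγ := K.gamma_ne_zero
  induction m generalizing st with
  | zero =>
    have h0 : alive st = ∅ := by rw [← Finset.card_eq_zero]; omega
    refine ⟨by rw [stateSum_of_alive_eq_empty G ζ h0]; exact one_ne_zero, fun u hu => ?_⟩
    rw [← mem_alive, h0] at hu
    simp at hu
  | succ m ih =>
    have hcard : ∀ (st' : State V) (u : V) (f : V → Option Bool), (alive st').card ≤ m + 1 →
        st' u = none → (alive (remove st' u f)).card ≤ m := by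
      intro st' u f h hu
      rw [alive_remove, Finset.card_erase_of_mem (mem_alive.2 hu)]
      omega
    have key : ∀ u, st u = none → ∀ f, m + 1 ≤ f + 1 →
        plusW G ζ st u * stateSum G ζ (pin st u true) =
          ratio G ζ ord f st u * (minusW G ζ st u * stateSum G ζ (pin st u false)) := by
      intro u hu f hf
      rw [← mul_assoc, ratio_mul_minusW ord hγ, mul_assoc]
      congr 1
      set N := (Finset.univ.filter fun w => G.Adj u w).filter (fun w => st w = none) with hN
      -- `A` is the set of alive neighbours that see `+` at `u`. Growing it from `∅` to `N` in the
      -- order `ord` turns `u` from `-` into `+`, and each step changes the view of a single vertex.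
      have htel := telescope_filter ord hord
        (fun A => stateSum G ζ (remove st u fun x => some (decide (x ∈ A))))
        (fun w => edgeMsg G ζ ord f st u w) N ?_
      · have e1 : stateSum G ζ (pin st u true) =
            stateSum G ζ (remove st u fun x => some (decide (x ∈ N))) :=
          stateSum_remove_congr _ _ fun x hx hux => by simp [hN, hx, hux]
        have e2 : stateSum G ζ (pin st u false) =
            stateSum G ζ (remove st u fun x => some (decide (x ∈ (∅ : Finset V)))) :=
          stateSum_remove_congr _ _ fun x hx hux => by simp
        rw [e1, e2]
        exact htel
      · intro w hw
        simp only [hN, Finset.mem_filter, Finset.mem_univ, true_and] at hw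
        obtain ⟨huw, hwn⟩ := hw
        have hne : u ≠ w := huw.ne
        have e3 : stateSum G ζ (remove st u fun x =>
              some (decide (x ∈ N.filter fun x => ord x ≤ ord w))) =
            stateSum G ζ (remove st u fun x => some (decide (ord x ≤ ord w))) :=
          stateSum_remove_congr _ _ fun x hx hux => by simp [hN, hx, hux]
        have e4 : stateSum G ζ (remove st u fun x =>
              some (decide (x ∈ N.filter fun x => ord x < ord w))) =
            stateSum G ζ (remove st u fun x => some (decide (ord x < ord w))) :=
          stateSum_remove_congr _ _ fun x hx hux => by simp [hN, hx, hux]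
        have hwa : ∀ g, remove st u g w = none := fun g => by simp [remove, hne.symm, hwn]
        -- Apart from the view of `w`, the states with `≤` and with `<` both agree with `towards ord
        -- w`, because `ord` is injective.
        have hp : ∀ s, stateSum G ζ (pin (remove st u fun x => some (decide (ord x ≤ ord w))) w s) =
            stateSum G ζ (pin (remove st u (towards ord w)) w s) := fun s =>
          stateSum_pin_remove_congr _ hne s fun x hx => by
            have : ord x ≠ ord w := fun h => hx (hord h)
            simp only [towards, hx, if_false, Option.some.injEq, decide_eq_decide]
            omega
        have hp' : ∀ s, stateSum G ζ (pin (remove st u fun x => some (decide (ord x < ord w))) w s) =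
            stateSum G ζ (pin (remove st u (towards ord w)) w s) := fun s =>
          stateSum_pin_remove_congr _ hne s fun x hx => by simp [towards, hx]
        have hpos : 0 < (alive (remove st u (towards ord w))).card :=
          Finset.card_pos.2 ⟨w, mem_alive.2 (hwa _)⟩
        have hm1 := hcard st u (towards ord w) hm hu
        -- Depth 0 is excluded because `w` is still alive after `u` has been removed.
        obtain ⟨f, rfl⟩ : ∃ f', f = f' + 1 := ⟨f - 1, by omega⟩
        have hih := (ih _ hm1).2 w (hwa _) f (by omega)
        have hne0 := ratio_add_ne_zero ord K hΔ f _ w (entered_remove_towards G ord st huw)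
        rw [plusW_remove G ζ hu, minusW_remove G ζ hu] at hih
        simp only [towards, if_true, reduceCtorEq, and_false, if_false, mul_one] at hih
        simp only [e3, e4]
        rw [stateSum_eq G ζ (hwa _), stateSum_eq G ζ (hwa _), hp, hp, hp', hp',
          plusW_remove G ζ hu, minusW_remove G ζ hu, plusW_remove G ζ hu, minusW_remove G ζ hu,
          edgeMsg_of_alive _ _ _ _ _ hwn, msg_succ, edgeFun]
        simp only [huw.symm, true_and, le_refl, decide_true, if_true, lt_irrefl, decide_false,
          Option.some.injEq, if_false, mul_one, Bool.true_eq_false,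
          Bool.false_eq_true]
        rw [div_mul_eq_mul_div, eq_div_iff hne0]
        change _ = ratio G ζ ord f (remove st u (towards ord w)) w * _ at hih
        -- With denominators cleared, the two sides differ by βγ - 1, the determinant of the Möbius
        -- map, times the ratio identity at `w`.
        linear_combination (ζ 0 * ζ 1 - 1) * hih
    refine ⟨?_, key⟩
    by_cases h0 : alive st = ∅
    · rw [stateSum_of_alive_eq_empty G ζ h0]; exact one_ne_zero
    · obtain ⟨u, hu⟩ := Finset.nonempty_iff_ne_empty.2 h0
      rw [mem_alive] at hu
      -- The sum over both spins is `1 + ratio` times the contribution of `-`.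
      rw [stateSum_eq G ζ hu, key u hu m le_rfl, ← add_one_mul, add_comm _ (1 : ℂ), pin]
      refine mul_ne_zero (fun h => ?_)
        (mul_ne_zero (minusW_ne_zero hγ st u) (ih _ (hcard st u _ hm hu)).1)
      have := half_le_norm_one_add_ratio ord K hΔ m st u
      rw [h, norm_zero] at this
      norm_num at this

variable (G) in
/-- The states agree on the vertices that can be reached from `u` in `1` to `k` steps. -/
def Agree : ℕ → State V → State V → V → Prop
  | 0, _, _, _ => True
  | k + 1, st, st', u => ∀ w, G.Adj u w → st w = st' w ∧ Agree k st st' w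

lemma Agree.remove {k : ℕ} {st st' : State V} {w : V} (h : Agree G k st st' w) (u : V)
    (f : V → Option Bool) : Agree G k (remove st u f) (remove st' u f) w := by
  induction k generalizing w with
  | zero => trivial
  | succ k ih =>
    intro x hx
    refine ⟨?_, ih (h x hx).2⟩
    by_cases hxu : x = u
    · simp [TwoSpin.remove, hxu]
    · simp [TwoSpin.remove, hxu, (h x hx).1]

lemma active_congr {k : ℕ} {st st' : State V} {u : V} (h : Agree G (k + 1) st st' u) :
    active G st u = active G st' u := by
  refine Finset.filter_congr fun w _ => and_congr_right fun hw => ?_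
  rw [seen, seen, (h w hw).1]

include hΔ in
lemma rel_edgeMsg {k f f' : ℕ} {st st' : State V} {u w : V} (h : Agree G (k + 1) st st' u)
    (hw : w ∈ active G st u)
    (hrel : ∀ st st' : State V, Agree G k st st' w → Entered G st w → Entered G st' w →
      K.rel k (msg G ζ ord f st w) (msg G ζ ord f' st' w)) :
    K.rel k (edgeMsg G ζ ord f st u w) (edgeMsg G ζ ord f' st' u w) := by
  have huw : G.Adj u w := (Finset.mem_filter.1 hw).2.1
  have hst := (h w huw).1
  cases hstw : st w with
  | none =>
    rw [edgeMsg_of_alive _ _ _ _ _ hstw, edgeMsg_of_alive _ _ _ _ _ (hst ▸ hstw)]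
    exact hrel _ _ ((h w huw).2.remove u _)
      (entered_remove_towards G ord st huw) (entered_remove_towards G ord st' huw)
  | some g =>
    have e : edgeMsg G ζ ord f' st' u w = edgeMsg G ζ ord f st u w := by
      rw [edgeMsg_of_some _ _ _ _ _ hstw, edgeMsg_of_some _ _ _ _ _ (hst ▸ hstw)]
    rw [e]
    exact K.rel_refl _ _ (edgeMsg_mem ord K hΔ _ _ _ hw)

include hΔ in
-- A different truncation depth and a different state beyond distance `k` are treated at once: after
-- `k` levels only membership in the region is known, and that is all `rel 0` asks for.
lemma rel_msg (k f f' : ℕ) (hf : k ≤ f) (hf' : k ≤ f') (st st' : State V) (u : V)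
    (h : Agree G k st st' u) (hu : Entered G st u) (hu' : Entered G st' u) :
    K.rel k (msg G ζ ord f st u) (msg G ζ ord f' st' u) := by
  induction k generalizing f f' st st' u with
  | zero => exact K.rel_zero _ (msg_mem ord K hΔ _ _ _ hu) _ (msg_mem ord K hΔ _ _ _ hu')
  | succ k ih =>
    obtain ⟨f, rfl⟩ : ∃ g, f = g + 1 := ⟨f - 1, by omega⟩
    obtain ⟨f', rfl⟩ : ∃ g, f' = g + 1 := ⟨f' - 1, by omega⟩
    rw [msg_succ, msg_succ, ratio_eq_prod_active, ratio_eq_prod_active, ← active_congr h]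
    exact K.rel_succ_finset _ _ (card_active_lt G hΔ hu) _ _
      (fun w hw => edgeMsg_mem ord K hΔ _ _ _ hw)
      (fun w hw => edgeMsg_mem ord K hΔ _ _ _ (active_congr h ▸ hw))
      fun w hw => rel_edgeMsg ord K hΔ h hw fun st st' h1 h2 h3 =>
        ih _ _ (by omega) (by omega) _ _ _ h1 h2 h3

include K hΔ in
-- The root may have `Δ` children, one more than the recursion admits. The last step, from messages
-- to ratios, is therefore left to `dist_le`, which allows arity `Δ` but claims no further
-- contraction.
theorem norm_ratio_sub_ratio_le (k f f' : ℕ) (hf : k ≤ f) (hf' : k ≤ f') (st st' : State V) (u : V)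
    (h : Agree G (k + 1) st st' u) :
    ‖ratio G ζ ord f st u - ratio G ζ ord f' st' u‖ ≤ C * η ^ k := by
  rw [ratio_eq_prod_active, ratio_eq_prod_active, ← active_congr h]
  exact K.dist_le_finset _ _ (card_active_le G hΔ _ _) _ _
    (fun w hw => edgeMsg_mem ord K hΔ _ _ _ hw)
    (fun w hw => edgeMsg_mem ord K hΔ _ _ _ (active_congr h ▸ hw))
    fun w hw => rel_edgeMsg ord K hΔ h hw fun st st' h1 h2 h3 =>
      rel_msg ord K hΔ _ _ _ hf hf' _ _ _ h1 h2 h3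

lemma agree_refl (k : ℕ) (st : State V) (u : V) : Agree G k st st u := by
  induction k generalizing u with
  | zero => trivial
  | succ k ih => exact fun w _ => ⟨rfl, ih w⟩

end Messages

/-! ### Zero-freeness and strong spatial mixing from contraction -/

section Consequences

variable {V : Type u} [Fintype V] [DecidableEq V] {G : SimpleGraph V} [DecidableRel G.Adj]
  {ζ : Fin 3 → ℂ} {Δ : ℕ} {C η : ℝ} (K : Contraction Δ ζ C η) (hΔ : ∀ v, G.degree v ≤ Δ)

include K hΔ in
theorem Z_ne_zero_of_contraction {p : V → Option Bool} (hp : Feasible G ζ p) : Z G ζ p ≠ 0 := by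
  rw [Z_eq_pinnedWeight_mul]
  refine mul_ne_zero (pinnedWeight_ne_zero G ζ hp K.gamma_ne_zero)
    (stateSum_ne_zero_and_ratio (fun v => (Fintype.equivFin V v : ℕ)) K hΔ ?_ _ _ le_rfl).1
  exact Fin.val_injective.comp (Fintype.equivFin V).injective

include K hΔ in
-- The weight of the pinned vertices and the contribution of the spin `-` at `v` cancel in the
-- quotient, leaving x/(1 + x) for the ratio x.
lemma marginal_eq (ord : V → ℕ) (hord : Function.Injective ord) {p : V → Option Bool}
    (hp : Feasible G ζ p) {v : V} (hv : p v = none) (f : ℕ)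
    (hf : (alive (ofPinning p)).card ≤ f + 1) :
    marginal G ζ p v =
      ratio G ζ ord f (ofPinning p) v / (1 + ratio G ζ ord f (ofPinning p) v) := by
  have hv' : ofPinning p v = none := ofPinning_eq_none.2 hv
  have h1 := (stateSum_ne_zero_and_ratio ord K hΔ hord _ _ le_rfl).2 v hv' f hf
  have h2 := (stateSum_ne_zero_and_ratio ord K hΔ hord _ (pin (ofPinning p) v false) le_rfl).1
  have h3 := minusW_ne_zero (G := G) K.gamma_ne_zero (ofPinning p) v
  have h4 := pinnedWeight_ne_zero G ζ hp K.gamma_ne_zero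
  have h5 : 1 + ratio G ζ ord f (ofPinning p) v ≠ 0 := fun h => by
    have := half_le_norm_one_add_ratio ord K hΔ f (ofPinning p) v
    rw [h, norm_zero] at this
    norm_num at this
  have hZ : Z G ζ p = pinnedWeight G ζ p * ((1 + ratio G ζ ord f (ofPinning p) v) *
      (minusW G ζ (ofPinning p) v * stateSum G ζ (pin (ofPinning p) v false))) := by
    rw [Z_eq_pinnedWeight_mul, stateSum_eq G ζ hv', h1]
    ring
  have hP : ZPlus G ζ p v = pinnedWeight G ζ p * (ratio G ζ ord f (ofPinning p) v *
      (minusW G ζ (ofPinning p) v * stateSum G ζ (pin (ofPinning p) v false))) := by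
    rw [ZPlus_eq G ζ hv, Z_eq_pinnedWeight_mul, pinnedWeight_update_true G ζ hv, ofPinning_update,
      ← h1]
    ring
  rw [marginal, hZ, hP]
  field_simp

lemma agree_of_walk (k : ℕ) (st st' : State V) (u : V)
    (h : ∀ w, ∀ q : G.Walk u w, q.length ≤ k → st w = st' w) : Agree G k st st' u := by
  induction k generalizing u with
  | zero => trivial
  | succ k ih =>
    refine fun w hw => ⟨h w (.cons hw .nil) (by simp), ih w fun x q hq => h x (.cons hw q) ?_⟩
    simpa using hq

lemma norm_div_one_add_sub_le {x y : ℂ} (hx : 1 / 2 ≤ ‖1 + x‖) (hy : 1 / 2 ≤ ‖1 + y‖) :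
    ‖x / (1 + x) - y / (1 + y)‖ ≤ 4 * ‖x - y‖ := by
  have hx0 : 1 + x ≠ 0 := norm_pos_iff.1 (by linarith)
  have hy0 : 1 + y ≠ 0 := norm_pos_iff.1 (by linarith)
  rw [div_sub_div _ _ hx0 hy0, norm_div, norm_mul, show x * (1 + y) - (1 + x) * y = x - y by ring,
    div_le_iff₀ (by positivity)]
  have : 1 / 4 ≤ ‖1 + x‖ * ‖1 + y‖ := by nlinarith
  nlinarith [norm_nonneg (x - y)]

lemma norm_div_one_add_le {x : ℂ} (hx : 1 / 2 ≤ ‖1 + x‖) : ‖x / (1 + x)‖ ≤ 3 := by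
  have hx0 : 1 + x ≠ 0 := norm_pos_iff.1 (by linarith)
  rw [norm_div, div_le_iff₀ (by linarith)]
  have : ‖x‖ ≤ ‖1 + x‖ + 1 := by
    calc ‖x‖ = ‖(1 + x) - 1‖ := by ring_nf
      _ ≤ ‖1 + x‖ + ‖(1 : ℂ)‖ := norm_sub_le _ _
      _ = _ := by simp
  linarith

/-- The factor `η ^ 2` in the denominator pays for two lost levels: distance `k + 2` gives agreement
along walks of at most `k + 1` steps, which gives decay `η ^ k`. For distances below 2 the bound 3
on each marginal is enough, whence the 6. The 4 is the Lipschitz constant of x/(1 + x) where |1 + x|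
≥ 1/2. -/
theorem strongSpatialMixing_of_contraction {Δ : ℕ} {ζ : Fin 3 → ℂ} {C η : ℝ}
    (K : Contraction Δ ζ C η) (h0 : 0 < η) (h1 : η < 1) : StrongSpatialMixing.{u} Δ ζ := by
  refine ⟨(6 + 4 * |C|) / η ^ 2, -Real.log η, by positivity, by
    simpa using Real.log_neg h0 h1, ?_⟩
  intro V _ _ G _ hΔ v p q hp hq hpv hqv
  refine ⟨Z_ne_zero_of_contraction K hΔ hp, Z_ne_zero_of_contraction K hΔ hq, fun k hk => ?_⟩
  rw [neg_neg, Real.exp_mul, Real.exp_log h0, Real.rpow_natCast]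
  set ord : V → ℕ := fun v => (Fintype.equivFin V v : ℕ) with hordd
  have hord : Function.Injective ord := Fin.val_injective.comp (Fintype.equivFin V).injective
  -- Deep enough to be exact in every state, and at least `k` as the decay estimate requires.
  set f := k + Fintype.card V with hf
  have hcard : ∀ st : State V, (alive st).card ≤ f + 1 := fun st =>
    (Finset.card_le_univ _).trans (by omega)
  rw [marginal_eq K hΔ ord hord hp hpv f (hcard _), marginal_eq K hΔ ord hord hq hqv f (hcard _)]
  have hb := fun st => half_le_norm_one_add_ratio ord K hΔ f st v
  have hC := abs_nonneg C
  match k, hk with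
  | 0, _ | 1, _ =>
    refine (norm_sub_le _ _).trans ((add_le_add (norm_div_one_add_le (hb _))
      (norm_div_one_add_le (hb _))).trans ?_)
    rw [div_mul_eq_mul_div, le_div_iff₀ (by positivity)]
    first
    | (have : η ^ 2 ≤ 1 := by nlinarith
       rw [pow_zero]
       nlinarith)
    | (have : η ^ 2 ≤ η := by nlinarith
       rw [pow_one]
       nlinarith)
  | k + 2, hk =>
    have hag : Agree G (k + 1) (ofPinning p) (ofPinning q) v := by
      refine agree_of_walk _ _ _ _ fun w W hW => ?_
      by_contra hne
      have hw : w ∈ {w | p w ≠ q w} := fun h => hne (by simp [ofPinning, h])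
      have h2 : ((k + 2 : ℕ) : ℕ∞) ≤ W.length :=
        hk.trans ((iInf₂_le w hw).trans (SimpleGraph.edist_le W))
      rw [Nat.cast_le] at h2
      omega
    refine (norm_div_one_add_sub_le (hb _) (hb _)).trans ?_
    have h3 := norm_ratio_sub_ratio_le ord K hΔ k f f (by omega) (by omega) _ _ v hag
    have h4 : C * η ^ k ≤ |C| * η ^ k := by gcongr; exact le_abs_self C
    have h5 : (6 + 4 * |C|) / η ^ 2 * η ^ (k + 2) = (6 + 4 * |C|) * η ^ k := by
      rw [pow_add]; field_simp
    rw [h5]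
    nlinarith [pow_pos h0 k]

end Consequences

/-! ### From real contraction to complex contraction -/

section Extension

open Filter Topology Set

/-- The real message function. -/
noncomputable def realEdgeFun (ζ : Fin 3 → ℝ) (x : ℝ) : ℝ := (ζ 0 * x + 1) / (x + ζ 1)

/-- The interval spanned by the messages of pinned vertices. -/
def msgInterval (ζ : Fin 3 → ℝ) : Set ℝ := uIcc (ζ 0) (ζ 1)⁻¹

/-- The real tree recursion with at most `Δ - 1` children contracts strictly with respect to the
weight `w` on the message interval. -/
structure RealContraction (Δ : ℕ) (ζ : Fin 3 → ℝ) (w : ℝ → ℝ) : Prop where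
  beta_nonneg : 0 ≤ ζ 0
  gamma_pos : 0 < ζ 1
  lambda_nonneg : 0 ≤ ζ 2
  continuous : Continuous w
  pos : ∀ y ∈ msgInterval ζ, 0 < w y
  lt : ∀ d < Δ, ∀ k : Fin d → ℝ, (∀ i, k i ∈ msgInterval ζ) →
    ∑ i, |ζ 0 * ζ 1 - 1| * ζ 2 * (∏ j ∈ Finset.univ.erase i, k j) / (ζ 2 * ∏ j, k j + ζ 1) ^ 2 *
      w (k i) < w (realEdgeFun ζ (ζ 2 * ∏ j, k j))

/-- The coefficient of `y i - y' i` in the difference of the images of `y` and `y'`. -/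
noncomputable def diffCoeff (ζ : Fin 3 → ℂ) {d : ℕ} (y y' : Fin d → ℂ) (i : Fin d) : ℂ :=
  (ζ 0 * ζ 1 - 1) * ζ 2 * ((∏ j with j < i, y' j) * ∏ j with i < j, y j) /
    ((ζ 2 * ∏ j, y j + ζ 1) * (ζ 2 * ∏ j, y' j + ζ 1))

lemma prod_sub_prod_eq {d : ℕ} (y y' : Fin d → ℂ) :
    ∏ j, y j - ∏ j, y' j =
      ∑ i, ((∏ j with j < i, y' j) * ∏ j with i < j, y j) * (y i - y' i) := by
  have := Finset.prod_sub_ordered Finset.univ y fun i => y i - y' i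
  simp only [sub_sub_cancel] at this
  rw [this, sub_sub_cancel]
  exact Finset.sum_congr rfl fun i _ => by ring

/-- An exact difference formula rather than a derivative estimate: it compares complex vectors
without a path between them inside the region, and for y = y' its coefficients are the partial
derivatives. -/
lemma edgeFun_sub_edgeFun {ζ : Fin 3 → ℂ} {d : ℕ} {y y' : Fin d → ℂ}
    (h : ζ 2 * ∏ j, y j + ζ 1 ≠ 0) (h' : ζ 2 * ∏ j, y' j + ζ 1 ≠ 0) :
    edgeFun ζ (ζ 2 * ∏ j, y j) - edgeFun ζ (ζ 2 * ∏ j, y' j) =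
      ∑ i, diffCoeff ζ y y' i * (y i - y' i) := by
  have h1 : edgeFun ζ (ζ 2 * ∏ j, y j) - edgeFun ζ (ζ 2 * ∏ j, y' j) =
      (ζ 0 * ζ 1 - 1) * ζ 2 / ((ζ 2 * ∏ j, y j + ζ 1) * (ζ 2 * ∏ j, y' j + ζ 1)) *
        (∏ j, y j - ∏ j, y' j) := by
    rw [edgeFun, edgeFun, div_sub_div _ _ h h', div_mul_eq_mul_div]
    congr 1
    ring
  rw [h1, prod_sub_prod_eq, Finset.mul_sum]
  refine Finset.sum_congr rfl fun i _ => ?_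
  rw [diffCoeff]
  ring

lemma prod_lt_mul_prod_gt {d : ℕ} (k : Fin d → ℂ) (i : Fin d) :
    (∏ j with j < i, k j) * ∏ j with i < j, k j = ∏ j ∈ Finset.univ.erase i, k j := by
  rw [← Finset.prod_union]
  · congr 1
    ext j
    simp [lt_or_lt_iff_ne]
  · rw [Finset.disjoint_left]
    intro j hj hj'
    simp only [Finset.mem_filter] at hj hj'
    exact lt_asymm hj.2 hj'.2

variable {Δ : ℕ} {ζ₀ : Fin 3 → ℝ} {w : ℝ → ℝ}

lemma mem_msgInterval_nonneg (hβ : 0 ≤ ζ₀ 0) (hγ : 0 < ζ₀ 1) {y : ℝ} (hy : y ∈ msgInterval ζ₀) :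
    0 ≤ y := by
  rcases mem_uIcc.1 hy with h | h
  · exact hβ.trans h.1
  · exact (inv_nonneg.2 hγ.le).trans h.1

/-- The message is the convex combination of β and 1/γ with coefficients x/(x + γ) and γ/(x + γ). -/
lemma realEdgeFun_mem (hγ : 0 < ζ₀ 1) {x : ℝ} (hx : 0 ≤ x) : realEdgeFun ζ₀ x ∈ msgInterval ζ₀ := by
  have h1 : 0 < x + ζ₀ 1 := by linarith
  have h := (convex_uIcc (ζ₀ 0) (ζ₀ 1)⁻¹) left_mem_uIcc right_mem_uIcc
    (div_nonneg hx h1.le) (div_nonneg hγ.le h1.le) (by field_simp)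
  have e : realEdgeFun ζ₀ x = (x / (x + ζ₀ 1)) • ζ₀ 0 + (ζ₀ 1 / (x + ζ₀ 1)) • (ζ₀ 1)⁻¹ := by
    rw [realEdgeFun, smul_eq_mul, smul_eq_mul]
    field_simp
  rw [e]
  exact h

lemma eventually_nhdsGT_of_eventually_nhds {X : Type*} [SeminormedAddCommGroup X] {x₀ : X}
    {P : X → Prop} (h : ∀ᶠ x in 𝓝 x₀, P x) : ∀ᶠ ρ in 𝓝[>] (0 : ℝ), ∀ x, ‖x - x₀‖ ≤ ρ → P x := by
  obtain ⟨ε, hε, h⟩ := Metric.eventually_nhds_iff.1 h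
  filter_upwards [Ioo_mem_nhdsGT hε] with ρ hρ x hx
  exact h (by rw [dist_eq_norm]; exact hx.trans_lt hρ.2)

lemma isCompact_msgVectors (ζ₀ : Fin 3 → ℝ) (d : ℕ) :
    IsCompact {k : Fin d → ℝ | ∀ i, k i ∈ msgInterval ζ₀} := by
  have := isCompact_univ_pi fun _ : Fin d => (isCompact_uIcc (a := ζ₀ 0) (b := (ζ₀ 1)⁻¹))
  convert this using 1
  ext k
  rw [mem_univ_pi]
  rfl

/-- At ρ = 0 this is the strict real inequality. Both sides are jointly continuous and the vectors
`k` form a compact set, so a single small ρ can serve both as radius of perturbation and as gain of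
the contraction. -/
lemma RealContraction.eventually_step (h : RealContraction Δ ζ₀ w) {d : ℕ} (hd : d < Δ) :
    ∀ᶠ ρ in 𝓝[>] (0 : ℝ), ∀ (ζ : Fin 3 → ℂ) (y y' : Fin d → ℂ) (k : Fin d → ℝ),
      ‖ζ - fun i => (ζ₀ i : ℂ)‖ ≤ ρ → (∀ i, k i ∈ msgInterval ζ₀) →
      (∀ i, ‖y i - k i‖ ≤ ρ) → (∀ i, ‖y' i - k i‖ ≤ ρ) →
      ζ 2 * ∏ i, y i + ζ 1 ≠ 0 ∧ ζ 2 * ∏ i, y' i + ζ 1 ≠ 0 ∧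
      ∑ i, ‖diffCoeff ζ y y' i‖ * w (k i) < (1 - ρ) * w (realEdgeFun ζ₀ (ζ₀ 2 * ∏ i, k i)) := by
  let P : (ℝ × (Fin 3 → ℂ) × (Fin d → ℂ) × (Fin d → ℂ)) → (Fin d → ℝ) → Prop := fun p k =>
    p.2.1 2 * ∏ i, (k i + p.2.2.1 i) + p.2.1 1 ≠ 0 ∧ p.2.1 2 * ∏ i, (k i + p.2.2.2 i) + p.2.1 1 ≠ 0 ∧
      ∑ i, ‖diffCoeff p.2.1 (fun i => k i + p.2.2.1 i) (fun i => k i + p.2.2.2 i) i‖ * w (k i) <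
        (1 - p.1) * w (realEdgeFun ζ₀ (ζ₀ 2 * ∏ i, k i))
  let p₀ : ℝ × (Fin 3 → ℂ) × (Fin d → ℂ) × (Fin d → ℂ) := (0, fun i => (ζ₀ i : ℂ), 0, 0)
  have hev : ∀ᶠ p in 𝓝 p₀, ∀ k ∈ {k : Fin d → ℝ | ∀ i, k i ∈ msgInterval ζ₀}, P p k := by
    refine (isCompact_msgVectors ζ₀ d).eventually_forall_of_forall_eventually fun k hk => ?_
    have hk0 : 0 ≤ ∏ i, k i := Finset.prod_nonneg fun i _ =>
      mem_msgInterval_nonneg h.beta_nonneg h.gamma_pos (hk i)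
    have hx0 : 0 ≤ ζ₀ 2 * ∏ i, k i := mul_nonneg h.lambda_nonneg hk0
    have hden : 0 < ζ₀ 2 * ∏ i, k i + ζ₀ 1 := by linarith [h.gamma_pos]
    have hdenC : (ζ₀ 2 : ℂ) * ∏ i, (k i : ℂ) + (ζ₀ 1 : ℂ) ≠ 0 := by
      exact_mod_cast hden.ne'
    have hc1 : Continuous fun z : (ℝ × (Fin 3 → ℂ) × (Fin d → ℂ) × (Fin d → ℂ)) × (Fin d → ℝ) =>
        z.1.2.1 2 * ∏ i, ((z.2 i : ℂ) + z.1.2.2.1 i) + z.1.2.1 1 := by fun_prop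
    have hc2 : Continuous fun z : (ℝ × (Fin 3 → ℂ) × (Fin d → ℂ) × (Fin d → ℂ)) × (Fin d → ℝ) =>
        z.1.2.1 2 * ∏ i, ((z.2 i : ℂ) + z.1.2.2.2 i) + z.1.2.1 1 := by fun_prop
    have hw := h.continuous
    have e1 := hc1.continuousAt.eventually_ne (x := (p₀, k)) (y := 0) (by simpa [p₀] using hdenC)
    have e2 := hc2.continuousAt.eventually_ne (x := (p₀, k)) (y := 0) (by simpa [p₀] using hdenC)
    have hc3 : ContinuousAt (fun z : (ℝ × (Fin 3 → ℂ) × (Fin d → ℂ) × (Fin d → ℂ)) × (Fin d → ℝ) =>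
        ∑ i, ‖diffCoeff z.1.2.1 (fun i => (z.2 i : ℂ) + z.1.2.2.1 i)
          (fun i => (z.2 i : ℂ) + z.1.2.2.2 i) i‖ * w (z.2 i)) (p₀, k) := by
      refine tendsto_finsetSum _ fun i _ => ContinuousAt.mul (ContinuousAt.norm ?_) ?_
      · unfold diffCoeff
        refine ContinuousAt.div (Continuous.continuousAt ?_)
          (Continuous.continuousAt (hc1.mul hc2)) ?_
        · fun_prop
        · simpa [p₀] using hdenC
      · exact Continuous.continuousAt (by fun_prop)
    have hc4 : ContinuousAt (fun z : (ℝ × (Fin 3 → ℂ) × (Fin d → ℂ) × (Fin d → ℂ)) × (Fin d → ℝ) =>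
        (1 - z.1.1) * w (realEdgeFun ζ₀ (ζ₀ 2 * ∏ i, z.2 i))) (p₀, k) := by
      refine ContinuousAt.mul (Continuous.continuousAt (by fun_prop)) ?_
      refine hw.continuousAt.comp ?_
      unfold realEdgeFun
      exact ContinuousAt.div (Continuous.continuousAt (by fun_prop))
        (Continuous.continuousAt (by fun_prop)) hden.ne'
    have e3 := hc3.eventually_lt hc4 (by
      have := h.lt d hd k hk
      simp only [p₀, Pi.zero_apply, add_zero, sub_zero, one_mul]
      refine lt_of_eq_of_lt (Finset.sum_congr rfl fun i _ => ?_) this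
      congr 1
      rw [diffCoeff, prod_lt_mul_prod_gt, norm_div, norm_mul, norm_mul, norm_mul]
      have n1 : ‖(ζ₀ 0 : ℂ) * ζ₀ 1 - 1‖ = |ζ₀ 0 * ζ₀ 1 - 1| := by
        rw [← Complex.ofReal_mul, ← Complex.ofReal_one, ← Complex.ofReal_sub, Complex.norm_real,
          Real.norm_eq_abs]
      have n2 : ‖(ζ₀ 2 : ℂ)‖ = ζ₀ 2 := by simp [abs_of_nonneg h.lambda_nonneg]
      have n3 : ‖∏ j ∈ Finset.univ.erase i, (k j : ℂ)‖ = ∏ j ∈ Finset.univ.erase i, k j := by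
        rw [← Complex.ofReal_prod, Complex.norm_real, Real.norm_eq_abs, abs_of_nonneg]
        exact Finset.prod_nonneg fun i _ =>
          mem_msgInterval_nonneg h.beta_nonneg h.gamma_pos (hk i)
      have n4 : ‖(ζ₀ 2 : ℂ) * ∏ j, (k j : ℂ) + ζ₀ 1‖ = ζ₀ 2 * ∏ j, k j + ζ₀ 1 := by
        rw [← Complex.ofReal_prod, ← Complex.ofReal_mul, ← Complex.ofReal_add, Complex.norm_real,
          Real.norm_eq_abs, abs_of_pos hden]
      rw [n1, n2, n3, n4, sq])
    exact e1.and (e2.and e3)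
  filter_upwards [eventually_nhdsGT_of_eventually_nhds hev, self_mem_nhdsWithin] with ρ hρ hρ0 ζ y y' k
    hζ hk hy hy'
  have hρ0' : (0 : ℝ) ≤ ρ := le_of_lt hρ0
  have := hρ (ρ, ζ, fun i => y i - k i, fun i => y' i - k i) (by
    simp only [p₀, Prod.norm_def, Prod.fst_sub, Prod.snd_sub, sub_zero, sup_le_iff]
    refine ⟨by rw [Real.norm_eq_abs, abs_of_nonneg hρ0'], hζ, ?_, ?_⟩
    · exact (pi_norm_le_iff_of_nonneg hρ0').2 hy
    · exact (pi_norm_le_iff_of_nonneg hρ0').2 hy') k hk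
  simpa [P] using this

/-- Isolates the effect of the parameters on real messages. The tolerance τ depends on the ρ found
before, so the radius of the parameter ball has to be chosen afterwards. -/
lemma RealContraction.eventually_param (h : RealContraction Δ ζ₀ w) (d : ℕ) {τ : ℝ} (hτ : 0 < τ) :
    ∀ᶠ ρ in 𝓝[>] (0 : ℝ), ∀ (ζ : Fin 3 → ℂ) (k : Fin d → ℝ),
      ‖ζ - fun i => (ζ₀ i : ℂ)‖ ≤ ρ → (∀ i, k i ∈ msgInterval ζ₀) →
      ‖edgeFun ζ (ζ 2 * ∏ i, (k i : ℂ)) - (realEdgeFun ζ₀ (ζ₀ 2 * ∏ i, k i) : ℝ)‖ < τ := by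
  have hev : ∀ᶠ ζ in 𝓝 (fun i => (ζ₀ i : ℂ)), ∀ k ∈ {k : Fin d → ℝ | ∀ i, k i ∈ msgInterval ζ₀},
      ‖edgeFun ζ (ζ 2 * ∏ i, (k i : ℂ)) - (realEdgeFun ζ₀ (ζ₀ 2 * ∏ i, k i) : ℝ)‖ < τ := by
    refine (isCompact_msgVectors ζ₀ d).eventually_forall_of_forall_eventually fun k hk => ?_
    have hk0 : 0 ≤ ∏ i, k i := Finset.prod_nonneg fun i _ =>
      mem_msgInterval_nonneg h.beta_nonneg h.gamma_pos (hk i)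
    have hx0 : 0 ≤ ζ₀ 2 * ∏ i, k i := mul_nonneg h.lambda_nonneg hk0
    have hden : 0 < ζ₀ 2 * ∏ i, k i + ζ₀ 1 := by linarith [h.gamma_pos]
    have hdenC : (ζ₀ 2 : ℂ) * ∏ i, (k i : ℂ) + (ζ₀ 1 : ℂ) ≠ 0 := by
      exact_mod_cast hden.ne'
    have hc : ContinuousAt (fun z : (Fin 3 → ℂ) × (Fin d → ℝ) =>
        ‖edgeFun z.1 (z.1 2 * ∏ i, (z.2 i : ℂ)) - (realEdgeFun ζ₀ (ζ₀ 2 * ∏ i, z.2 i) : ℝ)‖)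
        (fun i => (ζ₀ i : ℂ), k) := by
      refine ContinuousAt.norm (ContinuousAt.sub ?_ ?_)
      · unfold edgeFun
        exact ContinuousAt.div (Continuous.continuousAt (by fun_prop))
          (Continuous.continuousAt (by fun_prop)) hdenC
      · refine Complex.continuous_ofReal.continuousAt.comp ?_
        unfold realEdgeFun
        exact ContinuousAt.div (Continuous.continuousAt (by fun_prop))
          (Continuous.continuousAt (by fun_prop)) hden.ne'
    refine hc.eventually_lt continuousAt_const ?_
    simpa [edgeFun, realEdgeFun] using hτ
  filter_upwards [eventually_nhdsGT_of_eventually_nhds hev] with ρ hρ ζ k hζ hk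
  exact hρ ζ hζ k hk

/-- For the real data `1 + λ ∏ k` is at least 1, so a lower bound of 1/2 survives small
perturbations uniformly. No contraction is involved, hence no restriction on the arity. -/
lemma RealContraction.eventually_root (h : RealContraction Δ ζ₀ w) (d : ℕ) :
    ∀ᶠ ρ in 𝓝[>] (0 : ℝ), ∀ (ζ : Fin 3 → ℂ) (y : Fin d → ℂ) (k : Fin d → ℝ),
      ‖ζ - fun i => (ζ₀ i : ℂ)‖ ≤ ρ → (∀ i, k i ∈ msgInterval ζ₀) →
      (∀ i, ‖y i - k i‖ ≤ ρ) → 1 / 2 < ‖1 + ζ 2 * ∏ i, y i‖ := by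
  have hev : ∀ᶠ p in 𝓝 ((fun i => (ζ₀ i : ℂ), 0) : (Fin 3 → ℂ) × (Fin d → ℂ)),
      ∀ k ∈ {k : Fin d → ℝ | ∀ i, k i ∈ msgInterval ζ₀},
      1 / 2 < ‖1 + p.1 2 * ∏ i, ((k i : ℂ) + p.2 i)‖ := by
    refine (isCompact_msgVectors ζ₀ d).eventually_forall_of_forall_eventually fun k hk => ?_
    have hk0 : 0 ≤ ∏ i, k i := Finset.prod_nonneg fun i _ =>
      mem_msgInterval_nonneg h.beta_nonneg h.gamma_pos (hk i)
    have hx0 : 0 ≤ ζ₀ 2 * ∏ i, k i := mul_nonneg h.lambda_nonneg hk0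
    have hc : Continuous (fun z : ((Fin 3 → ℂ) × (Fin d → ℂ)) × (Fin d → ℝ) =>
        ‖1 + z.1.1 2 * ∏ i, ((z.2 i : ℂ) + z.1.2 i)‖) := by fun_prop
    refine ContinuousAt.eventually_lt continuousAt_const hc.continuousAt ?_
    have : ‖(1 : ℂ) + ζ₀ 2 * ∏ i, (k i : ℂ)‖ = 1 + ζ₀ 2 * ∏ i, k i := by
      rw [← Complex.ofReal_prod, ← Complex.ofReal_mul, ← Complex.ofReal_one, ← Complex.ofReal_add,
        Complex.norm_real, Real.norm_eq_abs, abs_of_nonneg (by linarith)]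
    simp only [Pi.zero_apply, add_zero, this]
    linarith
  filter_upwards [eventually_nhdsGT_of_eventually_nhds hev, self_mem_nhdsWithin] with ρ hρ hρ0 ζ y k
    hζ hk hy
  have hρ0' : (0 : ℝ) ≤ ρ := le_of_lt hρ0
  have := hρ (ζ, fun i => y i - k i) (by
    simp only [Prod.norm_def, Prod.fst_sub, Prod.snd_sub, sub_zero, sup_le_iff]
    exact ⟨hζ, (pi_norm_le_iff_of_nonneg hρ0').2 hy⟩) k hk
  simpa using this

/-- If all factors have norm at most `Y`, multiplying is Lipschitz. -/
lemma norm_prod_sub_prod_le {d : ℕ} {y y' : Fin d → ℂ} {Y s : ℝ} (hY : 1 ≤ Y)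
    (hy : ∀ i, ‖y i‖ ≤ Y) (hy' : ∀ i, ‖y' i‖ ≤ Y) (h : ∀ i, ‖y i - y' i‖ ≤ s) :
    ‖∏ j, y j - ∏ j, y' j‖ ≤ d * (Y ^ d * Y ^ d) * s := by
  have hprod : ∀ (z : Fin d → ℂ) (S : Finset (Fin d)), (∀ i, ‖z i‖ ≤ Y) → ‖∏ j ∈ S, z j‖ ≤ Y ^ d := by
    intro z S hz
    rw [norm_prod]
    refine (Finset.prod_le_prod (fun _ _ => norm_nonneg _) fun i _ => hz i).trans ?_
    rw [Finset.prod_const]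
    exact pow_le_pow_right₀ hY ((Finset.card_le_univ S).trans (by simp))
  rw [prod_sub_prod_eq]
  refine (norm_sum_le_of_le _ (f := fun i => _) (n := fun _ => Y ^ d * Y ^ d * s) fun i _ => ?_).trans
    (by simp [mul_assoc])
  rw [norm_mul, norm_mul]
  have := hprod y' (Finset.univ.filter (· < i)) hy'
  have := hprod y (Finset.univ.filter (i < ·)) hy
  have : 0 ≤ Y := by linarith
  gcongr
  exact h i

end Extension

/-! ### Discs, links and chains: construction of the complex certificate. -/

section Extension

open Filter Topology Set

/-- Two messages that are close to each other and to a common point of the message interval. -/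
def Linked (ζ₀ : Fin 3 → ℝ) (w : ℝ → ℝ) (ε s : ℝ) (y y' : ℂ) : Prop :=
  ∃ k ∈ msgInterval ζ₀, ‖y - k‖ ≤ ε * w k ∧ ‖y' - k‖ ≤ ε * w k ∧ ‖y - y'‖ ≤ s * w k

/-- The complex neighbourhood of the message interval. -/
def msgRegion (ζ₀ : Fin 3 → ℝ) (w : ℝ → ℝ) (ε : ℝ) : Set ℂ :=
  {y | ∃ k ∈ msgInterval ζ₀, ‖y - k‖ ≤ ε * w k}

/-- Two messages joined by a chain of `M` linked pairs. -/
def Chained (ζ₀ : Fin 3 → ℝ) (w : ℝ → ℝ) (ε : ℝ) (M : ℕ) (s : ℝ) (y y' : ℂ) : Prop :=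
  ∃ z : ℕ → ℂ, z 0 = y ∧ z M = y' ∧ ∀ j < M, Linked ζ₀ w ε s (z j) (z (j + 1))

variable {Δ : ℕ} {ζ₀ : Fin 3 → ℝ} {w : ℝ → ℝ} {ε : ℝ}

lemma Linked.mem_left {s : ℝ} {y y' : ℂ} (h : Linked ζ₀ w ε s y y') : y ∈ msgRegion ζ₀ w ε :=
  let ⟨k, hk, h1, _⟩ := h; ⟨k, hk, h1⟩

lemma chained_refl (hw : ∀ y ∈ msgInterval ζ₀, 0 < w y) {s : ℝ} (hs : 0 ≤ s) (M : ℕ) {y : ℂ}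
    (hy : y ∈ msgRegion ζ₀ w ε) : Chained ζ₀ w ε M s y y := by
  obtain ⟨k, hk, h⟩ := hy
  refine ⟨fun _ => y, rfl, rfl, fun j _ => ⟨k, hk, h, h, ?_⟩⟩
  rw [sub_self, norm_zero]
  exact mul_nonneg hs (hw k hk).le

/-- Neighbourhoods of points of the interval are joined by chains of a uniformly bounded length. -/
lemma exists_chain_length (hε : 0 < ε) {m : ℝ} (hm : 0 < m) (hw : ∀ y ∈ msgInterval ζ₀, m ≤ w y) :
    ∃ M : ℕ, ∀ y ∈ msgRegion ζ₀ w ε, ∀ y' ∈ msgRegion ζ₀ w ε, Chained ζ₀ w ε M (2 * ε) y y' := by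
  -- With `M` equal steps, consecutive points between any two points of the interval are at distance
  -- at most `ε * m`. Two more links lead into the interval and out of it.
  obtain ⟨M, hM⟩ := exists_nat_gt (|(ζ₀ 1)⁻¹ - ζ₀ 0| / (ε * m))
  have hM0 : 0 < (M : ℝ) := lt_of_le_of_lt (by positivity) hM
  have hM0' : 0 < M := by exact_mod_cast hM0
  refine ⟨M + 2, fun y hy y' hy' => ?_⟩
  obtain ⟨k, hk, hyk⟩ := hy
  obtain ⟨k', hk', hyk'⟩ := hy'
  set r : ℕ → ℝ := fun j => k + (j / M : ℝ) * (k' - k) with hr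
  have hr0 : r 0 = k := by simp [hr]
  have hrM : r M = k' := by simp only [hr]; field_simp; ring
  have hrmem : ∀ j ≤ M, r j ∈ msgInterval ζ₀ := by
    intro j hj
    have hj' : (j : ℝ) ≤ M := by exact_mod_cast hj
    have h1 : (j / M : ℝ) ≤ 1 := by rw [div_le_one hM0]; exact hj'
    have := (convex_uIcc (ζ₀ 0) (ζ₀ 1)⁻¹) hk hk' (a := 1 - (j : ℝ) / M) (b := (j : ℝ) / M)
      (by linarith) (by positivity) (by ring)
    have e : r j = (1 - (j : ℝ) / M) • k + ((j : ℝ) / M) • k' := by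
      simp only [hr, smul_eq_mul]
      ring
    rw [e]
    exact this
  have hstep : ∀ j, |r j - r (j + 1)| ≤ ε * m := by
    intro j
    have h1 : r j - r (j + 1) = -((k' - k) / M) := by
      simp only [hr]; push_cast; field_simp; ring
    rw [h1, abs_neg, abs_div, abs_of_pos hM0, div_le_iff₀ hM0]
    rw [div_lt_iff₀ (by positivity)] at hM
    have h2 : |k' - k| ≤ |(ζ₀ 1)⁻¹ - ζ₀ 0| := abs_sub_le_of_uIcc_subset_uIcc
      (uIcc_subset_uIcc hk hk')
    linarith
  have hpos : ∀ a ∈ msgInterval ζ₀, 0 ≤ ε * w a := fun a ha =>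
    mul_nonneg hε.le (hm.le.trans (hw a ha))
  -- The chain is y, r 0, …, r M, y'.
  refine ⟨fun j => if j = 0 then y else if j = M + 2 then y' else r (j - 1), by simp, by simp, ?_⟩
  intro j hj
  rcases Nat.eq_zero_or_pos j with rfl | hj0
  · refine ⟨k, hk, by simpa using hyk, ?_, ?_⟩
    · simpa [hr0] using hpos k hk
    · simp [hr0]; linarith [hpos k hk]
  · obtain ⟨i, rfl⟩ : ∃ i, j = i + 1 := ⟨j - 1, by omega⟩
    have hiM : i ≤ M := by omega
    simp only [Nat.add_eq_zero_iff, one_ne_zero, and_false, if_false, Nat.add_sub_cancel]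
    rw [if_neg (by omega : ¬ i + 1 = M + 2)]
    by_cases hi : i = M
    · subst hi
      rw [if_pos (by omega)]
      refine ⟨k', hk', by simpa [hrM] using hpos k' hk', hyk', ?_⟩
      rw [hrM, norm_sub_rev]
      linarith [hpos k' hk']
    · rw [if_neg (by omega : ¬ i + 1 + 1 = M + 2)]
      have h1 : ε * m ≤ ε * w (r i) := mul_le_mul_of_nonneg_left (hw _ (hrmem i hiM)) hε.le
      have h2 : ‖((r (i + 1) : ℝ) : ℂ) - r i‖ ≤ ε * w (r i) := by
        rw [← Complex.ofReal_sub, Complex.norm_real, Real.norm_eq_abs, abs_sub_comm]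
        exact (hstep i).trans h1
      refine ⟨r i, hrmem i hiM, by simpa using hpos _ (hrmem i hiM), h2, ?_⟩
      rw [norm_sub_rev]
      linarith [hpos _ (hrmem i hiM)]

lemma Chained.norm_sub_le {M : ℕ} {s B : ℝ} (hs : 0 ≤ s) (hB : ∀ y ∈ msgInterval ζ₀, w y ≤ B)
    {y y' : ℂ} (h : Chained ζ₀ w ε M s y y') : ‖y - y'‖ ≤ M * (s * B) := by
  obtain ⟨z, rfl, rfl, hz⟩ := h
  have : ∀ j ≤ M, ‖z 0 - z j‖ ≤ j * (s * B) := by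
    intro j
    induction j with
    | zero => simp
    | succ j ih =>
      intro hj
      obtain ⟨k, hk, _, _, h3⟩ := hz j hj
      have h4 : ‖z j - z (j + 1)‖ ≤ s * B := h3.trans (mul_le_mul_of_nonneg_left (hB k hk) hs)
      have h5 := norm_sub_le_norm_sub_add_norm_sub (z 0) (z j) (z (j + 1))
      push_cast
      linarith [ih (by omega)]
  exact this M le_rfl

/-- The region is the union of the discs of radius `ε * w k` about the points `k` of the interval. A
vector in discs about `k` is sent to the disc about the real image of `k`: contraction shrinks its
displacement by `1 - ρ`, and the freed part of the radius absorbs the change of parameters. Points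
of the region need not share a disc, so they are compared through chains of a fixed length; the
recursion acts on chains link by link and shrinks every link by `1 - ρ`. -/
theorem RealContraction.exists_contraction (h : RealContraction Δ ζ₀ w) :
    ∃ δ C η : ℝ, 0 < δ ∧ 0 < η ∧ η < 1 ∧ ∀ ζ : Fin 3 → ℂ, ‖ζ - (fun i => (ζ₀ i : ℂ))‖ < δ →
      Nonempty (Contraction Δ ζ C η) := by
  have hIne : (msgInterval ζ₀).Nonempty := nonempty_uIcc
  have hIc : IsCompact (msgInterval ζ₀) := isCompact_uIcc
  obtain ⟨kmin, hkmin, hmin⟩ := hIc.exists_isMinOn hIne h.continuous.continuousOn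
  obtain ⟨kmax, hkmax, hmax⟩ := hIc.exists_isMaxOn hIne h.continuous.continuousOn
  set m := w kmin with hm
  set B := w kmax with hB
  have hm0 : 0 < m := h.pos _ hkmin
  have hB0 : 0 < B := h.pos _ hkmax
  have hwm : ∀ y ∈ msgInterval ζ₀, m ≤ w y := fun y hy => hmin hy
  have hwB : ∀ y ∈ msgInterval ζ₀, w y ≤ B := fun y hy => hmax hy
  have ev1 : ∀ᶠ ρ in 𝓝[>] (0 : ℝ), ∀ d ∈ {d | d < Δ}, _ :=
    (eventually_all_finite (finite_lt_nat Δ)).2 fun d hd => h.eventually_step hd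
  have ev2 : ∀ᶠ ρ in 𝓝[>] (0 : ℝ), ∀ d ∈ {d | d ≤ Δ}, _ :=
    (eventually_all_finite (finite_le_nat Δ)).2 fun d _ => h.eventually_root d
  obtain ⟨ρ, ⟨hstep, hroot⟩, hρ0, hρ1⟩ :=
    ((ev1.and ev2).and (Ioo_mem_nhdsGT (zero_lt_one' ℝ))).exists
  -- This makes every disc have radius at most `ρ`, the range of validity of the perturbed
  -- contraction.
  set ε := ρ / B with hεd
  have hε : 0 < ε := by positivity
  have hεw : ∀ y ∈ msgInterval ζ₀, ε * w y ≤ ρ := by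
    intro y hy
    rw [hεd, div_mul_eq_mul_div, div_le_iff₀ hB0]
    exact mul_le_mul_of_nonneg_left (hwB y hy) hρ0.le
  -- A lower bound for `ε * ρ * w`, the part of the disc radius that contraction leaves unused.
  set τ := ε * ρ * m with hτd
  have hτ : 0 < τ := by positivity
  have ev3 : ∀ᶠ δ in 𝓝[>] (0 : ℝ), ∀ d ∈ {d | d < Δ}, _ :=
    (eventually_all_finite (finite_lt_nat Δ)).2 fun d _ => h.eventually_param d hτ
  have hζ1 : (ζ₀ 1 : ℂ) ≠ 0 := by exact_mod_cast h.gamma_pos.ne'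
  have ev4 : ∀ᶠ δ in 𝓝[>] (0 : ℝ), ∀ ζ : Fin 3 → ℂ, ‖ζ - fun i => (ζ₀ i : ℂ)‖ ≤ δ →
      (‖ζ 0 - ζ₀ 0‖ < ε * m ∧ ‖(ζ 1)⁻¹ - (ζ₀ 1 : ℂ)⁻¹‖ < ε * m ∧ ζ 1 ≠ 0) := by
    refine eventually_nhdsGT_of_eventually_nhds ?_
    have c0 : ContinuousAt (fun ζ : Fin 3 → ℂ => ‖ζ 0 - ζ₀ 0‖) fun i => (ζ₀ i : ℂ) :=
      Continuous.continuousAt (by fun_prop)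
    have c1 : ContinuousAt (fun ζ : Fin 3 → ℂ => ‖(ζ 1)⁻¹ - (ζ₀ 1 : ℂ)⁻¹‖) fun i => (ζ₀ i : ℂ) :=
      (((continuous_apply (1 : Fin 3)).continuousAt.inv₀ hζ1).sub continuousAt_const).norm
    refine (c0.eventually_lt continuousAt_const ?_).and
      ((c1.eventually_lt continuousAt_const ?_).and
        ((continuous_apply (1 : Fin 3)).continuousAt.eventually_ne hζ1))
    · simpa using by positivity
    · simpa using by positivity
  obtain ⟨δ, ⟨hparam, hpin⟩, hδ0, hδ1⟩ := ((ev3.and ev4).and (Ioo_mem_nhdsGT hρ0)).exists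
  obtain ⟨M, hM⟩ := exists_chain_length hε hm0 hwm
  set Y : ℝ := 1 + |ζ₀ 0| + |(ζ₀ 1)⁻¹| + ρ with hYd
  have hY1 : 1 ≤ Y := by
    rw [hYd]; linarith [abs_nonneg (ζ₀ 0), abs_nonneg (ζ₀ 1)⁻¹]
  have hY : ∀ y ∈ msgRegion ζ₀ w ε, ‖y‖ ≤ Y := by
    rintro y ⟨k, hk, hy⟩
    have h1 : |k| ≤ |ζ₀ 0| + |(ζ₀ 1)⁻¹| := by
      have h2 := mem_uIcc.1 hk
      rw [abs_le]
      have := neg_abs_le (ζ₀ 0); have := le_abs_self (ζ₀ 0)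
      have := neg_abs_le (ζ₀ 1)⁻¹; have := le_abs_self (ζ₀ 1)⁻¹
      constructor <;> rcases h2 with h2 | h2 <;> linarith
    have h2 : ‖y‖ ≤ ‖y - k‖ + ‖(k : ℂ)‖ := by
      simpa using norm_add_le (y - k) (k : ℂ)
    rw [Complex.norm_real, Real.norm_eq_abs] at h2
    rw [hYd]
    linarith [hεw k hk]
  refine ⟨δ, (|ζ₀ 2| + ρ) * (Δ * (Y ^ Δ * Y ^ Δ) * (M * (2 * ε * B))), 1 - ρ, hδ0,
    by linarith [hρ1], by linarith [hρ0], fun ζ hζ => ?_⟩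
  obtain ⟨hp0, hp1, hγ⟩ := hpin ζ hζ.le
  have hζρ : ‖ζ - fun i => (ζ₀ i : ℂ)‖ ≤ ρ := (hζ.trans hδ1).le
  have hstep' : ∀ d < Δ, ∀ y y' : Fin d → ℂ, ∀ s, 0 ≤ s → (∀ i, Linked ζ₀ w ε s (y i) (y' i)) →
      ζ 2 * ∏ i, y i + ζ 1 ≠ 0 ∧ Linked ζ₀ w ε (s * (1 - ρ)) (edgeFun ζ (ζ 2 * ∏ i, y i))
        (edgeFun ζ (ζ 2 * ∏ i, y' i)) := by
    intro d hd y y' s hs hl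
    choose k hk h1 h2 h3 using hl
    have h1' : ∀ i, ‖y i - k i‖ ≤ ρ := fun i => (h1 i).trans (hεw _ (hk i))
    have h2' : ∀ i, ‖y' i - k i‖ ≤ ρ := fun i => (h2 i).trans (hεw _ (hk i))
    have hk0 : 0 ≤ ζ₀ 2 * ∏ i, k i := mul_nonneg h.lambda_nonneg (Finset.prod_nonneg fun i _ =>
      mem_msgInterval_nonneg h.beta_nonneg h.gamma_pos (hk i))
    have hk' : realEdgeFun ζ₀ (ζ₀ 2 * ∏ i, k i) ∈ msgInterval ζ₀ := realEdgeFun_mem h.gamma_pos hk0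
    -- Used twice: with `b` the centres and `t = ε` to follow the discs, and with two linked vectors
    -- to shrink the links.
    have general : ∀ (a b : Fin d → ℂ) (t : ℝ), 0 ≤ t → (∀ i, ‖a i - k i‖ ≤ ρ) →
        (∀ i, ‖b i - k i‖ ≤ ρ) → (∀ i, ‖a i - b i‖ ≤ t * w (k i)) →
        ‖edgeFun ζ (ζ 2 * ∏ i, a i) - edgeFun ζ (ζ 2 * ∏ i, b i)‖ ≤
          t * (1 - ρ) * w (realEdgeFun ζ₀ (ζ₀ 2 * ∏ i, k i)) := by
      intro a b t ht ha hb hab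
      obtain ⟨g1, g2, g3⟩ := hstep d hd ζ a b k hζρ hk ha hb
      rw [edgeFun_sub_edgeFun g1 g2]
      calc ‖∑ i, diffCoeff ζ a b i * (a i - b i)‖
          ≤ ∑ i, ‖diffCoeff ζ a b i‖ * (t * w (k i)) := by
            refine norm_sum_le_of_le _ fun i _ => ?_
            rw [norm_mul]
            exact mul_le_mul_of_nonneg_left (hab i) (norm_nonneg _)
        _ = t * ∑ i, ‖diffCoeff ζ a b i‖ * w (k i) := by
            rw [Finset.mul_sum]
            exact Finset.sum_congr rfl fun i _ => by ring
        _ ≤ t * ((1 - ρ) * w (realEdgeFun ζ₀ (ζ₀ 2 * ∏ i, k i))) :=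
            mul_le_mul_of_nonneg_left g3.le ht
        _ = _ := by ring
    have hself : ∀ i, ‖(k i : ℂ) - k i‖ ≤ ρ := fun i => by simpa using hρ0.le
    have track : ∀ a : Fin d → ℂ, (∀ i, ‖a i - k i‖ ≤ ε * w (k i)) →
        ‖edgeFun ζ (ζ 2 * ∏ i, a i) - (realEdgeFun ζ₀ (ζ₀ 2 * ∏ i, k i) : ℝ)‖ ≤
          ε * w (realEdgeFun ζ₀ (ζ₀ 2 * ∏ i, k i)) := by
      intro a ha
      have g1 := general a (fun i => (k i : ℂ)) ε hε.le
        (fun i => (ha i).trans (hεw _ (hk i))) hself ha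
      have g2 := hparam d hd ζ k hζ.le hk
      have g3 := norm_sub_le_norm_sub_add_norm_sub (edgeFun ζ (ζ 2 * ∏ i, a i))
        (edgeFun ζ (ζ 2 * ∏ i, (k i : ℂ))) (realEdgeFun ζ₀ (ζ₀ 2 * ∏ i, k i) : ℝ)
      have g4 : τ ≤ ε * ρ * w (realEdgeFun ζ₀ (ζ₀ 2 * ∏ i, k i)) :=
        mul_le_mul_of_nonneg_left (hwm _ hk') (by positivity)
      linarith
    exact ⟨(hstep d hd ζ y y' k hζρ hk h1' h2').1, _, hk', track y h1, track y' h2,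
      general y y' s hs h1' h2' h3⟩
  -- Every point is linked to itself with `s = 0`, so the one-vector properties of the certificate
  -- are special cases of `hstep'`.
  have hmemLinked : ∀ y ∈ msgRegion ζ₀ w ε, Linked ζ₀ w ε 0 y y := by
    rintro y ⟨k, hk, hy⟩
    exact ⟨k, hk, hy, hy, by simp⟩
  have hη0 : 0 ≤ 1 - ρ := by linarith [hρ1]
  refine ⟨{
    U := msgRegion ζ₀ w ε
    rel := fun L y y' => Chained ζ₀ w ε M (2 * ε * (1 - ρ) ^ L) y y'
    gamma_ne_zero := hγ
    beta_mem := ⟨ζ₀ 0, left_mem_uIcc, hp0.le.trans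
      (mul_le_mul_of_nonneg_left (hwm _ left_mem_uIcc) hε.le)⟩
    gammaInv_mem := ⟨(ζ₀ 1)⁻¹, right_mem_uIcc, by
      push_cast
      exact hp1.le.trans (mul_le_mul_of_nonneg_left (hwm _ right_mem_uIcc) hε.le)⟩
    add_ne_zero := fun d hd y hy => (hstep' d hd y y 0 le_rfl fun i => hmemLinked _ (hy i)).1
    edgeFun_mem := fun d hd y hy =>
      (hstep' d hd y y 0 le_rfl fun i => hmemLinked _ (hy i)).2.mem_left
    rel_zero := fun y hy y' hy' => by
      simpa using hM y hy y' hy'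
    rel_refl := fun L y hy => chained_refl h.pos (by positivity) M hy
    rel_succ := ?_
    half_le := ?_
    dist_le := ?_ }⟩
  · intro L d hd y y' _ _ hr
    choose z hz0 hzM hz using hr
    refine ⟨fun j => edgeFun ζ (ζ 2 * ∏ i, z i j), by simp only [hz0], by simp only [hzM],
      fun j hj => ?_⟩
    rw [pow_succ, ← mul_assoc]
    exact (hstep' d hd (fun i => z i j) (fun i => z i (j + 1)) _ (by positivity)
      fun i => hz i j hj).2
  · intro d hd y hy
    choose k hk hyk using hy
    exact (hroot d hd ζ y k hζρ hk fun i => (hyk i).trans (hεw _ (hk i))).le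
  · intro L d hd y y' hy hy' hr
    have hdist : ∀ i, ‖y i - y' i‖ ≤ M * (2 * ε * (1 - ρ) ^ L * B) := fun i =>
      (hr i).norm_sub_le (by positivity) hwB
    have h1 := norm_prod_sub_prod_le hY1 (fun i => hY _ (hy i)) (fun i => hY _ (hy' i)) hdist
    have h2 : ‖ζ 2‖ ≤ |ζ₀ 2| + ρ := by
      have h3 := (norm_le_pi_norm (ζ - fun i => (ζ₀ i : ℂ)) 2).trans hζρ
      have h4 : ‖ζ 2‖ ≤ ‖ζ 2 - ζ₀ 2‖ + ‖(ζ₀ 2 : ℂ)‖ := by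
        simpa using norm_add_le (ζ 2 - ζ₀ 2) (ζ₀ 2 : ℂ)
      rw [Complex.norm_real, Real.norm_eq_abs] at h4
      simp only [Pi.sub_apply] at h3
      linarith
    rw [← mul_sub, norm_mul]
    have hdΔ : (d : ℝ) ≤ Δ := by exact_mod_cast hd
    calc ‖ζ 2‖ * ‖∏ i, y i - ∏ i, y' i‖
        ≤ (|ζ₀ 2| + ρ) * (d * (Y ^ d * Y ^ d) * (M * (2 * ε * (1 - ρ) ^ L * B))) := by
          gcongr
      _ ≤ (|ζ₀ 2| + ρ) * (Δ * (Y ^ Δ * Y ^ Δ) * (M * (2 * ε * (1 - ρ) ^ L * B))) := by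
          have hYY : Y ^ d ≤ Y ^ Δ := pow_le_pow_right₀ hY1 hd
          gcongr
      _ = _ := by ring

end Extension

/-! ### Real contraction on the four sets of parameters -/

section RealSets

open Filter Topology Set

lemma sum_coeff_mul_id {d : ℕ} (a l D : ℝ) (k : Fin d → ℝ) :
    ∑ i, a * l * (∏ j ∈ Finset.univ.erase i, k j) / D * k i = d * (a * (l * ∏ j, k j) / D) := by
  rw [Finset.sum_congr rfl fun i _ => ?_, Finset.sum_const, Finset.card_univ, Fintype.card_fin,
    nsmul_eq_mul]
  rw [← Finset.mul_prod_erase Finset.univ k (Finset.mem_univ i)]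
  ring

/-- The weight w(y) = y is the logarithmic metric. All children then contribute equally, and the sum
is d times the elasticity |βγ-1| x / ((βx+1)(x+γ)) of the message function, so the arity enters only
through d ≤ Δ - 1. -/
lemma realContraction_id {Δ : ℕ} {ζ : Fin 3 → ℝ} (hβ : 0 < ζ 0) (hγ : 0 < ζ 1) (hl : 0 ≤ ζ 2)
    (h : ∀ d < Δ, ∀ k : Fin d → ℝ, (∀ i, k i ∈ msgInterval ζ) →
      ((Δ : ℝ) - 1) * (|ζ 0 * ζ 1 - 1| * (ζ 2 * ∏ j, k j)) <
        (ζ 0 * (ζ 2 * ∏ j, k j) + 1) * (ζ 2 * ∏ j, k j + ζ 1)) :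
    RealContraction Δ ζ id where
  beta_nonneg := hβ.le
  gamma_pos := hγ
  lambda_nonneg := hl
  continuous := continuous_id
  pos := fun y hy => by
    rcases mem_uIcc.1 hy with h | h
    · exact hβ.trans_le h.1
    · exact (inv_pos.2 hγ).trans_le h.1
  lt := fun d hd k hk => by
    have h1 := h d hd k hk
    have hx : 0 ≤ ζ 2 * ∏ j, k j :=
      mul_nonneg hl (Finset.prod_nonneg fun i _ => mem_msgInterval_nonneg hβ.le hγ (hk i))
    simp only [id]
    rw [sum_coeff_mul_id, realEdgeFun]
    set x := ζ 2 * ∏ j, k j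
    have hxg : 0 < x + ζ 1 := by linarith
    rw [mul_div_assoc', div_lt_div_iff₀ (by positivity) hxg]
    have hd1 : (d : ℝ) + 1 ≤ Δ := by exact_mod_cast hd
    have h2 : (d : ℝ) * (|ζ 0 * ζ 1 - 1| * x) < (ζ 0 * x + 1) * (x + ζ 1) :=
      lt_of_le_of_lt (mul_le_mul_of_nonneg_right (by linarith) (by positivity)) h1
    calc (d : ℝ) * (|ζ 0 * ζ 1 - 1| * x) * (x + ζ 1)
        < ((ζ 0 * x + 1) * (x + ζ 1)) * (x + ζ 1) := mul_lt_mul_of_pos_right h2 hxg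
      _ = _ := by ring

/-- For λ = 0 the recursion is constant and all coefficients vanish, so any positive weight would
do. -/
lemma realContraction_of_lambda_eq_zero {Δ : ℕ} {ζ : Fin 3 → ℝ} (hβ : 0 ≤ ζ 0) (hγ : 0 < ζ 1)
    (hl : ζ 2 = 0) : RealContraction Δ ζ fun _ => 1 where
  beta_nonneg := hβ
  gamma_pos := hγ
  lambda_nonneg := hl.ge
  continuous := continuous_const
  pos := fun _ _ => one_pos
  lt := fun d _ k _ => by simp [hl]

variable {Δ : ℕ} {ζ : Fin 3 → ℝ}

/-- With s = √(βγ), AM-GM gives (βx+1)(x+γ) ≥ (1+s)² x, while |βγ-1| = |s-1|(s+1). The two bounds on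
s together say exactly that (Δ-1)|s-1| < s+1. -/
lemma realContraction_of_mem_S1 (hΔ : 3 ≤ Δ) (h : ζ ∈ S1 Δ) : RealContraction Δ ζ id := by
  obtain ⟨h1, h2, hβ, hγ, hl⟩ := h
  refine realContraction_id hβ hγ hl fun d hd k hk => ?_
  have hx : 0 ≤ ζ 2 * ∏ j, k j :=
    mul_nonneg hl (Finset.prod_nonneg fun i _ => mem_msgInterval_nonneg hβ.le hγ (hk i))
  set x := ζ 2 * ∏ j, k j
  set s := √(ζ 0 * ζ 1) with hs
  have hs0 : 0 ≤ s := Real.sqrt_nonneg _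
  have hss : s * s = ζ 0 * ζ 1 := Real.mul_self_sqrt (by positivity)
  have hΔ' : (3 : ℝ) ≤ Δ := by exact_mod_cast hΔ
  rw [div_lt_iff₀ (by linarith)] at h1
  rw [lt_div_iff₀ (by linarith)] at h2
  have h3 : ((Δ : ℝ) - 1) * |s - 1| < s + 1 := by
    rcases abs_cases (s - 1) with ⟨h, _⟩ | ⟨h, _⟩ <;> rw [h] <;> nlinarith
  have h4 : |ζ 0 * ζ 1 - 1| = |s - 1| * (s + 1) := by
    rw [← hss, show s * s - 1 = (s - 1) * (s + 1) by ring, abs_mul, abs_of_pos (by linarith : 0 < s + 1)]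
  have h5 : 2 * s * x ≤ ζ 0 * x ^ 2 + ζ 1 := by
    have h6 := sq_nonneg (√(ζ 0) * x - √(ζ 1))
    have h7 : s = √(ζ 0) * √(ζ 1) := Real.sqrt_mul hβ.le _
    have h8 := Real.sq_sqrt hβ.le
    have h9 := Real.sq_sqrt hγ.le
    rw [h7]
    nlinarith
  rw [h4]
  have h6 : (ζ 0 * x + 1) * (x + ζ 1) = (ζ 0 * x ^ 2 + ζ 1) + (1 + s * s) * x := by rw [hss]; ring
  rw [h6]
  rcases hx.eq_or_lt with h0 | h0
  · rw [← h0]; simpa using hγ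
  · have h7 : ((Δ : ℝ) - 1) * |s - 1| * ((s + 1) * x) < (s + 1) * ((s + 1) * x) :=
      mul_lt_mul_of_pos_right h3 (by positivity)
    nlinarith

lemma one_lt_of_div_lt (hΔ : 3 ≤ Δ) {a : ℝ} (h : (Δ : ℝ) / (Δ - 2) < a) :
    1 < a ∧ 0 < ((Δ : ℝ) - 2) * a - Δ := by
  have hΔ' : (3 : ℝ) ≤ Δ := by exact_mod_cast hΔ
  rw [div_lt_iff₀ (by linarith)] at h
  constructor <;> nlinarith

lemma msgInterval_of_one_lt (hγ : 0 < ζ 1) (h : 1 < ζ 0 * ζ 1) {y : ℝ} (hy : y ∈ msgInterval ζ) :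
    (ζ 1)⁻¹ ≤ y ∧ y ≤ ζ 0 := by
  have h1 : (ζ 1)⁻¹ ≤ ζ 0 := by
    rw [inv_eq_one_div, div_le_iff₀ hγ]; exact h.le
  rw [msgInterval, uIcc_of_ge h1] at hy
  exact hy

/-- Dropping the term βx² leaves ((Δ-2)βγ - Δ) x < γ. Messages are at most β, so x ≤ λ t^(Δ-1), and
the bound on λ is what is needed. -/
lemma realContraction_of_mem_S3 (hΔ : 3 ≤ Δ) (h : ζ ∈ S3 Δ) : RealContraction Δ ζ id := by
  obtain ⟨h1, hβ, hγ, hl, h2⟩ := h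
  obtain ⟨hbg, hpos⟩ := one_lt_of_div_lt hΔ h1
  refine realContraction_id hβ hγ hl fun d hd k hk => ?_
  have hk0 : ∀ i, 0 ≤ k i := fun i => mem_msgInterval_nonneg hβ.le hγ (hk i)
  have ht : (1 : ℝ) ≤ max 1 (ζ 0) := le_max_left _ _
  have hprod : ∏ j, k j ≤ max 1 (ζ 0) ^ (Δ - 1) := by
    refine (Finset.prod_le_prod (fun i _ => hk0 i) fun i _ =>
      (msgInterval_of_one_lt hγ hbg (hk i)).2.trans (le_max_right 1 _)).trans ?_
    rw [Finset.prod_const, Finset.card_univ, Fintype.card_fin]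
    exact pow_le_pow_right₀ ht (by omega)
  have hx : 0 ≤ ζ 2 * ∏ j, k j := mul_nonneg hl (Finset.prod_nonneg fun i _ => hk0 i)
  have hxle : ζ 2 * ∏ j, k j ≤ ζ 2 * max 1 (ζ 0) ^ (Δ - 1) := mul_le_mul_of_nonneg_left hprod hl
  set x := ζ 2 * ∏ j, k j
  rw [lt_div_iff₀ (by positivity)] at h2
  rw [abs_of_pos (by linarith)]
  have h3 := mul_le_mul_of_nonneg_right hxle hpos.le
  have h4 : 0 ≤ ζ 0 * x ^ 2 := by positivity
  nlinarith

/-- Here the term γ is dropped, leaving (Δ-2)βγ - Δ < βx. Messages are at least 1/γ, so x ≥ λ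
r^(Δ-1). -/
lemma realContraction_of_mem_S4 (hΔ : 3 ≤ Δ) (h : ζ ∈ S4 Δ) : RealContraction Δ ζ id := by
  obtain ⟨h1, hβ, hγ, h2⟩ := h
  obtain ⟨hbg, hpos⟩ := one_lt_of_div_lt hΔ h1
  have hr0 : 0 < min 1 (1 / ζ 1) := lt_min one_pos (by positivity)
  rw [div_lt_iff₀ (by positivity)] at h2
  have hl : 0 < ζ 2 := by
    by_contra hneg
    have : ζ 2 * (ζ 0 * min 1 (1 / ζ 1) ^ (Δ - 1)) ≤ 0 :=
      mul_nonpos_of_nonpos_of_nonneg (not_lt.1 hneg) (by positivity)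
    linarith
  refine realContraction_id hβ hγ hl.le fun d hd k hk => ?_
  have hprod : min 1 (1 / ζ 1) ^ (Δ - 1) ≤ ∏ j, k j := by
    have h3 : min 1 (1 / ζ 1) ^ d ≤ ∏ j, k j := by
      have := Finset.prod_le_prod (s := Finset.univ) (f := fun _ : Fin d => min 1 (1 / ζ 1)) (g := k)
        (fun i _ => hr0.le) fun i _ => (min_le_right _ _).trans
          (by rw [one_div]; exact (msgInterval_of_one_lt hγ hbg (hk i)).1)
      simpa using this
    exact (pow_le_pow_of_le_one hr0.le (min_le_left _ _) (by omega)).trans h3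
  have hxle : ζ 2 * min 1 (1 / ζ 1) ^ (Δ - 1) ≤ ζ 2 * ∏ j, k j :=
    mul_le_mul_of_nonneg_left hprod hl.le
  have hx : 0 < ζ 2 * ∏ j, k j := lt_of_lt_of_le (by positivity) hxle
  set x := ζ 2 * ∏ j, k j
  rw [abs_of_pos (by linarith)]
  have h3 := mul_le_mul_of_nonneg_left hxle hβ.le
  have h4 : ((Δ : ℝ) - 2) * (ζ 0 * ζ 1) - Δ < ζ 0 * x := by nlinarith
  have h5 := mul_lt_mul_of_pos_right h4 hx
  nlinarith

end RealSets

/-! ### The antiferromagnetic case -/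

section Antiferro

open Filter Topology Set

/-- The absolute logarithmic derivative of the message function, as a function of the message. -/
noncomputable def slope (β γ y : ℝ) : ℝ := (1 + β * γ - γ * y - β / y) / (1 - β * γ)

/-- The logarithmic derivative of `slope`, multiplied by `slope`. -/
noncomputable def slopeDeriv (β γ y : ℝ) : ℝ := (β / y - γ * y) / (1 - β * γ)

variable {β γ : ℝ}

lemma slope_eq (hβγ : β * γ < 1) {y : ℝ} (hy : y ≠ 0) :
    slope β γ y = (1 - γ * y) * (y - β) / (y * (1 - β * γ)) := by
  have : 1 - β * γ ≠ 0 := by linarith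
  rw [slope]
  field_simp
  ring

lemma slopeDeriv_eq (hβγ : β * γ < 1) {y : ℝ} (hy : y ≠ 0) :
    slopeDeriv β γ y = (β - γ * y ^ 2) / (y * (1 - β * γ)) := by
  have : 1 - β * γ ≠ 0 := by linarith
  rw [slopeDeriv]
  field_simp

lemma mul_le_one_of_le_inv (hγ : 0 < γ) {y : ℝ} (hy : y ≤ γ⁻¹) : γ * y ≤ 1 := by
  have := mul_le_mul_of_nonneg_left hy hγ.le
  rwa [mul_inv_cancel₀ hγ.ne'] at this

lemma mul_lt_one_of_lt_inv (hγ : 0 < γ) {y : ℝ} (hy : y < γ⁻¹) : γ * y < 1 := by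
  have := mul_lt_mul_of_pos_left hy hγ
  rwa [mul_inv_cancel₀ hγ.ne'] at this

lemma slope_nonneg (hβ : 0 ≤ β) (hγ : 0 < γ) (hβγ : β * γ < 1) {y : ℝ} (h1 : β ≤ y)
    (h2 : y ≤ γ⁻¹) : 0 ≤ slope β γ y := by
  have h3 := mul_le_one_of_le_inv hγ h2
  rcases (hβ.trans h1).eq_or_lt with h | h
  · have hb : β = 0 := by linarith
    simp [slope, ← h, hb]
  · rw [slope_eq hβγ h.ne']
    have := mul_nonneg (sub_nonneg.2 h3) (sub_nonneg.2 h1)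
    have : 0 < 1 - β * γ := by linarith
    positivity

lemma slope_le_one (hβ : 0 ≤ β) (hγ : 0 < γ) (hβγ : β * γ < 1) {y : ℝ} (h1 : β ≤ y)
    (h2 : y ≤ γ⁻¹) : slope β γ y ≤ 1 := by
  have h3 := mul_le_one_of_le_inv hγ h2
  rw [slope, div_le_one (by linarith)]
  have h4 : β * γ ≤ γ * y := by nlinarith
  have h5 : β * γ ≤ β / y := by
    rcases (hβ.trans h1).eq_or_lt with h | h
    · have hb : β = 0 := by linarith
      simp [hb]
    · rw [le_div_iff₀ h]
      nlinarith
  linarith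

/-- `slope` at the message of a vertex with ratio `x`. -/
lemma slope_edge (hβ : 0 ≤ β) (hγ : 0 < γ) (hβγ : β * γ < 1) {x : ℝ} (hx : 0 ≤ x) :
    slope β γ ((β * x + 1) / (x + γ)) = (1 - β * γ) * x / ((β * x + 1) * (x + γ)) := by
  have h1 : 0 < β * x + 1 := by positivity
  have h2 : 0 < x + γ := by linarith
  have h3 : 1 - β * γ ≠ 0 := by linarith
  rw [slope, div_eq_div_iff h3 (by positivity), div_div_eq_mul_div]
  field_simp
  ring

/-- The right side is x times the absolute derivative of the message function; this is how `slope`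
enters the partial derivatives of the recursion. -/
lemma slope_edge_mul (hβ : 0 ≤ β) (hγ : 0 < γ) (hβγ : β * γ < 1) {x : ℝ} (hx : 0 ≤ x) :
    slope β γ ((β * x + 1) / (x + γ)) * ((β * x + 1) / (x + γ)) = (1 - β * γ) * x / (x + γ) ^ 2 := by
  have h1 : 0 < β * x + 1 := by positivity
  have h2 : 0 < x + γ := by linarith
  rw [slope_edge hβ hγ hβγ hx]
  field_simp

lemma slopeDeriv_lt (hβ : 0 ≤ β) (hγ : 0 < γ) (hβγ : β * γ < 1) {y y' : ℝ} (hy : 0 < y)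
    (h : y < y') : slopeDeriv β γ y' < slopeDeriv β γ y := by
  have h3 : 0 < 1 - β * γ := by linarith
  rw [slopeDeriv, slopeDeriv, div_lt_div_iff_of_pos_right h3]
  have h1 : β / y' ≤ β / y := div_le_div_of_nonneg_left hβ hy h.le
  nlinarith

/-- The quotient of `slopeDeriv` by `slope` decreases, that is, `slope` is log-concave as a function
of log y. The difference of the cross products is y' - y times a visibly nonnegative expression. -/
lemma slopeDeriv_mul_slope_le (hβ : 0 ≤ β) (hγ : 0 < γ) (hβγ : β * γ < 1) {y y' : ℝ}
    (hy : β < y) (h : y ≤ y') (hy' : y' < γ⁻¹) :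
    slopeDeriv β γ y' * slope β γ y ≤ slopeDeriv β γ y * slope β γ y' := by
  have h3 : 0 < 1 - β * γ := by linarith
  have hy0 : 0 < y := by linarith
  have hy0' : 0 < y' := by linarith
  have h4 := mul_lt_one_of_lt_inv hγ hy'
  have h5 : γ * y < 1 := by nlinarith
  rw [slopeDeriv_eq hβγ hy0.ne', slopeDeriv_eq hβγ hy0'.ne', slope_eq hβγ hy0.ne',
    slope_eq hβγ hy0'.ne', div_mul_div_comm, div_mul_div_comm, mul_comm (y' * (1 - β * γ))]
  refine div_le_div_of_nonneg_right ?_ (by positivity)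
  have key : (β - γ * y ^ 2) * ((1 - γ * y') * (y' - β)) - (β - γ * y' ^ 2) * ((1 - γ * y) * (y - β)) =
      (y' - y) * (β * ((1 - γ * y) * (1 - γ * y')) + γ * ((y - β) * (y' - β))) := by ring
  have h6 : 0 ≤ (1 - γ * y) * (1 - γ * y') := mul_nonneg (by linarith) (by linarith)
  have h7 : 0 ≤ (y - β) * (y' - β) := mul_nonneg (by linarith) (by linarith)
  have h8 : 0 ≤ (y' - y) * (β * ((1 - γ * y) * (1 - γ * y')) + γ * ((y - β) * (y' - β))) :=
    mul_nonneg (by linarith) (by positivity)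
  linarith

/-- The inequality at a critical point of the two-step contraction rate. -/
lemma critical_lt_one (hβ : 0 ≤ β) (hγ : 0 < γ) (hβγ : β * γ < 1) {d y Y z : ℝ} (hd : 0 < d)
    (hy : y ∈ Ioo β γ⁻¹) (hY : Y ∈ Ioo β γ⁻¹) (hz : z ∈ uIcc y Y) (hfix : d * slope β γ z < 1)
    (hcrit : slopeDeriv β γ y = d * slope β γ y * slopeDeriv β γ Y) :
    d ^ 2 * (slope β γ y * slope β γ Y) < 1 := by
  have hpos : ∀ t ∈ Ioo β γ⁻¹, 0 < slope β γ t := by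
    intro t ht
    have h0 : 0 < t := lt_of_le_of_lt hβ ht.1
    rw [slope_eq hβγ h0.ne']
    have := mul_lt_one_of_lt_inv hγ ht.2
    exact div_pos (mul_pos (by linarith) (by linarith [ht.1])) (mul_pos h0 (by linarith))
  have hzI : z ∈ Ioo β γ⁻¹ := by
    rcases mem_uIcc.1 hz with h | h
    · exact ⟨hy.1.trans_le h.1, h.2.trans_lt hY.2⟩
    · exact ⟨hY.1.trans_le h.1, h.2.trans_lt hy.2⟩
  have hanti : ∀ s ∈ Ioo β γ⁻¹, ∀ t, s ≤ t → slopeDeriv β γ t ≤ slopeDeriv β γ s := by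
    intro s hs t hst
    rcases hst.eq_or_lt with rfl | h
    · exact le_rfl
    · exact (slopeDeriv_lt hβ hγ hβγ (lt_of_le_of_lt hβ hs.1) h).le
  have hinj : ∀ s ∈ Ioo β γ⁻¹, ∀ t, s ≤ t → slopeDeriv β γ t = slopeDeriv β γ s → s = t := by
    intro s hs t hst he
    by_contra hne
    exact (slopeDeriv_lt hβ hγ hβγ (lt_of_le_of_lt hβ hs.1) (lt_of_le_of_ne hst hne)).ne he
  have ga := hpos y hy
  have gb := hpos Y hY
  have ge := hpos z hzI
  -- The cases say on which side of the fixed point `y` lies. In each of them one sign of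
  -- `slopeDeriv` at `Y` yields the claim after cancelling it, the opposite sign contradicts the
  -- bound at the fixed point, and the value 0 forces y = z = Y.
  rcases mem_uIcc.1 hz with ⟨h1, h2⟩ | ⟨h1, h2⟩
  · have m1 := hanti y hy z h1
    have m2 := hanti z hzI Y h2
    have q1 := slopeDeriv_mul_slope_le hβ hγ hβγ hy.1 h1 hzI.2
    have q2 := slopeDeriv_mul_slope_le hβ hγ hβγ hzI.1 h2 hY.2
    rcases lt_trichotomy (slopeDeriv β γ Y) 0 with hb | hb | hb
    · have ha : slopeDeriv β γ y < 0 := by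
        rw [hcrit]; exact mul_neg_of_pos_of_neg (by positivity) hb
      -- Since `slopeDeriv` is negative at `Y` and d · slope z < 1, it is less than d · slope z
      -- times itself; log-concavity and monotonicity then lead to the right side. The critical
      -- equation makes that d² · slope y · slope Y times `slopeDeriv` at `Y`, and dividing by a
      -- negative number gives the claim.
      have k1 : slopeDeriv β γ Y < d * (slopeDeriv β γ y * slope β γ Y) := by
        have : d * (slopeDeriv β γ z * slope β γ Y) ≤ d * (slopeDeriv β γ y * slope β γ Y) := by gcongr
        nlinarith
      rw [hcrit] at k1
      by_contra hcon
      nlinarith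
    · have ha : slopeDeriv β γ y = 0 := by rw [hcrit, hb, mul_zero]
      have e1 := hinj y hy z h1 (by linarith)
      have e2 := hinj z hzI Y h2 (by linarith)
      rw [← e2, e1]
      nlinarith [mul_pos hd ge]
    -- Log-concavity and the critical equation would make `slopeDeriv` at z at most d · slope z
    -- times its value at `Y`, hence less than the latter, against monotonicity.
    · exfalso
      rw [hcrit] at q1
      have k1 : slopeDeriv β γ z ≤ d * slopeDeriv β γ Y * slope β γ z := by
        by_contra hcon
        nlinarith
      nlinarith
  · have m1 := hanti z hzI y h2
    have m2 := hanti Y hY z h1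
    have q1 := slopeDeriv_mul_slope_le hβ hγ hβγ hzI.1 h2 hy.2
    have q2 := slopeDeriv_mul_slope_le hβ hγ hβγ hY.1 h1 hzI.2
    rcases lt_trichotomy (slopeDeriv β γ Y) 0 with hb | hb | hb
    · exfalso
      rw [hcrit] at q1
      have k1 : d * slopeDeriv β γ Y * slope β γ z ≤ slopeDeriv β γ z := by
        by_contra hcon
        nlinarith
      nlinarith
    · have ha : slopeDeriv β γ y = 0 := by rw [hcrit, hb, mul_zero]
      have e1 := hinj z hzI y h2 (by linarith)
      have e2 := hinj Y hY z h1 (by linarith)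
      rw [← e1, e2]
      nlinarith [mul_pos hd ge]
    · have ha : 0 < slopeDeriv β γ y := by
        rw [hcrit]; positivity
      have k1 : d * (slopeDeriv β γ y * slope β γ Y) < slopeDeriv β γ Y := by
        have : d * (slopeDeriv β γ y * slope β γ Y) ≤ d * (slopeDeriv β γ z * slope β γ Y) := by gcongr
        nlinarith
      rw [hcrit] at k1
      by_contra hcon
      nlinarith

end Antiferro

/-! ### The two-step rate at its maximum, and the weight on S₂. -/

section Antiferro

open Filter Topology Set

/-- For β = 0 the term β/y is identically 0, also at y = 0 by the convention on division, so `slope`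
is affine and the endpoint 0 does no harm. -/
lemma continuousOn_slope {β γ : ℝ} (hβ : 0 ≤ β) : ContinuousOn (slope β γ) (Icc β γ⁻¹) := by
  rcases hβ.eq_or_lt with rfl | hβ
  · unfold slope
    simp only [zero_div]
    fun_prop
  · intro y hy
    have : y ≠ 0 := (hβ.trans_le hy.1).ne'
    unfold slope
    exact ContinuousAt.continuousWithinAt (by fun_prop (disch := assumption))

lemma hasDerivAt_slope {β γ y : ℝ} (hy : y ≠ 0) :
    HasDerivAt (slope β γ) (slopeDeriv β γ y / y) y := by
  have h : HasDerivAt (slope β γ) _ y :=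
    ((((hasDerivAt_const y (1 + β * γ)).sub ((hasDerivAt_id y).const_mul γ)).sub
      ((hasDerivAt_const y β).div (hasDerivAt_id y) hy)).div_const (1 - β * γ))
  refine h.congr_deriv ?_
  simp only [slopeDeriv, id]
  field_simp
  ring

variable {ζ : Fin 3 → ℝ}

lemma hasDerivAt_realEdgeFun {x : ℝ} (hx : x + ζ 1 ≠ 0) :
    HasDerivAt (realEdgeFun ζ) (-(1 - ζ 0 * ζ 1) / (x + ζ 1) ^ 2) x := by
  have h : HasDerivAt (realEdgeFun ζ) _ x := ((((hasDerivAt_id x).const_mul (ζ 0)).add_const 1).div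
    ((hasDerivAt_id x).add_const (ζ 1)) hx)
  refine h.congr_deriv ?_
  simp only [id]
  ring

variable (hβ : 0 ≤ ζ 0) (hγ : 0 < ζ 1) (hβγ : ζ 0 * ζ 1 < 1)

include hβγ hγ in
lemma msgInterval_eq_Icc : msgInterval ζ = Icc (ζ 0) (ζ 1)⁻¹ := by
  rw [msgInterval, uIcc_of_le]
  rw [inv_eq_one_div, le_div_iff₀ hγ]
  exact hβγ.le

include hβ hγ hβγ in
lemma realEdgeFun_mem_Ioo {x : ℝ} (hx : 0 < x) : realEdgeFun ζ x ∈ Ioo (ζ 0) (ζ 1)⁻¹ := by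
  have h1 : 0 < x + ζ 1 := by linarith
  constructor
  · rw [realEdgeFun, lt_div_iff₀ h1]; nlinarith
  · rw [realEdgeFun, inv_eq_one_div, div_lt_div_iff₀ h1 hγ]; nlinarith

include hβ hγ hβγ in
lemma realEdgeFun_antitone {x x' : ℝ} (hx : 0 ≤ x) (h : x ≤ x') :
    realEdgeFun ζ x' ≤ realEdgeFun ζ x := by
  rw [realEdgeFun, realEdgeFun, div_le_div_iff₀ (by linarith) (by linarith)]
  nlinarith

include hβ hγ hβγ in
-- Translates uniqueness into messages: at the fixed point x = λ z^d the derivative of the tree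
-- recursion has absolute value d · slope z.
lemma abs_deriv_treeRec {d : ℕ} (hl : 0 < ζ 2) (hd : 1 ≤ d) {z : ℝ} (hz : 0 < z)
    (hfix : realEdgeFun ζ (ζ 2 * z ^ d) = z) :
    |deriv (treeRec ζ d) (ζ 2 * z ^ d)| = d * slope (ζ 0) (ζ 1) z := by
  have hx : 0 < ζ 2 * z ^ d := by positivity
  set x := ζ 2 * z ^ d with hxd
  have h1 : 0 < x + ζ 1 := by linarith
  have h2 := ((hasDerivAt_realEdgeFun (ζ := ζ) h1.ne').pow d).const_mul (ζ 2)
  have h3 : deriv (treeRec ζ d) x = _ := h2.deriv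
  have h4 := slope_edge_mul hβ hγ hβγ hx.le
  change slope (ζ 0) (ζ 1) (realEdgeFun ζ x) * realEdgeFun ζ x = _ at h4
  rw [hfix] at h4
  have h5 : slope (ζ 0) (ζ 1) z = (1 - ζ 0 * ζ 1) * x / (x + ζ 1) ^ 2 / z := by
    rw [← h4]; field_simp
  have h6 : 0 < 1 - ζ 0 * ζ 1 := by linarith
  obtain ⟨e, rfl⟩ : ∃ e, d = e + 1 := ⟨d - 1, by omega⟩
  rw [h3, hfix, h5, abs_mul, abs_mul, abs_mul, abs_of_pos hl, Nat.abs_cast, abs_div, abs_neg,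
    abs_of_pos h6, abs_of_pos (by positivity : 0 < (x + ζ 1) ^ 2), abs_of_pos (by positivity)]
  have h7 : x / z = ζ 2 * z ^ e := by
    rw [hxd, pow_succ]; field_simp
  have h8 : (1 - ζ 0 * ζ 1) * x / (x + ζ 1) ^ 2 / z = (1 - ζ 0 * ζ 1) / (x + ζ 1) ^ 2 * (x / z) := by
    field_simp
  rw [h8, h7, Nat.add_sub_cancel]
  ring

include hβ hγ hβγ in
/-- The two-step contraction rate of the symmetric recursion is smaller than one. -/
lemma two_step_lt_one {d : ℕ} (hl : 0 < ζ 2) (hd : 1 ≤ d)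
    (huniq : ∀ x : ℝ, 0 < x → treeRec ζ d x = x → |deriv (treeRec ζ d) x| < 1) :
    ∀ y ∈ Icc (ζ 0) (ζ 1)⁻¹, (d : ℝ) ^ 2 *
      (slope (ζ 0) (ζ 1) y * slope (ζ 0) (ζ 1) (realEdgeFun ζ (ζ 2 * y ^ d))) < 1 := by
  have hd0 : (0 : ℝ) < d := by exact_mod_cast hd
  set F : ℝ → ℝ := fun y => slope (ζ 0) (ζ 1) y * slope (ζ 0) (ζ 1) (realEdgeFun ζ (ζ 2 * y ^ d))
    with hF
  have hIcc := msgInterval_eq_Icc hγ hβγ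
  have hI0 : ∀ y ∈ Icc (ζ 0) (ζ 1)⁻¹, 0 ≤ ζ 2 * y ^ d := fun y hy =>
    mul_nonneg hl.le (pow_nonneg (hβ.trans hy.1) d)
  have hmem : ∀ y ∈ Icc (ζ 0) (ζ 1)⁻¹, realEdgeFun ζ (ζ 2 * y ^ d) ∈ Icc (ζ 0) (ζ 1)⁻¹ :=
    fun y hy => hIcc ▸ realEdgeFun_mem hγ (hI0 y hy)
  have hcontE : ContinuousOn (fun y => realEdgeFun ζ (ζ 2 * y ^ d)) (Icc (ζ 0) (ζ 1)⁻¹) := by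
    intro y hy
    have : ζ 2 * y ^ d + ζ 1 ≠ 0 := by linarith [hI0 y hy]
    unfold realEdgeFun
    exact ContinuousAt.continuousWithinAt (by fun_prop (disch := assumption))
  have hcont : ContinuousOn F (Icc (ζ 0) (ζ 1)⁻¹) :=
    (continuousOn_slope hβ).mul ((continuousOn_slope hβ).comp hcontE hmem)
  have hne : (Icc (ζ 0) (ζ 1)⁻¹).Nonempty := hIcc ▸ nonempty_uIcc
  obtain ⟨y₀, hy₀, hmax⟩ := isCompact_Icc.exists_isMaxOn hne hcont
  suffices hs : (d : ℝ) ^ 2 * F y₀ < 1 from fun y hy =>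
    lt_of_le_of_lt (mul_le_mul_of_nonneg_left (hmax hy) (by positivity)) hs
  -- A nonpositive maximum needs no argument, and a positive one excludes the endpoints, where one
  -- of the two slopes vanishes.
  by_cases hFpos : F y₀ ≤ 0
  · exact lt_of_le_of_lt (mul_nonpos_of_nonneg_of_nonpos (by positivity) hFpos) one_pos
  rw [not_le] at hFpos
  have h1 : 0 < 1 - ζ 0 * ζ 1 := by linarith
  have hne1 : y₀ ≠ (ζ 1)⁻¹ := by
    intro h
    have : slope (ζ 0) (ζ 1) y₀ = 0 := by
      rw [h, slope]; field_simp; ring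
    rw [hF] at hFpos
    simp [this] at hFpos
  have hne0 : y₀ ≠ ζ 0 := by
    intro h
    rcases hβ.eq_or_lt with h0 | h0
    -- For β = 0 the slope at y₀ = 0 is 1 and not 0. It is the second slope that vanishes, as the
    -- image of 0 is the other endpoint.
    · have h2 : realEdgeFun ζ (ζ 2 * y₀ ^ d) = (ζ 1)⁻¹ := by
        rw [h, ← h0, zero_pow (by omega), realEdgeFun]; simp
      have : slope (ζ 0) (ζ 1) (realEdgeFun ζ (ζ 2 * y₀ ^ d)) = 0 := by
        rw [h2, slope]; field_simp; ring
      rw [hF] at hFpos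
      simp [this] at hFpos
    · have : slope (ζ 0) (ζ 1) y₀ = 0 := by
        rw [h, slope]; field_simp; ring
      rw [hF] at hFpos
      simp [this] at hFpos
  have hyI : y₀ ∈ Ioo (ζ 0) (ζ 1)⁻¹ :=
    ⟨lt_of_le_of_ne hy₀.1 hne0.symm, lt_of_le_of_ne hy₀.2 hne1⟩
  have hy0 : 0 < y₀ := lt_of_le_of_lt hβ hyI.1
  have hx0 : 0 < ζ 2 * y₀ ^ d := by positivity
  set Y := realEdgeFun ζ (ζ 2 * y₀ ^ d) with hY
  have hYI : Y ∈ Ioo (ζ 0) (ζ 1)⁻¹ := realEdgeFun_mem_Ioo hβ hγ hβγ hx0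
  have hY0 : 0 < Y := lt_of_le_of_lt hβ hYI.1
  have hden : 0 < ζ 2 * y₀ ^ d + ζ 1 := by linarith
  -- The derivative of log F with respect to log y is slopeDeriv y / slope y - d · slopeDeriv Y,
  -- because log Y has derivative -d · slope Y. It vanishes at an interior maximum.
  have hcrit : slopeDeriv (ζ 0) (ζ 1) y₀ =
      d * slope (ζ 0) (ζ 1) y₀ * slopeDeriv (ζ 0) (ζ 1) Y := by
    have hloc : IsLocalMax F y₀ := hmax.isLocalMax (Icc_mem_nhds hyI.1 hyI.2)
    have hE := (hasDerivAt_realEdgeFun (ζ := ζ) hden.ne').comp y₀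
      ((hasDerivAt_pow d y₀).const_mul (ζ 2))
    have hS := (hasDerivAt_slope (β := ζ 0) (γ := ζ 1) hY0.ne').comp y₀ hE
    have hFd := (hasDerivAt_slope (β := ζ 0) (γ := ζ 1) hy0.ne').mul hS
    have hzero := hloc.hasDerivAt_eq_zero hFd
    simp only [Function.comp_apply] at hzero
    rw [← hY] at hzero
    have hsm := slope_edge_mul hβ hγ hβγ hx0.le
    change slope (ζ 0) (ζ 1) Y * Y = _ at hsm
    have hSY : slope (ζ 0) (ζ 1) Y ≠ 0 := by
      intro h
      have : F y₀ = 0 := by rw [hF]; simp only; rw [← hY, h, mul_zero]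
      linarith
    obtain ⟨e, rfl⟩ : ∃ e, d = e + 1 := ⟨d - 1, by omega⟩
    have hE' : -(1 - ζ 0 * ζ 1) / (ζ 2 * y₀ ^ (e + 1) + ζ 1) ^ 2 *
        (ζ 2 * (((e + 1 : ℕ) : ℝ) * y₀ ^ (e + 1 - 1))) =
        -(((e + 1 : ℕ) : ℝ) * (slope (ζ 0) (ζ 1) Y * Y) / y₀) := by
      rw [hsm, Nat.add_sub_cancel, pow_succ]
      field_simp
      ring
    rw [hE'] at hzero
    have hz2 : slope (ζ 0) (ζ 1) Y / y₀ * (slopeDeriv (ζ 0) (ζ 1) y₀ -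
        ((e + 1 : ℕ) : ℝ) * slope (ζ 0) (ζ 1) y₀ * slopeDeriv (ζ 0) (ζ 1) Y) = 0 := by
      rw [← hzero]
      field_simp
      ring
    rcases mul_eq_zero.1 hz2 with h | h
    · exact absurd h (div_ne_zero hSY hy0.ne')
    · linarith
  -- The map is decreasing, so a fixed point lies between a point and its image.
  obtain ⟨z, hz, hzfix⟩ : ∃ z ∈ uIcc y₀ Y, realEdgeFun ζ (ζ 2 * z ^ d) = z := by
    have hsub : uIcc y₀ Y ⊆ Icc (ζ 0) (ζ 1)⁻¹ :=
      uIcc_subset_Icc hy₀ ⟨hYI.1.le, hYI.2.le⟩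
    have hc : ContinuousOn (fun t => realEdgeFun ζ (ζ 2 * t ^ d) - t) (uIcc y₀ Y) :=
      (hcontE.mono hsub).sub continuousOn_id
    have hivt := intermediate_value_uIcc hc
    have h0 : (0 : ℝ) ∈ uIcc (realEdgeFun ζ (ζ 2 * y₀ ^ d) - y₀)
        (realEdgeFun ζ (ζ 2 * Y ^ d) - Y) := by
      rw [← hY, mem_uIcc]
      rcases le_total y₀ Y with h | h
      · right
        refine ⟨?_, by linarith⟩
        have : realEdgeFun ζ (ζ 2 * Y ^ d) ≤ Y := realEdgeFun_antitone hβ hγ hβγ hx0.le (by gcongr)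
        linarith
      · left
        refine ⟨by linarith, ?_⟩
        have : Y ≤ realEdgeFun ζ (ζ 2 * Y ^ d) :=
          realEdgeFun_antitone hβ hγ hβγ (by positivity) (by gcongr)
        linarith
    obtain ⟨z, hz, hz0⟩ := hivt h0
    exact ⟨z, hz, by linarith⟩
  have hz0 : 0 < z := by
    rcases mem_uIcc.1 hz with h | h <;> linarith [h.1]
  have hzd := huniq (ζ 2 * z ^ d) (by positivity) (by
    change ζ 2 * (realEdgeFun ζ (ζ 2 * z ^ d)) ^ d = _
    rw [hzfix])
  rw [abs_deriv_treeRec hβ hγ hβγ hl hd hz0 hzfix] at hzd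
  exact critical_lt_one hβ hγ hβγ hd0 hyI hYI hz hzd hcrit

/-- Among the vectors with a given product, the sum of the slopes is largest if all are equal. -/
lemma sum_slope_le {β γ : ℝ} (hβ : 0 ≤ β) (hγ : 0 < γ) (hβγ : β * γ < 1) {d : ℕ} (hd : 1 ≤ d)
    (k : Fin d → ℝ) (hk : ∀ i, 0 < k i) {y : ℝ} (hy : 0 < y) (hprod : ∏ i, k i = y ^ d) :
    ∑ i, slope β γ (k i) ≤ d * slope β γ y := by
  have h1 : 0 < 1 - β * γ := by linarith
  have hd0 : (0 : ℝ) < d := by exact_mod_cast hd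
  -- Used for the messages and for their inverses: both sums enter the sum of the slopes with
  -- nonpositive coefficients -γ and -β.
  have amgm : ∀ (a : Fin d → ℝ) (b : ℝ), (∀ i, 0 < a i) → 0 < b → ∏ i, a i = b ^ d →
      d * b ≤ ∑ i, a i := by
    intro a b ha hb hab
    have h2 := Real.geom_mean_le_arith_mean_weighted Finset.univ (fun _ => (1 / d : ℝ)) a
      (fun _ _ => by positivity) (by simp; field_simp) fun i _ => (ha i).le
    rw [Real.finsetProd_rpow _ _ fun i _ => (ha i).le, hab, ← Real.rpow_natCast, ← Real.rpow_mul hb.le,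
      mul_one_div_cancel hd0.ne', Real.rpow_one, ← Finset.mul_sum, one_div, inv_mul_eq_div,
      le_div_iff₀ hd0] at h2
    linarith
  have h2 := amgm k y hk hy hprod
  have h3 := amgm (fun i => (k i)⁻¹) y⁻¹ (fun i => inv_pos.2 (hk i)) (inv_pos.2 hy) (by
    rw [Finset.prod_inv_distrib, hprod, inv_pow])
  have h4 : ∑ i, slope β γ (k i) =
      (d * (1 + β * γ) - γ * ∑ i, k i - β * ∑ i, (k i)⁻¹) / (1 - β * γ) := by
    simp only [slope, div_eq_mul_inv β]
    rw [← Finset.sum_div, Finset.sum_sub_distrib, Finset.sum_sub_distrib, ← Finset.mul_sum,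
      ← Finset.mul_sum]
    simp only [Finset.sum_const, Finset.card_univ, Fintype.card_fin, nsmul_eq_mul]
  rw [h4, slope, mul_div_assoc', div_le_div_iff_of_pos_right h1, div_eq_mul_inv β]
  have h5 := mul_le_mul_of_nonneg_left h2 hγ.le
  have h6 := mul_le_mul_of_nonneg_left h3 hβ
  linarith

/-- The weight function of the antiferromagnetic case, before regularization at the message `0`. -/
noncomputable def antiWeight (β γ μ y : ℝ) : ℝ :=
  √(y * ((1 - γ * y) * (y - β)) / (1 - β * γ) + μ * y ^ 2)

/-- The definition keeps y² multiplied out under the root, so that it is continuous also at the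
message 0; this is the form that explains the weight. -/
lemma antiWeight_eq {β γ μ y : ℝ} (hβγ : β * γ < 1) (hy : 0 < y) :
    antiWeight β γ μ y = y * √(slope β γ y + μ) := by
  have h1 : 1 - β * γ ≠ 0 := by linarith
  rw [antiWeight, slope_eq hβγ hy.ne', ← Real.sqrt_sq hy.le, ← Real.sqrt_mul (sq_nonneg y),
    Real.sqrt_sq hy.le]
  congr 1
  field_simp

include hβ hγ hβγ in
-- Dividing by the outgoing message Y, the claim is slope Y · Σ √(slope k_i + μ) < √(slope Y + μ).
-- By Cauchy-Schwarz the square of the sum is at most d Σ (slope k_i + μ), and by `sum_slope_le`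
-- this is at most d² (slope y + μ) for the geometric mean y. The hypothesis on the two-step rate
-- finishes.
lemma antiWeight_step {μ : ℝ} (hμ : 0 < μ) (hl : 0 < ζ 2) {d : ℕ}
    (h : ∀ y ∈ Icc (ζ 0) (ζ 1)⁻¹, 1 ≤ d → (d : ℝ) ^ 2 *
      (slope (ζ 0) (ζ 1) y * slope (ζ 0) (ζ 1) (realEdgeFun ζ (ζ 2 * y ^ d))) + d ^ 2 * μ < 1)
    (k : Fin d → ℝ) (hk : ∀ i, k i ∈ msgInterval ζ) :
    ∑ i, |ζ 0 * ζ 1 - 1| * ζ 2 * (∏ j ∈ Finset.univ.erase i, k j) / (ζ 2 * ∏ j, k j + ζ 1) ^ 2 *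
      antiWeight (ζ 0) (ζ 1) μ (k i) <
      antiWeight (ζ 0) (ζ 1) μ (realEdgeFun ζ (ζ 2 * ∏ j, k j)) := by
  have hIcc := msgInterval_eq_Icc hγ hβγ
  have hk0 : ∀ i, 0 ≤ k i := fun i => mem_msgInterval_nonneg hβ hγ (hk i)
  have hP0 : 0 ≤ ∏ j, k j := Finset.prod_nonneg fun i _ => hk0 i
  have hx : 0 ≤ ζ 2 * ∏ j, k j := mul_nonneg hl.le hP0
  have hYI : realEdgeFun ζ (ζ 2 * ∏ j, k j) ∈ Icc (ζ 0) (ζ 1)⁻¹ := hIcc ▸ realEdgeFun_mem hγ hx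
  have hY0 : 0 < realEdgeFun ζ (ζ 2 * ∏ j, k j) := by
    rw [realEdgeFun]
    have : 0 < ζ 2 * ∏ j, k j + ζ 1 := by linarith
    positivity
  have hsm := slope_edge_mul hβ hγ hβγ hx
  change slope (ζ 0) (ζ 1) (realEdgeFun ζ (ζ 2 * ∏ j, k j)) * realEdgeFun ζ (ζ 2 * ∏ j, k j) = _
    at hsm
  set Y := realEdgeFun ζ (ζ 2 * ∏ j, k j) with hY
  have hsY := slope_nonneg hβ hγ hβγ hYI.1 hYI.2
  have hsY1 := slope_le_one hβ hγ hβγ hYI.1 hYI.2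
  have hpos : 0 < antiWeight (ζ 0) (ζ 1) μ Y := by
    rw [antiWeight_eq hβγ hY0]
    have : 0 < √(slope (ζ 0) (ζ 1) Y + μ) := Real.sqrt_pos.2 (by linarith)
    positivity
  have habs : |ζ 0 * ζ 1 - 1| = 1 - ζ 0 * ζ 1 := by rw [abs_sub_comm, abs_of_pos (by linarith)]
  rw [habs]
  rcases Nat.eq_zero_or_pos d with rfl | hd
  · simpa using hpos
  by_cases hall : ∀ i, 0 < k i
  · have hPpos : 0 < ∏ j, k j := Finset.prod_pos fun i _ => hall i
    have hd0 : (0 : ℝ) < d := by exact_mod_cast hd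
    -- The geometric mean of the messages: d equal messages y lead to the same Y.
    set y := (∏ j, k j) ^ (1 / d : ℝ) with hyd
    have hy0 : 0 < y := by positivity
    have hyp : ∏ j, k j = y ^ d := by
      rw [hyd, ← Real.rpow_natCast, ← Real.rpow_mul hP0, one_div_mul_cancel hd0.ne', Real.rpow_one]
    have hyI : y ∈ Icc (ζ 0) (ζ 1)⁻¹ := by
      constructor
      · refine le_of_pow_le_pow_left₀ hd.ne' hy0.le ?_
        rw [← hyp]
        simpa using Finset.prod_le_prod (s := Finset.univ) (f := fun _ : Fin d => ζ 0) (g := k)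
          (fun i _ => hβ) fun i _ => (hIcc ▸ hk i : k i ∈ Icc _ _).1
      · refine le_of_pow_le_pow_left₀ hd.ne' (inv_nonneg.2 hγ.le) ?_
        rw [← hyp]
        simpa using Finset.prod_le_prod (s := Finset.univ) (f := k) (g := fun _ : Fin d => (ζ 1)⁻¹)
          (fun i _ => hk0 i) fun i _ => (hIcc ▸ hk i : k i ∈ Icc _ _).2
    have hstep := h y hyI hd
    rw [← hyp, ← hY] at hstep
    have hsum := sum_slope_le hβ hγ hβγ hd k hall hy0 hyp
    have hcoef : ∀ i, (1 - ζ 0 * ζ 1) * ζ 2 * (∏ j ∈ Finset.univ.erase i, k j) /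
        (ζ 2 * ∏ j, k j + ζ 1) ^ 2 * antiWeight (ζ 0) (ζ 1) μ (k i) =
        slope (ζ 0) (ζ 1) Y * Y * √(slope (ζ 0) (ζ 1) (k i) + μ) := by
      intro i
      rw [antiWeight_eq hβγ (hall i), hsm]
      generalize (ζ 2 * ∏ j, k j + ζ 1) ^ 2 = D
      rw [← Finset.mul_prod_erase Finset.univ k (Finset.mem_univ i)]
      ring
    rw [Finset.sum_congr rfl fun i _ => hcoef i, ← Finset.mul_sum, antiWeight_eq hβγ hY0]
    set S := ∑ i, √(slope (ζ 0) (ζ 1) (k i) + μ) with hS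
    have hS0 : 0 ≤ S := Finset.sum_nonneg fun i _ => Real.sqrt_nonneg _
    have hki : ∀ i, 0 ≤ slope (ζ 0) (ζ 1) (k i) + μ := fun i => by
      have := hIcc ▸ hk i
      linarith [slope_nonneg hβ hγ hβγ this.1 this.2]
    have hS2 : S ^ 2 ≤ d * (d * slope (ζ 0) (ζ 1) y + d * μ) := by
      have := sq_sum_le_card_mul_sum_sq (s := Finset.univ)
        (f := fun i => √(slope (ζ 0) (ζ 1) (k i) + μ))
      rw [Finset.card_univ, Fintype.card_fin,
        Finset.sum_congr rfl fun i _ => Real.sq_sqrt (hki i), Finset.sum_add_distrib] at this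
      refine this.trans (mul_le_mul_of_nonneg_left ?_ hd0.le)
      simpa using hsum
    have hlt : slope (ζ 0) (ζ 1) Y * S < √(slope (ζ 0) (ζ 1) Y + μ) := by
      refine Real.lt_sqrt_of_sq_lt ?_
      rw [mul_pow]
      set a := slope (ζ 0) (ζ 1) Y
      have e1 : a ^ 2 * S ^ 2 ≤ a ^ 2 * (d * (d * slope (ζ 0) (ζ 1) y + d * μ)) :=
        mul_le_mul_of_nonneg_left hS2 (sq_nonneg a)
      have e2 : a ^ 2 * (d * (d * slope (ζ 0) (ζ 1) y + d * μ)) =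
          a * (d ^ 2 * (slope (ζ 0) (ζ 1) y * a) + a * (d ^ 2 * μ)) := by ring
      have e3 : a * (d ^ 2 * μ) ≤ d ^ 2 * μ := mul_le_of_le_one_left (by positivity) hsY1
      have e4 : a * (d ^ 2 * (slope (ζ 0) (ζ 1) y * a) + a * (d ^ 2 * μ)) ≤ a * 1 :=
        mul_le_mul_of_nonneg_left (by linarith) hsY
      linarith
    nlinarith
  -- If some message is 0, each summand has a factor 0: the weight at 0 for that child, the product
  -- over its siblings for every other child.
  · push Not at hall
    obtain ⟨i₀, hi₀⟩ := hall
    have hi0 : k i₀ = 0 := le_antisymm hi₀ (hk0 i₀)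
    rw [Finset.sum_eq_zero fun i _ => ?_]
    · exact hpos
    · by_cases hii : i = i₀
      · subst hii
        rw [hi0]
        simp [antiWeight]
      · rw [Finset.prod_eq_zero (Finset.mem_erase.2 ⟨Ne.symm hii, Finset.mem_univ i₀⟩) hi0]
        simp

/-- Two regularisations make the weight admissible. The parameter μ keeps it positive at endpoints
where `slope` vanishes, and adding t > 0 keeps it positive at the message 0, which occurs for β = 0.
Both can be afforded by strictness and compactness. -/
lemma exists_realContraction_of_mem_S2 {Δ : ℕ} (h : ζ ∈ S2 Δ) : ∃ w, RealContraction Δ ζ w := by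
  obtain ⟨hβγ, hβ, hγ, hl0, hu⟩ := h
  rcases hu with hl | ⟨hl, c, hc0, hc1, hu⟩
  · exact ⟨_, realContraction_of_lambda_eq_zero hβ hγ hl⟩
  have hIcc := msgInterval_eq_Icc hγ hβγ
  have hμ : ∀ᶠ μ in 𝓝[>] (0 : ℝ), ∀ d ∈ {d | d < Δ}, ∀ y ∈ Icc (ζ 0) (ζ 1)⁻¹, 1 ≤ d →
      (d : ℝ) ^ 2 * (slope (ζ 0) (ζ 1) y * slope (ζ 0) (ζ 1) (realEdgeFun ζ (ζ 2 * y ^ d))) +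
        d ^ 2 * μ < 1 := by
    refine (eventually_all_finite (finite_lt_nat Δ)).2 fun d hd => ?_
    rcases Nat.eq_zero_or_pos d with rfl | hd1
    · exact Eventually.of_forall fun μ y _ h => absurd h (by norm_num)
    have hlt := two_step_lt_one hβ hγ hβγ hl hd1 fun x hx hfx =>
      (hu d hd1 (Nat.le_sub_one_of_lt hd) x hx hfx).trans_lt hc1
    have hcontE : ContinuousOn (fun y => realEdgeFun ζ (ζ 2 * y ^ d)) (Icc (ζ 0) (ζ 1)⁻¹) := by
      intro y hy
      have : 0 ≤ ζ 2 * y ^ d := mul_nonneg hl.le (pow_nonneg (hβ.trans hy.1) d)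
      have : ζ 2 * y ^ d + ζ 1 ≠ 0 := by linarith
      unfold realEdgeFun
      exact ContinuousAt.continuousWithinAt (by fun_prop (disch := assumption))
    have hmem : ∀ y ∈ Icc (ζ 0) (ζ 1)⁻¹, realEdgeFun ζ (ζ 2 * y ^ d) ∈ Icc (ζ 0) (ζ 1)⁻¹ :=
      fun y hy => hIcc ▸ realEdgeFun_mem hγ (mul_nonneg hl.le (pow_nonneg (hβ.trans hy.1) d))
    have hcont := (continuousOn_const (c := (d : ℝ) ^ 2)).mul
      ((continuousOn_slope (γ := ζ 1) hβ).mul ((continuousOn_slope hβ).comp hcontE hmem))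
    obtain ⟨y₀, hy₀, hmax⟩ := isCompact_Icc.exists_isMaxOn (hIcc ▸ nonempty_uIcc) hcont
    have h0 := hlt y₀ hy₀
    have hd0 : (0 : ℝ) < d := by exact_mod_cast hd1
    filter_upwards [Ioo_mem_nhdsGT (div_pos (sub_pos.2 h0) (pow_pos hd0 2))] with μ hμ y hy _
    have h1 : (d : ℝ) ^ 2 *
        (slope (ζ 0) (ζ 1) y * slope (ζ 0) (ζ 1) (realEdgeFun ζ (ζ 2 * y ^ d))) ≤ (d : ℝ) ^ 2 *
        (slope (ζ 0) (ζ 1) y₀ * slope (ζ 0) (ζ 1) (realEdgeFun ζ (ζ 2 * y₀ ^ d))) := hmax hy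
    have h2 := hμ.2
    rw [lt_div_iff₀ (pow_pos hd0 2)] at h2
    linarith
  obtain ⟨μ, hμ, hμ0⟩ := (hμ.and self_mem_nhdsWithin).exists
  have hμ0' : 0 < μ := hμ0
  have hwc : Continuous (antiWeight (ζ 0) (ζ 1) μ) := by unfold antiWeight; fun_prop
  have ht : ∀ᶠ t in 𝓝[>] (0 : ℝ), ∀ d ∈ {d | d < Δ}, ∀ k : Fin d → ℝ, (∀ i, k i ∈ msgInterval ζ) →
      ∑ i, |ζ 0 * ζ 1 - 1| * ζ 2 * (∏ j ∈ Finset.univ.erase i, k j) / (ζ 2 * ∏ j, k j + ζ 1) ^ 2 *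
        (antiWeight (ζ 0) (ζ 1) μ (k i) + t) <
        antiWeight (ζ 0) (ζ 1) μ (realEdgeFun ζ (ζ 2 * ∏ j, k j)) + t := by
    refine (eventually_all_finite (finite_lt_nat Δ)).2 fun d hd => ?_
    refine nhdsWithin_le_nhds ?_
    refine (isCompact_msgVectors ζ d).eventually_forall_of_forall_eventually
      (x₀ := (0 : ℝ)) fun k hk => ?_
    have hk0 : 0 ≤ ∏ i, k i := Finset.prod_nonneg fun i _ => mem_msgInterval_nonneg hβ hγ (hk i)
    have hden : ζ 2 * ∏ i, k i + ζ 1 ≠ 0 := by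
      have := mul_nonneg hl.le hk0
      linarith
    refine ContinuousAt.eventually_lt ?_ ?_ ?_
    · refine tendsto_finsetSum _ fun i _ => ContinuousAt.mul ?_ (Continuous.continuousAt (by fun_prop))
      exact ContinuousAt.div (Continuous.continuousAt (by fun_prop))
        (Continuous.continuousAt (by fun_prop)) (pow_ne_zero _ hden)
    · refine ContinuousAt.add (hwc.continuousAt.comp ?_) (Continuous.continuousAt (by fun_prop))
      unfold realEdgeFun
      exact ContinuousAt.div (Continuous.continuousAt (by fun_prop))
        (Continuous.continuousAt (by fun_prop)) hden
    · simpa using antiWeight_step hβ hγ hβγ hμ0' hl (hμ d hd) k hk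
  obtain ⟨t, ht, ht0⟩ := (ht.and self_mem_nhdsWithin).exists
  have ht0' : 0 < t := ht0
  exact ⟨fun y => antiWeight (ζ 0) (ζ 1) μ y + t, hβ, hγ, hl0, by fun_prop,
    fun y _ => add_pos_of_nonneg_of_pos (Real.sqrt_nonneg _) ht0', ht⟩

theorem exists_realContraction {Δ : ℕ} (hΔ : 3 ≤ Δ) (h : ζ ∈ S1 Δ ∪ S2 Δ ∪ S3 Δ ∪ S4 Δ) :
    ∃ w, RealContraction Δ ζ w := by
  rcases h with ((h | h) | h) | h
  · exact ⟨_, realContraction_of_mem_S1 hΔ h⟩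
  · exact exists_realContraction_of_mem_S2 h
  · exact ⟨_, realContraction_of_mem_S3 hΔ h⟩
  · exact ⟨_, realContraction_of_mem_S4 hΔ h⟩

end Antiferro

/-! ### Fraction-free evaluation of truncated self-avoiding walk trees -/

section Fraction

/-- The view encoded by an integer: `n` or more stands for an alive vertex, any other number `z`
separates the vertices that see `+` from those that see `-`. -/
def decode (n : ℕ) (z : ℤ) : Option (Fin n → Option Bool) :=
  if (n : ℤ) ≤ z then none else
    some fun x => if ((x : ℕ) : ℤ) = z then none else some (decide (((x : ℕ) : ℤ) < z))

/-- The state encoded by a sequence of integers. -/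
def decodeState (n : ℕ) (c : ℕ → ℤ) : State (Fin n) := fun x => decode n (c x)

variable (n : ℕ) (a : ℕ → ℕ → Bool) (b g l D : ℂ)

/-- Numerator and denominator of the message from `u` to `v`; `rec` evaluates subtrees. -/
def kid (rec : (ℕ → ℤ) → ℕ → ℂ × ℂ) (c : ℕ → ℤ) (v u : ℕ) : ℂ × ℂ :=
  if a v u then
    if (n : ℤ) ≤ c u then rec (Function.update c v (u : ℤ)) u
    else if (v : ℤ) < c u then (b, D)
    else if c u < v then (D, g)
    else (1, 1)
  else (1, 1)

/-- Numerator and denominator of the weights of the two spins at `v`. -/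
def nodePair (rec : (ℕ → ℤ) → ℕ → ℂ × ℂ) (c : ℕ → ℤ) (v : ℕ) : ℂ × ℂ :=
  (l * ∏ u ∈ Finset.range n, (kid n a b g D rec c v u).1,
    D * ∏ u ∈ Finset.range n, (kid n a b g D rec c v u).2)

/-- Numerator and denominator of the truncated message of `v`. -/
def pairVal : ℕ → (ℕ → ℤ) → ℕ → ℂ × ℂ
  | 0, _, _ => (D, g)
  | f + 1, c, v =>
    (b * (nodePair n a b g l D (pairVal f) c v).1 + D * (nodePair n a b g l D (pairVal f) c v).2,
      D * (nodePair n a b g l D (pairVal f) c v).1 + g * (nodePair n a b g l D (pairVal f) c v).2)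

/-- The codes at the root of the tree of the vertex `v`: the earlier vertices are pinned to `-`. -/
def rootCode (v x : ℕ) : ℤ := if x < v then -1 else n

/-- The numerator of the output. -/
noncomputable def outNum (f : ℕ) (i : ℕ) : ℂ :=
  ∏ v ∈ Finset.range i, (∏ w ∈ Finset.range v, if a v w then g else 1) *
    ((nodePair n a b g l D (pairVal n a b g l D f) (rootCode n v) v).1 +
      (nodePair n a b g l D (pairVal n a b g l D f) (rootCode n v) v).2)

/-- The denominator of the output. -/
noncomputable def outDen (f : ℕ) (i : ℕ) : ℂ :=
  ∏ v ∈ Finset.range i, (∏ w ∈ Finset.range v, if a v w then D else 1) *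
    (nodePair n a b g l D (pairVal n a b g l D f) (rootCode n v) v).2

variable {n a b g l D} {G : SimpleGraph (Fin n)} [DecidableRel G.Adj] {ζ : Fin 3 → ℂ}

/-- One integer per removed vertex is enough: the index of the next vertex of the walk determines
the whole view, as the neighbours are ordered by their indices. -/
lemma decodeState_update (c : ℕ → ℤ) (v u : Fin n) :
    decodeState n (Function.update c v ((u : ℕ) : ℤ)) =
      remove (decodeState n c) v (towards (fun x : Fin n => (x : ℕ)) u) := by
  funext x
  by_cases hx : x = v
  · subst hx
    have : ¬ (n : ℤ) ≤ ((u : ℕ) : ℤ) := by exact_mod_cast not_le.2 u.2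
    simp only [decodeState, Function.update_self, decode, this, if_false, remove]
    congr 1
    funext y
    simp only [towards, Nat.cast_inj, Fin.val_inj, Nat.cast_lt]
  · have : (x : ℕ) ≠ v := fun h => hx (Fin.ext h)
    simp [decodeState, remove, hx, this]

/-! ### Uncancelled fractions against the truncated ratios, and the resulting error. -/

section Ratio

variable {Δ : ℕ} {C η : ℝ} (K : Contraction Δ ζ C η) (hΔ : ∀ v, G.degree v ≤ Δ)
  (ha : ∀ i j : Fin n, a i j = true ↔ G.Adj i j) (hD : D ≠ 0)
  (hb : b = ζ 0 * D) (hg : g = ζ 1 * D) (hl : l = ζ 2 * D)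

include K ha hD hb hg in
/-- Ratio of numerator and denominator of a received message. -/
lemma kid_eq (f : ℕ) (c : ℕ → ℤ) (v u : Fin n)
    (hrec : G.Adj v u → decodeState n c u = none →
      (pairVal n a b g l D f (Function.update c v ((u : ℕ) : ℤ)) u).2 ≠ 0 ∧
      (pairVal n a b g l D f (Function.update c v ((u : ℕ) : ℤ)) u).1 =
        msg G ζ (fun x : Fin n => (x : ℕ)) f
          (remove (decodeState n c) v (towards (fun x : Fin n => (x : ℕ)) u)) u *
        (pairVal n a b g l D f (Function.update c v ((u : ℕ) : ℤ)) u).2) :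
    (kid n a b g D (pairVal n a b g l D f) c v u).2 ≠ 0 ∧
    (kid n a b g D (pairVal n a b g l D f) c v u).1 =
      (if G.Adj v u then edgeMsg G ζ (fun x : Fin n => (x : ℕ)) f (decodeState n c) v u else 1) *
        (kid n a b g D (pairVal n a b g l D f) c v u).2 := by
  have hγ := K.gamma_ne_zero
  rw [kid]
  by_cases hadj : G.Adj v u
  · rw [if_pos ((ha v u).2 hadj), if_pos hadj]
    by_cases h1 : (n : ℤ) ≤ c u
    · have hst : decodeState n c u = none := by simp [decodeState, decode, h1]
      rw [if_pos h1, edgeMsg_of_alive _ _ _ _ _ hst]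
      exact hrec hadj hst
    · have hst : decodeState n c u = some fun x : Fin n =>
          if ((x : ℕ) : ℤ) = c u then none else some (decide (((x : ℕ) : ℤ) < c u)) := by
        simp [decodeState, decode, h1]
      rw [if_neg h1, edgeMsg_of_some _ _ _ _ _ hst]
      rcases lt_trichotomy ((v : ℕ) : ℤ) (c u) with h2 | h2 | h2
      · simp [h2, h2.ne, viewMsg, hb, hD]
      · simp [h2, viewMsg]
      · simp [h2, h2.ne', not_lt.2 h2.le, viewMsg, hg, hD, hγ]
  · have : a v u = false := by
      rw [← Bool.not_eq_true, ha]; exact hadj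
    simp [this, hadj]

include K ha hD hb hg hl in
lemma nodePair_eq (f : ℕ) (c : ℕ → ℤ) (v : Fin n)
    (hrec : ∀ u : Fin n, G.Adj v u → decodeState n c u = none →
      (pairVal n a b g l D f (Function.update c v ((u : ℕ) : ℤ)) u).2 ≠ 0 ∧
      (pairVal n a b g l D f (Function.update c v ((u : ℕ) : ℤ)) u).1 =
        msg G ζ (fun x : Fin n => (x : ℕ)) f
          (remove (decodeState n c) v (towards (fun x : Fin n => (x : ℕ)) u)) u *
        (pairVal n a b g l D f (Function.update c v ((u : ℕ) : ℤ)) u).2) :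
    (nodePair n a b g l D (pairVal n a b g l D f) c v).2 ≠ 0 ∧
    (nodePair n a b g l D (pairVal n a b g l D f) c v).1 =
      ratio G ζ (fun x : Fin n => (x : ℕ)) f (decodeState n c) v *
        (nodePair n a b g l D (pairVal n a b g l D f) c v).2 := by
  have hk := fun u => kid_eq K ha hD hb hg f c v u (hrec u)
  simp only [nodePair, Finset.prod_range]
  refine ⟨mul_ne_zero hD (Finset.prod_ne_zero_iff.2 fun u _ => (hk u).1), ?_⟩
  rw [Finset.prod_congr rfl fun u _ => (hk u).2, Finset.prod_mul_distrib, ratio,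
    Finset.prod_filter, hl]
  ring

include K hΔ ha hD hb hg hl in
-- For a fraction A/B with value x, the new denominator D A + g B equals (x + γ) D B, so it is
-- nonzero by the certificate even though nothing is ever cancelled.
lemma pairVal_eq (f : ℕ) (c : ℕ → ℤ) (v : Fin n) (hv : Entered G (decodeState n c) v) :
    (pairVal n a b g l D f c v).2 ≠ 0 ∧
    (pairVal n a b g l D f c v).1 =
      msg G ζ (fun x : Fin n => (x : ℕ)) f (decodeState n c) v * (pairVal n a b g l D f c v).2 := by
  have hγ := K.gamma_ne_zero
  induction f generalizing c v with
  | zero =>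
    simp only [pairVal, msg, hg]
    exact ⟨mul_ne_zero hγ hD, by field_simp⟩
  | succ f ih =>
    obtain ⟨h1, h2⟩ := nodePair_eq K ha hD hb hg hl f c v fun u hu hst => by
      have := ih (Function.update c v ((u : ℕ) : ℤ)) u (by
        rw [decodeState_update]; exact entered_remove_towards G _ _ hu)
      rwa [decodeState_update] at this
    have h3 := ratio_add_ne_zero (fun x : Fin n => (x : ℕ)) K hΔ f (decodeState n c) v hv
    rw [pairVal, msg_succ, edgeFun]
    simp only
    rw [h2]
    set r := ratio G ζ (fun x : Fin n => (x : ℕ)) f (decodeState n c) v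
    set B := (nodePair n a b g l D (pairVal n a b g l D f) c v).2
    have h4 : D * (r * B) + g * B = (r + ζ 1) * (D * B) := by rw [hg]; ring
    rw [h4]
    refine ⟨mul_ne_zero h3 (mul_ne_zero hD h1), ?_⟩
    rw [hb]
    field_simp

include K hΔ ha hD hb hg hl in
lemma rootPair_eq (f : ℕ) (c : ℕ → ℤ) (v : Fin n) :
    (nodePair n a b g l D (pairVal n a b g l D f) c v).2 ≠ 0 ∧
    (nodePair n a b g l D (pairVal n a b g l D f) c v).1 =
      ratio G ζ (fun x : Fin n => (x : ℕ)) f (decodeState n c) v *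
        (nodePair n a b g l D (pairVal n a b g l D f) c v).2 :=
  nodePair_eq K ha hD hb hg hl f c v fun u hu hst => by
    have := pairVal_eq K hΔ ha hD hb hg hl f (Function.update c v ((u : ℕ) : ℤ)) u (by
      rw [decodeState_update]; exact entered_remove_towards G _ _ hu)
    rwa [decodeState_update] at this

/-- The state in which the vertices before `i` are pinned to `-`. -/
def prefixState (n i : ℕ) : State (Fin n) :=
  fun x => if (x : ℕ) < i then some fun _ => some false else none

/-- The code -1 lies below every index, so every neighbour sees `-` at such a vertex. -/
lemma decodeState_rootCode (i : ℕ) : decodeState n (rootCode n i) = prefixState n i := by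
  funext x
  by_cases hx : (x : ℕ) < i
  · simp only [decodeState, decode, rootCode, hx, if_true, prefixState]
    rw [if_neg (by omega)]
    congr 1
  · simp [decodeState, decode, rootCode, hx, prefixState]

lemma pin_prefixState {i : ℕ} (hi : i < n) :
    pin (prefixState n i) ⟨i, hi⟩ false = prefixState n (i + 1) := by
  funext x
  by_cases hx : x = ⟨i, hi⟩
  · subst hx; simp [pin, remove, prefixState]
  · have hx' : (x : ℕ) ≠ i := fun h => hx (Fin.ext h)
    have : (x : ℕ) < i + 1 ↔ (x : ℕ) < i := by omega
    simp [pin, remove, prefixState, hx, this]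

include ha in
lemma minusW_prefixState {i : ℕ} (hi : i < n) :
    minusW G ζ (prefixState n i) ⟨i, hi⟩ = ∏ w ∈ Finset.range i, if a i w then ζ 1 else 1 := by
  have h : minusW G ζ (prefixState n i) ⟨i, hi⟩ =
      ∏ w ∈ Finset.range n, if a i w = true ∧ w < i then ζ 1 else 1 := by
    rw [minusW, Finset.prod_filter, Finset.prod_range]
    refine Finset.prod_congr rfl fun w _ => ?_
    have := ha ⟨i, hi⟩ w
    by_cases h1 : (w : ℕ) < i <;> by_cases h2 : G.Adj ⟨i, hi⟩ w <;>
      simp_all [seen, prefixState, not_lt.2]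
  rw [h, ← Finset.prod_filter, ← Finset.prod_filter]
  refine Finset.prod_congr ?_ fun _ _ => rfl
  ext w
  simp only [Finset.mem_filter, Finset.mem_range]
  constructor
  · rintro ⟨_, h1, h2⟩; exact ⟨h2, h1⟩
  · rintro ⟨h1, h2⟩; exact ⟨h1.trans hi, h2, h1⟩

include K hΔ ha in
/-- The partition function as a telescoping product over the vertices. -/
lemma Z_eq_prod (F : ℕ) (hF : n ≤ F) :
    Z G ζ (fun _ => none) = ∏ v ∈ Finset.range n, (∏ w ∈ Finset.range v, if a v w then ζ 1 else 1) *
      (1 + if h : v < n then ratio G ζ (fun x : Fin n => (x : ℕ)) F (prefixState n v) ⟨v, h⟩ else 0) := by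
  -- Summing over the spin of vertex `i` gives its weight for `-`, times `1 + ratio`, times the sum
  -- with `i` pinned to `-`.
  have key : ∀ i ≤ n, stateSum G ζ (prefixState n 0) =
      (∏ v ∈ Finset.range i, (∏ w ∈ Finset.range v, if a v w then ζ 1 else 1) *
        (1 + if h : v < n then ratio G ζ (fun x : Fin n => (x : ℕ)) F (prefixState n v) ⟨v, h⟩
          else 0)) * stateSum G ζ (prefixState n i) := by
    intro i
    induction i with
    | zero => simp
    | succ i ih =>
      intro hi
      have hin : i < n := hi
      have hst : prefixState n i ⟨i, hin⟩ = none := by simp [prefixState]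
      have hcard : (alive (prefixState n i)).card ≤ n :=
        (Finset.card_le_univ _).trans (by simp)
      rw [ih hin.le, Finset.prod_range_succ, stateSum_eq G ζ hst,
        (stateSum_ne_zero_and_ratio (fun x : Fin n => (x : ℕ)) K hΔ Fin.val_injective _ _
          hcard).2 _ hst F (by omega), minusW_prefixState ha hin, pin_prefixState hin, dif_pos hin]
      ring
  have hpw : pinnedWeight G ζ (fun _ => none) = 1 := by
    have h0 : ∀ s, pinnedSet (fun _ : Fin n => (none : Option Bool)) s = ∅ := by
      intro s; simp [pinnedSet]
    have h1 : innerEdges G ∅ = 0 := by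
      rw [innerEdges, Finset.card_eq_zero, Finset.filter_eq_empty_iff]
      intro e _
      simp
    simp [pinnedWeight, h0, h1]
  have h0 : ofPinning (fun _ : Fin n => none) = prefixState n 0 := by
    funext x; simp [ofPinning, prefixState]
  have hn : alive (prefixState n n) = ∅ := by
    rw [Finset.eq_empty_iff_forall_notMem]
    intro x hx
    simp [prefixState] at hx
  rw [Z_eq_pinnedWeight_mul, hpw, one_mul, h0, key n le_rfl, stateSum_of_alive_eq_empty G ζ hn,
    mul_one]

include K hΔ ha in
/-- A lower bound for the partition function. -/
lemma le_norm_Z {μ : ℝ} (hμ0 : 0 ≤ μ) (hμ1 : μ ≤ 1) (hμ : μ ≤ ‖ζ 1‖) :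
    (μ ^ n / 2) ^ n ≤ ‖Z G ζ (fun _ => none)‖ := by
  rw [Z_eq_prod K hΔ ha n le_rfl, norm_prod]
  have : (μ ^ n / 2) ^ n = ∏ v ∈ Finset.range n, (μ ^ n / 2) := by
    rw [Finset.prod_const, Finset.card_range]
  rw [this]
  refine Finset.prod_le_prod (fun _ _ => by positivity) fun v hv => ?_
  rw [Finset.mem_range] at hv
  rw [norm_mul, dif_pos hv, div_eq_mul_one_div]
  refine mul_le_mul ?_ (half_le_norm_one_add_ratio _ K hΔ _ _ _) (by norm_num) (norm_nonneg _)
  rw [norm_prod]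
  calc μ ^ n ≤ μ ^ v := pow_le_pow_of_le_one hμ0 hμ1 hv.le
    _ = ∏ w ∈ Finset.range v, μ := by simp
    _ ≤ _ := by
      refine Finset.prod_le_prod (fun _ _ => hμ0) fun w _ => ?_
      split_ifs
      · exact hμ
      · simpa using hμ1

include K hΔ ha hD hb hg hl in
-- Truncation changes each ratio by at most θ/2, so each factor `1 + ratio`, of norm at least 1/2,
-- changes by a relative error of at most θ. The product of n such factors has relative error at
-- most e^(nθ) - 1 ≤ 2nθ. The powers of D cancel.
theorem norm_outNum_div_outDen_sub_le (f : ℕ) {θ : ℝ} (hC : C * η ^ f ≤ θ / 2) (hθ1 : n * θ ≤ 1) :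
    outDen n a b g l D f n ≠ 0 ∧
    ‖outNum n a b g l D f n / outDen n a b g l D f n - Z G ζ (fun _ => none)‖ ≤
      2 * (n * θ) * ‖Z G ζ (fun _ => none)‖ := by
  set ord := fun x : Fin n => (x : ℕ)
  have hden : ∀ v ∈ Finset.range n, (∏ w ∈ Finset.range v, if a v w then D else 1) *
      (nodePair n a b g l D (pairVal n a b g l D f) (rootCode n v) v).2 ≠ 0 := by
    intro v hv
    rw [Finset.mem_range] at hv
    refine mul_ne_zero (Finset.prod_ne_zero_iff.2 fun w _ => ?_)
      (rootPair_eq K hΔ ha hD hb hg hl f (rootCode n v) ⟨v, hv⟩).1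
    split_ifs
    exacts [hD, one_ne_zero]
  refine ⟨Finset.prod_ne_zero_iff.2 hden, ?_⟩
  -- Depth `f + n` is at least `n`, hence exact.
  set R : ℕ → ℂ := fun v => if h : v < n then ratio G ζ ord (f + n) (prefixState n v) ⟨v, h⟩ else 0
    with hR
  set R' : ℕ → ℂ := fun v => if h : v < n then ratio G ζ ord f (prefixState n v) ⟨v, h⟩ else 0
    with hR'
  have hR0 : ∀ v, v < n → 1 / 2 ≤ ‖1 + R v‖ := by
    intro v hv
    simp only [hR, dif_pos hv]
    exact half_le_norm_one_add_ratio ord K hΔ _ _ _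
  have hdiff : ∀ v, v < n → ‖R' v - R v‖ ≤ θ / 2 := by
    intro v hv
    simp only [hR, hR', dif_pos hv]
    exact (norm_ratio_sub_ratio_le ord K hΔ f f (f + n) le_rfl (by omega) _ _ _
      (agree_refl _ _ _)).trans hC
  set e : ℕ → ℂ := fun v => (R' v - R v) / (1 + R v) with he
  have hquot : outNum n a b g l D f n / outDen n a b g l D f n =
      Z G ζ (fun _ => none) * ∏ v ∈ Finset.range n, (1 + e v) := by
    rw [Z_eq_prod K hΔ ha (f + n) (by omega), outNum, outDen, ← Finset.prod_div_distrib,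
      ← Finset.prod_mul_distrib]
    refine Finset.prod_congr rfl fun v hv => ?_
    have hv' := Finset.mem_range.1 hv
    obtain ⟨h1, h2⟩ := rootPair_eq K hΔ ha hD hb hg hl f (rootCode n v) ⟨v, hv'⟩
    simp only [decodeState_rootCode] at h1 h2
    have h3 : 1 + R v ≠ 0 := norm_pos_iff.1 (by linarith [hR0 v hv'])
    have h4 : (1 + R v) * (1 + e v) = 1 + R' v := by
      simp only [he]; field_simp; ring
    change _ = _ * (1 + R v) * (1 + e v)
    rw [mul_assoc, h4]
    have h5 : R' v = ratio G ζ ord f (prefixState n v) ⟨v, hv'⟩ := by simp only [hR', dif_pos hv']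
    rw [h2, ← h5, ← add_one_mul, add_comm _ (1 : ℂ)]
    have h6 : ∏ w ∈ Finset.range v, (if a v w = true then g else 1) =
        (∏ w ∈ Finset.range v, if a v w = true then ζ 1 else 1) *
          ∏ w ∈ Finset.range v, if a v w = true then D else 1 := by
      rw [← Finset.prod_mul_distrib]
      refine Finset.prod_congr rfl fun w _ => ?_
      split_ifs <;> simp [hg]
    have h7 : ∏ w ∈ Finset.range v, (if a v w = true then D else 1) ≠ 0 :=
      (mul_ne_zero_iff.1 (hden v hv)).1
    rw [h6]
    field_simp
  have hsum : ∑ v ∈ Finset.range n, ‖e v‖ ≤ n * θ := by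
    refine (Finset.sum_le_card_nsmul _ _ θ fun v hv => ?_).trans (by simp)
    have hv' := Finset.mem_range.1 hv
    have := hR0 v hv'
    simp only [he]
    rw [norm_div, div_le_iff₀ (by linarith)]
    have h1 := hdiff v hv'
    have h0 : 0 ≤ θ / 2 := (norm_nonneg _).trans h1
    nlinarith
  have hprod := Finset.norm_prod_one_add_sub_one_le (Finset.range n) e
  have hsum0 : 0 ≤ ∑ v ∈ Finset.range n, ‖e v‖ := Finset.sum_nonneg fun _ _ => norm_nonneg _
  have hexp := Real.abs_exp_sub_one_le (x := ∑ v ∈ Finset.range n, ‖e v‖) (by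
    rw [abs_of_nonneg hsum0]; exact hsum.trans hθ1)
  rw [abs_of_nonneg hsum0] at hexp
  have hle : ‖∏ v ∈ Finset.range n, (1 + e v) - 1‖ ≤ 2 * (n * θ) := by
    have := le_abs_self (Real.exp (∑ v ∈ Finset.range n, ‖e v‖) - 1)
    linarith
  rw [hquot, show Z G ζ (fun _ => none) * ∏ v ∈ Finset.range n, (1 + e v) - Z G ζ (fun _ => none) =
    (∏ v ∈ Finset.range n, (1 + e v) - 1) * Z G ζ (fun _ => none) by ring, norm_mul]
  exact mul_le_mul_of_nonneg_right hle (norm_nonneg _)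

end Ratio

end Fraction

/-! ### A program logic with cost bounds -/

section Logic

/-- All cells hold integers of binary length at most `B`. -/
def Bounded (B : ℕ) (m : Memory) : Prop := ∀ i, |m i| < 2 ^ B

lemma bitLen_le_iff {z : ℤ} {B : ℕ} : bitLen z ≤ B ↔ |z| < 2 ^ B := by
  rw [bitLen, Nat.size_le, Int.abs_eq_natAbs]
  exact_mod_cast Iff.rfl

lemma Bounded.update {B : ℕ} {m : Memory} (hm : Bounded B m) (i : ℤ) {z : ℤ} (hz : |z| < 2 ^ B) :
    Bounded B (Function.update m i z) := by
  intro j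
  by_cases h : j = i
  · subst h; simpa using hz
  · simpa [h] using hm j

lemma bitLen_add_le (x y : ℤ) : bitLen (x + y) ≤ bitLen x + bitLen y + 1 := by
  have hx := bitLen_le_iff.1 (le_refl (bitLen x))
  have hy := bitLen_le_iff.1 (le_refl (bitLen y))
  rw [bitLen_le_iff]
  have h1 : (2 : ℤ) ^ bitLen x ≤ 2 ^ (bitLen x + bitLen y) :=
    pow_le_pow_right₀ (by norm_num) (by omega)
  have h2 : (2 : ℤ) ^ bitLen y ≤ 2 ^ (bitLen x + bitLen y) :=
    pow_le_pow_right₀ (by norm_num) (by omega)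
  rw [pow_succ]
  have := abs_add_le x y
  linarith

lemma bitLen_neg (x : ℤ) : bitLen (-x) = bitLen x := by simp [bitLen]

lemma bitLen_sub_le (x y : ℤ) : bitLen (x - y) ≤ bitLen x + bitLen y + 1 := by
  rw [sub_eq_add_neg, ← bitLen_neg y]
  exact bitLen_add_le x (-y)

lemma bitLen_mul_le (x y : ℤ) : bitLen (x * y) ≤ bitLen x + bitLen y := by
  have hx := bitLen_le_iff.1 (le_refl (bitLen x))
  have hy := bitLen_le_iff.1 (le_refl (bitLen y))
  rw [bitLen_le_iff, abs_mul, pow_add]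
  exact mul_lt_mul'' hx hy (abs_nonneg x) (abs_nonneg y)

/-- A cost factor of an expression. -/
def Expr.wt : Expr → ℕ
  | .const c => 1 + bitLen c
  | .load a => 2 * a.wt + 1
  | .add a b => 2 * a.wt + 2 * b.wt + 1
  | .sub a b => 2 * a.wt + 2 * b.wt + 1
  | .mul a b => 2 * a.wt + 2 * b.wt + 1
  | .queryRe _ a => a.wt + 2
  | .queryIm _ a => a.wt + 2

/-- The oracle queries of an expression have precision at most `B` and answers of length at
most `B`. -/
def Expr.Ok (ω : ParamOracle) (B : ℕ) (m : Memory) : Expr → Prop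
  | .const _ => True
  | .load a => a.Ok ω B m
  | .add a b => a.Ok ω B m ∧ b.Ok ω B m
  | .sub a b => a.Ok ω B m ∧ b.Ok ω B m
  | .mul a b => a.Ok ω B m ∧ b.Ok ω B m
  | .queryRe i a => a.Ok ω B m ∧ (a.eval ω m).toNat ≤ B ∧ |(ω i (a.eval ω m).toNat).1| < 2 ^ B
  | .queryIm i a => a.Ok ω B m ∧ (a.eval ω m).toNat ≤ B ∧ |(ω i (a.eval ω m).toNat).2| < 2 ^ B

/-- Only stored values have to fit into `B` bits. Intermediate values of a fixed expression are
longer by at most the constant factor `wt`, so the program logic needs no bounds for them. -/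
lemma Expr.cost_le {ω : ParamOracle} {B : ℕ} {m : Memory} (hm : Bounded B m) (e : Expr)
    (he : e.Ok ω B m) :
    e.cost ω m ≤ e.wt * (B + 1) ∧ bitLen (e.eval ω m) ≤ e.wt * (B + 1) := by
  induction e with
  | const c =>
    simp only [Expr.cost, Expr.wt, Expr.eval]
    constructor <;> nlinarith [Nat.zero_le (bitLen c), Nat.zero_le B]
  | load a ih =>
    obtain ⟨h1, h2⟩ := ih he
    have h3 := bitLen_le_iff.2 (hm (a.eval ω m))
    simp only [Expr.cost, Expr.wt, Expr.eval]
    constructor <;> nlinarith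
  | add a b iha ihb =>
    obtain ⟨h1, h2⟩ := iha he.1
    obtain ⟨h3, h4⟩ := ihb he.2
    have := bitLen_add_le (a.eval ω m) (b.eval ω m)
    simp only [Expr.cost, Expr.wt, Expr.eval]
    constructor <;> nlinarith
  | sub a b iha ihb =>
    obtain ⟨h1, h2⟩ := iha he.1
    obtain ⟨h3, h4⟩ := ihb he.2
    have := bitLen_sub_le (a.eval ω m) (b.eval ω m)
    simp only [Expr.cost, Expr.wt, Expr.eval]
    constructor <;> nlinarith
  | mul a b iha ihb =>
    obtain ⟨h1, h2⟩ := iha he.1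
    obtain ⟨h3, h4⟩ := ihb he.2
    have := bitLen_mul_le (a.eval ω m) (b.eval ω m)
    simp only [Expr.cost, Expr.wt, Expr.eval]
    constructor <;> nlinarith
  | queryRe i a ih =>
    obtain ⟨h1, h2⟩ := ih he.1
    have h3 := he.2.1
    have h4 := bitLen_le_iff.2 he.2.2
    simp only [Expr.cost, Expr.wt, Expr.eval]
    constructor <;> nlinarith
  | queryIm i a ih =>
    obtain ⟨h1, h2⟩ := ih he.1
    have h3 := he.2.1
    have h4 := bitLen_le_iff.2 he.2.2
    simp only [Expr.cost, Expr.wt, Expr.eval]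
    constructor <;> nlinarith

/-- A cost factor of a program. -/
def Prog.wt : Prog → ℕ
  | .skip => 1
  | .store a e => 2 * a.wt + 2 * e.wt + 1
  | .seq c₁ c₂ => c₁.wt + c₂.wt
  | .branch e c₁ c₂ => e.wt + c₁.wt + c₂.wt + 1
  | .loop e c => e.wt + c.wt + 1

/-- Started in the memory `m`, the program `P` halts in a memory with property `Q`. While the cells
hold integers of length at most `B`, the cost is at most `s * (P.wt * (B + 1))`. -/
def Runs (ω : ParamOracle) (B : ℕ) (P : Prog) (m : Memory) (s : ℕ) (Q : Memory → Prop) : Prop :=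
  Bounded B m → ∃ t m', Exec ω P m t m' ∧ t ≤ s * (P.wt * (B + 1)) ∧ Bounded B m' ∧ Q m'

variable {ω : ParamOracle} {B : ℕ} {P P₁ P₂ : Prog} {a e : Expr} {m : Memory} {s s' : ℕ}
  {Q Q' : Memory → Prop}

lemma Runs.mono (h : Runs ω B P m s Q) (hs : s ≤ s') (hQ : ∀ m', Q m' → Q' m') :
    Runs ω B P m s' Q' := by
  intro hm
  obtain ⟨t, m', h1, h2, h3, h4⟩ := h hm
  exact ⟨t, m', h1, h2.trans (Nat.mul_le_mul_right _ hs), h3, hQ _ h4⟩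

lemma Runs.skip (hs : 1 ≤ s) (h : Q m) : Runs ω B .skip m s Q := by
  intro hm
  refine ⟨1, m, .skip m, ?_, hm, h⟩
  simp only [Prog.wt]
  nlinarith

lemma Runs.store (hs : 1 ≤ s) (ha : a.Ok ω B m) (he : e.Ok ω B m) (hv : |e.eval ω m| < 2 ^ B)
    (h : Q (Function.update m (a.eval ω m) (e.eval ω m))) : Runs ω B (.store a e) m s Q := by
  intro hm
  refine ⟨_, _, .store a e m, ?_, hm.update _ hv, h⟩
  obtain ⟨h1, h2⟩ := a.cost_le hm ha
  obtain ⟨h3, h4⟩ := e.cost_le hm he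
  refine le_trans ?_ (Nat.le_mul_of_pos_left _ hs)
  simp only [Prog.wt]
  nlinarith

/-- Both parts use the same `s`, because their weights already add up in `Prog.wt`. Thus `s`
measures only repetition by loops. -/
lemma Runs.seq (h : Runs ω B P₁ m s fun m' => Runs ω B P₂ m' s Q) :
    Runs ω B (.seq P₁ P₂) m s Q := by
  intro hm
  obtain ⟨t₁, m₁, h1, h2, h3, h4⟩ := h hm
  obtain ⟨t₂, m₂, h5, h6, h7, h8⟩ := h4 h3
  refine ⟨_, _, .seq h1 h5, ?_, h7, h8⟩
  simp only [Prog.wt]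
  nlinarith

lemma Runs.branch (hs : 1 ≤ s) (he : e.Ok ω B m) (h1 : 0 < e.eval ω m → Runs ω B P₁ m s Q)
    (h2 : e.eval ω m ≤ 0 → Runs ω B P₂ m s Q) : Runs ω B (.branch e P₁ P₂) m s Q := by
  intro hm
  have hc := (e.cost_le hm he).1
  have hs' : e.wt * (B + 1) + 1 ≤ s * ((e.wt + 1) * (B + 1)) := by
    refine le_trans ?_ (Nat.le_mul_of_pos_left _ hs)
    nlinarith
  rcases lt_or_ge 0 (e.eval ω m) with h | h
  · obtain ⟨t, m', h3, h4, h5, h6⟩ := h1 h hm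
    refine ⟨_, _, .branchPos h h3, ?_, h5, h6⟩
    simp only [Prog.wt]
    have : 0 ≤ s * (P₂.wt * (B + 1)) := Nat.zero_le _
    nlinarith
  · obtain ⟨t, m', h3, h4, h5, h6⟩ := h2 h hm
    refine ⟨_, _, .branchNonpos h h3, ?_, h5, h6⟩
    simp only [Prog.wt]
    have : 0 ≤ s * (P₁.wt * (B + 1)) := Nat.zero_le _
    nlinarith

/-- The weight of a loop contains that of its body only once, so here the counts of steps add. -/
lemma Runs.loop_pos (he : e.Ok ω B m) (h : 0 < e.eval ω m) (hs : 1 ≤ s)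
    (h1 : Runs ω B P m s fun m' => Runs ω B (.loop e P) m' s' Q) :
    Runs ω B (.loop e P) m (s + s') Q := by
  intro hm
  have hc := (e.cost_le hm he).1
  have hs' : e.wt * (B + 1) + 1 ≤ s * ((e.wt + 1) * (B + 1)) := by
    refine le_trans ?_ (Nat.le_mul_of_pos_left _ hs)
    nlinarith
  obtain ⟨t₁, m₁, h2, h3, h4, h5⟩ := h1 hm
  obtain ⟨t₂, m₂, h6, h7, h8, h9⟩ := h5 h4
  refine ⟨_, _, .loopPos h h2 h6, ?_, h8, h9⟩
  simp only [Prog.wt] at h7 ⊢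
  nlinarith

lemma Runs.loop_nonpos (he : e.Ok ω B m) (h : e.eval ω m ≤ 0) (hs : 1 ≤ s) (hQ : Q m) :
    Runs ω B (.loop e P) m s Q := by
  intro hm
  have hc := (e.cost_le hm he).1
  refine ⟨_, _, .loopNonpos h, ?_, hm, hQ⟩
  refine le_trans ?_ (Nat.le_mul_of_pos_left _ hs)
  simp only [Prog.wt]
  nlinarith

/-! Scalars and arrays are kept in the cells with negative addresses. -/

/-- Contents of the entry `i` of the array `x`. -/
def rd (m : Memory) (x i : ℤ) : ℤ := m (-(x + 1) - 32 * i)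

/-- Replace the entry `i` of the array `x`. -/
def wr (m : Memory) (x i z : ℤ) : Memory := Function.update m (-(x + 1) - 32 * i) z

lemma rd_wr_self (m : Memory) (x i z : ℤ) : rd (wr m x i z) x i = z := by simp [rd, wr]

/-- The array `x` occupies addresses in one residue class modulo 32, so arrays with incongruent
numbers never collide, whatever the indices. -/
lemma rd_wr_of_ne (m : Memory) (x y i j z : ℤ) (h : (x - y) % 32 ≠ 0) :
    rd (wr m x i z) y j = rd m y j := by
  rw [rd, wr, Function.update_of_ne (by omega), rd]

lemma rd_wr_of_index_ne (m : Memory) (x i j z : ℤ) (h : j ≠ i) :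
    rd (wr m x i z) x j = rd m x j := by
  rw [rd, wr, Function.update_of_ne (by omega), rd]

lemma wr_apply_of_nonneg (m : Memory) (x i z c : ℤ) (hx : 0 ≤ x) (hi : 0 ≤ i) (hc : 0 ≤ c) :
    wr m x i z c = m c := by
  rw [wr, Function.update_of_ne (by omega)]

/-- Address of an array entry. -/
def adr (x : ℤ) (i : Expr) : Expr := .sub (.const (-(x + 1))) (.mul (.const 32) i)

/-- Array access. -/
def arr (x : ℤ) (i : Expr) : Expr := .load (adr x i)

/-- Access to a scalar. -/
def vr (x : ℤ) : Expr := arr x (.const 0)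

/-- Assignment to an array entry. -/
def put (x : ℤ) (i e : Expr) : Prog := .store (adr x i) e

/-- Assignment to a scalar. -/
def assign (x : ℤ) (e : Expr) : Prog := put x (.const 0) e

variable (ω m) in
lemma eval_arr (x : ℤ) (i : Expr) : (arr x i).eval ω m = rd m x (i.eval ω m) := rfl

variable (ω m) in
lemma eval_vr (x : ℤ) : (vr x).eval ω m = rd m x 0 := rfl

lemma ok_arr (x : ℤ) (i : Expr) : (arr x i).Ok ω B m ↔ i.Ok ω B m := by
  simp [arr, adr, Expr.Ok]

lemma ok_vr (x : ℤ) : (vr x).Ok ω B m := by simp [vr, ok_arr, Expr.Ok]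

lemma Runs.put {x : ℤ} {i : Expr} (hs : 1 ≤ s) (hi : i.Ok ω B m) (he : e.Ok ω B m)
    (hv : |e.eval ω m| < 2 ^ B) (h : Q (wr m x (i.eval ω m) (e.eval ω m))) :
    Runs ω B (put x i e) m s Q :=
  Runs.store hs (by simpa [adr, Expr.Ok] using hi) he hv h

lemma Runs.assign {x : ℤ} (hs : 1 ≤ s) (he : e.Ok ω B m)
    (hv : |e.eval ω m| < 2 ^ B) (h : Q (wr m x 0 (e.eval ω m))) :
    Runs ω B (assign x e) m s Q :=
  Runs.put hs trivial he hv h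

/-- Run `P` with the scalar `x` ranging over `0, 1, …` below the value of `e`. -/
def forLoop (x : ℤ) (e : Expr) (P : Prog) : Prog :=
  .seq (assign x (.const 0)) (.loop (.sub e (vr x)) (.seq P (assign x (.add (vr x) (.const 1)))))

lemma Runs.forLoop {x : ℤ} (n : ℕ) (Inv : ℕ → Memory → Prop) (hn : (n : ℤ) < 2 ^ B)
    (hs : 1 ≤ s) (hs' : n * s + 1 ≤ s')
    (hInv : ∀ i m, i ≤ n → Inv i m → e.Ok ω B m ∧ e.eval ω m = n ∧ rd m x 0 = i)
    (h0 : Inv 0 (wr m x 0 0))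
    (hstep : ∀ i m, i < n → Inv i m →
      Runs ω B P m s fun m' => rd m' x 0 = i ∧ Inv (i + 1) (wr m' x 0 ((i + 1 : ℕ) : ℤ)))
    (hQ : ∀ m', Inv n m' → Q m') :
    Runs ω B (forLoop x e P) m s' Q := by
  refine Runs.seq (Runs.assign (by omega) trivial (by simp [Expr.eval]) ?_)
  refine Runs.mono (s := n * s + 1) (Q := Q) ?_ hs' fun _ h => h
  have key : ∀ j i m, i + j = n → Inv i m → Runs ω B (.loop (.sub e (vr x))
      (.seq P (TwoSpin.assign x (.add (vr x) (.const 1))))) m (j * s + 1) Q := by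
    intro j
    induction j with
    | zero =>
      intro i m hi hm
      obtain ⟨h1, h2, h3⟩ := hInv i m (by omega) hm
      refine Runs.loop_nonpos ⟨h1, ok_vr _⟩ ?_ (by omega) (hQ _ ?_)
      · simp only [Expr.eval, eval_vr, h2, h3]; omega
      · obtain rfl : i = n := by omega
        exact hm
    | succ j ih =>
      intro i m hi hm
      obtain ⟨h1, h2, h3⟩ := hInv i m (by omega) hm
      refine Runs.mono (Runs.loop_pos (s := s) (s' := j * s + 1) ⟨h1, ok_vr _⟩ ?_ hs
        (Runs.seq ((hstep i m (by omega) hm).mono le_rfl ?_)))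
        (by rw [Nat.succ_mul]; omega) fun _ h => h
      · simp only [Expr.eval, eval_vr, h2, h3]; omega
      · rintro m' ⟨h4, h5⟩
        have h6 : (Expr.add (vr x) (.const 1)).eval ω m' = ((i + 1 : ℕ) : ℤ) := by
          simp [Expr.eval, eval_vr, h4]
        refine Runs.assign hs ⟨ok_vr _, trivial⟩ ?_ ?_
        · rw [h6, abs_of_nonneg (by omega)]; omega
        · rw [h6]
          exact ih (i + 1) _ (by omega) h5
  exact key n 0 _ (by omega) h0

end Logic

/-! ### Gaussian integers in memory -/

section Gaussian

/-- A pair of cells read as a Gaussian integer. -/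
def gx (m : Memory) (x i : ℤ) : GaussianInt := ⟨rd m x i, rd m (x + 1) i⟩

/-- Expressions for Gaussian integers. -/
abbrev GExpr := Expr × Expr

/-- The value of an expression for a Gaussian integer. -/
def geval (ω : ParamOracle) (m : Memory) (e : GExpr) : GaussianInt := ⟨e.1.eval ω m, e.2.eval ω m⟩

/-- A product of expressions. -/
def gmul (e f : GExpr) : GExpr :=
  (.sub (.mul e.1 f.1) (.mul e.2 f.2), .add (.mul e.1 f.2) (.mul e.2 f.1))

/-- A sum of expressions. -/
def gadd (e f : GExpr) : GExpr := (.add e.1 f.1, .add e.2 f.2)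

/-- Access to an array of Gaussian integers. -/
def garr (x : ℤ) (i : Expr) : GExpr := (arr x i, arr (x + 1) i)

/-- An integer as a Gaussian integer. -/
def gint (e : Expr) : GExpr := (e, .const 0)

/-- Assignment to an entry of an array of Gaussian integers, by way of the scalar `15`. -/
def gput (x : ℤ) (i : Expr) (e : GExpr) : Prog :=
  .seq (assign 15 e.1) (.seq (put (x + 1) i e.2) (put x i (vr 15)))

/-- The effect of `gput`. -/
def gwr (m : Memory) (x i : ℤ) (z : GaussianInt) : Memory :=
  wr (wr (wr m 15 0 z.re) (x + 1) i z.im) x i z.re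

variable {ω : ParamOracle} {B : ℕ} {m : Memory} {s : ℕ} {Q : Memory → Prop}

/-- The expressions have no queries of excessive precision. -/
def GOk (ω : ParamOracle) (B : ℕ) (m : Memory) (e : GExpr) : Prop :=
  e.1.Ok ω B m ∧ e.2.Ok ω B m

variable (ω m) in
lemma geval_gmul (e f : GExpr) : geval ω m (gmul e f) = geval ω m e * geval ω m f := by
  simp only [geval, gmul, Expr.eval]
  ext <;> simp [Zsqrtd.re_mul, Zsqrtd.im_mul] ; ring

variable (ω m) in
lemma geval_gadd (e f : GExpr) : geval ω m (gadd e f) = geval ω m e + geval ω m f := by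
  simp only [geval, gadd, Expr.eval]
  ext <;> simp

variable (ω m) in
lemma geval_garr (x : ℤ) (i : Expr) : geval ω m (garr x i) = gx m x (i.eval ω m) := rfl

variable (ω m) in
lemma geval_gint (e : Expr) : geval ω m (gint e) = (e.eval ω m : GaussianInt) := by
  ext <;> simp [geval, gint, Expr.eval]

lemma gok_gmul (e f : GExpr) : GOk ω B m (gmul e f) ↔ GOk ω B m e ∧ GOk ω B m f := by
  simp only [GOk, gmul, Expr.Ok]; tauto

lemma gok_gadd (e f : GExpr) : GOk ω B m (gadd e f) ↔ GOk ω B m e ∧ GOk ω B m f := by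
  simp only [GOk, gadd, Expr.Ok]; tauto

lemma gok_garr (x : ℤ) (i : Expr) : GOk ω B m (garr x i) ↔ i.Ok ω B m := by
  simp [GOk, garr, ok_arr]

lemma gok_gint (e : Expr) : GOk ω B m (gint e) ↔ e.Ok ω B m := by
  simp [GOk, gint, Expr.Ok]

lemma gx_gwr_self (m : Memory) (x i : ℤ) (z : GaussianInt) : gx (gwr m x i z) x i = z := by
  ext
  · simp [gx, gwr, rd_wr_self]
  · simp only [gx, gwr]
    rw [rd_wr_of_ne _ _ _ _ _ _ (by omega), rd_wr_self]

lemma rd_gwr_of_ne (m : Memory) (x y i j : ℤ) (z : GaussianInt) (h : (x - y) % 32 ≠ 0)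
    (h' : (x + 1 - y) % 32 ≠ 0) (h15 : (15 - y) % 32 ≠ 0) : rd (gwr m x i z) y j = rd m y j := by
  rw [gwr, rd_wr_of_ne _ _ _ _ _ _ h, rd_wr_of_ne _ _ _ _ _ _ h', rd_wr_of_ne _ _ _ _ _ _ h15]

lemma gx_gwr_of_ne (m : Memory) (x y i j : ℤ) (z : GaussianInt) (h : (x - y) % 32 ≠ 0)
    (h' : (x + 1 - y) % 32 ≠ 0) (h'' : (x - (y + 1)) % 32 ≠ 0) (h15 : (15 - y) % 32 ≠ 0)
    (h15' : (15 - (y + 1)) % 32 ≠ 0) : gx (gwr m x i z) y j = gx m y j := by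
  rw [gx, rd_gwr_of_ne _ _ _ _ _ _ h h' h15, rd_gwr_of_ne _ _ _ _ _ _ h'' (by omega) h15', gx]

lemma gx_wr_of_ne (m : Memory) (x y i j z : ℤ) (h : (x - y) % 32 ≠ 0)
    (h' : (x - (y + 1)) % 32 ≠ 0) : gx (wr m x i z) y j = gx m y j := by
  rw [gx, rd_wr_of_ne _ _ _ _ _ _ h, rd_wr_of_ne _ _ _ _ _ _ h', gx]

lemma gwr_apply_of_nonneg (m : Memory) (x i c : ℤ) (z : GaussianInt) (hx : 0 ≤ x) (hi : 0 ≤ i)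
    (hc : 0 ≤ c) : gwr m x i z c = m c := by
  rw [gwr, wr_apply_of_nonneg _ _ _ _ _ hx hi hc,
    wr_apply_of_nonneg _ _ _ _ _ (by omega) hi hc,
    wr_apply_of_nonneg _ _ _ _ _ (by omega) le_rfl hc]

lemma abs_re_lt {z : GaussianInt} (h : ‖(z : ℂ)‖ < 2 ^ B) : |z.re| < 2 ^ B := by
  have h1 : |(z.re : ℝ)| < 2 ^ B := by
    rw [GaussianInt.intCast_re]
    exact (Complex.abs_re_le_norm _).trans_lt h
  exact_mod_cast h1

lemma abs_im_lt {z : GaussianInt} (h : ‖(z : ℂ)‖ < 2 ^ B) : |z.im| < 2 ^ B := by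
  have h1 : |(z.im : ℝ)| < 2 ^ B := by
    rw [GaussianInt.intCast_im]
    exact (Complex.abs_im_le_norm _).trans_lt h
  exact_mod_cast h1

/-- The real part waits in the scalar 15 until the imaginary part has been stored, since the target
may occur in `e`. Hence `e` is evaluated only in memories that differ from `m` in the array 15. -/
lemma Runs.gput {x : ℤ} {i : Expr} {i₀ : ℤ} {e : GExpr} {z : GaussianInt} (hs : 1 ≤ s)
    (hi : ∀ m', (∀ y j, (15 - y) % 32 ≠ 0 → (x + 1 - y) % 32 ≠ 0 → rd m' y j = rd m y j) →
      i.Ok ω B m' ∧ i.eval ω m' = i₀)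
    (he : ∀ m', (∀ y j, (15 - y) % 32 ≠ 0 → rd m' y j = rd m y j) → (∀ c, 0 ≤ c → m' c = m c) →
      GOk ω B m' e ∧ geval ω m' e = z)
    (hx : (15 - (x + 1)) % 32 ≠ 0)
    (hz : ‖(z : ℂ)‖ < 2 ^ B) (h : Q (gwr m x i₀ z)) : Runs ω B (gput x i e) m s Q := by
  obtain ⟨h1, h2⟩ := he m (fun _ _ _ => rfl) fun _ _ => rfl
  have hre : e.1.eval ω m = z.re := congrArg Zsqrtd.re h2
  have hlt1 := abs_re_lt hz
  refine Runs.seq (Runs.assign hs h1.1 (hre ▸ hlt1) ?_)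
  rw [hre]
  obtain ⟨h3, h4⟩ := he (wr m 15 0 z.re)
    (fun y j hy => rd_wr_of_ne _ _ _ _ _ _ hy)
    fun c hc => wr_apply_of_nonneg _ _ _ _ _ (by norm_num) le_rfl hc
  obtain ⟨h5, h6⟩ := hi (wr m 15 0 z.re) fun y j hy _ => rd_wr_of_ne _ _ _ _ _ _ hy
  have him : e.2.eval ω (wr m 15 0 z.re) = z.im := congrArg Zsqrtd.im h4
  refine Runs.seq (Runs.put hs h5 h3.2 (him ▸ abs_im_lt hz) ?_)
  rw [him, h6]
  obtain ⟨h7, h8⟩ := hi (wr (wr m 15 0 z.re) (x + 1) i₀ z.im) fun y j hy hy' => by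
    rw [rd_wr_of_ne _ _ _ _ _ _ hy', rd_wr_of_ne _ _ _ _ _ _ hy]
  have h9 : (vr 15).eval ω (wr (wr m 15 0 z.re) (x + 1) i₀ z.im) = z.re := by
    rw [eval_vr, rd_wr_of_ne _ _ _ _ _ _ (by omega), rd_wr_self]
  refine Runs.put hs h7 (ok_vr _) (by rw [h9]; exact hlt1) ?_
  rw [h9, h8]
  exact h

end Gaussian

/-! ### Depth-first evaluation of the tree

Scalars and arrays: `0` common denominator, `1` depth bound, `2`, `4`, `6` parameters, `8`, `9`
outer loops, `10` depth, `11`, `13` output, `15` auxiliary, `16` vertices, `17` next neighbours,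
`18`, `20` partial products, `22` codes minus the number of vertices, `26`, `27` current vertices,
`28`, `30` finished values. -/

section Search

/-- Multiply the products at the current depth. -/
def mulBoth (X Y : GExpr) : Prog :=
  .seq (gput 18 (vr 10) (gmul (garr 18 (vr 10)) X)) (gput 20 (vr 10) (gmul (garr 20 (vr 10)) Y))

/-- A pair of scalars. -/
def gvr (x : ℤ) : GExpr := garr x (.const 0)

/-- Number of vertices. -/
def numE : Expr := .load (.const 0)

/-- Enter a child. -/
def descend : Prog :=
  .seq (put 22 (vr 26) (.sub (vr 27) numE)) <|
  .seq (assign 10 (.add (vr 10) (.const 1))) <|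
  .seq (put 16 (vr 10) (vr 27)) <|
  .seq (put 17 (vr 10) (.const 0)) <|
  .seq (gput 18 (vr 10) (gvr 6)) (gput 20 (vr 10) (gint (vr 0)))

/-- Treat the neighbour `27` of the vertex `26`. -/
def visit : Prog :=
  .branch (.load (.add (.const 2) (.add (.mul (vr 26) numE) (vr 27))))
    (.branch (.add (arr 22 (vr 27)) (.const 1))
      (.branch (.sub (vr 1) (vr 10)) descend (mulBoth (gint (vr 0)) (gvr 4)))
      (.branch (.sub (.add (arr 22 (vr 27)) numE) (vr 26)) (mulBoth (gvr 2) (gint (vr 0)))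
        (.branch (.sub (vr 26) (.add (arr 22 (vr 27)) numE)) (mulBoth (gint (vr 0)) (gvr 4)) .skip)))
    .skip

/-- Leave a child. -/
def leave : Prog :=
  .seq (gput 28 (.const 0) (gadd (gmul (gvr 2) (garr 18 (vr 10))) (gmul (gint (vr 0)) (garr 20 (vr 10))))) <|
  .seq (gput 30 (.const 0) (gadd (gmul (gint (vr 0)) (garr 18 (vr 10))) (gmul (gvr 4) (garr 20 (vr 10))))) <|
  .seq (assign 10 (.sub (vr 10) (.const 1))) <|
  .seq (mulBoth (gvr 28) (gvr 30)) (put 22 (arr 16 (vr 10)) (.const 0))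

/-- One step of the search. -/
def searchStep : Prog :=
  .seq (assign 26 (arr 16 (vr 10))) <|
  .seq (assign 27 (arr 17 (vr 10))) <|
  .branch (.sub numE (vr 27)) (.seq (put 17 (vr 10) (.add (vr 27) (.const 1))) visit) leave

/-- The search. -/
def search : Prog := .loop (.add (vr 10) (.sub numE (arr 17 (vr 10)))) searchStep

/-- The data that the search does not modify. -/
structure Consts (n : ℕ) (a : ℕ → ℕ → Bool) (b g l : GaussianInt) (D : ℤ) (L : ℕ) (m : Memory) :
    Prop where
  num : m 0 = n
  adj : ∀ v < n, ∀ u < n, m (2 + ((v : ℤ) * n + u)) = if a v u then 1 else 0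
  den : rd m 0 0 = D
  depth : rd m 1 0 = L
  b : gx m 2 0 = b
  g : gx m 4 0 = g
  l : gx m 6 0 = l

/-- Cells outside the search are equal. -/
def Keeps (m m' : Memory) : Prop :=
  (∀ c, 0 ≤ c → m' c = m c) ∧ ∀ y, 0 ≤ y → y < 15 → y ≠ 10 → rd m' y 0 = rd m y 0

/-- The entries for smaller depth are equal. -/
def Below (m m' : Memory) (d : ℤ) : Prop :=
  ∀ i, i < d → ∀ y, 16 ≤ y → y < 22 → rd m' y i = rd m y i

/-- The search is at depth `d` at the vertex `v`, with next neighbour `u`. -/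
structure AtNode (m : Memory) (d v u : ℤ) (A E : GaussianInt) : Prop where
  depth : rd m 10 0 = d
  vert : rd m 16 d = v
  next : rd m 17 d = u
  num : gx m 18 d = A
  den : gx m 20 d = E

variable {n : ℕ} {a : ℕ → ℕ → Bool} {b g l : GaussianInt} {D : ℤ} {L : ℕ}
  {ω : ParamOracle} {B : ℕ} {m m' m'' : Memory} {s : ℕ} {Q : Memory → Prop}

lemma Keeps.refl (m : Memory) : Keeps m m := ⟨fun _ _ => rfl, fun _ _ _ _ => rfl⟩

lemma Keeps.trans (h : Keeps m m') (h' : Keeps m' m'') : Keeps m m'' :=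
  ⟨fun c hc => (h'.1 c hc).trans (h.1 c hc), fun y h1 h2 h3 => (h'.2 y h1 h2 h3).trans (h.2 y h1 h2 h3)⟩

lemma Keeps.gx (h : Keeps m m') {y : ℤ} (h0 : 0 ≤ y) (h1 : y + 1 < 15) (h2 : y ≠ 10) (h3 : y ≠ 9) :
    gx m' y 0 = gx m y 0 := by
  rw [TwoSpin.gx, h.2 y h0 (by omega) h2, h.2 (y + 1) (by omega) h1 (by omega), TwoSpin.gx]

lemma Keeps.wr (h : Keeps m m') (y i z : ℤ) (hy : y = 10 ∨ 15 ≤ y) (hy' : y < 32) (hi : 0 ≤ i) :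
    Keeps m (wr m' y i z) := by
  refine ⟨fun c hc => ?_, fun x h1 h2 h3 => ?_⟩
  · rw [wr_apply_of_nonneg _ _ _ _ _ (by omega) hi hc, h.1 c hc]
  · rw [rd_wr_of_ne _ _ _ _ _ _ (by omega), h.2 x h1 h2 h3]

lemma Keeps.gwr (h : Keeps m m') (y i : ℤ) (z : GaussianInt) (hy : 15 ≤ y) (hy' : y < 31)
    (hi : 0 ≤ i) : Keeps m (gwr m' y i z) :=
  ((h.wr _ _ _ (by omega) (by omega) le_rfl).wr _ _ _ (by omega) (by omega) hi).wr _ _ _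
    (by omega) (by omega) hi

lemma Below.refl (m : Memory) (d : ℤ) : Below m m d := fun _ _ _ _ _ => rfl

lemma Below.trans {d d' : ℤ} (h : Below m m' d) (h' : Below m' m'' d') (hd : d ≤ d') :
    Below m m'' d :=
  fun i hi y h1 h2 => (h' i (by omega) y h1 h2).trans (h i hi y h1 h2)

lemma Below.wr {d : ℤ} (h : Below m m' d) (y i z : ℤ) (hy : 0 ≤ y) (hy' : y < 32)
    (hi : y < 16 ∨ 22 ≤ y ∨ d ≤ i) : Below m (wr m' y i z) d := by
  intro j hj x h1 h2
  by_cases hxy : x = y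
  · subst hxy
    rw [rd_wr_of_index_ne _ _ _ _ _ (by omega), h j hj x h1 h2]
  · rw [rd_wr_of_ne _ _ _ _ _ _ (by omega), h j hj x h1 h2]

lemma Below.gwr {d : ℤ} (h : Below m m' d) (y i : ℤ) (z : GaussianInt) (hy : 0 ≤ y) (hy' : y < 31)
    (hi : y < 15 ∨ 22 ≤ y ∨ d ≤ i) : Below m (gwr m' y i z) d :=
  ((h.wr _ _ _ (by omega) (by omega) (by omega)).wr _ _ _ (by omega) (by omega) (by omega)).wr
    _ _ _ (by omega) (by omega) (by omega)

lemma Below.gx {d i : ℤ} (h : Below m m' d) (hi : i < d) {y : ℤ} (h1 : 16 ≤ y) (h2 : y + 1 < 22) :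
    gx m' y i = gx m y i := by
  rw [TwoSpin.gx, h i hi y h1 (by omega), h i hi (y + 1) (by omega) h2, TwoSpin.gx]

lemma Consts.keeps (h : Consts n a b g l D L m) (hk : Keeps m m') : Consts n a b g l D L m' where
  num := by rw [hk.1 0 le_rfl, h.num]
  adj v hv u hu := by rw [hk.1 _ (by positivity), h.adj v hv u hu]
  den := by rw [hk.2 0 (by norm_num) (by norm_num) (by norm_num), h.den]
  depth := by rw [hk.2 1 (by norm_num) (by norm_num) (by norm_num), h.depth]
  b := by rw [hk.gx (by norm_num) (by norm_num) (by norm_num) (by norm_num), h.b]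
  g := by rw [hk.gx (by norm_num) (by norm_num) (by norm_num) (by norm_num), h.g]
  l := by rw [hk.gx (by norm_num) (by norm_num) (by norm_num) (by norm_num), h.l]

lemma AtNode.below {d d' v u : ℤ} {A E : GaussianInt} (h : AtNode m d v u A E)
    (hb : Below m m' d') (hd : d < d') (h' : rd m' 10 0 = d) : AtNode m' d v u A E where
  depth := h'
  vert := by rw [hb d hd 16 (by norm_num) (by norm_num), h.vert]
  next := by rw [hb d hd 17 (by norm_num) (by norm_num), h.next]
  num := by rw [hb.gx hd (by norm_num) (by norm_num), h.num]
  den := by rw [hb.gx hd (by norm_num) (by norm_num), h.den]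

lemma eval_numE : numE.eval ω m = m 0 := rfl

lemma runs_mulBoth {X Y : GExpr} {d v u : ℤ} {A E x y : GaussianInt} (hs : 1 ≤ s)
    (hm : AtNode m d v u A E) (hd : 0 ≤ d)
    (hX : ∀ m', Keeps m m' → (∀ x, 22 ≤ x → x < 32 → rd m' x 0 = rd m x 0) →
      GOk ω B m' X ∧ geval ω m' X = x)
    (hY : ∀ m', Keeps m m' → (∀ x, 22 ≤ x → x < 32 → rd m' x 0 = rd m x 0) →
      GOk ω B m' Y ∧ geval ω m' Y = y)
    (hA : ‖((A * x : GaussianInt) : ℂ)‖ < 2 ^ B) (hE : ‖((E * y : GaussianInt) : ℂ)‖ < 2 ^ B)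
    (h : ∀ m', Keeps m m' → Below m m' d → AtNode m' d v u (A * x) (E * y) →
      (∀ x j, 22 ≤ x → x < 32 → rd m' x j = rd m x j) → Q m') :
    Runs ω B (mulBoth X Y) m s Q := by
  refine Runs.seq (Runs.gput (i₀ := d) (z := A * x) hs ?_ ?_ (by norm_num) hA ?_)
  · intro m' h'
    exact ⟨ok_vr _, by rw [eval_vr, h' _ _ (by norm_num) (by norm_num), hm.depth]⟩
  · intro m' h' h''
    obtain ⟨h1, h2⟩ := hX m' ⟨h'', fun z h1 h2 _ => h' z 0 (by omega)⟩
      fun z h1 h2 => h' z 0 (by omega)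
    refine ⟨(gok_gmul _ _).2 ⟨(gok_garr _ _).2 (ok_vr _), h1⟩, ?_⟩
    rw [geval_gmul, h2, geval_garr, eval_vr, h' _ _ (by norm_num), hm.depth, gx,
      h' _ _ (by norm_num), h' _ _ (by norm_num), ← hm.num, gx]
  refine Runs.gput (i₀ := d) (z := E * y) hs ?_ ?_ (by norm_num) hE ?_
  · intro m' h'
    refine ⟨ok_vr _, ?_⟩
    rw [eval_vr, h' _ _ (by norm_num) (by norm_num),
      rd_gwr_of_ne _ _ _ _ _ _ (by norm_num) (by norm_num) (by norm_num), hm.depth]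
  · intro m' h' h''
    obtain ⟨h1, h2⟩ := hY m' ⟨fun c hc => by
        rw [h'' c hc, gwr_apply_of_nonneg _ _ _ _ _ (by norm_num) hd hc], fun z h1 h2 _ => by
        rw [h' z 0 (by omega), rd_gwr_of_ne _ _ _ _ _ _ (by omega) (by omega) (by omega)]⟩
      fun z h1 h2 => by
        rw [h' z 0 (by omega), rd_gwr_of_ne _ _ _ _ _ _ (by omega) (by omega) (by omega)]
    refine ⟨(gok_gmul _ _).2 ⟨(gok_garr _ _).2 (ok_vr _), h1⟩, ?_⟩
    rw [geval_gmul, h2, geval_garr, eval_vr, h' _ _ (by norm_num),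
      rd_gwr_of_ne _ _ _ _ _ _ (by norm_num) (by norm_num) (by norm_num), hm.depth, gx,
      h' _ _ (by norm_num), h' _ _ (by norm_num),
      rd_gwr_of_ne _ _ _ _ _ _ (by norm_num) (by norm_num) (by norm_num),
      rd_gwr_of_ne _ _ _ _ _ _ (by norm_num) (by norm_num) (by norm_num), ← hm.den, gx]
  refine h _ (((Keeps.refl m).gwr _ _ _ (by norm_num) (by norm_num) hd).gwr _ _ _ (by norm_num)
    (by norm_num) hd) (((Below.refl m d).gwr _ _ _ (by norm_num) (by norm_num) (by simp)).gwr
    _ _ _ (by norm_num) (by norm_num) (by simp)) ⟨?_, ?_, ?_, ?_, ?_⟩ ?_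
  · rw [rd_gwr_of_ne _ _ _ _ _ _ (by norm_num) (by norm_num) (by norm_num),
      rd_gwr_of_ne _ _ _ _ _ _ (by norm_num) (by norm_num) (by norm_num), hm.depth]
  · rw [rd_gwr_of_ne _ _ _ _ _ _ (by norm_num) (by norm_num) (by norm_num),
      rd_gwr_of_ne _ _ _ _ _ _ (by norm_num) (by norm_num) (by norm_num), hm.vert]
  · rw [rd_gwr_of_ne _ _ _ _ _ _ (by norm_num) (by norm_num) (by norm_num),
      rd_gwr_of_ne _ _ _ _ _ _ (by norm_num) (by norm_num) (by norm_num), hm.next]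
  · rw [gx_gwr_of_ne _ _ _ _ _ _ (by norm_num) (by norm_num) (by norm_num) (by norm_num)
      (by norm_num), gx_gwr_self]
  · rw [gx_gwr_self]
  · intro z j h1 h2
    rw [rd_gwr_of_ne _ _ _ _ _ _ (by omega) (by omega) (by omega),
      rd_gwr_of_ne _ _ _ _ _ _ (by omega) (by omega) (by omega)]

lemma runs_searchStep {d v u : ℤ} {A E : GaussianInt} (hs : 1 ≤ s) (hnum : m 0 = n)
    (hm : AtNode m d v u A E) (hd : 0 ≤ d) (hv : |v| < 2 ^ B) (hu : |u| < 2 ^ B)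
    (hu' : u < n → |u + 1| < 2 ^ B)
    (h1 : u < n → ∀ m', Keeps m m' → Below m m' d → AtNode m' d v (u + 1) A E →
      rd m' 26 0 = v → rd m' 27 0 = u → (∀ j, rd m' 22 j = rd m 22 j) → Runs ω B visit m' s Q)
    (h2 : (n : ℤ) ≤ u → ∀ m', Keeps m m' → Below m m' (d + 1) → AtNode m' d v u A E →
      (∀ j, rd m' 22 j = rd m 22 j) → Runs ω B leave m' s Q) :
    Runs ω B searchStep m s Q := by
  have e1 : (arr 16 (vr 10)).eval ω m = v := by rw [eval_arr, eval_vr, hm.depth, hm.vert]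
  refine Runs.seq (Runs.assign hs ((ok_arr _ _).2 (ok_vr _)) (e1 ▸ hv) ?_)
  rw [e1]
  have e2 : (arr 17 (vr 10)).eval ω (wr m 26 0 v) = u := by
    rw [eval_arr, eval_vr, rd_wr_of_ne _ _ _ _ _ _ (by norm_num),
      rd_wr_of_ne _ _ _ _ _ _ (by norm_num), hm.depth, hm.next]
  refine Runs.seq (Runs.assign hs ((ok_arr _ _).2 (ok_vr _)) (by rwa [e2]) ?_)
  rw [e2]
  set m₁ := wr (wr m 26 0 v) 27 0 u with hm₁
  have hk : Keeps m m₁ := ((Keeps.refl m).wr _ _ _ (by norm_num) (by norm_num) le_rfl).wr _ _ _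
    (by norm_num) (by norm_num) le_rfl
  have hrd : ∀ y j, (26 - y) % 32 ≠ 0 → (27 - y) % 32 ≠ 0 → rd m₁ y j = rd m y j := by
    intro y j h h'
    rw [hm₁, rd_wr_of_ne _ _ _ _ _ _ h', rd_wr_of_ne _ _ _ _ _ _ h]
  have h27 : rd m₁ 27 0 = u := rd_wr_self _ _ _ _
  have h26 : rd m₁ 26 0 = v := by
    rw [hm₁, rd_wr_of_ne _ _ _ _ _ _ (by norm_num), rd_wr_self]
  have hnode : AtNode m₁ d v u A E :=
    ⟨by rw [hrd _ _ (by norm_num) (by norm_num), hm.depth],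
      by rw [hrd _ _ (by norm_num) (by norm_num), hm.vert],
      by rw [hrd _ _ (by norm_num) (by norm_num), hm.next],
      by rw [gx, hrd _ _ (by norm_num) (by norm_num), hrd _ _ (by norm_num) (by norm_num),
        ← hm.num, gx],
      by rw [gx, hrd _ _ (by norm_num) (by norm_num), hrd _ _ (by norm_num) (by norm_num),
        ← hm.den, gx]⟩
  have e3 : (Expr.sub numE (vr 27)).eval ω m₁ = n - u := by
    rw [Expr.eval, eval_numE, eval_vr, h27, hk.1 0 le_rfl, hnum]
  refine Runs.branch hs ⟨trivial, ok_vr _⟩ (fun h => ?_) fun h => ?_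
  · rw [e3] at h
    have e4 : (Expr.add (vr 27) (.const 1)).eval ω m₁ = u + 1 := by
      rw [Expr.eval, eval_vr, h27, Expr.eval]
    refine Runs.seq (Runs.put hs (ok_vr _) ⟨ok_vr _, trivial⟩ (by rw [e4]; exact hu' (by omega)) ?_)
    rw [e4, eval_vr, hnode.depth]
    refine h1 (by omega) _ (hk.wr _ _ _ (by norm_num) (by norm_num) hd)
      ((((Below.refl m d).wr _ _ _ (by norm_num) (by norm_num) (by norm_num)).wr _ _ _ (by norm_num)
        (by norm_num) (by norm_num)).wr _ _ _ (by norm_num) (by norm_num) (by simp))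
      ⟨?_, ?_, ?_, ?_, ?_⟩ ?_ ?_ ?_
    · rw [rd_wr_of_ne _ _ _ _ _ _ (by norm_num), hnode.depth]
    · rw [rd_wr_of_ne _ _ _ _ _ _ (by norm_num), hnode.vert]
    · rw [rd_wr_self]
    · rw [gx_wr_of_ne _ _ _ _ _ _ (by norm_num) (by norm_num), hnode.num]
    · rw [gx_wr_of_ne _ _ _ _ _ _ (by norm_num) (by norm_num), hnode.den]
    · rw [rd_wr_of_ne _ _ _ _ _ _ (by norm_num), h26]
    · rw [rd_wr_of_ne _ _ _ _ _ _ (by norm_num), h27]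
    · intro j
      rw [rd_wr_of_ne _ _ _ _ _ _ (by norm_num), hrd _ _ (by norm_num) (by norm_num)]
  · rw [e3] at h
    exact h2 (by omega) _ hk
      (((Below.refl m _).wr _ _ _ (by norm_num) (by norm_num) (by norm_num)).wr _ _ _ (by norm_num)
        (by norm_num) (by norm_num)) hnode fun j => hrd _ _ (by norm_num) (by norm_num)

/-- While the child `w` is searched, the parent `v` counts as removed with code `w`. Codes are
stored minus `n`, so that untouched memory means that all vertices are alive. -/
lemma runs_descend {d v u : ℤ} {A E : GaussianInt} (hs : 1 ≤ s) (hc : Consts n a b g l D L m)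
    (hm : AtNode m d v u A E) (hd : 0 ≤ d) (hv : 0 ≤ v) {w : ℤ} (h26 : rd m 26 0 = v)
    (h27 : rd m 27 0 = w) (hw : |w| < 2 ^ B) (hw' : |w - n| < 2 ^ B) (hd' : |d + 1| < 2 ^ B)
    (hl : ‖(l : ℂ)‖ < 2 ^ B) (hD : ‖(D : ℂ)‖ < 2 ^ B)
    (h : ∀ m', Keeps m m' → Below m m' (d + 1) → AtNode m' (d + 1) w 0 l D →
      rd m' 22 v = w - n → (∀ j, j ≠ v → rd m' 22 j = rd m 22 j) → Q m') :
    Runs ω B descend m s Q := by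
  have e1 : (Expr.sub (vr 27) numE).eval ω m = w - n := by
    rw [Expr.eval, eval_vr, h27, eval_numE, hc.num]
  refine Runs.seq (Runs.put hs (ok_vr _) ⟨ok_vr _, trivial⟩ (by rwa [e1]) ?_)
  rw [e1, eval_vr, h26]
  have e2 : (Expr.add (vr 10) (.const 1)).eval ω (wr m 22 v (w - n)) = d + 1 := by
    rw [Expr.eval, eval_vr, rd_wr_of_ne _ _ _ _ _ _ (by norm_num), hm.depth, Expr.eval]
  refine Runs.seq (Runs.assign hs ⟨ok_vr _, trivial⟩ (by rwa [e2]) ?_)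
  rw [e2]
  set m₁ := wr (wr m 22 v (w - n)) 10 0 (d + 1) with hm₁
  have h1 : rd m₁ 10 0 = d + 1 := rd_wr_self _ _ _ _
  have h2 : rd m₁ 27 0 = w := by
    rw [hm₁, rd_wr_of_ne _ _ _ _ _ _ (by norm_num), rd_wr_of_ne _ _ _ _ _ _ (by norm_num), h27]
  have hk : Keeps m m₁ := ((Keeps.refl m).wr _ _ _ (by norm_num) (by norm_num) hv).wr _ _ _
    (by norm_num) (by norm_num) le_rfl
  have hb : Below m m₁ (d + 1) := ((Below.refl m _).wr _ _ _ (by norm_num) (by norm_num)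
    (by norm_num)).wr _ _ _ (by norm_num) (by norm_num) (by norm_num)
  refine Runs.seq (Runs.put hs (ok_vr _) (ok_vr _) (by rwa [eval_vr, h2]) ?_)
  rw [eval_vr, eval_vr, h1, h2]
  refine Runs.seq (Runs.put hs (ok_vr _) trivial (by simp [Expr.eval]) ?_)
  have e3 : (vr 10).eval ω (wr m₁ 16 (d + 1) w) = d + 1 := by
    rw [eval_vr, rd_wr_of_ne _ _ _ _ _ _ (by norm_num), h1]
  rw [e3, show (Expr.const 0).eval ω (wr m₁ 16 (d + 1) w) = 0 from rfl]
  set m₂ := wr (wr m₁ 16 (d + 1) w) 17 (d + 1) 0 with hm₂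
  have hk₂ : Keeps m m₂ := (hk.wr _ _ _ (by norm_num) (by norm_num) (by omega)).wr _ _ _
    (by norm_num) (by norm_num) (by omega)
  have hb₂ : Below m m₂ (d + 1) := (hb.wr _ _ _ (by norm_num) (by norm_num)
    (by norm_num)).wr _ _ _ (by norm_num) (by norm_num) (by norm_num)
  have h3 : rd m₂ 10 0 = d + 1 := by
    rw [hm₂, rd_wr_of_ne _ _ _ _ _ _ (by norm_num), rd_wr_of_ne _ _ _ _ _ _ (by norm_num), h1]
  refine Runs.seq (Runs.gput (i₀ := d + 1) (z := l) hs ?_ ?_ (by norm_num) hl ?_)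
  · intro m' h'
    exact ⟨ok_vr _, by rw [eval_vr, h' _ _ (by norm_num) (by norm_num), h3]⟩
  · intro m' h' h''
    refine ⟨(gok_garr _ _).2 trivial, ?_⟩
    rw [gvr, geval_garr, ← hc.l, ← hk₂.gx (y := 6) (by norm_num) (by norm_num) (by norm_num)
      (by norm_num), gx, gx, Expr.eval, h' _ _ (by norm_num), h' _ _ (by norm_num)]
  refine Runs.gput (i₀ := d + 1) (z := D) hs ?_ ?_ (by norm_num) (by simpa using hD) ?_
  · intro m' h'
    refine ⟨ok_vr _, ?_⟩
    rw [eval_vr, h' _ _ (by norm_num) (by norm_num),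
      rd_gwr_of_ne _ _ _ _ _ _ (by norm_num) (by norm_num) (by norm_num), h3]
  · intro m' h' h''
    refine ⟨(gok_gint _).2 (ok_vr _), ?_⟩
    rw [geval_gint, eval_vr, ← hc.den, h' _ _ (by norm_num),
      rd_gwr_of_ne _ _ _ _ _ _ (by norm_num) (by norm_num) (by norm_num),
      hk₂.2 0 (by norm_num) (by norm_num) (by norm_num)]
  have hrd : ∀ y j, (18 - y) % 32 ≠ 0 → (19 - y) % 32 ≠ 0 → (20 - y) % 32 ≠ 0 →
      (21 - y) % 32 ≠ 0 → (15 - y) % 32 ≠ 0 →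
      rd (gwr (gwr m₂ 18 (d + 1) l) 20 (d + 1) D) y j = rd m₂ y j := by
    intro y j h1 h2 h3 h4 h5
    rw [rd_gwr_of_ne _ _ _ _ _ _ h3 (by omega) h5, rd_gwr_of_ne _ _ _ _ _ _ h1 (by omega) h5]
  refine h _ ((hk₂.gwr _ _ _ (by norm_num) (by norm_num) (by omega)).gwr _ _ _ (by norm_num)
    (by norm_num) (by omega)) ((hb₂.gwr _ _ _ (by norm_num) (by norm_num) (by norm_num)).gwr _ _ _
    (by norm_num) (by norm_num) (by norm_num)) ⟨?_, ?_, ?_, ?_, ?_⟩ ?_ ?_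
  · rw [hrd _ _ (by norm_num) (by norm_num) (by norm_num) (by norm_num) (by norm_num), h3]
  · rw [hrd _ _ (by norm_num) (by norm_num) (by norm_num) (by norm_num) (by norm_num), hm₂,
      rd_wr_of_ne _ _ _ _ _ _ (by norm_num), rd_wr_self]
  · rw [hrd _ _ (by norm_num) (by norm_num) (by norm_num) (by norm_num) (by norm_num), hm₂,
      rd_wr_self]
  · rw [gx_gwr_of_ne _ _ _ _ _ _ (by norm_num) (by norm_num) (by norm_num) (by norm_num)
      (by norm_num), gx_gwr_self]
  · rw [gx_gwr_self]
  · rw [hrd _ _ (by norm_num) (by norm_num) (by norm_num) (by norm_num) (by norm_num), hm₂,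
      rd_wr_of_ne _ _ _ _ _ _ (by norm_num), rd_wr_of_ne _ _ _ _ _ _ (by norm_num), hm₁,
      rd_wr_of_ne _ _ _ _ _ _ (by norm_num), rd_wr_self]
  · intro j hj
    rw [hrd _ _ (by norm_num) (by norm_num) (by norm_num) (by norm_num) (by norm_num), hm₂,
      rd_wr_of_ne _ _ _ _ _ _ (by norm_num), rd_wr_of_ne _ _ _ _ _ _ (by norm_num), hm₁,
      rd_wr_of_ne _ _ _ _ _ _ (by norm_num), rd_wr_of_index_ne _ _ _ _ _ hj]

/-- The Möbius map is applied to the finished fraction, the result is multiplied into the partial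
products of the parent, and the parent becomes alive again. -/
lemma runs_leave {d v u w z : ℤ} {A E A' E' : GaussianInt} (hs : 1 ≤ s)
    (hc : Consts n a b g l D L m) (hd : 0 ≤ d) (hv : 0 ≤ v) (hd' : |d| < 2 ^ B)
    (hm : AtNode m (d + 1) w z A' E')
    (hp : rd m 16 d = v ∧ rd m 17 d = u ∧ gx m 18 d = A ∧ gx m 20 d = E)
    (h1 : ‖((b * A' + D * E' : GaussianInt) : ℂ)‖ < 2 ^ B)
    (h2 : ‖((D * A' + g * E' : GaussianInt) : ℂ)‖ < 2 ^ B)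
    (h3 : ‖((A * (b * A' + D * E') : GaussianInt) : ℂ)‖ < 2 ^ B)
    (h4 : ‖((E * (D * A' + g * E') : GaussianInt) : ℂ)‖ < 2 ^ B)
    (h : ∀ m', Keeps m m' → Below m m' d →
      AtNode m' d v u (A * (b * A' + D * E')) (E * (D * A' + g * E')) →
      rd m' 22 v = 0 → (∀ j, j ≠ v → rd m' 22 j = rd m 22 j) → Q m') :
    Runs ω B leave m s Q := by
  refine Runs.seq (Runs.gput (i₀ := 0) (z := b * A' + D * E') hs ?_ ?_ (by norm_num) h1 ?_)
  · intro m' _; exact ⟨trivial, rfl⟩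
  · intro m' h' h''
    refine ⟨(gok_gadd _ _).2 ⟨(gok_gmul _ _).2 ⟨(gok_garr _ _).2 trivial, (gok_garr _ _).2 (ok_vr _)⟩,
      (gok_gmul _ _).2 ⟨(gok_gint _).2 (ok_vr _), (gok_garr _ _).2 (ok_vr _)⟩⟩, ?_⟩
    have hg : ∀ y j, (15 - y) % 32 ≠ 0 → (15 - (y + 1)) % 32 ≠ 0 → gx m' y j = gx m y j := by
      intro y j h1 h2
      rw [gx, gx, h' _ _ h1, h' _ _ h2]
    rw [geval_gadd, geval_gmul, geval_gmul, gvr, geval_garr, geval_garr, geval_garr, geval_gint,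
      eval_vr, eval_vr, Expr.eval, hg _ _ (by norm_num) (by norm_num), h' 10 _ (by norm_num),
      h' 0 _ (by norm_num), hg _ _ (by norm_num) (by norm_num), hg _ _ (by norm_num) (by norm_num),
      hc.b, hc.den, hm.depth, hm.num, hm.den]
  set P := b * A' + D * E' with hP
  set m₁ := gwr m 28 0 P with hm₁
  have hrd₁ : ∀ y j, (28 - y) % 32 ≠ 0 → (29 - y) % 32 ≠ 0 → (15 - y) % 32 ≠ 0 →
      rd m₁ y j = rd m y j := fun y j h1 h2 h3 =>
    rd_gwr_of_ne _ _ _ _ _ _ h1 (by omega) h3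
  have hk₁ : Keeps m m₁ := (Keeps.refl m).gwr _ _ _ (by norm_num) (by norm_num) le_rfl
  refine Runs.seq (Runs.gput (i₀ := 0) (z := D * A' + g * E') hs ?_ ?_ (by norm_num) h2 ?_)
  · intro m' _; exact ⟨trivial, rfl⟩
  · intro m' h' h''
    refine ⟨(gok_gadd _ _).2 ⟨(gok_gmul _ _).2 ⟨(gok_gint _).2 (ok_vr _), (gok_garr _ _).2 (ok_vr _)⟩,
      (gok_gmul _ _).2 ⟨(gok_garr _ _).2 trivial, (gok_garr _ _).2 (ok_vr _)⟩⟩, ?_⟩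
    have hr : ∀ y j, (15 - y) % 32 ≠ 0 → (28 - y) % 32 ≠ 0 → (29 - y) % 32 ≠ 0 →
        rd m' y j = rd m y j := by
      intro y j h1 h2 h3
      rw [h' _ _ h1, hrd₁ _ _ h2 h3 h1]
    have hg : ∀ y j, (15 - y) % 32 ≠ 0 → (15 - (y + 1)) % 32 ≠ 0 → (28 - y) % 32 ≠ 0 →
        (29 - y) % 32 ≠ 0 → (28 - (y + 1)) % 32 ≠ 0 → gx m' y j = gx m y j := by
      intro y j h1 h2 h3 h4 h5
      rw [gx, gx, hr _ _ h1 h3 h4, hr _ _ h2 h5 (by omega)]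
    rw [geval_gadd, geval_gmul, geval_gmul, gvr, geval_garr, geval_garr, geval_garr, geval_gint,
      eval_vr, eval_vr, Expr.eval, hr 10 _ (by norm_num) (by norm_num) (by norm_num),
      hr 0 _ (by norm_num) (by norm_num) (by norm_num),
      hg 4 _ (by norm_num) (by norm_num) (by norm_num) (by norm_num) (by norm_num),
      hg 18 _ (by norm_num) (by norm_num) (by norm_num) (by norm_num) (by norm_num),
      hg 20 _ (by norm_num) (by norm_num) (by norm_num) (by norm_num) (by norm_num),
      hc.g, hc.den, hm.depth, hm.num, hm.den]
  set P' := D * A' + g * E' with hP'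
  set m₂ := gwr m₁ 30 0 P' with hm₂
  have hrd₂ : ∀ y j, (28 - y) % 32 ≠ 0 → (29 - y) % 32 ≠ 0 → (30 - y) % 32 ≠ 0 →
      (31 - y) % 32 ≠ 0 → (15 - y) % 32 ≠ 0 → rd m₂ y j = rd m y j := fun y j h1 h2 h3 h4 h5 =>
    (rd_gwr_of_ne _ _ _ _ _ _ h3 (by omega) h5).trans (hrd₁ y j h1 h2 h5)
  have hk₂ : Keeps m m₂ := hk₁.gwr _ _ _ (by norm_num) (by norm_num) le_rfl
  have e1 : (Expr.sub (vr 10) (.const 1)).eval ω m₂ = d := by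
    rw [Expr.eval, eval_vr, hrd₂ _ _ (by norm_num) (by norm_num) (by norm_num) (by norm_num)
      (by norm_num), hm.depth, Expr.eval]
    ring
  refine Runs.seq (Runs.assign hs ⟨ok_vr _, trivial⟩ (by rwa [e1]) ?_)
  rw [e1]
  set m₃ := wr m₂ 10 0 d with hm₃
  have hrd₃ : ∀ y j, (28 - y) % 32 ≠ 0 → (29 - y) % 32 ≠ 0 → (30 - y) % 32 ≠ 0 →
      (31 - y) % 32 ≠ 0 → (15 - y) % 32 ≠ 0 → (10 - y) % 32 ≠ 0 → rd m₃ y j = rd m y j :=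
    fun y j h1 h2 h3 h4 h5 h6 =>
    (rd_wr_of_ne _ _ _ _ _ _ h6).trans (hrd₂ y j h1 h2 h3 h4 h5)
  have hk₃ : Keeps m m₃ := hk₂.wr _ _ _ (by norm_num) (by norm_num) le_rfl
  have hb₃ : Below m m₃ (d + 1) := fun i hi y h1 h2 =>
    hrd₃ y i (by omega) (by omega) (by omega) (by omega) (by omega) (by omega)
  have hn₃ : AtNode m₃ d v u A E :=
    ⟨rd_wr_self _ _ _ _, by rw [hb₃ d (by omega) _ (by norm_num) (by norm_num), hp.1],
      by rw [hb₃ d (by omega) _ (by norm_num) (by norm_num), hp.2.1],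
      by rw [hb₃.gx (by omega) (by norm_num) (by norm_num), hp.2.2.1],
      by rw [hb₃.gx (by omega) (by norm_num) (by norm_num), hp.2.2.2]⟩
  have g1 : gx m₃ 28 0 = P := by
    rw [hm₃, gx_wr_of_ne _ _ _ _ _ _ (by norm_num) (by norm_num), hm₂,
      gx_gwr_of_ne _ _ _ _ _ _ (by norm_num) (by norm_num) (by norm_num) (by norm_num)
        (by norm_num), hm₁, gx_gwr_self]
  have g2 : gx m₃ 30 0 = P' := by
    rw [hm₃, gx_wr_of_ne _ _ _ _ _ _ (by norm_num) (by norm_num), hm₂, gx_gwr_self]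
  refine Runs.seq (runs_mulBoth (x := P) (y := P') hs hn₃ hd ?_ ?_ h3 h4 ?_)
  · intro m' _ h'
    refine ⟨(gok_garr _ _).2 trivial, ?_⟩
    rw [gvr, geval_garr, Expr.eval, ← g1, gx, gx, h' _ (by norm_num) (by norm_num),
      h' _ (by norm_num) (by norm_num)]
  · intro m' _ h'
    refine ⟨(gok_garr _ _).2 trivial, ?_⟩
    rw [gvr, geval_garr, Expr.eval, ← g2, gx, gx, h' _ (by norm_num) (by norm_num),
      h' _ (by norm_num) (by norm_num)]
  · intro m₄ hk₄ hb₄ hn₄ h22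
    have e2 : (arr 16 (vr 10)).eval ω m₄ = v := by
      rw [eval_arr, eval_vr, hn₄.depth, hn₄.vert]
    refine Runs.put hs ((ok_arr _ _).2 (ok_vr _)) trivial (by simp [Expr.eval]) ?_
    rw [e2, show (Expr.const 0).eval ω m₄ = 0 from rfl]
    refine h _ ((hk₃.trans hk₄).wr _ _ _ (by norm_num) (by norm_num) hv)
      ((Below.trans (fun i hi => hb₃ i (by omega)) hb₄ le_rfl).wr _ _ _ (by norm_num) (by norm_num)
        (by norm_num)) ⟨?_, ?_, ?_, ?_, ?_⟩ (rd_wr_self _ _ _ _) ?_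
    · rw [rd_wr_of_ne _ _ _ _ _ _ (by norm_num), hn₄.depth]
    · rw [rd_wr_of_ne _ _ _ _ _ _ (by norm_num), hn₄.vert]
    · rw [rd_wr_of_ne _ _ _ _ _ _ (by norm_num), hn₄.next]
    · rw [gx_wr_of_ne _ _ _ _ _ _ (by norm_num) (by norm_num), hn₄.num]
    · rw [gx_wr_of_ne _ _ _ _ _ _ (by norm_num) (by norm_num), hn₄.den]
    · intro j hj
      rw [rd_wr_of_index_ne _ _ _ _ _ hj, h22 _ _ (by norm_num) (by norm_num),
        hrd₃ _ _ (by norm_num) (by norm_num) (by norm_num) (by norm_num) (by norm_num)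
          (by norm_num)]

end Search

/-! ### Correctness and number of steps of the search. -/

section Search

variable {n : ℕ} {a : ℕ → ℕ → Bool} {b g l : GaussianInt} {D : ℤ} {L : ℕ}
  {ω : ParamOracle} {B : ℕ}

/-- A partial product at a node. -/
noncomputable def partialPair (n : ℕ) (a : ℕ → ℕ → Bool) (b g l D : ℂ) (f : ℕ) (c : ℕ → ℤ)
    (v i : ℕ) : ℂ × ℂ :=
  (l * ∏ u ∈ Finset.range i, (kid n a b g D (pairVal n a b g l D f) c v u).1,
    D * ∏ u ∈ Finset.range i, (kid n a b g D (pairVal n a b g l D f) c v u).2)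

/-- All numbers in the evaluation of the tree are small. -/
structure Small (n : ℕ) (a : ℕ → ℕ → Bool) (b g l D : ℂ) (L B : ℕ) : Prop where
  fst : ∀ f ≤ L, ∀ c, ∀ v < n, ∀ i ≤ n, ‖(partialPair n a b g l D f c v i).1‖ < 2 ^ B
  snd : ∀ f ≤ L, ∀ c, ∀ v < n, ∀ i ≤ n, ‖(partialPair n a b g l D f c v i).2‖ < 2 ^ B
  val_fst : ∀ f ≤ L, ∀ c, ∀ v < n, ‖(pairVal n a b g l D f c v).1‖ < 2 ^ B
  val_snd : ∀ f ≤ L, ∀ c, ∀ v < n, ‖(pairVal n a b g l D f c v).2‖ < 2 ^ B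
  num : (n : ℤ) < 2 ^ B
  depth : (L : ℤ) < 2 ^ B

/-- The search evaluates a node with remaining depth `f` in at most `I` steps. -/
def NodeSpec (n : ℕ) (a : ℕ → ℕ → Bool) (b g l : GaussianInt) (D : ℤ) (L : ℕ) (ω : ParamOracle)
    (B f I : ℕ) : Prop :=
  ∀ (d v : ℕ) (m : Memory) (c : ℕ → ℤ) (s : ℕ) (Q : Memory → Prop), d + f = L →
    Consts n a b g l D L m → AtNode m d v 0 l D → (∀ x < n, rd m 22 x + n = c x) → v < n →
    c v = n → (∀ x < n, c x ≤ n) →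
    (∀ m' A E, Keeps m m' → Below m m' d → AtNode m' d v n A E →
      (A : ℂ) = (nodePair n a b g l D (pairVal n a b g l D f) c v).1 →
      (E : ℂ) = (nodePair n a b g l D (pairVal n a b g l D f) c v).2 →
      (∀ j, rd m' 22 j = rd m 22 j) → Runs ω B search m' s Q) →
    Runs ω B search m (s + I) Q

lemma ok_guard (m : Memory) : (Expr.add (vr 10) (.sub numE (arr 17 (vr 10)))).Ok ω B m :=
  ⟨ok_vr _, trivial, (ok_arr _ _).2 (ok_vr _)⟩

/-- With d ≥ 0 and u ≤ n the guard is positive except at depth 0 with no neighbour left, so the loop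
stops exactly when the root is finished. -/
lemma eval_guard {m : Memory} {d v u : ℤ} {A E : GaussianInt} (h0 : m 0 = n)
    (hm : AtNode m d v u A E) :
    (Expr.add (vr 10) (.sub numE (arr 17 (vr 10)))).eval ω m = d + (n - u) := by
  rw [Expr.eval, Expr.eval, eval_arr, eval_vr, eval_numE, hm.depth, hm.next, h0]

lemma partialPair_succ_fst (b g l D : ℂ) (f : ℕ) (c : ℕ → ℤ) (v i : ℕ) :
    (partialPair n a b g l D f c v (i + 1)).1 = (partialPair n a b g l D f c v i).1 *
      (kid n a b g D (pairVal n a b g l D f) c v i).1 := by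
  simp only [partialPair, Finset.prod_range_succ, mul_assoc]

lemma partialPair_succ_snd (b g l D : ℂ) (f : ℕ) (c : ℕ → ℤ) (v i : ℕ) :
    (partialPair n a b g l D f c v (i + 1)).2 = (partialPair n a b g l D f c v i).2 *
      (kid n a b g D (pairVal n a b g l D f) c v i).2 := by
  simp only [partialPair, Finset.prod_range_succ, mul_assoc]

/-- The number of neighbours of `v` that are at least `u`. -/
def degFrom (n : ℕ) (a : ℕ → ℕ → Bool) (v u : ℕ) : ℕ :=
  ((Finset.range n).filter fun x => u ≤ x ∧ a v x).card

lemma degFrom_eq {v u : ℕ} (hu : u < n) :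
    degFrom n a v u = degFrom n a v (u + 1) + if a v u then 1 else 0 := by
  rw [degFrom, degFrom]
  split_ifs with h
  · rw [← Finset.card_insert_of_notMem (a := u) (by simp)]
    congr 1
    ext x
    simp only [Finset.mem_filter, Finset.mem_range, Finset.mem_insert]
    constructor
    · rintro ⟨h1, h2, h3⟩
      rcases h2.eq_or_lt with h4 | h4
      · exact Or.inl h4.symm
      · exact Or.inr ⟨h1, h4, h3⟩
    · rintro (rfl | ⟨h1, h2, h3⟩)
      · exact ⟨hu, le_rfl, h⟩
      · exact ⟨h1, by omega, h3⟩
  · rw [add_zero]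
    congr 1
    ext x
    simp only [Finset.mem_filter, Finset.mem_range]
    constructor
    · rintro ⟨h1, h2, h3⟩
      refine ⟨h1, lt_of_le_of_ne h2 ?_, h3⟩
      rintro rfl
      exact h h3
    · rintro ⟨h1, h2, h3⟩
      exact ⟨h1, by omega, h3⟩

lemma abs_lt_of_le {B : ℕ} {x y : ℤ} (h : x < 2 ^ B) (h0 : 0 ≤ y) (hy : y ≤ x) : |y| < 2 ^ B := by
  rw [abs_of_nonneg h0]; omega

/-- The search is one flat loop, so evaluating a subtree is not the run of a subprogram; correctness
is phrased by a continuation, namely the rest of the loop after the node is finished. The induction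
runs over the `r` remaining neighbours. Each costs one iteration, and an adjacent one costs at most
`I` more for its subtree and one for leaving it. -/
lemma runs_scan (hsmall : Small n a b g l D L B) (hirr : ∀ v, a v v = false) {f I : ℕ}
    (hchild : ∀ f', f = f' + 1 → NodeSpec n a b g l D L ω B f' I) {d v : ℕ} {c : ℕ → ℤ}
    {s : ℕ} {Q : Memory → Prop} (hdf : d + f = L) (hv : v < n) (hcv : c v = n)
    (hcn : ∀ x < n, c x ≤ n) (r : ℕ) :
    ∀ (u : ℕ) (m : Memory) (A E : GaussianInt), u + r = n → Consts n a b g l D L m →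
    AtNode m d v u A E → (A : ℂ) = (partialPair n a b g l D f c v u).1 →
    (E : ℂ) = (partialPair n a b g l D f c v u).2 → (∀ x < n, rd m 22 x + n = c x) →
    (∀ m' A E, Keeps m m' → Below m m' d → AtNode m' d v n A E →
      (A : ℂ) = (nodePair n a b g l D (pairVal n a b g l D f) c v).1 →
      (E : ℂ) = (nodePair n a b g l D (pairVal n a b g l D f) c v).2 →
      (∀ j, rd m' 22 j = rd m 22 j) → Runs ω B search m' s Q) →
    Runs ω B search m (s + (r + degFrom n a v u * (I + 1))) Q := by
  have hfL : f ≤ L := by omega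
  induction r with
  | zero =>
    intro u m A E hu _ hm hA hE _ hQ
    obtain rfl : u = n := by omega
    exact (hQ m A E (.refl m) (.refl m _) hm hA hE fun _ => rfl).mono (by omega) fun _ h => h
  | succ r ih =>
    intro u m A E hu hc hm hA hE hcode hQ
    have hun : u < n := by omega
    have hvB := abs_lt_of_le hsmall.num (y := v) (by positivity) (by omega)
    have huB := abs_lt_of_le hsmall.num (y := u) (by positivity) (by omega)
    have huB' := abs_lt_of_le hsmall.num (y := (u : ℤ) + 1) (by positivity) (by omega)
    have hfst := hsmall.fst f hfL c v hv (u + 1) hun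
    have hsnd := hsmall.snd f hfL c v hv (u + 1) hun
    rw [partialPair_succ_fst, ← hA] at hfst
    rw [partialPair_succ_snd, ← hE] at hsnd
    set T := s + (r + degFrom n a v (u + 1) * (I + 1)) with hT
    have hdeg := degFrom_eq (a := a) (v := v) hun
    have hpos : 0 < (Expr.add (vr 10) (.sub numE (arr 17 (vr 10)))).eval ω m := by
      rw [eval_guard hc.num hm]; omega
    -- continuing after the neighbour `u`
    have next : ∀ (m' : Memory) (x y : GaussianInt), Keeps m m' → Below m m' d →
        AtNode m' d v ((u + 1 : ℕ) : ℤ) (A * x) (E * y) →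
        (x : ℂ) = (kid n a b g D (pairVal n a b g l D f) c v u).1 →
        (y : ℂ) = (kid n a b g D (pairVal n a b g l D f) c v u).2 →
        (∀ j, rd m' 22 j = rd m 22 j) → Runs ω B search m' T Q := by
      intro m' x y hk hb hn hx hy h22
      refine ih (u + 1) m' (A * x) (E * y) (by omega) (hc.keeps hk) hn ?_ ?_ ?_ ?_
      · rw [partialPair_succ_fst, map_mul, hA, hx]
      · rw [partialPair_succ_snd, map_mul, hE, hy]
      · intro z hz; rw [h22, hcode z hz]
      · intro m'' A' E' hk' hb' hn' hA' hE' h22'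
        exact hQ m'' A' E' (hk.trans hk') (hb.trans hb' le_rfl) hn' hA' hE'
          fun j => (h22' j).trans (h22 j)
    -- neighbours whose message is read off
    have easy : ∀ {X Y : GExpr} (x y : GaussianInt) (m₁ : Memory), Keeps m m₁ → Below m m₁ d →
        AtNode m₁ d v (u + 1) A E → (∀ j, rd m₁ 22 j = rd m 22 j) →
        (x : ℂ) = (kid n a b g D (pairVal n a b g l D f) c v u).1 →
        (y : ℂ) = (kid n a b g D (pairVal n a b g l D f) c v u).2 →
        (∀ m', Consts n a b g l D L m' → GOk ω B m' X ∧ geval ω m' X = x) →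
        (∀ m', Consts n a b g l D L m' → GOk ω B m' Y ∧ geval ω m' Y = y) →
        Runs ω B (mulBoth X Y) m₁ 1 fun m' => Runs ω B search m' T Q := by
      intro X Y x y m₁ hk hb hn h22 hx hy hX hY
      refine runs_mulBoth le_rfl hn (by omega) (fun m' hk' _ => hX m' ((hc.keeps hk).keeps hk'))
        (fun m' hk' _ => hY m' ((hc.keeps hk).keeps hk')) ?_ ?_ ?_
      · rw [map_mul, hx]; exact hfst
      · rw [map_mul, hy]; exact hsnd
      · intro m' hk' hb' hn' h22'
        refine next m' x y (hk.trans hk') (hb.trans hb' le_rfl) (by push_cast; exact hn') hx hy ?_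
        intro j
        rw [h22' _ _ (by norm_num) (by norm_num), h22]
    have XD : ∀ m', Consts n a b g l D L m' → GOk ω B m' (gint (vr 0)) ∧
        geval ω m' (gint (vr 0)) = D := fun m' h =>
      ⟨(gok_gint _).2 (ok_vr _), by rw [geval_gint, eval_vr, h.den]⟩
    have Xb : ∀ m', Consts n a b g l D L m' → GOk ω B m' (gvr 2) ∧ geval ω m' (gvr 2) = b :=
      fun m' h => ⟨(gok_garr _ _).2 trivial, by rw [gvr, geval_garr, Expr.eval, h.b]⟩
    have Xg : ∀ m', Consts n a b g l D L m' → GOk ω B m' (gvr 4) ∧ geval ω m' (gvr 4) = g :=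
      fun m' h => ⟨(gok_garr _ _).2 trivial, by rw [gvr, geval_garr, Expr.eval, h.g]⟩
    set J := if a v u = true then I + 1 else 0 with hJ
    have hcost : 1 + (T + J) ≤ s + (r + 1 + degFrom n a v u * (I + 1)) := by
      rw [hdeg, hT, hJ]
      split_ifs <;> simp only [Nat.add_mul] <;> omega
    refine Runs.mono (Runs.loop_pos (s := 1) (s' := T + J) (ok_guard m) hpos le_rfl ?_) hcost
      fun _ h => h
    refine runs_searchStep (n := n) le_rfl hc.num hm (by omega) hvB huB (fun _ => huB') ?_ fun h => by omega
    intro _ m₁ hk hb hn h26 h27 h22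
    have hc₁ := hc.keeps hk
    have e1 : (Expr.load (.add (.const 2) (.add (.mul (vr 26) numE) (vr 27)))).eval ω m₁ =
        if a v u then 1 else 0 := by
      rw [Expr.eval, Expr.eval, Expr.eval, Expr.eval, Expr.eval, eval_vr, eval_vr, eval_numE, h26,
        h27, hc₁.num, hc₁.adj v hv u hun]
    have e2 : (arr 22 (vr 27)).eval ω m₁ = c u - n := by
      have := hcode u hun
      rw [eval_arr, eval_vr, h27, h22]
      omega
    refine Runs.branch le_rfl ⟨trivial, ⟨ok_vr _, trivial⟩, ok_vr _⟩ (fun h => ?_) fun h => ?_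
    · rw [e1] at h
      have hadj : a v u = true := by
        by_contra h'
        simp [h'] at h
      have hvu : (v : ℤ) ≠ u := by
        intro h'
        rw [Nat.cast_inj] at h'
        rw [h', hirr] at hadj
        exact absurd hadj (by simp)
      have hJ' : J = I + 1 := by rw [hJ, if_pos hadj]
      refine Runs.branch le_rfl ⟨(ok_arr _ _).2 (ok_vr _), trivial⟩ (fun h => ?_) fun h => ?_
      · rw [Expr.eval, e2, Expr.eval] at h
        have hcu : c u = n := le_antisymm (hcn u hun) (by omega)
        have hkid : kid n a b g D (pairVal n a b g l D f) c v u =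
            pairVal n a b g l D f (Function.update c v (u : ℤ)) u := by
          rw [kid, if_pos hadj, if_pos hcu.ge]
        refine Runs.branch le_rfl ⟨ok_vr _, ok_vr _⟩ (fun h => ?_) fun h => ?_
        · rw [Expr.eval, eval_vr, eval_vr, hc₁.depth, hn.depth] at h
          obtain ⟨f', rfl⟩ : ∃ f', f = f' + 1 := ⟨f - 1, by omega⟩
          have hl0 := hsmall.fst 0 (by omega) c v hv 0 (by omega)
          have hD0 := hsmall.snd 0 (by omega) c v hv 0 (by omega)
          simp only [partialPair, Finset.range_zero, Finset.prod_empty, mul_one] at hl0 hD0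
          refine runs_descend le_rfl hc₁ hn (by omega) (by omega) h26 h27 huB ?_ ?_ hl0 hD0 ?_
          · have := hsmall.num
            rw [abs_lt]; constructor <;> omega
          · have := hsmall.depth
            rw [abs_lt]; constructor <;> omega
          intro m₂ hk₂ hb₂ hn₂ h22v h22o
          have hc₂ := hc₁.keeps hk₂
          have hn₂' : AtNode m₂ ((d + 1 : ℕ) : ℤ) u 0 l D := by push_cast; exact hn₂
          -- `I` steps pay for the subtree of the child, one further step for leaving it.
          rw [hJ', show T + (I + 1) = (T + 1) + I by ring]
          refine hchild f' rfl (d + 1) u m₂ (Function.update c v (u : ℤ)) _ _ (by omega) hc₂ hn₂'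
            ?_ hun ?_ ?_ ?_
          · intro x hx
            by_cases hxv : x = v
            · subst hxv; rw [h22v, Function.update_self]; ring
            · rw [h22o _ (by simpa using hxv), h22, Function.update_of_ne hxv, hcode x hx]
          · rw [Function.update_of_ne (by rintro rfl; exact hvu rfl), hcu]
          · intro x hx
            by_cases hxv : x = v
            · subst hxv; rw [Function.update_self]; omega
            · rw [Function.update_of_ne hxv]; exact hcn x hx
          intro m₃ A' E' hk₃ hb₃ hn₃ hA' hE' h22₃
          have hc₃ := hc₂.keeps hk₃
          rw [add_comm T 1]
          refine Runs.loop_pos (ok_guard m₃) (by rw [eval_guard hc₃.num hn₃]; push_cast; omega)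
            le_rfl ?_
          have hnB := abs_lt_of_le hsmall.num (y := (n : ℤ)) (by positivity) le_rfl
          have hval : ((b * A' + D * E' : GaussianInt) : ℂ) =
                (kid n a b g D (pairVal n a b g l D (f' + 1)) c v u).1 ∧
              ((D * A' + g * E' : GaussianInt) : ℂ) =
                (kid n a b g D (pairVal n a b g l D (f' + 1)) c v u).2 := by
            rw [hkid, pairVal]
            simp [hA', hE']
          have hvf := hsmall.val_fst (f' + 1) hfL (Function.update c v (u : ℤ)) u hun
          have hvs := hsmall.val_snd (f' + 1) hfL (Function.update c v (u : ℤ)) u hun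
          rw [← hkid] at hvf hvs
          have hb₁₃ : Below m₁ m₃ ((d : ℤ) + 1) := hb₂.trans hb₃ (by push_cast; omega)
          refine runs_searchStep (n := n) le_rfl hc₃.num hn₃ (by omega) huB hnB (fun h => by omega)
            (fun h => by omega) ?_
          intro _ m₄ hk₄ hb₄ hn₄ h22₄
          have hn₄' : AtNode m₄ ((d : ℤ) + 1) u n A' E' := by
            have := hn₄; push_cast at this; exact this
          have hb₁₄ : Below m₁ m₄ ((d : ℤ) + 1) := hb₁₃.trans hb₄ (by push_cast; omega)
          refine runs_leave le_rfl (hc₃.keeps hk₄) (by omega) (v := v) (u := u + 1) (A := A) (E := E)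
            (by omega) ?_ hn₄' ⟨?_, ?_, ?_, ?_⟩ (by rw [hval.1]; exact hvf)
            (by rw [hval.2]; exact hvs) (by rw [map_mul, hval.1]; exact hfst)
            (by rw [map_mul, hval.2]; exact hsnd) ?_
          · have := hsmall.depth
            rw [abs_lt]; constructor <;> omega
          · rw [hb₁₄ d (by omega) _ (by norm_num) (by norm_num), hn.vert]
          · rw [hb₁₄ d (by omega) _ (by norm_num) (by norm_num), hn.next]
          · rw [hb₁₄.gx (by omega) (by norm_num) (by norm_num), hn.num]
          · rw [hb₁₄.gx (by omega) (by norm_num) (by norm_num), hn.den]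
          · intro m₅ hk₅ hb₅ hn₅ h22v' h22o'
            refine next m₅ _ _ (hk.trans (hk₂.trans (hk₃.trans (hk₄.trans hk₅))))
              (hb.trans (Below.trans (fun i hi => hb₁₄ i (by omega)) hb₅ le_rfl) le_rfl)
              (by push_cast; exact hn₅) hval.1 hval.2 ?_
            intro j
            by_cases hj : j = v
            -- The code of `v` returns to what it was: `v` is alive with code `n`, which is stored
            -- as 0.
            · subst hj
              have := hcode v hv
              rw [h22v']
              omega
            · rw [h22o' j hj, h22₄, h22₃, h22o j hj, h22]
        · rw [Expr.eval, eval_vr, eval_vr, hc₁.depth, hn.depth] at h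
          -- At the depth bound an alive child is replaced by its truncated value D/g.
          obtain rfl : f = 0 := by omega
          refine (easy (D : GaussianInt) g m₁ hk hb hn h22 ?_ ?_ XD Xg).mono le_rfl
            fun _ h => h.mono (by omega) fun _ h => h
          · rw [hkid, pairVal]; simp
          · rw [hkid, pairVal]
      · rw [Expr.eval, e2, Expr.eval] at h
        have e3 : (Expr.add (arr 22 (vr 27)) numE).eval ω m₁ = c u := by
          rw [Expr.eval, e2, eval_numE, hc₁.num]; ring
        have hcu : ¬ (n : ℤ) ≤ c u := by omega
        refine Runs.branch le_rfl ⟨⟨(ok_arr _ _).2 (ok_vr _), trivial⟩, ok_vr _⟩ (fun h => ?_)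
          fun h => ?_
        · rw [Expr.eval, e3, eval_vr, h26] at h
          have hkid : kid n a b g D (pairVal n a b g l D f) c v u = ((b : ℂ), (D : ℂ)) := by
            rw [kid, if_pos hadj, if_neg hcu, if_pos (by omega)]
          refine (easy b (D : GaussianInt) m₁ hk hb hn h22 ?_ ?_ Xb XD).mono le_rfl
            fun _ h => h.mono (by omega) fun _ h => h
          · rw [hkid]
          · rw [hkid]; simp
        · rw [Expr.eval, e3, eval_vr, h26] at h
          refine Runs.branch le_rfl ⟨ok_vr _, (ok_arr _ _).2 (ok_vr _), trivial⟩ (fun h' => ?_)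
            fun h' => ?_
          · rw [Expr.eval, e3, eval_vr, h26] at h'
            have hkid : kid n a b g D (pairVal n a b g l D f) c v u = ((D : ℂ), (g : ℂ)) := by
              rw [kid, if_pos hadj, if_neg hcu, if_neg (by omega), if_pos (by omega)]
            refine (easy (D : GaussianInt) g m₁ hk hb hn h22 ?_ ?_ XD Xg).mono le_rfl
              fun _ h => h.mono (by omega) fun _ h => h
            · rw [hkid]; simp
            · rw [hkid]
          · rw [Expr.eval, e3, eval_vr, h26] at h'
            have hkid : kid n a b g D (pairVal n a b g l D f) c v u = (1, 1) := by
              rw [kid, if_pos hadj, if_neg hcu, if_neg (by omega), if_neg (by omega)]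
            refine Runs.skip le_rfl ((next m₁ 1 1 hk hb ?_ ?_ ?_ h22).mono (by omega) fun _ h => h)
            · push_cast; rw [mul_one, mul_one]; exact hn
            · rw [hkid]; simp
            · rw [hkid]; simp
    · rw [e1] at h
      have hadj : ¬ a v u = true := by
        intro h'
        simp [h'] at h
      have hkid : kid n a b g D (pairVal n a b g l D f) c v u = (1, 1) := by
        rw [kid, if_neg hadj]
      refine Runs.skip le_rfl ((next m₁ 1 1 hk hb ?_ ?_ ?_ h22).mono (by omega) fun _ h => h)
      · push_cast; rw [mul_one, mul_one]; exact hn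
      · rw [hkid]; simp
      · rw [hkid]; simp

/-- `runs_scan` needs children of smaller remaining depth only. The resulting recursion I ↦ n + Δ (I
+ 1) for the number of steps stays below the closed form. -/
lemma nodeSpec (hsmall : Small n a b g l D L B) (hirr : ∀ v, a v v = false) {Δ : ℕ}
    (hdeg : ∀ v < n, degFrom n a v 0 ≤ Δ) (f : ℕ) :
    NodeSpec n a b g l D L ω B f ((n + 1) * (Δ + 1) ^ (f + 1) - 1) := by
  have key : ∀ f, (∀ f', f = f' + 1 →
      NodeSpec n a b g l D L ω B f' ((n + 1) * (Δ + 1) ^ f - 1)) →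
      NodeSpec n a b g l D L ω B f ((n + 1) * (Δ + 1) ^ (f + 1) - 1) := by
    intro f hf d v m c s Q hd hc hm hcode hv hcv hcn hQ
    refine (runs_scan hsmall hirr hf hd hv hcv hcn n 0 m l
      D (by omega) hc hm ?_ ?_ hcode hQ).mono ?_ fun _ h => h
    · simp [partialPair]
    · simp [partialPair]
    · have h1 : 1 ≤ (n + 1) * (Δ + 1) ^ f := Nat.one_le_iff_ne_zero.2 (by positivity)
      have h2 : n + 1 ≤ (n + 1) * (Δ + 1) ^ f := Nat.le_mul_of_pos_right _ (by positivity)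
      have h3 := Nat.mul_le_mul_right ((n + 1) * (Δ + 1) ^ f) (hdeg v hv)
      rw [Nat.sub_add_cancel h1,
        show (n + 1) * (Δ + 1) ^ (f + 1) = Δ * ((n + 1) * (Δ + 1) ^ f) + (n + 1) * (Δ + 1) ^ f by ring]
      omega
  induction f with
  | zero => exact key 0 fun f' h => absurd h (by omega)
  | succ f ih => exact key (f + 1) fun f' h => by obtain rfl : f' = f := by omega
                                                  exact ih

lemma runs_search (hsmall : Small n a b g l D L B) (hirr : ∀ v, a v v = false) {Δ : ℕ}
    (hdeg : ∀ v < n, degFrom n a v 0 ≤ Δ) {v : ℕ} {m : Memory} {c : ℕ → ℤ} {Q : Memory → Prop}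
    (hc : Consts n a b g l D L m) (hm : AtNode m 0 v 0 l D)
    (hcode : ∀ x < n, rd m 22 x + n = c x) (hv : v < n) (hcv : c v = n) (hcn : ∀ x < n, c x ≤ n)
    (hQ : ∀ m', Keeps m m' →
      (gx m' 18 0 : ℂ) = (nodePair n a b g l D (pairVal n a b g l D L) c v).1 →
      (gx m' 20 0 : ℂ) = (nodePair n a b g l D (pairVal n a b g l D L) c v).2 →
      (∀ j, rd m' 22 j = rd m 22 j) → Q m') :
    Runs ω B search m ((n + 1) * (Δ + 1) ^ (L + 1)) Q := by
  have h1 : 1 ≤ (n + 1) * (Δ + 1) ^ (L + 1) := Nat.one_le_iff_ne_zero.2 (by positivity)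
  rw [show (n + 1) * (Δ + 1) ^ (L + 1) = 1 + ((n + 1) * (Δ + 1) ^ (L + 1) - 1) by omega]
  refine nodeSpec hsmall hirr hdeg L 0 v m c 1 Q (by omega) hc hm hcode hv hcv hcn ?_
  intro m' A E hk _ hn hA hE h22
  refine Runs.loop_nonpos (ok_guard m') ?_ le_rfl (hQ m' hk ?_ ?_ h22)
  · rw [eval_guard (hc.keeps hk).num hn]; simp
  · have := hn.num; push_cast at this; rw [this, hA]
  · have := hn.den; push_cast at this; rw [this, hE]

end Search

/-! ### The approximation algorithm -/

section Algorithm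

/-- The square of the size of the input. -/
def sizeSq : Expr :=
  .mul (.add numE (.load (.const 1))) (.add numE (.load (.const 1)))

/-- Common denominator and depth bound. -/
def setupLoop (κ : ℤ) : Prog :=
  forLoop 24 (vr 23) (.seq (.branch (.sub (vr 25) (vr 0)) (assign 1 (.add (vr 1) (.const κ))) .skip)
    (assign 0 (.add (vr 0) (vr 0))))

/-- Read a parameter. -/
def readParam (x : ℤ) (i : Fin 3) : Prog :=
  gput x (.const 0) (.queryRe i (vr 23), .queryIm i (vr 23))

/-- Preparations. -/
def setup (K₁ K₂ κ : ℤ) : Prog :=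
  .seq (assign 23 (.mul (.const K₁) sizeSq)) <|
  .seq (assign 25 (.mul (.const K₂) sizeSq)) <|
  .seq (assign 0 (.const 1)) <|
  .seq (assign 1 (.const 0)) <|
  .seq (setupLoop κ) <|
  .seq (readParam 2 0) <| .seq (readParam 4 1) <| .seq (readParam 6 2) <|
  .seq (gput 11 (.const 0) (gint (.const 1))) (gput 13 (.const 0) (gint (.const 1)))

/-- Multiply the output by the weights of the edges to earlier vertices. -/
def edgeLoop : Prog :=
  forLoop 9 (vr 8) <|
    .branch (.load (.add (.const 2) (.add (.mul (vr 8) numE) (vr 9))))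
      (.seq (gput 11 (.const 0) (gmul (gvr 11) (gvr 4)))
        (gput 13 (.const 0) (gmul (gvr 13) (gint (vr 0))))) .skip

/-- Enter the root. -/
def enterRoot : Prog :=
  .seq (assign 10 (.const 0)) <|
  .seq (put 16 (.const 0) (vr 8)) <|
  .seq (put 17 (.const 0) (.const 0)) <|
  .seq (gput 18 (.const 0) (gvr 6)) (gput 20 (.const 0) (gint (vr 0)))

/-- Treat all vertices. -/
def vertexLoop : Prog :=
  forLoop 8 numE <|
    .seq edgeLoop <| .seq enterRoot <| .seq search <|
    .seq (gput 11 (.const 0) (gmul (gvr 11) (gadd (gvr 18) (gvr 20)))) <|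
    .seq (gput 13 (.const 0) (gmul (gvr 13) (gvr 20))) <|
    put 22 (vr 8) (.sub (.const (-1)) numE)

/-- Write the output. -/
def output : Prog :=
  .seq (.store (.const 0) (.add (.mul (vr 11) (vr 13)) (.mul (vr 12) (vr 14)))) <|
  .seq (.store (.const 1) (.sub (.mul (vr 12) (vr 13)) (.mul (vr 11) (vr 14))))
    (.store (.const 2) (.add (.mul (vr 13) (vr 13)) (.mul (vr 14) (vr 14))))

/-- The algorithm. -/
def algorithm (K₁ K₂ κ : ℤ) : Prog := .seq (setup K₁ K₂ κ) (.seq vertexLoop output)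

variable {n : ℕ} {a : ℕ → ℕ → Bool} {b g l : GaussianInt} {D : ℤ} {L : ℕ}
  {ω : ParamOracle} {B : ℕ} {m m' m'' : Memory} {s : ℕ} {Q : Memory → Prop}

lemma Consts.of_eq (h : Consts n a b g l D L m) (h1 : ∀ c, 0 ≤ c → m' c = m c)
    (h2 : ∀ y, 0 ≤ y → y < 8 → rd m' y 0 = rd m y 0) : Consts n a b g l D L m' where
  num := by rw [h1 0 le_rfl, h.num]
  adj v hv u hu := by rw [h1 _ (by positivity), h.adj v hv u hu]
  den := by rw [h2 0 (by norm_num) (by norm_num), h.den]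
  depth := by rw [h2 1 (by norm_num) (by norm_num), h.depth]
  b := by rw [gx, h2 2 (by norm_num) (by norm_num), h2 (2 + 1) (by norm_num) (by norm_num), ← h.b, gx]
  g := by rw [gx, h2 4 (by norm_num) (by norm_num), h2 (4 + 1) (by norm_num) (by norm_num), ← h.g, gx]
  l := by rw [gx, h2 6 (by norm_num) (by norm_num), h2 (6 + 1) (by norm_num) (by norm_num), ← h.l, gx]

lemma Consts.wr (h : Consts n a b g l D L m) {x i : ℤ} (z : ℤ) (hx : 8 ≤ x) (hx' : x < 32)
    (hi : 0 ≤ i) : Consts n a b g l D L (wr m x i z) :=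
  h.of_eq (fun c hc => wr_apply_of_nonneg _ _ _ _ _ (by omega) hi hc)
    fun y h1 h2 => rd_wr_of_ne _ _ _ _ _ _ (by omega)

lemma Consts.gwr (h : Consts n a b g l D L m) {x i : ℤ} (z : GaussianInt) (hx : 8 ≤ x)
    (hx' : x < 31) (hi : 0 ≤ i) : Consts n a b g l D L (gwr m x i z) :=
  ((h.wr _ (by norm_num) (by norm_num) le_rfl).wr _ (by omega) (by omega) hi).wr _ hx (by omega) hi

/-- Assignment to a scalar with Gaussian integer value. -/
lemma Runs.gassign {x : ℤ} {e : GExpr} {z : GaussianInt} (hs : 1 ≤ s)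
    (he : ∀ m', (∀ y j, (15 - y) % 32 ≠ 0 → rd m' y j = rd m y j) → (∀ c, 0 ≤ c → m' c = m c) →
      GOk ω B m' e ∧ geval ω m' e = z)
    (hx : (15 - (x + 1)) % 32 ≠ 0)
    (hz : ‖(z : ℂ)‖ < 2 ^ B) (h : Q (gwr m x 0 z)) : Runs ω B (TwoSpin.gput x (.const 0) e) m s Q :=
  Runs.gput hs (fun _ _ => ⟨trivial, rfl⟩) he hx hz h

lemma geval_gvr_of_eq {y : ℤ} (h : ∀ y j, (15 - y) % 32 ≠ 0 → rd m' y j = rd m y j)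
    (h1 : (15 - y) % 32 ≠ 0) (h2 : (15 - (y + 1)) % 32 ≠ 0) :
    GOk ω B m' (gvr y) ∧ geval ω m' (gvr y) = gx m y 0 :=
  ⟨(gok_garr _ _).2 trivial, by rw [gvr, geval_garr, Expr.eval, gx, gx, h _ _ h1, h _ _ h2]⟩

lemma geval_gint_of_eq {y : ℤ} (h : ∀ y j, (15 - y) % 32 ≠ 0 → rd m' y j = rd m y j)
    (h1 : (15 - y) % 32 ≠ 0) :
    GOk ω B m' (gint (vr y)) ∧ geval ω m' (gint (vr y)) = rd m y 0 :=
  ⟨(gok_gint _).2 (ok_vr _), by rw [geval_gint, eval_vr, h _ _ h1]⟩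

lemma GOk.mul {e f : GExpr} {x y : GaussianInt} (h : GOk ω B m e ∧ geval ω m e = x)
    (h' : GOk ω B m f ∧ geval ω m f = y) :
    GOk ω B m (gmul e f) ∧ geval ω m (gmul e f) = x * y :=
  ⟨(gok_gmul _ _).2 ⟨h.1, h'.1⟩, by rw [geval_gmul, h.2, h'.2]⟩

lemma GOk.add {e f : GExpr} {x y : GaussianInt} (h : GOk ω B m e ∧ geval ω m e = x)
    (h' : GOk ω B m f ∧ geval ω m f = y) :
    GOk ω B m (gadd e f) ∧ geval ω m (gadd e f) = x + y :=
  ⟨(gok_gadd _ _).2 ⟨h.1, h'.1⟩, by rw [geval_gadd, h.2, h'.2]⟩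

/-- All numbers in the evaluation of the output are small. -/
structure SmallOut (n : ℕ) (a : ℕ → ℕ → Bool) (b g l D : ℂ) (L B : ℕ) : Prop where
  num : ∀ i < n, ∀ w ≤ i, ‖outNum n a b g l D L i * ∏ x ∈ Finset.range w, if a i x then g else 1‖ < 2 ^ B
  den : ∀ i < n, ∀ w ≤ i, ‖outDen n a b g l D L i * ∏ x ∈ Finset.range w, if a i x then D else 1‖ < 2 ^ B
  mul : ‖outNum n a b g l D L n‖ * ‖outDen n a b g l D L n‖ < 2 ^ B
  sq : ‖outDen n a b g l D L n‖ * ‖outDen n a b g l D L n‖ < 2 ^ B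
  num' : ∀ i ≤ n, ‖outNum n a b g l D L i‖ < 2 ^ B
  den' : ∀ i ≤ n, ‖outDen n a b g l D L i‖ < 2 ^ B

/-- The state of the algorithm with current output `x`, `y`, when `i` vertices have been treated. -/
structure Stage (n : ℕ) (a : ℕ → ℕ → Bool) (b g l : GaussianInt) (D : ℤ) (L : ℕ) (i : ℕ) (x y : ℂ)
    (m : Memory) : Prop where
  consts : Consts n a b g l D L m
  num : (gx m 11 0 : ℂ) = x
  den : (gx m 13 0 : ℂ) = y
  codes : ∀ j : ℕ, rd m 22 j + n = rootCode n i j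

lemma outNum_succ (b g l D : ℂ) (f i : ℕ) : outNum n a b g l D f (i + 1) = outNum n a b g l D f i *
    ((∏ w ∈ Finset.range i, if a i w then g else 1) *
    ((nodePair n a b g l D (pairVal n a b g l D f) (rootCode n i) i).1 +
      (nodePair n a b g l D (pairVal n a b g l D f) (rootCode n i) i).2)) :=
  Finset.prod_range_succ _ _

lemma outDen_succ (b g l D : ℂ) (f i : ℕ) : outDen n a b g l D f (i + 1) = outDen n a b g l D f i *
    ((∏ w ∈ Finset.range i, if a i w then D else 1) *
    (nodePair n a b g l D (pairVal n a b g l D f) (rootCode n i) i).2) :=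
  Finset.prod_range_succ _ _

lemma runs_edgeLoop (hn : (n : ℤ) < 2 ^ B) (hout : SmallOut n a b g l D L B) {i : ℕ} (hi : i < n)
    (hs : n + 1 ≤ s) (hm : Stage n a b g l D L i (outNum n a b g l D L i) (outDen n a b g l D L i) m)
    (h8 : rd m 8 0 = i)
    (hQ : ∀ m', Stage n a b g l D L i
      (outNum n a b g l D L i * ∏ x ∈ Finset.range i, if a i x then (g : ℂ) else 1)
      (outDen n a b g l D L i * ∏ x ∈ Finset.range i, if a i x then (D : ℂ) else 1) m' →
      rd m' 8 0 = i → Q m') :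
    Runs ω B edgeLoop m s Q := by
  refine Runs.forLoop (s := 1) i (fun w m' => Stage n a b g l D L i
      (outNum n a b g l D L i * ∏ x ∈ Finset.range w, if a i x then (g : ℂ) else 1)
      (outDen n a b g l D L i * ∏ x ∈ Finset.range w, if a i x then (D : ℂ) else 1) m' ∧
      rd m' 8 0 = i ∧ rd m' 9 0 = w) (by omega) le_rfl (by omega) ?_ ?_ ?_ ?_
  · rintro w m' _ ⟨_, h1, h2⟩
    exact ⟨ok_vr _, by rw [eval_vr, h1], h2⟩
  · refine ⟨⟨hm.consts.wr _ (by norm_num) (by norm_num) le_rfl, ?_, ?_, ?_⟩, ?_, rd_wr_self _ _ _ _⟩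
    · rw [gx_wr_of_ne _ _ _ _ _ _ (by norm_num) (by norm_num), hm.num]; simp
    · rw [gx_wr_of_ne _ _ _ _ _ _ (by norm_num) (by norm_num), hm.den]; simp
    · intro j; rw [rd_wr_of_ne _ _ _ _ _ _ (by norm_num), hm.codes]
    · rw [rd_wr_of_ne _ _ _ _ _ _ (by norm_num), h8]
  · rintro w m₁ hw ⟨hst, h8', h9⟩
    have e1 : (Expr.load (.add (.const 2) (.add (.mul (vr 8) numE) (vr 9)))).eval ω m₁ =
        if a i w then 1 else 0 := by
      rw [Expr.eval, Expr.eval, Expr.eval, Expr.eval, Expr.eval, eval_vr, eval_vr, eval_numE, h8',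
        h9, hst.consts.num, hst.consts.adj i hi w (by omega)]
    refine Runs.branch le_rfl ⟨trivial, ⟨ok_vr _, trivial⟩, ok_vr _⟩ (fun h => ?_) fun h => ?_
    · rw [e1] at h
      have hadj : a i w = true := by
        by_contra h'
        simp [h'] at h
      have hx : ((gx m₁ 11 0 * g : GaussianInt) : ℂ) = outNum n a b g l D L i *
          ∏ x ∈ Finset.range (w + 1), if a i x then (g : ℂ) else 1 := by
        rw [map_mul, hst.num, Finset.prod_range_succ, if_pos hadj, mul_assoc]
      have hy : ((gx m₁ 13 0 * D : GaussianInt) : ℂ) = outDen n a b g l D L i *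
          ∏ x ∈ Finset.range (w + 1), if a i x then (D : ℂ) else 1 := by
        rw [map_mul, hst.den, Finset.prod_range_succ, if_pos hadj, mul_assoc]
        simp
      refine Runs.seq (Runs.gassign (z := gx m₁ 11 0 * g) le_rfl (fun m' h' _ => ?_) (by norm_num)
        (by rw [hx]; exact hout.num i hi (w + 1) hw) ?_)
      · rw [← hst.consts.g]
        exact GOk.mul (geval_gvr_of_eq h' (by norm_num) (by norm_num))
          (geval_gvr_of_eq h' (by norm_num) (by norm_num))
      refine Runs.gassign (z := gx m₁ 13 0 * D) le_rfl (fun m' h' _ => ?_) (by norm_num)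
        (by rw [hy]; exact hout.den i hi (w + 1) hw) ?_
      · rw [← hst.consts.den, ← gx_gwr_of_ne m₁ 11 13 0 0 (gx m₁ 11 0 * g) (by norm_num)
          (by norm_num) (by norm_num) (by norm_num) (by norm_num),
          ← rd_gwr_of_ne m₁ 11 0 0 0 (gx m₁ 11 0 * g) (by norm_num) (by norm_num) (by norm_num)]
        exact GOk.mul (geval_gvr_of_eq h' (by norm_num) (by norm_num))
          (geval_gint_of_eq h' (by norm_num))
      set z := gx m₁ 11 0 * g
      set z' := gx m₁ 13 0 * (D : GaussianInt)
      have hrd : ∀ y j, (11 - y) % 32 ≠ 0 → (12 - y) % 32 ≠ 0 → (13 - y) % 32 ≠ 0 →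
          (14 - y) % 32 ≠ 0 → (15 - y) % 32 ≠ 0 →
          rd (gwr (gwr m₁ 11 0 z) 13 0 z') y j = rd m₁ y j := by
        intro y j h1 h2 h3 h4 h5
        rw [rd_gwr_of_ne _ _ _ _ _ _ h3 (by omega) h5, rd_gwr_of_ne _ _ _ _ _ _ h1 (by omega) h5]
      refine ⟨?_, ⟨?_, ?_, ?_, ?_⟩, ?_, rd_wr_self _ _ _ _⟩
      · rw [hrd _ _ (by norm_num) (by norm_num) (by norm_num) (by norm_num) (by norm_num), h9]
      · exact ((hst.consts.gwr _ (by norm_num) (by norm_num) le_rfl).gwr _ (by norm_num) (by norm_num)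
          le_rfl).wr _ (by norm_num) (by norm_num) le_rfl
      · rw [gx_wr_of_ne _ _ _ _ _ _ (by norm_num) (by norm_num), gx_gwr_of_ne _ _ _ _ _ _
          (by norm_num) (by norm_num) (by norm_num) (by norm_num) (by norm_num), gx_gwr_self, hx]
      · rw [gx_wr_of_ne _ _ _ _ _ _ (by norm_num) (by norm_num), gx_gwr_self, hy]
      · intro j
        rw [rd_wr_of_ne _ _ _ _ _ _ (by norm_num), hrd _ _ (by norm_num) (by norm_num) (by norm_num)
          (by norm_num) (by norm_num), hst.codes]
      · rw [rd_wr_of_ne _ _ _ _ _ _ (by norm_num), hrd _ _ (by norm_num) (by norm_num) (by norm_num)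
          (by norm_num) (by norm_num), h8']
    · rw [e1] at h
      have hadj : ¬ a i w = true := by
        intro h'
        simp [h'] at h
      refine Runs.skip le_rfl ⟨h9, ⟨hst.consts.wr _ (by norm_num) (by norm_num) le_rfl, ?_, ?_, ?_⟩,
        ?_, rd_wr_self _ _ _ _⟩
      · rw [gx_wr_of_ne _ _ _ _ _ _ (by norm_num) (by norm_num), hst.num, Finset.prod_range_succ,
          if_neg hadj, mul_one]
      · rw [gx_wr_of_ne _ _ _ _ _ _ (by norm_num) (by norm_num), hst.den, Finset.prod_range_succ,
          if_neg hadj, mul_one]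
      · intro j; rw [rd_wr_of_ne _ _ _ _ _ _ (by norm_num), hst.codes]
      · rw [rd_wr_of_ne _ _ _ _ _ _ (by norm_num), h8']
  · rintro m' ⟨h1, h2, _⟩
    exact hQ m' h1 h2

lemma runs_enterRoot {i : ℕ} {x y : ℂ} (hs : 1 ≤ s) (hm : Stage n a b g l D L i x y m)
    (h8 : rd m 8 0 = i) (hi : |(i : ℤ)| < 2 ^ B) (hl : ‖(l : ℂ)‖ < 2 ^ B) (hD : ‖(D : ℂ)‖ < 2 ^ B)
    (hQ : ∀ m', Stage n a b g l D L i x y m' → rd m' 8 0 = i → AtNode m' 0 i 0 l D → Q m') :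
    Runs ω B enterRoot m s Q := by
  refine Runs.seq (Runs.assign hs trivial (by simp [Expr.eval]) ?_)
  rw [show (Expr.const 0).eval ω m = 0 from rfl]
  have e1 : (vr 8).eval ω (wr m 10 0 0) = i := by
    rw [eval_vr, rd_wr_of_ne _ _ _ _ _ _ (by norm_num), h8]
  refine Runs.seq (Runs.put hs trivial (ok_vr _) (by rwa [e1]) ?_)
  rw [e1]
  refine Runs.seq (Runs.put hs trivial trivial (by simp [Expr.eval]) ?_)
  simp only [Expr.eval]
  set m₁ := wr (wr (wr m 10 0 0) 16 0 i) 17 0 0 with hm₁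
  have hrd₁ : ∀ y j, (10 - y) % 32 ≠ 0 → (16 - y) % 32 ≠ 0 → (17 - y) % 32 ≠ 0 →
      rd m₁ y j = rd m y j := by
    intro y j h1 h2 h3
    rw [hm₁, rd_wr_of_ne _ _ _ _ _ _ h3, rd_wr_of_ne _ _ _ _ _ _ h2, rd_wr_of_ne _ _ _ _ _ _ h1]
  have hc₁ : Consts n a b g l D L m₁ := ((hm.consts.wr _ (by norm_num) (by norm_num) le_rfl).wr _
    (by norm_num) (by norm_num) le_rfl).wr _ (by norm_num) (by norm_num) le_rfl
  refine Runs.seq (Runs.gassign (z := l) hs (fun m' h' _ => ?_) (by norm_num) hl ?_)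
  · rw [← hc₁.l]
    exact geval_gvr_of_eq h' (by norm_num) (by norm_num)
  refine Runs.gassign (z := D) hs (fun m' h' _ => ?_) (by norm_num) (by simpa using hD) ?_
  · rw [← (hc₁.gwr l (by norm_num : (8 : ℤ) ≤ 18) (by norm_num) le_rfl).den]
    exact geval_gint_of_eq h' (by norm_num)
  have hrd : ∀ y j, (18 - y) % 32 ≠ 0 → (19 - y) % 32 ≠ 0 → (20 - y) % 32 ≠ 0 →
      (21 - y) % 32 ≠ 0 → (15 - y) % 32 ≠ 0 →
      rd (gwr (gwr m₁ 18 0 l) 20 0 D) y j = rd m₁ y j := by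
    intro y j h1 h2 h3 h4 h5
    rw [rd_gwr_of_ne _ _ _ _ _ _ h3 (by omega) h5, rd_gwr_of_ne _ _ _ _ _ _ h1 (by omega) h5]
  have hgx : ∀ y, 8 ≤ y → y + 1 < 15 → (10 - y) % 32 ≠ 0 → (9 - y) % 32 ≠ 0 →
      gx (gwr (gwr m₁ 18 0 l) 20 0 D) y 0 = gx m y 0 := by
    intro y h1 h2 h3 h4
    rw [gx, gx, hrd _ _ (by omega) (by omega) (by omega) (by omega) (by omega),
      hrd _ _ (by omega) (by omega) (by omega) (by omega) (by omega),
      hrd₁ _ _ (by omega) (by omega) (by omega), hrd₁ _ _ (by omega) (by omega) (by omega)]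
  refine hQ _ ⟨(hc₁.gwr _ (by norm_num) (by norm_num) le_rfl).gwr _ (by norm_num) (by norm_num) le_rfl,
    ?_, ?_, ?_⟩ ?_ ⟨?_, ?_, ?_, ?_, ?_⟩
  · rw [hgx _ (by norm_num) (by norm_num) (by norm_num) (by norm_num), hm.num]
  · rw [hgx _ (by norm_num) (by norm_num) (by norm_num) (by norm_num), hm.den]
  · intro j
    rw [hrd _ _ (by norm_num) (by norm_num) (by norm_num) (by norm_num) (by norm_num),
      hrd₁ _ _ (by norm_num) (by norm_num) (by norm_num), hm.codes]
  · rw [hrd _ _ (by norm_num) (by norm_num) (by norm_num) (by norm_num) (by norm_num),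
      hrd₁ _ _ (by norm_num) (by norm_num) (by norm_num), h8]
  · rw [hrd _ _ (by norm_num) (by norm_num) (by norm_num) (by norm_num) (by norm_num), hm₁,
      rd_wr_of_ne _ _ _ _ _ _ (by norm_num), rd_wr_of_ne _ _ _ _ _ _ (by norm_num), rd_wr_self]
  · rw [hrd _ _ (by norm_num) (by norm_num) (by norm_num) (by norm_num) (by norm_num), hm₁,
      rd_wr_of_ne _ _ _ _ _ _ (by norm_num), rd_wr_self]
  · rw [hrd _ _ (by norm_num) (by norm_num) (by norm_num) (by norm_num) (by norm_num), hm₁,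
      rd_wr_self]
  · rw [gx_gwr_of_ne _ _ _ _ _ _ (by norm_num) (by norm_num) (by norm_num) (by norm_num)
      (by norm_num), gx_gwr_self]
  · rw [gx_gwr_self]

lemma runs_vertexLoop (hsmall : Small n a b g l D L B) (hout : SmallOut n a b g l D L B)
    (hirr : ∀ v, a v v = false) {Δ : ℕ} (hdeg : ∀ v < n, degFrom n a v 0 ≤ Δ)
    (hn : (n : ℤ) + 1 < 2 ^ B) (hs : n * ((n + 1) * (Δ + 1) ^ (L + 1)) + 1 ≤ s)
    (hm : Stage n a b g l D L 0 1 1 m)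
    (hQ : ∀ m', Stage n a b g l D L n (outNum n a b g l D L n) (outDen n a b g l D L n) m' → Q m') :
    Runs ω B vertexLoop m s Q := by
  have hS : n + 1 ≤ (n + 1) * (Δ + 1) ^ (L + 1) := Nat.le_mul_of_pos_right _ (by positivity)
  refine Runs.forLoop (s := (n + 1) * (Δ + 1) ^ (L + 1)) n (fun i m' => Stage n a b g l D L i
      (outNum n a b g l D L i) (outDen n a b g l D L i) m' ∧ rd m' 8 0 = i) (by omega) (by omega) hs
      ?_ ?_ ?_ fun m' h => hQ m' h.1
  · rintro i m' _ ⟨h1, h2⟩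
    exact ⟨trivial, h1.consts.num, h2⟩
  · refine ⟨⟨hm.consts.wr _ (by norm_num) (by norm_num) le_rfl, ?_, ?_, ?_⟩, rd_wr_self _ _ _ _⟩
    · rw [gx_wr_of_ne _ _ _ _ _ _ (by norm_num) (by norm_num), hm.num]; simp [outNum]
    · rw [gx_wr_of_ne _ _ _ _ _ _ (by norm_num) (by norm_num), hm.den]; simp [outDen]
    · intro j; rw [rd_wr_of_ne _ _ _ _ _ _ (by norm_num), hm.codes]
  rintro i m₁ hi ⟨hst, h8⟩
  have hl0 := hsmall.fst 0 (by omega) 0 i hi 0 (by omega)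
  have hD0 := hsmall.snd 0 (by omega) 0 i hi 0 (by omega)
  simp only [partialPair, Finset.range_zero, Finset.prod_empty, mul_one] at hl0 hD0
  refine Runs.seq (runs_edgeLoop (by omega) hout hi hS hst h8 fun m₂ hst₂ h8₂ => ?_)
  refine Runs.seq (runs_enterRoot (by omega) hst₂ h8₂ (abs_lt_of_le hsmall.num (by positivity)
    (by omega)) hl0 hD0 fun m₃ hst₃ h8₃ hnode => ?_)
  refine Runs.seq (runs_search hsmall hirr hdeg hst₃.consts hnode (fun x _ => hst₃.codes x) hi ?_ ?_
    fun m₄ hk hA hE h22 => ?_)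
  · simp [rootCode]
  · intro x _
    rw [rootCode]
    split_ifs <;> omega
  set c := rootCode n i
  have hc₄ := hst₃.consts.keeps hk
  have h8₄ : rd m₄ 8 0 = i := by
    rw [hk.2 8 (by norm_num) (by norm_num) (by norm_num), h8₃]
  have hnum : ((gx m₄ 11 0 * (gx m₄ 18 0 + gx m₄ 20 0) : GaussianInt) : ℂ) =
      outNum n a b g l D L (i + 1) := by
    rw [map_mul, map_add, hA, hE, hk.gx (by norm_num) (by norm_num) (by norm_num) (by norm_num),
      hst₃.num, outNum_succ, mul_assoc]
  have hden : ((gx m₄ 13 0 * gx m₄ 20 0 : GaussianInt) : ℂ) = outDen n a b g l D L (i + 1) := by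
    rw [map_mul, hE, hk.gx (by norm_num) (by norm_num) (by norm_num) (by norm_num),
      hst₃.den, outDen_succ, mul_assoc]
  refine Runs.seq (Runs.gassign (z := gx m₄ 11 0 * (gx m₄ 18 0 + gx m₄ 20 0)) (by omega)
    (fun m' h' _ => ?_) (by norm_num) (by rw [hnum]; exact hout.num' _ hi) ?_)
  · exact GOk.mul (geval_gvr_of_eq h' (by norm_num) (by norm_num)) (GOk.add
      (geval_gvr_of_eq h' (by norm_num) (by norm_num)) (geval_gvr_of_eq h' (by norm_num) (by norm_num)))
  set z := gx m₄ 11 0 * (gx m₄ 18 0 + gx m₄ 20 0)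
  refine Runs.seq (Runs.gassign (z := gx m₄ 13 0 * gx m₄ 20 0) (by omega)
    (fun m' h' _ => ?_) (by norm_num) (by rw [hden]; exact hout.den' _ hi) ?_)
  · rw [← gx_gwr_of_ne m₄ 11 13 0 0 z (by norm_num) (by norm_num) (by norm_num) (by norm_num)
      (by norm_num), ← gx_gwr_of_ne m₄ 11 20 0 0 z (by norm_num) (by norm_num) (by norm_num)
      (by norm_num) (by norm_num)]
    exact GOk.mul (geval_gvr_of_eq h' (by norm_num) (by norm_num))
      (geval_gvr_of_eq h' (by norm_num) (by norm_num))
  set z' := gx m₄ 13 0 * gx m₄ 20 0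
  set m₅ := gwr (gwr m₄ 11 0 z) 13 0 z' with hm₅
  have hc₅ : Consts n a b g l D L m₅ := (hc₄.gwr _ (by norm_num) (by norm_num) le_rfl).gwr _
    (by norm_num) (by norm_num) le_rfl
  have hrd : ∀ y j, (11 - y) % 32 ≠ 0 → (12 - y) % 32 ≠ 0 → (13 - y) % 32 ≠ 0 →
      (14 - y) % 32 ≠ 0 → (15 - y) % 32 ≠ 0 → rd m₅ y j = rd m₄ y j := by
    intro y j h1 h2 h3 h4 h5
    rw [hm₅, rd_gwr_of_ne _ _ _ _ _ _ h3 (by omega) h5, rd_gwr_of_ne _ _ _ _ _ _ h1 (by omega) h5]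
  have h8₅ : rd m₅ 8 0 = i := by
    rw [hrd _ _ (by norm_num) (by norm_num) (by norm_num) (by norm_num) (by norm_num), h8₄]
  -- Vertex `i` receives the code -1, stored minus `n`; in all later trees it is pinned to `-`.
  have e1 : (Expr.sub (.const (-1)) numE).eval ω m₅ = -1 - n := by
    rw [Expr.eval, Expr.eval, eval_numE, hc₅.num]
  refine Runs.put (by omega) (ok_vr _) ⟨trivial, trivial⟩ ?_ ?_
  · rw [e1, abs_lt]; constructor <;> omega
  rw [e1, eval_vr, h8₅]
  refine ⟨?_, ⟨?_, ?_, ?_, ?_⟩, rd_wr_self _ _ _ _⟩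
  · rw [rd_wr_of_ne _ _ _ _ _ _ (by norm_num), h8₅]
  · exact (hc₅.wr _ (by norm_num) (by norm_num) (by omega)).wr _ (by norm_num) (by norm_num) le_rfl
  · rw [gx_wr_of_ne _ _ _ _ _ _ (by norm_num) (by norm_num),
      gx_wr_of_ne _ _ _ _ _ _ (by norm_num) (by norm_num), hm₅, gx_gwr_of_ne _ _ _ _ _ _
      (by norm_num) (by norm_num) (by norm_num) (by norm_num) (by norm_num), gx_gwr_self, hnum]
  · rw [gx_wr_of_ne _ _ _ _ _ _ (by norm_num) (by norm_num),
      gx_wr_of_ne _ _ _ _ _ _ (by norm_num) (by norm_num), hm₅, gx_gwr_self, hden]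
  · intro j
    rw [rd_wr_of_ne _ _ _ _ _ _ (by norm_num)]
    by_cases hj : j = i
    · subst hj
      rw [rd_wr_self, rootCode, if_pos (by omega)]; ring
    · rw [rd_wr_of_index_ne _ _ _ _ _ (by simpa using hj),
        hrd _ _ (by norm_num) (by norm_num) (by norm_num) (by norm_num) (by norm_num), h22,
        hst₃.codes, rootCode, rootCode]
      have : j < i + 1 ↔ j < i := by omega
      simp only [this]

end Algorithm

/-! ### Output, preparations and the whole program. -/

section Algorithm

variable {n : ℕ} {a : ℕ → ℕ → Bool} {b g l : GaussianInt} {D : ℤ} {L : ℕ}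
  {ω : ParamOracle} {B : ℕ} {m m' m'' : Memory} {s : ℕ} {Q : Memory → Prop}

lemma rd_update_of_nonneg {c y z : ℤ} (hc : 0 ≤ c) (hy : 0 ≤ y) :
    rd (Function.update m c z) y 0 = rd m y 0 := by
  rw [rd, Function.update_of_ne (by omega), rd]

/-- Writing x/y as x ȳ / |y|² turns the quotient of two Gaussian integers into one with an integer
denominator, without any division. -/
lemma runs_output {x y : ℂ} (hs : 1 ≤ s) (hx : (gx m 11 0 : ℂ) = x) (hy : (gx m 13 0 : ℂ) = y)
    (h1 : ‖x‖ * ‖y‖ < 2 ^ B) (h2 : ‖y‖ * ‖y‖ < 2 ^ B) (hy0 : y ≠ 0)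
    (hQ : ∀ m', m' 2 ≠ 0 → ((m' 0 : ℂ) + (m' 1 : ℂ) * Complex.I) / (m' 2 : ℂ) = x / y → Q m') :
    Runs ω B output m s Q := by
  set X := gx m 11 0 with hX
  set Y := gx m 13 0 with hY
  have r11 : rd m 11 0 = X.re := rfl
  have r12 : rd m 12 0 = X.im := rfl
  have r13 : rd m 13 0 = Y.re := rfl
  have r14 : rd m 14 0 = Y.im := rfl
  have hXY : ‖((X * star Y : GaussianInt) : ℂ)‖ < 2 ^ B := by
    rw [map_mul, GaussianInt.toComplex_star, norm_mul, RCLike.norm_conj, hx, hy]; exact h1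
  have hYY : ‖((Y * star Y : GaussianInt) : ℂ)‖ < 2 ^ B := by
    rw [map_mul, GaussianInt.toComplex_star, norm_mul, RCLike.norm_conj, hy]; exact h2
  have e0 : (Expr.add (.mul (vr 11) (vr 13)) (.mul (vr 12) (vr 14))).eval ω m = (X * star Y).re := by
    simp only [Expr.eval, eval_vr, r11, r12, r13, r14, Zsqrtd.re_mul, Zsqrtd.re_star, Zsqrtd.im_star]
    ring
  refine Runs.seq (Runs.store hs trivial ⟨⟨ok_vr _, ok_vr _⟩, ok_vr _, ok_vr _⟩
    (by rw [e0]; exact abs_re_lt hXY) ?_)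
  rw [e0]
  simp only [Expr.eval]
  set m₁ := Function.update m 0 (X * star Y).re with hm₁
  have e1 : (Expr.sub (.mul (vr 12) (vr 13)) (.mul (vr 11) (vr 14))).eval ω m₁ =
      (X * star Y).im := by
    simp only [Expr.eval, eval_vr, hm₁, rd_update_of_nonneg le_rfl (by norm_num : (0 : ℤ) ≤ 11),
      rd_update_of_nonneg le_rfl (by norm_num : (0 : ℤ) ≤ 12),
      rd_update_of_nonneg le_rfl (by norm_num : (0 : ℤ) ≤ 13),
      rd_update_of_nonneg le_rfl (by norm_num : (0 : ℤ) ≤ 14), r11, r12, r13, r14, Zsqrtd.im_mul,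
      Zsqrtd.re_star, Zsqrtd.im_star]
    ring
  refine Runs.seq (Runs.store hs trivial ⟨⟨ok_vr _, ok_vr _⟩, ok_vr _, ok_vr _⟩
    (by rw [e1]; exact abs_im_lt hXY) ?_)
  rw [e1]
  simp only [Expr.eval]
  set m₂ := Function.update m₁ 1 (X * star Y).im with hm₂
  have e2 : (Expr.add (.mul (vr 13) (vr 13)) (.mul (vr 14) (vr 14))).eval ω m₂ =
      (Y * star Y).re := by
    simp only [Expr.eval, eval_vr, hm₂, hm₁,
      rd_update_of_nonneg le_rfl (by norm_num : (0 : ℤ) ≤ 13),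
      rd_update_of_nonneg le_rfl (by norm_num : (0 : ℤ) ≤ 14),
      rd_update_of_nonneg zero_le_one (by norm_num : (0 : ℤ) ≤ 13),
      rd_update_of_nonneg zero_le_one (by norm_num : (0 : ℤ) ≤ 14), r13, r14, Zsqrtd.re_mul,
      Zsqrtd.re_star, Zsqrtd.im_star]
    ring
  refine Runs.store hs trivial ⟨⟨ok_vr _, ok_vr _⟩, ok_vr _, ok_vr _⟩
    (by rw [e2]; exact abs_re_lt hYY) ?_
  rw [e2]
  simp only [Expr.eval]
  have hYc : (((Y * star Y).re : ℤ) : ℂ) = y * (starRingEnd ℂ) y := by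
    have h3 : (Y * star Y) = (((Y * star Y).re : ℤ) : GaussianInt) := by
      ext
      · simp
      · simp; ring
    have h4 := congrArg GaussianInt.toComplex h3
    rw [map_mul, GaussianInt.toComplex_star, hy, map_intCast] at h4
    exact h4.symm
  have hXc : (((X * star Y).re : ℤ) : ℂ) + (((X * star Y).im : ℤ) : ℂ) * Complex.I =
      x * (starRingEnd ℂ) y := by
    rw [← GaussianInt.toComplex_def, map_mul, GaussianInt.toComplex_star, hx, hy]
  have hyc : (starRingEnd ℂ) y ≠ 0 := (map_ne_zero _).2 hy0
  refine hQ _ ?_ ?_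
  · rw [Function.update_self]
    intro h
    rw [h, Int.cast_zero] at hYc
    exact mul_ne_zero hy0 hyc hYc.symm
  · rw [Function.update_self, Function.update_of_ne (by norm_num), hm₂,
      Function.update_of_ne (by norm_num), hm₁, Function.update_self,
      Function.update_of_ne (by norm_num), Function.update_self, hXc, hYc,
      mul_div_mul_right _ _ hyc]

/-- The answer of the oracle. -/
def answer (ω : ParamOracle) (K : ℕ) (i : Fin 3) : GaussianInt := ⟨(ω i K).1, (ω i K).2⟩

lemma runs_readParam {x : ℤ} {i : Fin 3} {K : ℕ} (hs : 1 ≤ s) (h23 : rd m 23 0 = K) (hK : K ≤ B)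
    (hB : ‖(answer ω K i : ℂ)‖ < 2 ^ B) (hx : (15 - (x + 1)) % 32 ≠ 0)
    (hQ : Q (gwr m x 0 (answer ω K i))) : Runs ω B (readParam x i) m s Q := by
  refine Runs.gassign hs (fun m' h' _ => ?_) hx hB hQ
  have h : ((vr 23).eval ω m').toNat = K := by
    rw [eval_vr, h' _ _ (by norm_num), h23, Int.toNat_natCast]
  refine ⟨⟨⟨ok_vr _, ?_, ?_⟩, ok_vr _, ?_, ?_⟩, ?_⟩
  · rwa [h]
  · rw [h]; exact abs_re_lt hB
  · rwa [h]
  · rw [h]; exact abs_im_lt hB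
  · simp only [geval, Expr.eval, h, answer]

/-- The depth of the search. -/
def depthBound (κ K T : ℕ) : ℕ := κ * min K (Nat.clog 2 T)

/-- `K` doublings produce the denominator 2^K. Comparing the running power 2^j with `T` on the way
counts the rounded-up logarithm of `T`, adding `κ` to the depth each time. -/
lemma runs_setupLoop {κ K T : ℕ} (hs : K + 1 ≤ s) (hKB : K < B)
    (hL : ((depthBound κ K T : ℕ) : ℤ) < 2 ^ B) (h23 : rd m 23 0 = K) (h25 : rd m 25 0 = T)
    (h0 : rd m 0 0 = 1) (h1 : rd m 1 0 = 0)
    (hQ : ∀ m', (∀ c, 0 ≤ c → m' c = m c) → (∀ y j, 2 ≤ y → y < 32 → y ≠ 24 → rd m' y j = rd m y j) →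
      rd m' 0 0 = 2 ^ K → rd m' 1 0 = depthBound κ K T → Q m') :
    Runs ω B (setupLoop κ) m s Q := by
  have hKB' : (K : ℤ) < 2 ^ B := by
    have h : K < 2 ^ B := hKB.trans Nat.lt_two_pow_self
    exact_mod_cast h
  refine Runs.forLoop (s := 1) K (fun j m' => (∀ c, 0 ≤ c → m' c = m c) ∧
    (∀ y j, 2 ≤ y → y < 32 → y ≠ 24 → rd m' y j = rd m y j) ∧ rd m' 24 0 = j ∧
    rd m' 0 0 = 2 ^ j ∧ rd m' 1 0 = depthBound κ j T) hKB' le_rfl (by omega) ?_ ?_ ?_ ?_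
  · rintro j m' _ ⟨_, h2, h3, _⟩
    exact ⟨ok_vr _, by rw [eval_vr, h2 _ _ (by norm_num) (by norm_num) (by norm_num), h23], h3⟩
  · refine ⟨fun c hc => wr_apply_of_nonneg _ _ _ _ _ (by norm_num) le_rfl hc, fun y j h1 h2 h3 =>
      rd_wr_of_ne _ _ _ _ _ _ (by omega), rd_wr_self _ _ _ _, ?_, ?_⟩
    · rw [rd_wr_of_ne _ _ _ _ _ _ (by norm_num), h0, pow_zero]
    · rw [rd_wr_of_ne _ _ _ _ _ _ (by norm_num), h1]; simp [depthBound]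
  · rintro j m₁ hj ⟨hc, hr, h24, hD, hd⟩
    have hpow : |(2 : ℤ) ^ (j + 1)| < 2 ^ B := by
      rw [abs_of_nonneg (by positivity)]
      exact pow_lt_pow_right₀ (by norm_num) (by omega)
    -- the second half of the body
    have fin : ∀ m₂ : Memory, (∀ c, 0 ≤ c → m₂ c = m c) →
        (∀ y j, 2 ≤ y → y < 32 → y ≠ 24 → rd m₂ y j = rd m y j) → rd m₂ 24 0 = j →
        rd m₂ 0 0 = 2 ^ j → rd m₂ 1 0 = depthBound κ (j + 1) T →
        Runs ω B (assign 0 (.add (vr 0) (vr 0))) m₂ 1 fun m' => rd m' 24 0 = j ∧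
          ((∀ c, 0 ≤ c → (wr m' 24 0 ((j + 1 : ℕ) : ℤ)) c = m c) ∧
          (∀ y i, 2 ≤ y → y < 32 → y ≠ 24 → rd (wr m' 24 0 ((j + 1 : ℕ) : ℤ)) y i = rd m y i) ∧
          rd (wr m' 24 0 ((j + 1 : ℕ) : ℤ)) 24 0 = ((j + 1 : ℕ) : ℤ) ∧
          rd (wr m' 24 0 ((j + 1 : ℕ) : ℤ)) 0 0 = 2 ^ (j + 1) ∧
          rd (wr m' 24 0 ((j + 1 : ℕ) : ℤ)) 1 0 = depthBound κ (j + 1) T) := by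
      intro m₂ hc hr h24 hD hd
      have e : (Expr.add (vr 0) (vr 0)).eval ω m₂ = 2 ^ (j + 1) := by
        rw [Expr.eval, eval_vr, hD]; ring
      refine Runs.assign le_rfl ⟨ok_vr _, ok_vr _⟩ (by rwa [e]) ?_
      rw [e]
      refine ⟨?_, fun c hc' => ?_, fun y i h1 h2 h3 => ?_, rd_wr_self _ _ _ _, ?_, ?_⟩
      · rw [rd_wr_of_ne _ _ _ _ _ _ (by norm_num), h24]
      · rw [wr_apply_of_nonneg _ _ _ _ _ (by norm_num) le_rfl hc',
          wr_apply_of_nonneg _ _ _ _ _ le_rfl le_rfl hc', hc c hc']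
      · rw [rd_wr_of_ne _ _ _ _ _ _ (by omega), rd_wr_of_ne _ _ _ _ _ _ (by omega), hr y i h1 h2 h3]
      · rw [rd_wr_of_ne _ _ _ _ _ _ (by norm_num), rd_wr_self]
      · rw [rd_wr_of_ne _ _ _ _ _ _ (by norm_num), rd_wr_of_ne _ _ _ _ _ _ (by norm_num), hd]
    have e1 : (Expr.sub (vr 25) (vr 0)).eval ω m₁ = T - 2 ^ j := by
      rw [Expr.eval, eval_vr, eval_vr, hr _ _ (by norm_num) (by norm_num) (by norm_num), h25, hD]
    refine Runs.seq (Runs.branch le_rfl ⟨ok_vr _, ok_vr _⟩ (fun h => ?_) fun h => ?_)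
    · rw [e1] at h
      have h' : 2 ^ j < T := by
        have : ((2 ^ j : ℕ) : ℤ) < T := by push_cast; omega
        exact_mod_cast this
      have hclog : j < Nat.clog 2 T := (Nat.lt_clog_iff_pow_lt (by norm_num)).2 h'
      have e2 : (Expr.add (vr 1) (.const κ)).eval ω m₁ = depthBound κ (j + 1) T := by
        rw [Expr.eval, eval_vr, hd, Expr.eval, depthBound, depthBound, min_eq_left hclog.le,
          min_eq_left (Nat.succ_le_of_lt hclog)]
        push_cast; ring
      have hle : depthBound κ (j + 1) T ≤ depthBound κ K T :=
        Nat.mul_le_mul_left _ (min_le_min_right _ hj)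
      refine Runs.assign le_rfl ⟨ok_vr _, trivial⟩ (by
        rw [e2]; exact abs_lt_of_le hL (by positivity) (by exact_mod_cast hle)) ?_
      rw [e2]
      refine fin _ (fun c hc' => ?_) (fun y i h1 h2 h3 => ?_) ?_ ?_ (rd_wr_self _ _ _ _)
      · rw [wr_apply_of_nonneg _ _ _ _ _ (by norm_num) le_rfl hc', hc c hc']
      · rw [rd_wr_of_ne _ _ _ _ _ _ (by omega), hr y i h1 h2 h3]
      · rw [rd_wr_of_ne _ _ _ _ _ _ (by norm_num), h24]
      · rw [rd_wr_of_ne _ _ _ _ _ _ (by norm_num), hD]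
    · rw [e1] at h
      have h' : T ≤ 2 ^ j := by
        have : (T : ℤ) ≤ ((2 ^ j : ℕ) : ℤ) := by push_cast; omega
        exact_mod_cast this
      have hclog : Nat.clog 2 T ≤ j := (Nat.clog_le_iff_le_pow (by norm_num)).2 h'
      refine Runs.skip le_rfl (fin m₁ hc hr h24 hD ?_)
      rw [hd, depthBound, depthBound, min_eq_right hclog, min_eq_right (hclog.trans (Nat.le_succ _))]
  · rintro m' ⟨h2, h3, _, h4, h5⟩
    exact hQ m' h2 h3 h4 h5

lemma eval_sizeSq {N : ℕ} (h0 : m 0 = n) (h1 : m 1 = N) :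
    sizeSq.eval ω m = (((n + N) ^ 2 : ℕ) : ℤ) := by
  simp only [sizeSq, Expr.eval, eval_numE, h0, h1]
  push_cast; ring

lemma ok_sizeSq : sizeSq.Ok ω B m := ⟨⟨trivial, trivial⟩, trivial, trivial⟩

lemma runs_setup {N K₁ K₂ κ K T : ℕ} (hK : K = K₁ * (n + N) ^ 2) (hT : T = K₂ * (n + N) ^ 2)
    (hs : K + 1 ≤ s) (hKB : K < B) (hTB : (T : ℤ) < 2 ^ B)
    (hL : ((depthBound κ K T : ℕ) : ℤ) < 2 ^ B) (hans : ∀ i, ‖(answer ω K i : ℂ)‖ < 2 ^ B)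
    (h0 : m 0 = n) (h1 : m 1 = N)
    (hadj : ∀ v < n, ∀ u < n, m (2 + ((v : ℤ) * n + u)) = if a v u then 1 else 0)
    (h22 : ∀ j : ℕ, rd m 22 j = 0)
    (hQ : ∀ m', Stage n a (answer ω K 0) (answer ω K 1) (answer ω K 2) (2 ^ K) (depthBound κ K T)
      0 1 1 m' → Q m') :
    Runs ω B (setup K₁ K₂ κ) m s Q := by
  have h1s : 1 ≤ s := by omega
  have hKB' : (K : ℤ) < 2 ^ B := by
    have h : K < 2 ^ B := hKB.trans Nat.lt_two_pow_self
    exact_mod_cast h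
  have hB : 0 < B := by omega
  have h1B : |(1 : ℤ)| < 2 ^ B := by
    rw [abs_one]; exact one_lt_pow₀ (by norm_num) (by omega)
  have h1B' : ‖((1 : ℤ) : ℂ)‖ < 2 ^ B := by
    rw [Int.cast_one, norm_one]; exact one_lt_pow₀ (by norm_num) (by omega)
  have e1 : (Expr.mul (.const K₁) sizeSq).eval ω m = K := by
    rw [Expr.eval, eval_sizeSq h0 h1, Expr.eval, hK]; push_cast; ring
  refine Runs.seq (Runs.assign h1s ⟨trivial, ok_sizeSq⟩
    (by rw [e1]; exact abs_lt_of_le hKB' (by positivity) le_rfl) ?_)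
  rw [e1]
  have e2 : (Expr.mul (.const K₂) sizeSq).eval ω (wr m 23 0 K) = T := by
    rw [Expr.eval, eval_sizeSq (n := n) (N := N), Expr.eval, hT]
    · push_cast; ring
    · rw [wr_apply_of_nonneg _ _ _ _ _ (by norm_num) le_rfl le_rfl, h0]
    · rw [wr_apply_of_nonneg _ _ _ _ _ (by norm_num) le_rfl zero_le_one, h1]
  refine Runs.seq (Runs.assign h1s ⟨trivial, ok_sizeSq⟩
    (by rw [e2]; exact abs_lt_of_le hTB (by positivity) le_rfl) ?_)
  rw [e2]
  refine Runs.seq (Runs.assign h1s trivial h1B ?_)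
  refine Runs.seq (Runs.assign h1s trivial (by simp [Expr.eval]) ?_)
  simp only [Expr.eval]
  set m₁ := wr (wr (wr (wr m 23 0 K) 25 0 T) 0 0 1) 1 0 0 with hm₁
  have hc₁ : ∀ c, 0 ≤ c → m₁ c = m c := by
    intro c hc
    rw [hm₁, wr_apply_of_nonneg _ _ _ _ _ (by norm_num) le_rfl hc,
      wr_apply_of_nonneg _ _ _ _ _ (by norm_num) le_rfl hc,
      wr_apply_of_nonneg _ _ _ _ _ (by norm_num) le_rfl hc,
      wr_apply_of_nonneg _ _ _ _ _ (by norm_num) le_rfl hc]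
  have h22₁ : ∀ j : ℕ, rd m₁ 22 j = 0 := by
    intro j
    rw [hm₁, rd_wr_of_ne _ _ _ _ _ _ (by norm_num), rd_wr_of_ne _ _ _ _ _ _ (by norm_num),
      rd_wr_of_ne _ _ _ _ _ _ (by norm_num), rd_wr_of_ne _ _ _ _ _ _ (by norm_num), h22]
  have h23₁ : rd m₁ 23 0 = K := by
    rw [hm₁, rd_wr_of_ne _ _ _ _ _ _ (by norm_num), rd_wr_of_ne _ _ _ _ _ _ (by norm_num),
      rd_wr_of_ne _ _ _ _ _ _ (by norm_num), rd_wr_self]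
  refine Runs.seq (runs_setupLoop hs hKB hL h23₁ ?_ ?_ ?_ fun m₂ hc₂ hr₂ hD hd => ?_)
  · rw [hm₁, rd_wr_of_ne _ _ _ _ _ _ (by norm_num), rd_wr_of_ne _ _ _ _ _ _ (by norm_num),
      rd_wr_self]
  · rw [hm₁, rd_wr_of_ne _ _ _ _ _ _ (by norm_num), rd_wr_self]
  · rw [hm₁, rd_wr_self]
  have h23₂ : rd m₂ 23 0 = K := by
    rw [hr₂ _ _ (by norm_num) (by norm_num) (by norm_num), h23₁]
  have h22₂ : ∀ j : ℕ, rd m₂ 22 j = 0 := by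
    intro j; rw [hr₂ _ _ (by norm_num) (by norm_num) (by norm_num), h22₁]
  refine Runs.seq (runs_readParam h1s h23₂ hKB.le (hans 0) (by norm_num) ?_)
  refine Runs.seq (runs_readParam h1s ?_ hKB.le (hans 1) (by norm_num) ?_)
  · rw [rd_gwr_of_ne _ _ _ _ _ _ (by norm_num) (by norm_num) (by norm_num), h23₂]
  refine Runs.seq (runs_readParam h1s ?_ hKB.le (hans 2) (by norm_num) ?_)
  · rw [rd_gwr_of_ne _ _ _ _ _ _ (by norm_num) (by norm_num) (by norm_num),
      rd_gwr_of_ne _ _ _ _ _ _ (by norm_num) (by norm_num) (by norm_num), h23₂]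
  set m₃ := gwr (gwr (gwr m₂ 2 0 (answer ω K 0)) 4 0 (answer ω K 1)) 6 0 (answer ω K 2) with hm₃
  have hc₃ : ∀ c, 0 ≤ c → m₃ c = m c := by
    intro c hc
    rw [hm₃, gwr_apply_of_nonneg _ _ _ _ _ (by norm_num) le_rfl hc,
      gwr_apply_of_nonneg _ _ _ _ _ (by norm_num) le_rfl hc,
      gwr_apply_of_nonneg _ _ _ _ _ (by norm_num) le_rfl hc, hc₂ c hc, hc₁ c hc]
  have hr₃ : ∀ y j, (y < 2 ∨ 8 ≤ y) → 0 ≤ y → y < 32 → y ≠ 15 → rd m₃ y j = rd m₂ y j := by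
    intro y j h1 h2 h3 h4
    rw [hm₃, rd_gwr_of_ne _ _ _ _ _ _ (by omega) (by omega) (by omega),
      rd_gwr_of_ne _ _ _ _ _ _ (by omega) (by omega) (by omega),
      rd_gwr_of_ne _ _ _ _ _ _ (by omega) (by omega) (by omega)]
  have hconst : Consts n a (answer ω K 0) (answer ω K 1) (answer ω K 2) (2 ^ K)
      (depthBound κ K T) m₃ :=
    { num := by rw [hc₃ 0 le_rfl, h0]
      adj := fun v hv u hu => by rw [hc₃ _ (by positivity), hadj v hv u hu]
      den := by rw [hr₃ _ _ (by norm_num) (by norm_num) (by norm_num) (by norm_num), hD]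
      depth := by rw [hr₃ _ _ (by norm_num) (by norm_num) (by norm_num) (by norm_num), hd]
      b := by
        rw [hm₃, gx_gwr_of_ne _ _ _ _ _ _ (by norm_num) (by norm_num) (by norm_num) (by norm_num)
          (by norm_num), gx_gwr_of_ne _ _ _ _ _ _ (by norm_num) (by norm_num) (by norm_num)
          (by norm_num) (by norm_num), gx_gwr_self]
      g := by
        rw [hm₃, gx_gwr_of_ne _ _ _ _ _ _ (by norm_num) (by norm_num) (by norm_num) (by norm_num)
          (by norm_num), gx_gwr_self]
      l := by rw [hm₃, gx_gwr_self] }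
  have h1v : ‖(((1 : ℤ) : GaussianInt) : ℂ)‖ < 2 ^ B := by simpa using h1B'
  refine Runs.seq (Runs.gassign (z := ((1 : ℤ) : GaussianInt)) h1s (fun m' _ _ =>
    ⟨(gok_gint _).2 trivial, by rw [geval_gint, Expr.eval]⟩) (by norm_num) h1v ?_)
  refine Runs.gassign (z := ((1 : ℤ) : GaussianInt)) h1s (fun m' _ _ =>
    ⟨(gok_gint _).2 trivial, by rw [geval_gint, Expr.eval]⟩) (by norm_num) h1v ?_
  refine hQ _ ⟨(hconst.gwr _ (by norm_num) (by norm_num) le_rfl).gwr _ (by norm_num) (by norm_num)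
    le_rfl, ?_, ?_, ?_⟩
  · rw [gx_gwr_of_ne _ _ _ _ _ _ (by norm_num) (by norm_num) (by norm_num) (by norm_num)
      (by norm_num), gx_gwr_self]; simp
  · rw [gx_gwr_self]; simp
  · intro j
    rw [rd_gwr_of_ne _ _ _ _ _ _ (by norm_num) (by norm_num) (by norm_num),
      rd_gwr_of_ne _ _ _ _ _ _ (by norm_num) (by norm_num) (by norm_num),
      hr₃ _ _ (by norm_num) (by norm_num) (by norm_num) (by norm_num), h22₂]
    simp [rootCode]

theorem runs_algorithm {N K₁ K₂ κ K T Δ : ℕ} (hK : K = K₁ * (n + N) ^ 2)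
    (hT : T = K₂ * (n + N) ^ 2)
    (hsmall : Small n a (answer ω K 0) (answer ω K 1) (answer ω K 2) ((2 ^ K : ℤ) : ℂ)
      (depthBound κ K T) B)
    (hout : SmallOut n a (answer ω K 0) (answer ω K 1) (answer ω K 2) ((2 ^ K : ℤ) : ℂ)
      (depthBound κ K T) B)
    (hden : outDen n a (answer ω K 0) (answer ω K 1) (answer ω K 2) ((2 ^ K : ℤ) : ℂ)
      (depthBound κ K T) n ≠ 0)
    (hirr : ∀ v, a v v = false) (hdeg : ∀ v < n, degFrom n a v 0 ≤ Δ) (hn : (n : ℤ) + 1 < 2 ^ B)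
    (hs : K + n * ((n + 1) * (Δ + 1) ^ (depthBound κ K T + 1)) + 1 ≤ s)
    (hKB : K < B) (hTB : (T : ℤ) < 2 ^ B) (hans : ∀ i, ‖(answer ω K i : ℂ)‖ < 2 ^ B)
    (h0 : m 0 = n) (h1 : m 1 = N)
    (hadj : ∀ v < n, ∀ u < n, m (2 + ((v : ℤ) * n + u)) = if a v u then 1 else 0)
    (h22 : ∀ j : ℕ, rd m 22 j = 0) :
    Runs ω B (algorithm K₁ K₂ κ) m s fun m' => m' 2 ≠ 0 ∧
      ((m' 0 : ℂ) + (m' 1 : ℂ) * Complex.I) / (m' 2 : ℂ) =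
        outNum n a (answer ω K 0) (answer ω K 1) (answer ω K 2) ((2 ^ K : ℤ) : ℂ)
          (depthBound κ K T) n /
        outDen n a (answer ω K 0) (answer ω K 1) (answer ω K 2) ((2 ^ K : ℤ) : ℂ)
          (depthBound κ K T) n :=
  Runs.seq (runs_setup hK hT (by omega) hKB hTB hsmall.depth hans h0 h1 hadj h22 fun m₁ h₁ =>
    Runs.seq (runs_vertexLoop hsmall hout hirr hdeg hn (by omega) h₁ fun m₂ h₂ =>
      runs_output (by omega) h₂.num h₂.den hout.mul hout.sq hden fun _ h3 h4 => ⟨h3, h4⟩))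

end Algorithm

/-! ### Size of the numbers in the algorithm -/

section Size

variable {n : ℕ} {a : ℕ → ℕ → Bool} {b g l D : ℂ}

/-- Exponents for the size of the numerators and denominators of messages. -/
def sizeExp (Δ : ℕ) : ℕ → ℕ
  | 0 => 1
  | f + 1 => Δ * sizeExp Δ f + 3

lemma one_le_sizeExp (Δ f : ℕ) : 1 ≤ sizeExp Δ f := by
  cases f <;> simp [sizeExp]

lemma lt_sizeExp (Δ : ℕ) (hΔ : 1 ≤ Δ) (f : ℕ) : f < sizeExp Δ f := by
  induction f with
  | zero => simp [sizeExp]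
  | succ f ih =>
    have := Nat.mul_le_mul_right (sizeExp Δ f) hΔ
    rw [sizeExp]; omega

lemma sizeExp_mono (Δ : ℕ) (hΔ : 1 ≤ Δ) : Monotone (sizeExp Δ) :=
  monotone_nat_of_le_succ fun f => by
    have := Nat.mul_le_mul_right (sizeExp Δ f) hΔ
    rw [sizeExp]; omega

lemma sizeExp_le (Δ f : ℕ) : sizeExp Δ f ≤ (Δ + 3) ^ f := by
  induction f with
  | zero => simp [sizeExp]
  | succ f ih =>
    have h := one_le_sizeExp Δ f
    rw [sizeExp, pow_succ]
    nlinarith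

lemma norm_prod_le_pow {z : ℕ → ℂ} {x : ℝ} (i : ℕ) (h : ∀ w < i, ‖z w‖ ≤ x) :
    ‖∏ w ∈ Finset.range i, z w‖ ≤ x ^ i := by
  rw [norm_prod]
  refine (Finset.prod_le_prod (fun _ _ => norm_nonneg _) fun w hw =>
    h w (Finset.mem_range.1 hw)).trans ?_
  rw [Finset.prod_const, Finset.card_range]

variable {X : ℝ} {Δ : ℕ} (hX : 2 ≤ X) (hb : ‖b‖ ≤ X) (hg : ‖g‖ ≤ X) (hl : ‖l‖ ≤ X) (hD : ‖D‖ ≤ X)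
  (hdeg : ∀ v < n, degFrom n a v 0 ≤ Δ)

include hX hdeg in
-- Vertices that are not neighbours contribute factors of norm at most 1, so the exponent grows with
-- the degree and not with `n`.
lemma prod_norm_le {z : ℕ → ℂ} {v i e : ℕ} (hv : v < n) (hi : i ≤ n)
    (hz : ∀ u < n, ‖z u‖ ≤ if a v u then X ^ e else 1) :
    ‖∏ u ∈ Finset.range i, z u‖ ≤ X ^ (Δ * e) := by
  have h1 : 1 ≤ X ^ e := one_le_pow₀ (by linarith)
  calc ‖∏ u ∈ Finset.range i, z u‖ = ∏ u ∈ Finset.range i, ‖z u‖ := norm_prod _ _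
    _ ≤ ∏ u ∈ Finset.range i, if a v u then X ^ e else 1 :=
      Finset.prod_le_prod (fun _ _ => norm_nonneg _) fun u hu =>
        hz u ((Finset.mem_range.1 hu).trans_le hi)
    _ = (X ^ e) ^ ((Finset.range i).filter fun u => a v u).card := by
      rw [← Finset.prod_filter, Finset.prod_const]
    _ ≤ (X ^ e) ^ Δ := by
      refine pow_le_pow_right₀ h1 (le_trans (Finset.card_le_card ?_) (hdeg v hv))
      intro u hu
      simp only [Finset.mem_filter, Finset.mem_range] at hu ⊢
      exact ⟨hu.1.trans_le hi, Nat.zero_le _, hu.2⟩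
    _ = X ^ (Δ * e) := by rw [← pow_mul, mul_comm]

include hX hb hg hl hD hdeg in
-- The 3 in `sizeExp` collects one factor X from `l` or `D` at the node, one from the coefficients
-- of the Möbius map, and one that covers the sum of two terms because 2 ≤ X.
lemma norm_pairVal_le (f : ℕ) : (∀ c, ∀ v < n, ‖(pairVal n a b g l D f c v).1‖ ≤ X ^ sizeExp Δ f ∧
      ‖(pairVal n a b g l D f c v).2‖ ≤ X ^ sizeExp Δ f) ∧
    ∀ c, ∀ v < n, ∀ i ≤ n, ‖(partialPair n a b g l D f c v i).1‖ ≤ X ^ (Δ * sizeExp Δ f + 1) ∧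
      ‖(partialPair n a b g l D f c v i).2‖ ≤ X ^ (Δ * sizeExp Δ f + 1) := by
  have hX1 : 1 ≤ X := by linarith
  have step : ∀ f, (∀ c, ∀ v < n, ‖(pairVal n a b g l D f c v).1‖ ≤ X ^ sizeExp Δ f ∧
      ‖(pairVal n a b g l D f c v).2‖ ≤ X ^ sizeExp Δ f) →
      ∀ c, ∀ v < n, ∀ i ≤ n, ‖(partialPair n a b g l D f c v i).1‖ ≤ X ^ (Δ * sizeExp Δ f + 1) ∧
      ‖(partialPair n a b g l D f c v i).2‖ ≤ X ^ (Δ * sizeExp Δ f + 1) := by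
    intro f hf c v hv i hi
    have hXe : X ≤ X ^ sizeExp Δ f := le_self_pow₀ hX1 (by have := one_le_sizeExp Δ f; omega)
    have h1e : 1 ≤ X ^ sizeExp Δ f := hX1.trans hXe
    have hk : ∀ u < n, ‖(kid n a b g D (pairVal n a b g l D f) c v u).1‖ ≤
        (if a v u then X ^ sizeExp Δ f else 1) ∧
        ‖(kid n a b g D (pairVal n a b g l D f) c v u).2‖ ≤
        (if a v u then X ^ sizeExp Δ f else 1) := by
      intro u hu
      rw [kid]
      split_ifs with h1 h2 h3 h4
      · exact hf _ u hu
      · exact ⟨hb.trans hXe, hD.trans hXe⟩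
      · exact ⟨hD.trans hXe, hg.trans hXe⟩
      · simpa using h1e
      · simp
    simp only [partialPair, norm_mul, pow_succ', norm_mul]
    exact ⟨mul_le_mul hl (prod_norm_le hX hdeg hv hi fun u hu => (hk u hu).1) (norm_nonneg _)
      (by linarith), mul_le_mul hD (prod_norm_le hX hdeg hv hi fun u hu => (hk u hu).2)
      (norm_nonneg _) (by linarith)⟩
  induction f with
  | zero =>
    have h0 : ∀ c, ∀ v < n, ‖(pairVal n a b g l D 0 c v).1‖ ≤ X ^ sizeExp Δ 0 ∧
        ‖(pairVal n a b g l D 0 c v).2‖ ≤ X ^ sizeExp Δ 0 := by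
      intro c v _
      simpa [pairVal, sizeExp] using ⟨hD, hg⟩
    exact ⟨h0, step 0 h0⟩
  | succ f ih =>
    have h1 : ∀ c, ∀ v < n, ‖(pairVal n a b g l D (f + 1) c v).1‖ ≤ X ^ sizeExp Δ (f + 1) ∧
        ‖(pairVal n a b g l D (f + 1) c v).2‖ ≤ X ^ sizeExp Δ (f + 1) := by
      intro c v hv
      obtain ⟨h1, h2⟩ := ih.2 c v hv n le_rfl
      have key : ∀ x y z w : ℂ, ‖x‖ ≤ X → ‖z‖ ≤ X → ‖y‖ ≤ X ^ (Δ * sizeExp Δ f + 1) →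
          ‖w‖ ≤ X ^ (Δ * sizeExp Δ f + 1) → ‖x * y + z * w‖ ≤ X ^ sizeExp Δ (f + 1) := by
        intro x y z w hx hz hy hw
        calc ‖x * y + z * w‖ ≤ ‖x‖ * ‖y‖ + ‖z‖ * ‖w‖ := by
              rw [← norm_mul, ← norm_mul]; exact norm_add_le _ _
          _ ≤ X * X ^ (Δ * sizeExp Δ f + 1) + X * X ^ (Δ * sizeExp Δ f + 1) := by gcongr
          _ = 2 * (X * X ^ (Δ * sizeExp Δ f + 1)) := by ring
          _ ≤ X * (X * X ^ (Δ * sizeExp Δ f + 1)) := by gcongr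
          _ = X ^ sizeExp Δ (f + 1) := by rw [sizeExp]; ring
      exact ⟨key _ _ _ _ hb hD h1 h2, key _ _ _ _ hD hg h1 h2⟩
    exact ⟨h1, step (f + 1) h1⟩

/-- A bound for all exponents in the algorithm. -/
def totalExp (n Δ L : ℕ) : ℕ :=
  2 * n * (n + sizeExp Δ (L + 1)) + n + sizeExp Δ (L + 1)

include hX hb hg hl hD hdeg in
lemma norm_outNum_le (L : ℕ) {i : ℕ} (hi : i ≤ n) :
    ‖outNum n a b g l D L i‖ ≤ X ^ (i * (n + sizeExp Δ (L + 1))) ∧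
    ‖outDen n a b g l D L i‖ ≤ X ^ (i * (n + sizeExp Δ (L + 1))) := by
  have hX1 : 1 ≤ X := by linarith
  have hprod : ∀ z : ℂ, ‖z‖ ≤ X → ∀ v ≤ n, ‖∏ w ∈ Finset.range v, (if a v w then z else 1)‖ ≤
      X ^ n := by
    intro z hz v hv
    refine (norm_prod_le_pow (x := X) v fun w _ => ?_).trans (pow_le_pow_right₀ hX1 hv)
    split_ifs
    · exact hz
    · simpa using hX1
  have hnode : ∀ v < n, ‖(nodePair n a b g l D (pairVal n a b g l D L) (rootCode n v) v).1‖ ≤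
      X ^ (Δ * sizeExp Δ L + 1) ∧
      ‖(nodePair n a b g l D (pairVal n a b g l D L) (rootCode n v) v).2‖ ≤
      X ^ (Δ * sizeExp Δ L + 1) := fun v hv =>
    (norm_pairVal_le hX hb hg hl hD hdeg L).2 (rootCode n v) v hv n le_rfl
  have hle : X ^ (Δ * sizeExp Δ L + 1) + X ^ (Δ * sizeExp Δ L + 1) ≤ X ^ sizeExp Δ (L + 1) :=
    calc X ^ (Δ * sizeExp Δ L + 1) + X ^ (Δ * sizeExp Δ L + 1)
        = 2 * X ^ (Δ * sizeExp Δ L + 1) := by ring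
      _ ≤ X * X ^ (Δ * sizeExp Δ L + 1) := by gcongr
      _ = X ^ (Δ * sizeExp Δ L + 2) := by ring
      _ ≤ X ^ sizeExp Δ (L + 1) := pow_le_pow_right₀ hX1 (by rw [sizeExp]; omega)
  have hpos : 0 ≤ X ^ (Δ * sizeExp Δ L + 1) := by positivity
  constructor
  · rw [outNum]
    refine (norm_prod_le_pow (x := X ^ (n + sizeExp Δ (L + 1))) i fun v hv => ?_).trans ?_
    · have hv' := hv.trans_le hi
      rw [norm_mul, pow_add]
      refine mul_le_mul (hprod g hg v hv'.le) ?_ (norm_nonneg _) (by positivity)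
      exact (norm_add_le _ _).trans ((add_le_add (hnode v hv').1 (hnode v hv').2).trans hle)
    · rw [← pow_mul, mul_comm]
  · rw [outDen]
    refine (norm_prod_le_pow (x := X ^ (n + sizeExp Δ (L + 1))) i fun v hv => ?_).trans ?_
    · have hv' := hv.trans_le hi
      rw [norm_mul, pow_add]
      refine mul_le_mul (hprod D hD v hv'.le) ?_ (norm_nonneg _) (by positivity)
      linarith [(hnode v hv').2]
    · rw [← pow_mul, mul_comm]

include hX hb hg hl hD hdeg in
lemma small_of_le {L B : ℕ} (hΔ : 1 ≤ Δ) (hB : X ^ (totalExp n Δ L + 1) ≤ 2 ^ B)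
    (hn : (n : ℤ) < 2 ^ B) (hL : (L : ℤ) < 2 ^ B) :
    Small n a b g l D L B ∧ SmallOut n a b g l D L B := by
  have hX1 : 1 ≤ X := by linarith
  have key : ∀ {x : ℝ} {e : ℕ}, x ≤ X ^ e → e ≤ totalExp n Δ L → x < 2 ^ B := by
    intro x e h1 h2
    exact h1.trans_lt ((pow_lt_pow_right₀ (by linarith) (by omega)).trans_le hB)
  have e1 : ∀ f ≤ L, Δ * sizeExp Δ f + 1 ≤ totalExp n Δ L := by
    intro f hf
    have h1 := sizeExp_mono Δ hΔ (Nat.succ_le_succ hf)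
    have h2 : sizeExp Δ f.succ = Δ * sizeExp Δ f + 3 := rfl
    rw [totalExp]
    have h3 : sizeExp Δ L.succ = sizeExp Δ (L + 1) := rfl
    omega
  have e2 : ∀ f ≤ L, sizeExp Δ f ≤ totalExp n Δ L := by
    intro f hf
    have h1 := sizeExp_mono Δ hΔ (show f ≤ L + 1 by omega)
    rw [totalExp]
    omega
  have e3 : ∀ i ≤ n, i * (n + sizeExp Δ (L + 1)) + n ≤ totalExp n Δ L := by
    intro i hi
    have := Nat.mul_le_mul_right (n + sizeExp Δ (L + 1)) hi
    rw [totalExp, mul_assoc, two_mul]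
    omega
  have e4 : n * (n + sizeExp Δ (L + 1)) + n * (n + sizeExp Δ (L + 1)) ≤ totalExp n Δ L := by
    rw [totalExp, mul_assoc, two_mul]
    omega
  have hp := norm_pairVal_le hX hb hg hl hD hdeg
  have ho := fun {i} (hi : i ≤ n) => norm_outNum_le hX hb hg hl hD hdeg L hi
  have hprod : ∀ z : ℂ, ‖z‖ ≤ X → ∀ i, ∀ w ≤ n, ‖∏ x ∈ Finset.range w, (if a i x then z else 1)‖ ≤
      X ^ n := by
    intro z hz i w hw
    refine (norm_prod_le_pow (x := X) w fun x _ => ?_).trans (pow_le_pow_right₀ hX1 hw)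
    split_ifs
    · exact hz
    · simpa using hX1
  refine ⟨⟨fun f hf c v hv i hi => key ((hp f).2 c v hv i hi).1 (e1 f hf),
    fun f hf c v hv i hi => key ((hp f).2 c v hv i hi).2 (e1 f hf),
    fun f hf c v hv => key ((hp f).1 c v hv).1 (e2 f hf),
    fun f hf c v hv => key ((hp f).1 c v hv).2 (e2 f hf), hn, hL⟩, ⟨?_, ?_, ?_, ?_, ?_, ?_⟩⟩
  · intro i hi w hw
    refine key ?_ (e3 i hi.le)
    rw [norm_mul, pow_add]
    exact mul_le_mul (ho hi.le).1 (hprod g hg i w (by omega)) (norm_nonneg _) (by positivity)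
  · intro i hi w hw
    refine key ?_ (e3 i hi.le)
    rw [norm_mul, pow_add]
    exact mul_le_mul (ho hi.le).2 (hprod D hD i w (by omega)) (norm_nonneg _) (by positivity)
  · refine key ?_ e4
    rw [pow_add]
    exact mul_le_mul (ho le_rfl).1 (ho le_rfl).2 (norm_nonneg _) (by positivity)
  · refine key ?_ e4
    rw [pow_add]
    exact mul_le_mul (ho le_rfl).2 (ho le_rfl).2 (norm_nonneg _) (by positivity)
  · exact fun i hi => key (ho hi).1 (by have := e3 i hi; omega)
  · exact fun i hi => key (ho hi).2 (by have := e3 i hi; omega)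

end Size

/-! ### Perturbation of the parameters -/

section Perturbation

lemma norm_pow_sub_pow_le {x y : ℂ} {Y ε : ℝ} (hY : 1 ≤ Y) (hx : ‖x‖ ≤ Y) (hy : ‖y‖ ≤ Y)
    (h : ‖x - y‖ ≤ ε) (p : ℕ) : ‖x ^ p - y ^ p‖ ≤ p * Y ^ p * ε := by
  have hε : 0 ≤ ε := (norm_nonneg _).trans h
  induction p with
  | zero => simp
  | succ p ih =>
    have hyp : ‖y ^ p‖ ≤ Y ^ p := by rw [norm_pow]; exact pow_le_pow_left₀ (norm_nonneg _) hy p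
    have h1 : 1 * (Y ^ p * ε) ≤ Y * (Y ^ p * ε) := mul_le_mul_of_nonneg_right hY (by positivity)
    calc ‖x ^ (p + 1) - y ^ (p + 1)‖ = ‖x * (x ^ p - y ^ p) + (x - y) * y ^ p‖ := by ring_nf
      _ ≤ ‖x‖ * ‖x ^ p - y ^ p‖ + ‖x - y‖ * ‖y ^ p‖ := by
        rw [← norm_mul, ← norm_mul]; exact norm_add_le _ _
      _ ≤ Y * (p * Y ^ p * ε) + ε * Y ^ p := by gcongr
      _ ≤ ((p + 1 : ℕ) : ℝ) * Y ^ (p + 1) * ε := by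
        push_cast
        rw [pow_succ]
        linarith

lemma norm_mul_sub_mul_le {x y x' y' : ℂ} {Y ε : ℝ} {p q : ℕ} (hY : 1 ≤ Y)
    (hx : ‖x‖ ≤ Y ^ p) (hy' : ‖y'‖ ≤ Y ^ q) (h1 : ‖x - x'‖ ≤ p * Y ^ p * ε)
    (h2 : ‖y - y'‖ ≤ q * Y ^ q * ε) :
    ‖x * y - x' * y'‖ ≤ ((p + q : ℕ) : ℝ) * Y ^ (p + q) * ε := by
  have h3 : 0 ≤ p * Y ^ p * ε := (norm_nonneg _).trans h1
  calc ‖x * y - x' * y'‖ = ‖x * (y - y') + (x - x') * y'‖ := by ring_nf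
    _ ≤ ‖x‖ * ‖y - y'‖ + ‖x - x'‖ * ‖y'‖ := by
      rw [← norm_mul, ← norm_mul]; exact norm_add_le _ _
    _ ≤ Y ^ p * (q * Y ^ q * ε) + p * Y ^ p * ε * Y ^ q := by gcongr
    _ = ((p + q : ℕ) : ℝ) * Y ^ (p + q) * ε := by push_cast; ring

/-- There are at most 2^n weights, each a monomial in the parameters of degree at most 2n² + n. -/
lemma norm_Z_sub_Z_le {n : ℕ} (G : SimpleGraph (Fin n)) [DecidableRel G.Adj] {ζ ζ' : Fin 3 → ℂ}
    {Y ε : ℝ} (hY : 1 ≤ Y) (h1 : ∀ i, ‖ζ i‖ ≤ Y) (h2 : ∀ i, ‖ζ' i‖ ≤ Y)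
    (h : ∀ i, ‖ζ i - ζ' i‖ ≤ ε) :
    ‖Z G ζ (fun _ => none) - Z G ζ' (fun _ => none)‖ ≤
      2 ^ n * (((2 * n ^ 2 + n : ℕ) : ℝ) * Y ^ (2 * n ^ 2 + n) * ε) := by
  have hε : 0 ≤ ε := (norm_nonneg _).trans (h 0)
  have hE : G.edgeFinset.card ≤ n ^ 2 := by
    refine SimpleGraph.card_edgeFinset_le_card_choose_two.trans ?_
    rw [Fintype.card_fin, sq, Nat.choose_two_right]
    exact (Nat.div_le_self _ _).trans (Nat.mul_le_mul_left _ (Nat.sub_le _ _))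
  have hpow : ∀ (i : Fin 3) (p : ℕ), ‖ζ i ^ p‖ ≤ Y ^ p ∧ ‖ζ' i ^ p‖ ≤ Y ^ p := fun i p => by
    rw [norm_pow, norm_pow]
    exact ⟨pow_le_pow_left₀ (norm_nonneg _) (h1 i) p, pow_le_pow_left₀ (norm_nonneg _) (h2 i) p⟩
  have hw : ∀ σ : Fin n → Bool, ‖weight G ζ σ - weight G ζ' σ‖ ≤
      ((2 * n ^ 2 + n : ℕ) : ℝ) * Y ^ (2 * n ^ 2 + n) * ε := by
    intro σ
    rw [weight, weight]
    set p := (G.edgeFinset.filter fun e => e.map σ = s(true, true)).card with hp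
    set q := (G.edgeFinset.filter fun e => e.map σ = s(false, false)).card with hq
    set r := (Finset.univ.filter fun v => σ v = true).card with hr
    have hp' : p ≤ n ^ 2 := (Finset.card_filter_le _ _).trans hE
    have hq' : q ≤ n ^ 2 := (Finset.card_filter_le _ _).trans hE
    have hr' : r ≤ n := (Finset.card_filter_le _ _).trans (by simp)
    have hd := fun i => norm_pow_sub_pow_le hY (h1 i) (h2 i) (h i)
    have hpq := norm_mul_sub_mul_le hY (hpow 0 p).1 (hpow 1 q).2 (hd 0 p) (hd 1 q)
    have hpq' : ‖ζ 0 ^ p * ζ 1 ^ q‖ ≤ Y ^ (p + q) := by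
      rw [norm_mul, pow_add]
      exact mul_le_mul (hpow 0 p).1 (hpow 1 q).1 (norm_nonneg _) (by positivity)
    refine (norm_mul_sub_mul_le hY hpq' (hpow 2 r).2 hpq (hd 2 r)).trans ?_
    have hle : p + q + r ≤ 2 * n ^ 2 + n := by omega
    gcongr
  rw [Z, Z, ← Finset.sum_sub_distrib]
  refine (norm_sum_le_of_le _ fun σ _ => hw σ).trans ?_
  rw [Finset.sum_const, nsmul_eq_mul]
  refine mul_le_mul_of_nonneg_right ?_ (by positivity)
  have : ((Finset.univ.filter fun σ : Fin n → Bool => Extends (fun _ => none) σ).card : ℝ) ≤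
      ((2 ^ n : ℕ) : ℝ) := by
    exact_mod_cast (Finset.card_filter_le _ _).trans (by simp)
  simpa using this

end Perturbation

/-! ### The approximation scheme -/

section Scheme

/-- Polynomially bounded functions of a positive integer. -/
def PolyBounded (F : ℕ → ℕ) : Prop := ∃ K d, ∀ y, 1 ≤ y → F y ≤ K * y ^ d

lemma PolyBounded.const (c : ℕ) : PolyBounded fun _ => c := ⟨c, 0, fun y _ => by simp⟩

lemma PolyBounded.id : PolyBounded fun y => y := ⟨1, 1, fun y _ => by simp⟩

lemma PolyBounded.add {F H : ℕ → ℕ} (hF : PolyBounded F) (hH : PolyBounded H) :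
    PolyBounded fun y => F y + H y := by
  obtain ⟨K, d, h1⟩ := hF
  obtain ⟨K', d', h2⟩ := hH
  refine ⟨K + K', d + d', fun y hy => ?_⟩
  rw [add_mul]
  refine add_le_add ((h1 y hy).trans ?_) ((h2 y hy).trans ?_)
  · exact Nat.mul_le_mul_left _ (Nat.pow_le_pow_right hy (by omega))
  · exact Nat.mul_le_mul_left _ (Nat.pow_le_pow_right hy (by omega))

lemma PolyBounded.mul {F H : ℕ → ℕ} (hF : PolyBounded F) (hH : PolyBounded H) :
    PolyBounded fun y => F y * H y := by
  obtain ⟨K, d, h1⟩ := hF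
  obtain ⟨K', d', h2⟩ := hH
  refine ⟨K * K', d + d', fun y hy => ?_⟩
  rw [pow_add, mul_mul_mul_comm]
  exact Nat.mul_le_mul (h1 y hy) (h2 y hy)

lemma PolyBounded.pow {F : ℕ → ℕ} (hF : PolyBounded F) (k : ℕ) :
    PolyBounded fun y => F y ^ k := by
  induction k with
  | zero => simpa using PolyBounded.const 1
  | succ k ih => simpa only [pow_succ] using ih.mul hF

/-- The adjacency matrix with natural number indices. -/
noncomputable def adjBool {n : ℕ} (G : SimpleGraph (Fin n)) (i j : ℕ) : Bool :=
  haveI := Classical.propDecidable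
  decide (∃ (hi : i < n) (hj : j < n), G.Adj ⟨i, hi⟩ ⟨j, hj⟩)

variable {n : ℕ} (G : SimpleGraph (Fin n))

lemma adjBool_iff (i j : Fin n) : adjBool G i j = true ↔ G.Adj i j := by
  simp [adjBool]

lemma adjBool_self (i : ℕ) : adjBool G i i = false := by
  simp [adjBool]

lemma degFrom_adjBool_le [DecidableRel G.Adj] {v : ℕ} (hv : v < n) :
    degFrom n (adjBool G) v 0 ≤ G.degree ⟨v, hv⟩ := by
  rw [degFrom, ← SimpleGraph.card_neighborFinset_eq_degree,
    ← Finset.card_map Fin.valEmbedding]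
  refine Finset.card_le_card fun x hx => ?_
  simp only [Finset.mem_filter, Finset.mem_range] at hx
  rw [Finset.mem_map]
  exact ⟨⟨x, hx.1⟩, by
    rw [SimpleGraph.mem_neighborFinset]
    exact (adjBool_iff G ⟨v, hv⟩ ⟨x, hx.1⟩).1 hx.2.2, rfl⟩

lemma inputMemory_adj (N : ℕ) {v u : ℕ} (hv : v < n) (hu : u < n) :
    inputMemory G N (2 + ((v : ℤ) * n + u)) = if adjBool G v u then 1 else 0 := by
  have h0 : 0 ≤ (v : ℤ) * n + u := by positivity
  have key : (∃ i j : Fin n, 2 + ((v : ℤ) * n + u) = 2 + (i : ℤ) * n + j ∧ G.Adj i j) ↔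
      adjBool G v u = true := by
    rw [adjBool_iff G ⟨v, hv⟩ ⟨u, hu⟩]
    constructor
    · rintro ⟨i, j, h, hadj⟩
      have h1 : v * n + u = (i : ℕ) * n + j := by
        have : ((v * n + u : ℕ) : ℤ) = (((i : ℕ) * n + j : ℕ) : ℤ) := by push_cast; linarith
        exact_mod_cast this
      have hn : 0 < n := by omega
      -- Row and column are quotient and remainder of the address by `n`.
      have h2 : v = i := by
        have h3 := congrArg (· / n) h1
        simpa [Nat.mul_add_div hn, mul_comm _ n, Nat.div_eq_of_lt hu, Nat.div_eq_of_lt j.2] using h3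
      subst h2
      have h4 : u = j := by omega
      subst h4
      exact hadj
    · intro hadj
      exact ⟨⟨v, hv⟩, ⟨u, hu⟩, by push_cast; ring, hadj⟩
  rw [inputMemory, if_neg (by omega), if_neg (by omega)]
  by_cases h : adjBool G v u = true
  · rw [if_pos (key.2 h), if_pos h]
  · rw [if_neg fun h' => h (key.1 h'), if_neg h]

lemma inputMemory_one (N : ℕ) : inputMemory G N 1 = N := by
  rw [inputMemory, if_neg one_ne_zero, if_pos rfl]

lemma inputMemory_of_neg (N : ℕ) {c : ℤ} (hc : c < 0) : inputMemory G N c = 0 := by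
  rw [inputMemory, if_neg (by omega), if_neg (by omega), if_neg]
  rintro ⟨i, k, h, _⟩
  have : 0 ≤ (i : ℤ) * n := by positivity
  omega

lemma bounded_inputMemory {N B : ℕ} (hB : 0 < B) (hn : (n : ℤ) < 2 ^ B) (hN : (N : ℤ) < 2 ^ B) :
    Bounded B (inputMemory G N) := by
  have h1 : (1 : ℤ) < 2 ^ B := one_lt_pow₀ (by norm_num) (by omega)
  intro i
  rw [inputMemory]
  split_ifs
  · rwa [Nat.abs_cast]
  · rwa [Nat.abs_cast]
  · simpa using h1
  · simp

lemma norm_sub_answer_le {ω : ParamOracle} {ζ : Fin 3 → ℂ} (hω : ω.Represents ζ) (i : Fin 3)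
    (K : ℕ) : ‖ζ i * 2 ^ K - (answer ω K i : ℂ)‖ ≤ 2 := by
  obtain ⟨h1, h2⟩ := hω i K
  refine (Complex.norm_le_abs_re_add_abs_im _).trans ?_
  have h3 : ((2 : ℂ) ^ K) = (((2 : ℝ) ^ K : ℝ) : ℂ) := by push_cast; rfl
  have h4 : (ζ i * 2 ^ K - (answer ω K i : ℂ)).re = 2 ^ K * (ζ i).re - ((ω i K).1 : ℝ) := by
    rw [h3, Complex.sub_re, Complex.re_mul_ofReal, answer, GaussianInt.re_toComplex, mul_comm]
  have h5 : (ζ i * 2 ^ K - (answer ω K i : ℂ)).im = 2 ^ K * (ζ i).im - ((ω i K).2 : ℝ) := by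
    rw [h3, Complex.sub_im, Complex.im_mul_ofReal, answer, GaussianInt.im_toComplex, mul_comm]
  rw [h4, h5]
  linarith

lemma exponent_le {n N q S : ℕ} (h1 : 1 ≤ S) (hn : n ≤ S) (hn2 : n ^ 2 ≤ S) (hN : N ≤ S) :
    n + (2 * n ^ 2 + n) + q * (2 * n ^ 2 + n) + 1 + (2 + N + (q * n + 1) * n) ≤ (9 + 4 * q) * S := by
  have h2 := Nat.mul_le_mul_left q hn
  have h3 := Nat.mul_le_mul_left q hn2
  have h4 : q * (2 * n ^ 2 + n) = 2 * (q * n ^ 2) + q * n := by ring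
  have h5 : (q * n + 1) * n = q * n ^ 2 + n := by ring
  have h6 : (9 + 4 * q) * S = 9 * S + 4 * (q * S) := by ring
  omega

/-- After bounding every quantity by a power of two, only exponents are compared: `K` of order
(n+N)² outweighs the number of configurations, the degree of the weights, the parameters of size
2^q, the accuracy, and the lower bound for |Z|. -/
lemma perturbation_le {n N q K : ℕ} (hN : 1 ≤ N) (hK : (9 + 4 * q) * (n + N) ^ 2 ≤ K) :
    (2 : ℝ) ^ n * (((2 * n ^ 2 + n : ℕ) : ℝ) * (2 ^ q) ^ (2 * n ^ 2 + n) * (2 / 2 ^ K)) ≤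
      1 / (4 * N) * (((1 / 2) ^ q) ^ n / 2) ^ n := by
  have hS : n + N ≤ (n + N) ^ 2 := Nat.le_self_pow (by norm_num) _
  have hn2 : n ^ 2 ≤ (n + N) ^ 2 := Nat.pow_le_pow_left (by omega) 2
  have hexp := (exponent_le (q := q) (n := n) (N := N) (S := (n + N) ^ 2) (by omega) (by omega) hn2
    (by omega)).trans hK
  set M := 2 * n ^ 2 + n with hM
  have h1 : ((M : ℕ) : ℝ) ≤ 2 ^ M := by exact_mod_cast Nat.lt_two_pow_self.le
  have h2 : ((N : ℕ) : ℝ) ≤ 2 ^ N := by exact_mod_cast Nat.lt_two_pow_self.le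
  have hN0 : (0 : ℝ) < N := by exact_mod_cast hN
  calc (2 : ℝ) ^ n * ((M : ℝ) * (2 ^ q) ^ M * (2 / 2 ^ K))
      ≤ 2 ^ n * (2 ^ M * (2 ^ q) ^ M * (2 / 2 ^ K)) := by gcongr
    _ = 2 ^ (n + M + q * M + 1) / 2 ^ K := by rw [← pow_mul]; ring
    _ ≤ 1 / 2 ^ (2 + N + (q * n + 1) * n) := by
      rw [div_le_div_iff₀ (by positivity) (by positivity), one_mul, ← pow_add]
      exact pow_le_pow_right₀ (by norm_num) hexp
    _ = 1 / (4 * 2 ^ N) * (((1 / 2) ^ q) ^ n / 2) ^ n := by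
      rw [← pow_mul, div_pow, ← pow_mul, one_div_pow, pow_add, pow_add, add_mul, one_mul, pow_add]
      field_simp
      norm_num
    _ ≤ 1 / (4 * N) * (((1 / 2) ^ q) ^ n / 2) ^ n := by gcongr

lemma two_pow_clog_le {T : ℕ} (hT : 2 ≤ T) : 2 ^ Nat.clog 2 T ≤ 2 * T := by
  have h1 : 0 < Nat.clog 2 T := Nat.clog_pos (by norm_num) hT
  have h2 := Nat.pow_pred_clog_lt_self (b := 2) (by norm_num) (show 1 < T by omega)
  rw [show Nat.clog 2 T = (Nat.clog 2 T).pred + 1 from (Nat.succ_pred_eq_of_pos h1).symm, pow_succ]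
  omega

/-- The intermediate value satisfies ‖y‖ ≤ 2‖z‖, so the two errors add up to at most 3/(4N) relative
to `z`. -/
lemma norm_sub_le_of_le {x y z : ℂ} {N : ℕ} (hN : 1 ≤ N) (h1 : ‖x - y‖ ≤ 1 / (4 * N) * ‖y‖)
    (h2 : ‖y - z‖ ≤ 1 / (4 * N) * ‖z‖) : ‖x - z‖ ≤ 1 / (N : ℝ) * ‖z‖ := by
  have hN1 : (1 : ℝ) ≤ N := by exact_mod_cast hN
  have hy : ‖y‖ ≤ 2 * ‖z‖ := by
    have h3 : ‖y‖ ≤ ‖y - z‖ + ‖z‖ := by simpa using norm_add_le (y - z) z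
    have h4 : 1 / (4 * (N : ℝ)) * ‖z‖ ≤ 1 * ‖z‖ := by
      refine mul_le_mul_of_nonneg_right ?_ (norm_nonneg _)
      rw [div_le_one (by positivity)]; linarith
    linarith
  have h3 : ‖x - z‖ ≤ ‖x - y‖ + ‖y - z‖ := by simpa using norm_add_le (x - y) (y - z)
  have h4 : 1 / (4 * (N : ℝ)) * ‖y‖ ≤ 1 / (4 * N) * (2 * ‖z‖) := by gcongr
  have h5 : 1 / (N : ℝ) * ‖z‖ = 4 * (1 / (4 * N) * ‖z‖) := by field_simp
  have h6 : 0 ≤ 1 / (4 * (N : ℝ)) * ‖z‖ := by positivity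
  nlinarith

end Scheme

/-! ### Choice of the constants and the complete scheme. -/

section Scheme

/-- The depth is logarithmic in `T`, so quantities exponential in the depth are polynomial in `T`.
-/
lemma clog_bound {Δ r κ T : ℕ} (hΔ : Δ + 3 ≤ 2 ^ r) (hT : 2 ≤ T) :
    (Δ + 3) ^ (κ * Nat.clog 2 T + 1) ≤ (2 * T) ^ (r * κ) * (Δ + 3) := by
  rw [pow_succ]
  refine Nat.mul_le_mul_right _ ?_
  calc (Δ + 3) ^ (κ * Nat.clog 2 T) ≤ (2 ^ r) ^ (κ * Nat.clog 2 T) := Nat.pow_le_pow_left hΔ _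
    _ = (2 ^ Nat.clog 2 T) ^ (r * κ) := by rw [← pow_mul, ← pow_mul]; ring_nf
    _ ≤ (2 * T) ^ (r * κ) := Nat.pow_le_pow_left (two_pow_clog_le hT) _

/-- A polynomial bound for the cost of the algorithm. -/
def costBound (Δ q r κ K₁ K₂ wt : ℕ) (y : ℕ) : ℕ :=
  (K₁ * y ^ 2 + y * ((y + 1) * ((2 * (K₂ * y ^ 2)) ^ (r * κ) * (Δ + 3))) + 1) *
    (wt * ((K₁ * y ^ 2 + q + 1) * (2 * y * (y + (2 * (K₂ * y ^ 2)) ^ (r * κ) * (Δ + 3)) + y +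
      (2 * (K₂ * y ^ 2)) ^ (r * κ) * (Δ + 3) + 1) + 1))

lemma polyBounded_costBound (Δ q r κ K₁ K₂ wt : ℕ) :
    PolyBounded (costBound Δ q r κ K₁ K₂ wt) := by
  unfold costBound
  repeat' first
    | exact PolyBounded.id
    | exact PolyBounded.const _
    | apply PolyBounded.add
    | apply PolyBounded.mul
    | apply PolyBounded.pow

/-- Every `κ` levels halve the error, so the chosen depth gains a factor `T = K₂ * S`, and `K₂`
absorbs the constant 16|C|. -/
lemma truncation_le {C η : ℝ} (hη0 : 0 ≤ η) {κ K₂ S : ℕ} (hS : 1 ≤ S) (hκ : η ^ κ ≤ 1 / 2)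
    (hK₂ : 16 * |C| ≤ K₂) :
    C * η ^ (κ * Nat.clog 2 (K₂ * S)) ≤ 1 / (8 * (S : ℝ)) / 2 := by
  have hS' : (1 : ℝ) ≤ S := by exact_mod_cast hS
  set T := K₂ * S with hT
  have h1 : (T : ℝ) ≤ 2 ^ Nat.clog 2 T := by
    exact_mod_cast Nat.le_pow_clog (by norm_num) T
  have h2 : η ^ (κ * Nat.clog 2 T) ≤ 1 / 2 ^ Nat.clog 2 T := by
    rw [pow_mul, ← one_div_pow]
    exact pow_le_pow_left₀ (by positivity) hκ _
  have h3 : 16 * |C| * S ≤ 2 ^ Nat.clog 2 T := by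
    refine le_trans ?_ h1
    rw [hT]; push_cast
    gcongr
  calc C * η ^ (κ * Nat.clog 2 T) ≤ |C| * (1 / 2 ^ Nat.clog 2 T) :=
        mul_le_mul (le_abs_self C) h2 (by positivity) (abs_nonneg C)
    _ ≤ 1 / (8 * (S : ℝ)) / 2 := by
      rw [mul_one_div, div_div, div_le_div_iff₀ (by positivity) (by positivity)]
      linarith

/-- The program computes with rounded parameters as if they were exact. For these the certificate
bounds the truncation error relative to Z(ζ'); the step from ζ' to ζ is a crude perturbation bound,
compensated by the lower bound on |Z(ζ)|. The certificate is needed on a whole ball for this reason.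
-/
theorem hasFPTAS_of_contraction {Δ : ℕ} (hΔ : 1 ≤ Δ) {ζ₀ : Fin 3 → ℂ} {δ C η : ℝ} (hη0 : 0 < η)
    (hη1 : η < 1) (hK : ∀ ζ, ‖ζ - ζ₀‖ < δ → Nonempty (Contraction Δ ζ C η)) {ζ : Fin 3 → ℂ}
    (hζ : ‖ζ - ζ₀‖ < δ) : HasFPTAS Δ ζ := by
  obtain ⟨Kζ⟩ := hK ζ hζ
  have hγ : 0 < ‖ζ 1‖ := norm_pos_iff.2 Kζ.gamma_ne_zero
  -- The first two exponents give 2^q bounding the parameters, with room for the rounding, and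
  -- 2^(-q) below |γ|. The third keeps the rounded parameters in the ball, `r` compares Δ + 3 with a
  -- power of two, and `κ` levels halve the truncation error.
  obtain ⟨q₁, hq₁⟩ := pow_unbounded_of_one_lt (‖ζ‖ + 2) (one_lt_two (α := ℝ))
  obtain ⟨q₂, hq₂⟩ := exists_pow_lt_of_lt_one hγ (show (1 / 2 : ℝ) < 1 by norm_num)
  obtain ⟨q₃, hq₃⟩ := pow_unbounded_of_one_lt (2 / (δ - ‖ζ - ζ₀‖)) (one_lt_two (α := ℝ))
  obtain ⟨r, hr⟩ := pow_unbounded_of_one_lt (Δ + 3) (one_lt_two (α := ℕ))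
  obtain ⟨κ, hκ⟩ := exists_pow_lt_of_lt_one (show (0 : ℝ) < 1 / 2 by norm_num) hη1
  obtain ⟨K₂', hK₂'⟩ := exists_nat_ge (16 * |C|)
  set q := q₁ + q₂ with hq
  have hqY : ‖ζ‖ + 2 ≤ 2 ^ q :=
    hq₁.le.trans (pow_le_pow_right₀ (by norm_num) (by omega))
  have hqμ : (1 / 2 : ℝ) ^ q ≤ ‖ζ 1‖ :=
    (pow_le_pow_of_le_one (by norm_num) (by norm_num) (by omega)).trans hq₂.le
  -- The summand 2 guarantees T ≥ 2, as the estimate of 2^(clog T) by 2T requires.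
  set K₂ := K₂' + 2 with hK₂
  have hK₂C : 16 * |C| ≤ (K₂ : ℝ) := by rw [hK₂]; push_cast; linarith
  -- The summands serve, in turn, the perturbation bound (9 + 4q), the ball of parameters (q₃) and
  -- the inequality T ≤ 2^K (K₂).
  set K₁ := 9 + 4 * q + q₃ + K₂ with hK₁
  obtain ⟨Kc, dc, hpoly⟩ := polyBounded_costBound Δ q r κ K₁ K₂ (algorithm K₁ K₂ κ).wt
  refine ⟨algorithm K₁ K₂ κ, Kc, dc, fun ω hω n G _ hdegG N hN => ?_⟩
  set y := n + N with hy
  have hy1 : 1 ≤ y := by omega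
  set S := y ^ 2 with hS
  have hS1 : 1 ≤ S := Nat.one_le_pow _ _ hy1
  have hyS : y ≤ S := Nat.le_self_pow (by norm_num) _
  set K := K₁ * S with hKdef
  set T := K₂ * S with hTdef
  have hKS : ∀ c, c ≤ K₁ → c * S ≤ K := fun c hc => Nat.mul_le_mul_right S hc
  have hKy : y ≤ K := hyS.trans (by have := hKS 1 (by omega); omega)
  have hKK₁ : K₁ ≤ K := Nat.le_mul_of_pos_right _ hS1
  have hT2 : 2 ≤ T := by
    have := Nat.mul_le_mul (show 2 ≤ K₂ by omega) hS1
    omega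
  have hTK : T ≤ 2 ^ K := (hKS K₂ (by omega)).trans Nat.lt_two_pow_self.le
  set L := depthBound κ K T with hL
  -- Since T ≤ 2^K, the cap by `K` in the depth is not active.
  have hLeq : L = κ * Nat.clog 2 T := by
    rw [hL, depthBound, min_eq_right ((Nat.clog_le_iff_le_pow (by norm_num)).2 hTK)]
  -- the approximate parameters
  set ζ' : Fin 3 → ℂ := fun i => (answer ω K i : ℂ) / 2 ^ K with hζ'
  have h2K : (0 : ℝ) < 2 ^ K := by positivity
  have hD0 : ((2 : ℂ) ^ K) ≠ 0 := pow_ne_zero _ two_ne_zero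
  have hclose : ∀ i, ‖ζ i - ζ' i‖ ≤ 2 / 2 ^ K := by
    intro i
    have h1 : ζ i - ζ' i = (ζ i * 2 ^ K - (answer ω K i : ℂ)) / 2 ^ K := by
      simp only [hζ']; field_simp
    rw [h1, norm_div, norm_pow, RCLike.norm_ofNat]
    gcongr
    exact norm_sub_answer_le hω i K
  have hsmallK : 2 / 2 ^ K < δ - ‖ζ - ζ₀‖ := by
    have hρ : 0 < δ - ‖ζ - ζ₀‖ := by linarith
    rw [div_lt_iff₀ hρ] at hq₃
    rw [div_lt_iff₀ h2K]
    have : (2 : ℝ) ^ q₃ ≤ 2 ^ K := pow_le_pow_right₀ (by norm_num) (by omega)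
    nlinarith
  have hζ'δ : ‖ζ' - ζ₀‖ < δ := by
    have h1 : ‖ζ - ζ'‖ ≤ 2 / 2 ^ K := (pi_norm_le_iff_of_nonneg (by positivity)).2 hclose
    have h2 : ‖ζ' - ζ₀‖ ≤ ‖ζ - ζ'‖ + ‖ζ - ζ₀‖ := by
      rw [norm_sub_rev ζ ζ']
      simpa using norm_add_le (ζ' - ζ) (ζ - ζ₀)
    linarith
  -- The truncation error is that of the rounded parameters, so their own certificate is used, with
  -- the same constants `C` and `η`.
  obtain ⟨Kζ'⟩ := hK ζ' hζ'δ
  have hDc : (((2 : ℤ) ^ K : ℤ) : ℂ) = 2 ^ K := by push_cast; rfl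
  have hpar : ∀ i, (answer ω K i : ℂ) = ζ' i * (((2 : ℤ) ^ K : ℤ) : ℂ) := by
    intro i; rw [hDc]; simp only [hζ']; field_simp
  have hθ1 : (n : ℝ) * (1 / (8 * (S : ℝ))) ≤ 1 / (8 * N) := by
    have hnN : n * N ≤ S := by rw [hS, hy]; nlinarith
    have hnN' : (n : ℝ) * N ≤ S := by exact_mod_cast hnN
    have hN0 : (0 : ℝ) < N := by exact_mod_cast hN
    have hS0 : (0 : ℝ) < S := by exact_mod_cast hS1
    rw [mul_one_div, div_le_div_iff₀ (by positivity) (by positivity)]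
    linarith
  have hN1 : (1 : ℝ) ≤ N := by exact_mod_cast hN
  have hle1 : 1 / (8 * (N : ℝ)) ≤ 1 := by rw [div_le_one (by positivity)]; linarith
  obtain ⟨hden, herr⟩ := norm_outNum_div_outDen_sub_le (a := adjBool G) Kζ' hdegG
    (fun i j => adjBool_iff G i j) (by rw [hDc]; exact hD0) (hpar 0) (hpar 1) (hpar 2) L
    (θ := 1 / (8 * (S : ℝ))) (by rw [hLeq]; exact truncation_le hη0.le hS1 hκ.le hK₂C)
    (hθ1.trans hle1)
  -- sizes
  have hans : ∀ i, ‖(answer ω K i : ℂ)‖ ≤ 2 ^ (K + q + 1) := by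
    intro i
    have h1 := norm_sub_answer_le hω i K
    have h2 : ‖(answer ω K i : ℂ)‖ ≤ ‖ζ i * 2 ^ K - (answer ω K i : ℂ)‖ + ‖ζ i * 2 ^ K‖ := by
      have := norm_sub_le (ζ i * 2 ^ K) (ζ i * 2 ^ K - (answer ω K i : ℂ))
      rw [sub_sub_cancel] at this
      linarith
    have h3 : ‖ζ i * 2 ^ K‖ ≤ ‖ζ‖ * 2 ^ K := by
      rw [norm_mul, norm_pow, RCLike.norm_ofNat]
      exact mul_le_mul_of_nonneg_right (norm_le_pi_norm ζ i) (by positivity)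
    have h4 : (1 : ℝ) ≤ 2 ^ K := one_le_pow₀ (by norm_num)
    have h5 : (2 : ℝ) ^ (K + q + 1) = 2 ^ q * 2 ^ K * 2 := by ring
    have h6 : (‖ζ‖ + 2) * 2 ^ K ≤ 2 ^ q * 2 ^ K := by gcongr
    rw [h5]
    nlinarith [norm_nonneg ζ]
  set W := sizeExp Δ (L + 1) with hW
  -- The oracle answers and the denominator are at most X = 2^(K+q+1), and all values formed from
  -- them are bounded by powers of X with exponent at most `totalExp`; the extra 1 makes the bound
  -- strict.
  set B := (K + q + 1) * (totalExp n Δ L + 1) with hB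
  have hWB : n + W + 1 ≤ totalExp n Δ L + 1 := by rw [totalExp]; omega
  have htB : totalExp n Δ L + 1 ≤ B := Nat.le_mul_of_pos_left _ (by omega)
  have hKB : K < B := by
    have : K + q + 1 ≤ B := Nat.le_mul_of_pos_right _ (by omega)
    omega
  have hcast : ∀ {x : ℕ}, x < 2 ^ B → (x : ℤ) < 2 ^ B := fun h => by exact_mod_cast h
  have hltB : ∀ {x : ℕ}, x ≤ B → (x : ℤ) < 2 ^ B := fun h => hcast (h.trans_lt Nat.lt_two_pow_self)
  have hnB : ((n + 1 : ℕ) : ℤ) < 2 ^ B := hltB (by omega)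
  have hLW : L + 1 < W := lt_sizeExp Δ hΔ (L + 1)
  have hX2 : (2 : ℝ) ≤ 2 ^ (K + q + 1) := le_self_pow₀ (by norm_num) (by omega)
  have hdeg : ∀ v < n, degFrom n (adjBool G) v 0 ≤ Δ := fun v hv =>
    (degFrom_adjBool_le G hv).trans (hdegG _)
  obtain ⟨hsm, hout⟩ := small_of_le (n := n) (a := adjBool G) (L := L) (B := B)
    (D := (((2 : ℤ) ^ K : ℤ) : ℂ)) hX2 (hans 0) (hans 1) (hans 2) (by
      rw [hDc, norm_pow, RCLike.norm_ofNat]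
      exact pow_le_pow_right₀ (by norm_num) (by omega)) hdeg hΔ (by rw [hB, pow_mul])
    (hltB (by omega)) (hltB (by omega))
  have hrun := runs_algorithm (ω := ω) (B := B) (m := inputMemory G N) (a := adjBool G) (n := n)
    (N := N) (K₁ := K₁) (K₂ := K₂) (κ := κ) (K := K) (T := T) (Δ := Δ)
    (s := K + n * ((n + 1) * (Δ + 1) ^ (L + 1)) + 1) rfl rfl hsm hout hden
    (adjBool_self G) hdeg (by exact_mod_cast hnB) le_rfl hKB
    (hcast (hTK.trans_lt (Nat.pow_lt_pow_right (by norm_num) hKB)))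
    (fun i => (hans i).trans_lt (pow_lt_pow_right₀ (by norm_num) (by
      have : (K + q + 1) * 2 ≤ B := Nat.mul_le_mul_left _ (by omega)
      omega)))
    (if_pos rfl) (inputMemory_one G N) (fun v hv u hu => inputMemory_adj G N hv hu)
    (fun j => inputMemory_of_neg G N (by omega))
  obtain ⟨t, m', hex, ht, -, hne, hval⟩ := hrun (bounded_inputMemory G (by omega)
    (hltB (by omega)) (hltB (by omega)))
  refine ⟨t, m', hex, ?_, hne, ?_⟩
  · refine (ht.trans ?_).trans (hpoly y hy1)
    have hR := clog_bound (κ := κ) (Δ := Δ) hr.le hT2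
    rw [← hLeq] at hR
    have hR1 : (Δ + 1) ^ (L + 1) ≤ (2 * T) ^ (r * κ) * (Δ + 3) :=
      (Nat.pow_le_pow_left (by omega) _).trans hR
    have hR2 : W ≤ (2 * T) ^ (r * κ) * (Δ + 3) := (sizeExp_le Δ (L + 1)).trans hR
    have hny : n ≤ y := by omega
    rw [costBound, hB, totalExp]
    gcongr
  · rw [hval]
    refine norm_sub_le_of_le (y := Z G ζ' fun _ => none) hN (herr.trans ?_) ?_
    · refine mul_le_mul_of_nonneg_right ?_ (norm_nonneg _)
      have : 1 / (4 * (N : ℝ)) = 2 * (1 / (8 * N)) := by field_simp; norm_num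
      linarith
    · have hnorm : ∀ i, ‖ζ i‖ ≤ 2 ^ q := fun i => (norm_le_pi_norm ζ i).trans (by linarith)
      have hnorm' : ∀ i, ‖ζ' i‖ ≤ 2 ^ q := fun i => by
        have h1 : ‖ζ' i‖ ≤ ‖ζ i‖ + ‖ζ i - ζ' i‖ := by
          have := norm_sub_le (ζ i) (ζ i - ζ' i)
          rwa [sub_sub_cancel] at this
        have h2 : (2 : ℝ) / 2 ^ K ≤ 2 := div_le_self (by norm_num) (one_le_pow₀ (by norm_num))
        linarith [hclose i, norm_le_pi_norm ζ i]
      rw [norm_sub_rev]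
      refine (norm_Z_sub_Z_le G (one_le_pow₀ (by norm_num)) hnorm hnorm' hclose).trans
        ((perturbation_le (n := n) (q := q) hN (hKS _ (by omega))).trans ?_)
      refine mul_le_mul_of_nonneg_left ?_ (by positivity)
      exact le_norm_Z (a := adjBool G) Kζ hdegG (fun i j => adjBool_iff G i j) (by positivity)
        (pow_le_one₀ (by norm_num) (by norm_num)) hqμ

end Scheme

end TwoSpin

/-- The certificate is available on a whole ball around ζ₀ with uniform constants. Zero-freeness and
mixing use it at ζ alone; the approximation scheme uses it at rounded parameters as well. -/
theorem mainTheorem1 (Δ : ℕ) (hΔ : 3 ≤ Δ) (ζ₀ : Fin 3 → ℝ)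
    (hζ₀ : ζ₀ ∈ TwoSpin.S1 Δ ∪ TwoSpin.S2 Δ ∪ TwoSpin.S3 Δ ∪ TwoSpin.S4 Δ) :
    ∃ δ : ℝ, 0 < δ ∧ ∀ ζ : Fin 3 → ℂ, ‖ζ - (fun i => (ζ₀ i : ℂ))‖ < δ →
      (∀ (V : Type u) [Fintype V] [DecidableEq V] (G : SimpleGraph V) [DecidableRel G.Adj],
        (∀ v, G.degree v ≤ Δ) →
        ∀ p : V → Option Bool, TwoSpin.Feasible G ζ p → TwoSpin.Z G ζ p ≠ 0) ∧
      TwoSpin.StrongSpatialMixing.{u} Δ ζ ∧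
      TwoSpin.HasFPTAS Δ ζ := by
  obtain ⟨w, hw⟩ := TwoSpin.exists_realContraction hΔ hζ₀
  obtain ⟨δ, C, η, hδ, hη0, hη1, hK⟩ := hw.exists_contraction
  refine ⟨δ, hδ, fun ζ hζ => ?_⟩
  obtain ⟨K⟩ := hK ζ hζ
  exact ⟨fun V _ _ G _ hG p hp => TwoSpin.Z_ne_zero_of_contraction K hG hp,
    TwoSpin.strongSpatialMixing_of_contraction K hη0 hη1,
    TwoSpin.hasFPTAS_of_contraction (by omega) hη0 hη1 hK hζ⟩
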